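/- **Setting.** Let $d\ge 1$, $l>0$, $\eta_{AB}=\mathrm{diag}(-1,1,\dots,1,-1)$ with $A,B=0,\dots,d$, and $\eta_{ab}$ its restriction to $a,b=0,\dots,d-1$. Let $U\subset\mathbb R^d$ be open with coordinates $x^m$, with a smooth vielbein $e^a_m$ with inverse $e^m_a$ and a smooth Lorentz connection $\omega^a_{m\,b}$, $\omega_{ab}=-\omega_{ba}$, such that $de^a+\omega^a{}_b e^b=0$ and $d\omega^{ab}+\omega^a{}_c\omega^{cb}=-l^{-2}e^ae^b$ (a local frame of AdS of radius $l$). Put $V^A=l\delta^A_{(d)}$, $\omega^a{}_{(d)}=l^{-1}e^a$, $\omega^{(d)}{}_b=l^{-1}e_b$, $\omega^{(d)}{}_{(d)}=0$, and $\partial_a=e_a^m\partial/\partial x^m$, $\omega^B_{a\,C}=e_a^m\omega^B_{m\,C}$. The ghosts $c_0,c^\dagger,b^\dagger,\xi,\mu,\nu,\theta^m$ are anticommuting; $b^\dagger$ has ghost number $-1$, all the others $1$. A *BRST system* is a space of states with a nilpotent differential operator of finite order and ghost number $1$. The system $(\Omega,\Gamma(\mathcal H))$ is *consistently reduced* to $(\tilde\Omega,\Gamma(\mathcal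 E))$ if $\mathcal H=\mathcal E\oplus\mathcal G\oplus\mathcal F$ (subbundles, homogeneous in ghost number) such that the component $\Omega^{\mathcal G\mathcal F}:\Gamma(\mathcal F)\to\Gamma(\mathcal G)$ of $\Omega$ is invertible in differential operators of graded finite order (of finite order to each order in the formal variables) and $\tilde\Omega=\Omega^{\mathcal E\mathcal E}-\Omega^{\mathcal E\mathcal F}(\Omega^{\mathcal G\mathcal F})^{-1}\Omega^{\mathcal G\mathcal E}$. For operators $\Box,S,S^\dagger,T,h,\bar S^\dagger$ write $$\begin{aligned}Q[\Box,S,S^\dagger,T,h,\bar S^\dagger]={}&c_0\Box+c^\dagger S+S^\dagger\partial_{b^\dagger}+\xi T+\mu h+\nu\bar S^\dagger-c^\dagger\partial_{b^\dagger}\partial_{c_0}-2\xi\partial_{b^\dagger}\partial_{c^\dagger}-2\mu c_0\partial_{c_0}-2\mu\partial_{b^\dagger}b^\dagger\\&+2\mu\xi\partial_\xi+2\nu c_0\partial_{c^\dagger}+2\mu\nu\partial_\nu+\nu c^\dagger\partial_\xi+\nu\partial_{b^\dagger}\partial_\mu .\end{aligned}$$ *Parent system.* States: polynomials in $a^{\dagger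 A}$ ($A=0,\dots,d$) and all the ghosts, with coefficients in formal power series in $Y^A$ over $C^\infty(U)$. Operator: $\Omega^{\rm T}=\theta^m\partial_m-\theta^m\omega^B_{m\,A}\big(Y^A\partial_{Y^B}+a^{\dagger A}\partial_{a^{\dagger B}}\big)-\theta^m e^a_m\partial_{Y^a}+Q[\Box,S,S^\dagger,T,h,\bar S^\dagger]$ with $\Box=\partial_{Y^A}\partial_{Y_A}$, $S=\partial_{a^\dagger_A}\partial_{Y^A}$, $S^\dagger=a^{\dagger A}\partial_{Y^A}$, $T=\partial_{a^{\dagger A}}\partial_{a^\dagger_A}$, $h=a^{\dagger A}\partial_{a^{\dagger A}}-(Y^A+V^A)\partial_{Y^A}$, $\bar S^\dagger=(Y^A+V^A)\partial_{a^{\dagger A}}$. *Intermediate system.* States: those independent of $Y^a$ $(a<d)$ and $\theta^m$. With $Y^{(d)}=lz$, $a^{\dagger(d)}=lw$, $\mathcal D_a=\partial_a-\omega^B_{a\,C}a^{\dagger C}\partial_{a^{\dagger B}}$, the operator is $\tilde\Omega=Q[\tilde\Box,\tilde S,\tilde S^\dagger,\tilde T,\tilde h,\tilde{\bar S}{}^\dagger]$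 with $$\begin{gathered}\tilde\Box=(1+z)^{-2}\eta^{ac}(\delta^b_c\mathcal D_a-\omega^b_{a\,c})\mathcal D_b-l^{-2}\partial_z^2-\tfrac{d}{l^2}(1+z)^{-1}\partial_z,\quad \tilde S=(1+z)^{-1}\partial_{a^\dagger_a}\mathcal D_a-l^{-2}\partial_w\partial_z,\\ \tilde S^\dagger=(1+z)^{-1}a^{\dagger a}\mathcal D_a+w\partial_z,\quad \tilde T=\partial_{a^\dagger_A}\partial_{a^{\dagger A}},\quad \tilde h=a^{\dagger A}\partial_{a^{\dagger A}}-(1+z)\partial_z,\quad \tilde{\bar S}{}^\dagger=(1+z)\partial_w.\end{gathered}$$ *System in intrinsic coordinates.* States: polynomials in $a^{\dagger a}$ $(a<d)$, $c_0,c^\dagger,b^\dagger,\xi$ over $C^\infty(U)$. With $D_a=\partial_a-\omega^b_{a\,c}a^{\dagger c}\partial_{a^{\dagger b}}$, $\Box_0=\eta^{ac}(\delta^b_cD_a-\omega^b_{a\,c})D_b$, $N_Z=Z\partial_Z$ and $N_{a^\dagger}=a^{\dagger a}\partial_{a^{\dagger a}}$, the operator is $$\hat\Omega=c_0\hat\Box+c^\dagger\hat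 S+\hat S^\dagger\partial_{b^\dagger}-c^\dagger\partial_{b^\dagger}\partial_{c_0}+\xi\hat{\mathcal T},$$ $$\begin{aligned}\hat\Box&=\Box_0+l^{-2}\big(N_{a^\dagger}+2c^\dagger\partial_\xi\,a^{\dagger a}D_a+(3-d-N_{a^\dagger}-2N_{b^\dagger}-2N_\xi)(N_{a^\dagger}-2+2N_{b^\dagger}+2N_\xi)\big),\\ \hat S&=\partial_{a^\dagger_a}D_a+2l^{-2}c_0\partial_{c^\dagger}(2N_{a^\dagger}+d-3+2N_{b^\dagger}+2N_\xi),\\ \hat S^\dagger&=a^{\dagger a}D_a+l^{-2}a^{\dagger a}a^\dagger_a(c^\dagger\partial_\xi+2c_0\partial_{c^\dagger}),\\ \hat{\mathcal T}&=\partial_{a^\dagger_a}\partial_{a^{\dagger a}}-2\partial_{b^\dagger}\partial_{c^\dagger}-2l^{-2}c_0(1-2N_{c^\dagger})\partial_\xi.\end{aligned}$$ Let $\hat\Omega_{\xi=0=\pi}$ be $\hat\Omega$ with all terms containing $\xi$ or $\partial_\xi$ dropped, and $\hat{\mathcal T}_0=\partial_{a^\dagger_a}\partial_{a^{\dagger a}}-2\partial_{b^\dagger}\partial_{c^\dagger}$;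 both act on $\xi$-independent states. Put $\Omega_{\rm mod}=\hat\Omega_{\xi=0=\pi}+l^{-2}c_0(a^{\dagger a}a^\dagger_a+4c^\dagger b^\dagger)\hat{\mathcal T}_0$. **Theorem.** 1. The parent, intermediate and intrinsic systems are BRST systems. The parent system is consistently reduced to the intermediate system (elimination of $Y^a,\theta^m$), and this one to the intrinsic system (elimination of $z,w,\mu,\nu$). 2. $\hat\Omega_{\xi=0=\pi}$ preserves the space of $\xi$-independent states annihilated by $\hat{\mathcal T}_0$, is nilpotent and coincides with $\Omega_{\rm mod}$ there, and the intrinsic system is consistently reduced to this space with the operator $\hat\Omega_{\xi=0=\pi}$. 3. On all $\xi$-independent states, $\Omega_{\rm mod}$ is a nilpotent differential operator of finite order and ghost number $1$, and it commutes with $\hat{\mathcal T}_0$. 4. $\Omega_{\rm mod}=-Q_{\rm tr}$, where $Q_{\rm tr}$ is the triplet BRST charge on AdS (Buchbinder–Pashnev–Tsulaia; Sagnotti–Tsulaia), $$\begin{aligned}Q_{\rm tr}={}&c_0\big(\tilde l_0-\tfrac4{l^2}N+\tfrac6{l^2}\big)+c_1l_{-1}+c_{-1}l_1-c_{-1}c_1b_0-\tfrac6{l^2}c_0(c_{-1}b_1+b_{-1}c_1)+\tfrac4{l^2}c_0(c_{-1}b_1+b_{-1}c_1)N\\&-\tfrac8{l^2}c_0c_{-1}b_{-1}M+\tfrac8{l^2}c_0c_1b_1M^\dagger+\tfrac{12}{l^2}c_0c_{-1}b_{-1}c_1b_1,\\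 \tilde l_0={}&l_0-\tfrac1{l^2}\big(-d+\tfrac{d^2}4+4M^\dagger M-N^2+2N\big),\end{aligned}$$ with $l_0=-\Box_0$, $l_1=-\partial_{a^\dagger_a}D_a$, $l_{-1}=a^{\dagger a}D_a$, $N=N_{a^\dagger}+\tfrac d2$, $M=-\tfrac12\partial_{a^\dagger_a}\partial_{a^{\dagger a}}$, $M^\dagger=-\tfrac12a^{\dagger a}a^\dagger_a$ (that is, oscillators $\alpha_{-1}=ia^\dagger$, $\alpha_1=-ia$ and momenta $p=-iD$), $b_0=\partial_{c_0}$, $c_1=-\partial_{b^\dagger}$, $b_{-1}=-b^\dagger$, $c_{-1}=c^\dagger$, $b_1=\partial_{c^\dagger}$. -/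

import Mathlib

open scoped ContDiff BigOperators

noncomputable section

namespace AdSHigherSpin

/-! ### Smooth functions on a coordinate domain -/

/-- The algebra of real-valued smooth functions on an open set `U` of `ℝ^d`. -/
def smoothFn {d : ℕ} (U : TopologicalSpace.Opens (Fin d → ℝ)) : Subalgebra ℝ (U → ℝ) where
  carrier := {f | ∃ F : (Fin d → ℝ) → ℝ, ContDiffOn ℝ ∞ F U ∧ ∀ x : U, F x = f x}
  mul_mem' := by
    rintro f g ⟨F, hF, hf⟩ ⟨G, hG, hg⟩
    exact ⟨fun x => F x * G x, hF.mul hG, fun x => by simp [hf, hg]⟩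
  add_mem' := by
    rintro f g ⟨F, hF, hf⟩ ⟨G, hG, hg⟩
    exact ⟨fun x => F x + G x, hF.add hG, fun x => by simp [hf, hg]⟩
  algebraMap_mem' r := ⟨fun _ => r, contDiffOn_const, fun _ => rfl⟩

/-- The ring of real-valued smooth functions on `U`. -/
def SmoothFn {d : ℕ} (U : TopologicalSpace.Opens (Fin d → ℝ)) : Type := smoothFn U

instance {d : ℕ} (U : TopologicalSpace.Opens (Fin d → ℝ)) : CommRing (SmoothFn U) :=
  inferInstanceAs (CommRing (smoothFn U))

instance {d : ℕ} (U : TopologicalSpace.Opens (Fin d → ℝ)) : Algebra ℝ (SmoothFn U) :=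
  inferInstanceAs (Algebra ℝ (smoothFn U))

/-- An extension of a smooth function by zero outside of `U`, used only to differentiate it at
points of `U`. -/
def extendFn {d : ℕ} {U : TopologicalSpace.Opens (Fin d → ℝ)} (f : smoothFn U) :
    (Fin d → ℝ) → ℝ :=
  Function.extend Subtype.val (f : U → ℝ) 0

theorem extendFn_apply {d : ℕ} {U : TopologicalSpace.Opens (Fin d → ℝ)} (f : smoothFn U) (x : U) :
    extendFn f x = (f : U → ℝ) x :=
  Subtype.val_injective.extend_apply _ _ _

theorem contDiffOn_extendFn {d : ℕ} {U : TopologicalSpace.Opens (Fin d → ℝ)} (f : smoothFn U) :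
    ContDiffOn ℝ ∞ (extendFn f) U := by
  obtain ⟨F, hF, h⟩ := f.2
  exact hF.congr fun x hx => (extendFn_apply f ⟨x, hx⟩).trans (h ⟨x, hx⟩).symm

theorem differentiableAt_extendFn {d : ℕ} {U : TopologicalSpace.Opens (Fin d → ℝ)}
    (f : smoothFn U) (x : U) : DifferentiableAt ℝ (extendFn f) x :=
  ((contDiffOn_extendFn f).differentiableOn (by simp)).differentiableAt
    (U.isOpen.mem_nhds x.2)

/-- The partial derivative `∂/∂x^μ`, on the subalgebra of smooth functions. -/
def pdAux {d : ℕ} {U : TopologicalSpace.Opens (Fin d → ℝ)} (m : Fin d) :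
    smoothFn U →ₗ[ℝ] smoothFn U where
  toFun f := ⟨fun x => fderiv ℝ (extendFn f) x (Pi.single m 1),
    fun x => fderiv ℝ (extendFn f) x (Pi.single m 1),
    ((contDiffOn_extendFn f).fderiv_of_isOpen U.isOpen (by simp)).clm_apply contDiffOn_const,
    fun _ => rfl⟩
  map_add' f g := by
    ext x
    have h : extendFn (f + g) =ᶠ[nhds (x : Fin d → ℝ)] extendFn f + extendFn g := by
      filter_upwards [U.isOpen.mem_nhds x.2] with y hy
      have h1 := extendFn_apply (f + g) ⟨y, hy⟩
      have h2 := extendFn_apply f ⟨y, hy⟩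
      have h3 := extendFn_apply g ⟨y, hy⟩
      simp only at h1 h2 h3
      simp [h1, h2, h3]
    change fderiv ℝ (extendFn (f + g)) x (Pi.single m 1) =
      fderiv ℝ (extendFn f) x (Pi.single m 1) + fderiv ℝ (extendFn g) x (Pi.single m 1)
    rw [h.fderiv_eq, fderiv_add (differentiableAt_extendFn f x) (differentiableAt_extendFn g x)]
    simp
  map_smul' c f := by
    ext x
    have h : extendFn (c • f) =ᶠ[nhds (x : Fin d → ℝ)] c • extendFn f := by
      filter_upwards [U.isOpen.mem_nhds x.2] with y hy
      have h1 := extendFn_apply (c • f) ⟨y, hy⟩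
      have h2 := extendFn_apply f ⟨y, hy⟩
      simp only at h1 h2
      simp [h1, h2]
    change fderiv ℝ (extendFn (c • f)) x (Pi.single m 1) =
      c • fderiv ℝ (extendFn f) x (Pi.single m 1)
    rw [h.fderiv_eq, fderiv_const_smul (differentiableAt_extendFn f x)]
    simp

/-- The partial derivative `∂/∂x^μ` of smooth functions on `U`. -/
def pd {d : ℕ} {U : TopologicalSpace.Opens (Fin d → ℝ)} (m : Fin d) :
    SmoothFn U →ₗ[ℝ] SmoothFn U := pdAux m

/-! ### The AdS background -/

/-- The diagonal entries of `η = diag(-1, 1, …, 1, -1)` on `ℝ^{d+1}`; the entries with index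
`A < d` are those of the metric `η_{ab} = diag(-1, 1, …, 1)`. -/
def eta {d : ℕ} (A : Fin (d + 1)) : ℝ := if A = 0 ∨ A = Fin.last d then -1 else 1

/-- The diagonal entries of the Minkowski metric `η_{ab}`. -/
def etaT {d : ℕ} (a : Fin d) : ℝ := eta a.castSucc

/-- An AdS geometry of radius `l` in the coordinate domain `U`, in a local Lorentz frame:
`e m a` is the vielbein `e^a_μ`, `einv a m` its inverse `e^μ_a`, and `conn m a b` the Lorentz
connection `ω^a_{μ b}`, which is metric, torsion-free (`de^a + ω^a_b e^b = 0`) and of constant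
curvature (`dω^{ab} + ω^a_c ω^{cb} = - l⁻² e^a e^b`). -/
structure AdSFrame {d : ℕ} (l : ℝ) (U : TopologicalSpace.Opens (Fin d → ℝ)) where
  e : Fin d → Fin d → SmoothFn U
  einv : Fin d → Fin d → SmoothFn U
  conn : Fin d → Fin d → Fin d → SmoothFn U
  einv_e : ∀ a b, ∑ m, einv a m * e m b = if a = b then 1 else 0
  e_einv : ∀ m n, ∑ a, e m a * einv a n = if m = n then 1 else 0
  metric : ∀ m a b, etaT a • conn m a b + etaT b • conn m b a = 0
  torsion : ∀ m n a, pd m (e n a) - pd n (e m a) +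
    ∑ b, (conn m a b * e n b - conn n a b * e m b) = 0
  curvature : ∀ m n a b, pd m (conn n a b) - pd n (conn m a b) +
    ∑ c, (conn m a c * conn n c b - conn n a c * conn m c b) =
      -(l ^ 2)⁻¹ • (etaT b • (e m a * e n b - e n a * e m b))

/-- The flat `so(d-1,2)` connection `ω^A_{μ B}` in the frame where `V^A = l δ^A_{(d)}`: its entries
are `ω^a_{μ b}`, `ω^a_{μ (d)} = l⁻¹ e^a_μ`, `ω^{(d)}_{μ b} = l⁻¹ e_{μ b}` and `ω^{(d)}_{μ (d)} = 0`. -/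
def AdSFrame.W {d : ℕ} {l : ℝ} {U : TopologicalSpace.Opens (Fin d → ℝ)} (F : AdSFrame l U)
    (m : Fin d) (A B : Fin (d + 1)) : SmoothFn U :=
  Fin.lastCases (motive := fun _ => SmoothFn U)
    (Fin.lastCases (motive := fun _ => SmoothFn U) 0
      (fun b => (l⁻¹ * etaT b) • F.e m b) B)
    (fun a => Fin.lastCases (motive := fun _ => SmoothFn U) (l⁻¹ • F.e m a)
      (fun b => F.conn m a b) B) A

/-! ### Spaces of states

The ghosts are numbered `0 : c₀`, `1 : c†`, `2 : b†`, `3 : ξ`, `4 : μ`, `5 : ν`,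
`6 + m : θ^m`; a space of states with `k` ghosts involves those with number `< k`. -/

/-- Formal power series in the commuting variables `Y` with smooth coefficients. -/
abbrev Coef {d : ℕ} (U : TopologicalSpace.Opens (Fin d → ℝ)) (Y : Type) : Type :=
  MvPowerSeries Y (SmoothFn U)

/-- Polynomials in the commuting variables `a†^A`, `A : B`, and in the first `k` anticommuting
ghosts, with coefficients in formal power series in `Y` over the smooth functions on `U`.
The value at `S` is the coefficient of the product, in increasing order, of the ghosts in `S`. -/
def Fock {d : ℕ} (U : TopologicalSpace.Opens (Fin d → ℝ)) (Y B : Type) (k : ℕ) : Type :=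
  Finset (Fin k) → MvPolynomial B (Coef U Y)

section Instances

variable {d : ℕ} {U : TopologicalSpace.Opens (Fin d → ℝ)} {Y B : Type} {k : ℕ}

instance : AddCommGroup (Fock U Y B k) :=
  inferInstanceAs (AddCommGroup (Finset (Fin k) → MvPolynomial B (MvPowerSeries Y (SmoothFn U))))

instance : Module (SmoothFn U) (Fock U Y B k) :=
  inferInstanceAs (Module (SmoothFn U)
    (Finset (Fin k) → MvPolynomial B (MvPowerSeries Y (SmoothFn U))))

instance : Module ℝ (Fock U Y B k) :=
  inferInstanceAs (Module ℝ (Finset (Fin k) → MvPolynomial B (MvPowerSeries Y (SmoothFn U))))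

instance : IsScalarTower ℝ (SmoothFn U) (Fock U Y B k) :=
  inferInstanceAs (IsScalarTower ℝ (SmoothFn U)
    (Finset (Fin k) → MvPolynomial B (MvPowerSeries Y (SmoothFn U))))

instance : SMulCommClass ℝ (SmoothFn U) (Fock U Y B k) :=
  inferInstanceAs (SMulCommClass ℝ (SmoothFn U)
    (Finset (Fin k) → MvPolynomial B (MvPowerSeries Y (SmoothFn U))))

instance : SMulCommClass (SmoothFn U) ℝ (Fock U Y B k) := SMulCommClass.symm _ _ _

end Instances

section Operators

variable {d : ℕ} {U : TopologicalSpace.Opens (Fin d → ℝ)} {Y B : Type} {k : ℕ}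

/-- Apply an `ℝ`-linear map to all coefficients of a polynomial. -/
def mapCoef {R S : Type} [CommRing R] [CommRing S] [Algebra ℝ R] [Algebra ℝ S] (L : R →ₗ[ℝ] S) :
    MvPolynomial B R →ₗ[ℝ] MvPolynomial B S where
  toFun p := AddMonoidAlgebra.map L.toAddMonoidHom p
  map_add' p q := AddMonoidAlgebra.map_add _ p q
  map_smul' c p := by
    refine MvPolynomial.ext _ _ fun n => ?_
    exact L.map_smul c (MvPolynomial.coeff n p)

/-- Multiplication by a power series in `Y` with smooth coefficients. -/
def coefM (f : Coef U Y) : Module.End ℝ (Fock U Y B k) :=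
  (LinearMap.mulLeft ℝ (MvPolynomial.C f : MvPolynomial B (Coef U Y))).compLeft _

/-- Multiplication by `Y^i`. -/
def yM (i : Y) : Module.End ℝ (Fock U Y B k) := coefM (MvPowerSeries.X i)

/-- The derivative `∂/∂Y^i`. -/
def yD (i : Y) : Module.End ℝ (Fock U Y B k) :=
  (mapCoef ((MvPowerSeries.pderiv (SmoothFn U) i).toLinearMap.restrictScalars ℝ)).compLeft _

/-- The partial derivative `∂/∂x^m` of power series in `Y` with smooth coefficients. -/
def coefPd (m : Fin d) : Coef U Y →ₗ[ℝ] Coef U Y where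
  toFun f := fun n => pd m (f n)
  map_add' f g := funext fun n => (pd m).map_add (f n) (g n)
  map_smul' c f := funext fun n => (pd m).map_smul c (f n)

/-- The derivative `∂/∂x^m`. -/
def xD (m : Fin d) : Module.End ℝ (Fock U Y B k) := (mapCoef (coefPd m)).compLeft _

/-- Multiplication by the oscillator `a†^i`. -/
def aM (i : B) : Module.End ℝ (Fock U Y B k) :=
  (LinearMap.mulLeft ℝ (MvPolynomial.X i : MvPolynomial B (Coef U Y))).compLeft _

/-- The derivative `∂/∂a†^i` as an operator linear over functions of `x`. -/
def aDlin (i : B) : Module.End (SmoothFn U) (Fock U Y B k) :=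
  ((MvPolynomial.pderiv i).toLinearMap.restrictScalars (SmoothFn U)).compLeft _

/-- The derivative `∂/∂a†^i`. -/
def aD (i : B) : Module.End ℝ (Fock U Y B k) := (aDlin i).restrictScalars ℝ

/-- The sign `(-1)^{#{h ∈ S, h < n}}` picked up in moving the `n`-th ghost past those that precede
it in the ordered product of the ghosts in `S`. -/
def ghSign (n : ℕ) (S : Finset (Fin k)) : ℝ := (-1) ^ (S.filter fun h => h.val < n).card

/-- Left multiplication by the ghost number `n` (zero if that ghost is absent, `k ≤ n`). -/
def gM (n : ℕ) : Module.End ℝ (Fock U Y B k) where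
  toFun φ := fun S =>
    if hn : n < k then
      if (⟨n, hn⟩ : Fin k) ∈ S then
        ghSign n S • (φ (S.erase ⟨n, hn⟩) : MvPolynomial B (Coef U Y)) else 0
    else 0
  map_add' φ ψ := by
    funext S
    change (if hn : n < k then _ else _) =
      (if hn : n < k then _ else _ : MvPolynomial B (Coef U Y)) + (if hn : n < k then _ else _)
    split_ifs
    · exact smul_add _ _ _
    · exact (add_zero _).symm
    · exact (add_zero _).symm
  map_smul' c φ := by
    funext S
    change (if hn : n < k then _ else _) =
      c • (if hn : n < k then _ else _ : MvPolynomial B (Coef U Y))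
    split_ifs
    · exact smul_comm (α := MvPolynomial B (Coef U Y)) (ghSign n S) c _
    · exact (smul_zero _).symm
    · exact (smul_zero _).symm

/-- The left derivative with respect to the ghost number `n` (zero if that ghost is absent), as an
operator linear over functions of `x`. -/
def gDlin (n : ℕ) : Module.End (SmoothFn U) (Fock U Y B k) where
  toFun φ := fun S =>
    if hn : n < k then
      if (⟨n, hn⟩ : Fin k) ∈ S then 0
      else ghSign n S • (φ (insert ⟨n, hn⟩ S) : MvPolynomial B (Coef U Y))
    else 0
  map_add' φ ψ := by
    funext S
    change (if hn : n < k then _ else _) =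
      (if hn : n < k then _ else _ : MvPolynomial B (Coef U Y)) + (if hn : n < k then _ else _)
    split_ifs
    · exact (add_zero _).symm
    · exact smul_add _ _ _
    · exact (add_zero _).symm
  map_smul' c φ := by
    funext S
    change (if hn : n < k then _ else _) =
      c • (if hn : n < k then _ else _ : MvPolynomial B (Coef U Y))
    split_ifs
    · exact (smul_zero _).symm
    · exact smul_comm (α := MvPolynomial B (Coef U Y)) (ghSign n S) c _
    · exact (smul_zero _).symm

/-- The left derivative with respect to the ghost number `n`. -/
def gD (n : ℕ) : Module.End ℝ (Fock U Y B k) := (gDlin n).restrictScalars ℝ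

/-- The ghost number operator: `b†` has ghost number `-1`, all other ghosts have `1`. -/
def ghostNumber : Module.End ℝ (Fock U Y B k) :=
  ∑ n ∈ Finset.range k, (if n = 2 then (-1 : ℝ) else 1) • (gM n * gD n)

/-- The coefficient of a state at the ghosts in `S`, the monomial `β` in the variables `a†` and the
monomial `n` in the variables `Y`. -/
def Fock.coeff (φ : Fock U Y B k) (S : Finset (Fin k)) (β : B →₀ ℕ) (n : Y →₀ ℕ) : SmoothFn U :=
  MvPowerSeries.coeff n (MvPolynomial.coeff β (φ S : MvPolynomial B (Coef U Y)))

theorem Fock.coeff_add (φ ψ : Fock U Y B k) (S : Finset (Fin k)) (β : B →₀ ℕ) (n : Y →₀ ℕ) :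
    (φ + ψ).coeff S β n = φ.coeff S β n + ψ.coeff S β n := rfl

theorem Fock.coeff_zero (S : Finset (Fin k)) (β : B →₀ ℕ) (n : Y →₀ ℕ) :
    (0 : Fock U Y B k).coeff S β n = 0 := rfl

theorem Fock.coeff_smul (f : SmoothFn U) (φ : Fock U Y B k) (S : Finset (Fin k)) (β : B →₀ ℕ)
    (n : Y →₀ ℕ) : (f • φ).coeff S β n = f * φ.coeff S β n := rfl

/-- States of order at least `m` in the variables `Y`. -/
def fil (m : ℕ) : Submodule (SmoothFn U) (Fock U Y B k) where
  carrier := {φ | ∀ S β (n : Y →₀ ℕ), n.degree < m → φ.coeff S β n = 0}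
  add_mem' h h' S β n hn := by rw [Fock.coeff_add, h S β n hn, h' S β n hn, add_zero]
  zero_mem' S β n _ := Fock.coeff_zero S β n
  smul_mem' f φ h S β n hn := by rw [Fock.coeff_smul, h S β n hn, mul_zero]

end Operators

/-- The inclusion of polynomials in the variables `a†` and power series in `Y`, for inclusions of
the sets of variables. -/
def inclPoly {d : ℕ} {U : TopologicalSpace.Opens (Fin d → ℝ)} {Y Y' B B' : Type}
    (iY : Y ↪ Y') (iB : B ↪ B') :
    MvPolynomial B (Coef U Y) →ₗ[SmoothFn U] MvPolynomial B' (Coef U Y') :=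
  (((MvPolynomial.rename iB).restrictScalars (SmoothFn U)).comp
    (MvPolynomial.mapAlgHom (MvPowerSeries.rename iY))).toLinearMap

/-- The inclusion of states depending on fewer variables: the variables `Y`, `a†^i` and the ghosts
are identified with some of those of the larger space. -/
def incl {d : ℕ} {U : TopologicalSpace.Opens (Fin d → ℝ)} {Y Y' B B' : Type} {k k' : ℕ}
    (iY : Y ↪ Y') (iB : B ↪ B') (hk : k ≤ k') :
    Fock U Y B k →ₗ[SmoothFn U] Fock U Y' B' k' where
  toFun φ := fun S =>
    if ∀ h ∈ S, h.val < k then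
      inclPoly iY iB (φ (Finset.univ.filter fun h : Fin k => Fin.castLE hk h ∈ S))
    else 0
  map_add' φ ψ := by
    funext S
    change (if _ then _ else _) =
      (if _ then _ else _ : MvPolynomial B' (Coef U Y')) + (if _ then _ else _)
    split_ifs
    · exact (inclPoly iY iB).map_add _ _
    · exact (add_zero _).symm
  map_smul' c φ := by
    funext S
    change (if _ then _ else _) = c • (if _ then _ else _ : MvPolynomial B' (Coef U Y'))
    split_ifs
    · exact (inclPoly iY iB).map_smul _ _
    · exact (smul_zero _).symm

/-! ### BRST systems and their consistent reductions -/

section Reduction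

variable {A : Type} [CommRing A] [Algebra ℝ A]
variable {M : Type} [AddCommGroup M] [Module A M] [Module ℝ M] [IsScalarTower ℝ A M]
variable {N : Type} [AddCommGroup N] [Module A N] [Module ℝ N] [IsScalarTower ℝ A N]

/-- Multiplication by a function `f`. -/
def fnM (f : A) : M →ₗ[ℝ] M := (LinearMap.lsmul A M f).restrictScalars ℝ

/-- `O` is a differential operator of order at most `n`, modulo `N'`: all `(n+1)`-fold commutators
with multiplications by functions take values in `N'`. -/
def OrderLE (N' : Submodule A N) : ℕ → (M →ₗ[ℝ] N) → Prop
  | 0, O => ∀ (f : A) (φ : M), O (f • φ) - f • O φ ∈ N'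
  | n + 1, O => ∀ f : A, OrderLE N' n (O ∘ₗ fnM f - fnM f ∘ₗ O)

/-- Continuity with respect to decreasing filtrations. -/
def FilContinuous (fM : ℕ → Submodule A M) (fN : ℕ → Submodule A N) (O : M →ₗ[ℝ] N) : Prop :=
  ∀ k, ∃ m, ∀ φ ∈ fM m, O φ ∈ fN k

/-- A differential operator of graded finite order: to each finite order in the formal variables it
is a differential operator of finite order, depending on finitely many orders of its argument. -/
def IsGradedDiffOp (fM : ℕ → Submodule A M) (fN : ℕ → Submodule A N) (O : M →ₗ[ℝ] N) : Prop :=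
  FilContinuous fM fN O ∧ ∀ k, ∃ n, OrderLE (fN k) n O

/-- A BRST first-quantized system: the BRST operator is a differential operator of finite order, it
is nilpotent, and it has ghost number one. -/
structure IsBRSTSystem (fM : ℕ → Submodule A M) (gh Ω : Module.End ℝ M) : Prop where
  finite_order : ∃ n, OrderLE (⊥ : Submodule A M) n Ω
  continuous : FilContinuous fM fM Ω
  nilpotent : Ω * Ω = 0
  ghost : gh * Ω - Ω * gh = Ω

/-- The system `(Ω, M)` is consistently reduced to `(Ω', E)`, where `ι` identifies `E` with a
subbundle of `M`: there is a decomposition `M = E ⊕ G ⊕ F` into subbundles, homogeneous in the ghost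
number, with projectors `ι ∘ π`, `PG`, `PF`, such that the component `PG Ω PF : F → G` is
invertible in differential operators of graded finite order, with inverse `R : G → F`, and
`Ω' = Ω^{EE} - Ω^{EF} (Ω^{GF})⁻¹ Ω^{GE}`. -/
def ConsistentReduction (fM : ℕ → Submodule A M) (gh Ω : Module.End ℝ M)
    {E : Type} [AddCommGroup E] [Module A E] [Module ℝ E] [IsScalarTower ℝ A E]
    (fE : ℕ → Submodule A E) (ι : E →ₗ[A] M) (Ω' : Module.End ℝ E) : Prop :=
  ∃ (π : M →ₗ[A] E) (PG PF : M →ₗ[A] M) (R : M →ₗ[ℝ] M),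
    (π ∘ₗ ι = LinearMap.id ∧ PG ∘ₗ PG = PG ∧ PF ∘ₗ PF = PF ∧ PG ∘ₗ PF = 0 ∧ PF ∘ₗ PG = 0 ∧
      ι ∘ₗ π + PG + PF = LinearMap.id) ∧
    (FilContinuous fE fM (ι.restrictScalars ℝ) ∧ FilContinuous fM fE (π.restrictScalars ℝ) ∧
      FilContinuous fM fM (PG.restrictScalars ℝ) ∧ FilContinuous fM fM (PF.restrictScalars ℝ)) ∧
    (∀ φ, ι (π (gh φ)) = gh (ι (π φ)) ∧ PG (gh φ) = gh (PG φ) ∧ PF (gh φ) = gh (PF φ)) ∧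
    (IsGradedDiffOp fM fM R ∧ (∀ φ, PF (R (PG φ)) = R φ) ∧
      (∀ φ, R (PG (Ω (PF φ))) = PF φ) ∧ (∀ φ, PG (Ω (PF (R φ))) = PG φ)) ∧
    ∀ φ, Ω' φ = π (Ω (ι φ)) - π (Ω (PF (R (PG (Ω (ι φ))))))

end Reduction

/-! ### The BRST operators -/

/-- The ghost variables `c₀, c†, b†, ξ, μ, ν` and the corresponding derivatives. -/
structure GhostPairs (R : Type) where
  c₀ : R
  c : R
  b : R
  ξ : R
  μ : R
  ν : R
  dc₀ : R
  dc : R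
  db : R
  dξ : R
  dμ : R
  dν : R

/-- The ghost operators on a space of states; the operators of absent ghosts are zero. -/
def ghosts {d : ℕ} {U : TopologicalSpace.Opens (Fin d → ℝ)} {Y B : Type} {k : ℕ} :
    GhostPairs (Module.End ℝ (Fock U Y B k)) where
  c₀ := gM 0
  c := gM 1
  b := gM 2
  ξ := gM 3
  μ := gM 4
  ν := gM 5
  dc₀ := gD 0
  dc := gD 1
  db := gD 2
  dξ := gD 3
  dμ := gD 4
  dν := gD 5

/-- The BRST charge of the constraints `Box, S, S†, T, h, S̄†`, with its terms cubic in ghosts. -/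
def constraintCharge {R : Type} [Ring R] (g : GhostPairs R) (Box S Sd T h Sb : R) : R :=
  g.c₀ * Box + g.c * S + Sd * g.db + g.ξ * T + g.μ * h + g.ν * Sb
    - g.c * g.db * g.dc₀ - 2 * (g.ξ * g.db * g.dc) - 2 * (g.μ * g.c₀ * g.dc₀)
    - 2 * (g.μ * g.db * g.b) + 2 * (g.μ * g.ξ * g.dξ) + 2 * (g.ν * g.c₀ * g.dc)
    + 2 * (g.μ * g.ν * g.dν) + g.ν * g.c * g.dξ + g.ν * g.db * g.dμ

section Charges

variable {d : ℕ} {l : ℝ} {U : TopologicalSpace.Opens (Fin d → ℝ)}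

/-- The space of states of the parent system: all of `x, Y^A, a†^A, c₀, c†, b†, ξ, μ, ν, θ^m`. -/
abbrev ParentStates (U : TopologicalSpace.Opens (Fin d → ℝ)) : Type :=
  Fock U (Fin (d + 1)) (Fin (d + 1)) (6 + d)

/-- The operator `Y^A + V^A`, with `V^A = l δ^A_{(d)}`. -/
def shiftedY (l : ℝ) (A : Fin (d + 1)) : Module.End ℝ (ParentStates U) :=
  yM A + (if A = Fin.last d then l else 0) • 1

/-- The covariant derivative `∇ = θ^m ∂_m - θ^m ω^B_{m A} (Y^A ∂/∂Y^B + a†^A ∂/∂a†^B)`. -/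
def parentNabla (F : AdSFrame l U) : Module.End ℝ (ParentStates U) :=
  ∑ m : Fin d, gM (6 + m.val) * xD m -
    ∑ m, ∑ A, ∑ B, F.W m B A • (gM (6 + m.val) * (yM A * yD B + aM A * aD B))

/-- The operator `σ = - θ^m e^A_m ∂/∂Y^A` (`e^{(d)} = 0` in the chosen frame). -/
def parentSigma (F : AdSFrame l U) : Module.End ℝ (ParentStates U) :=
  -∑ m : Fin d, ∑ a : Fin d, F.e m a • (gM (6 + m.val) * yD a.castSucc)

/-- The parent BRST operator `Ω^T = ∇ + σ + Ω̄`. -/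
def parentCharge (F : AdSFrame l U) : Module.End ℝ (ParentStates U) :=
  parentNabla F + parentSigma F +
    constraintCharge ghosts
      (∑ A, eta A • (yD A * yD A))
      (∑ A, eta A • (aD A * yD A))
      (∑ A, aM A * yD A)
      (∑ A, eta A • (aD A * aD A))
      (∑ A, aM A * aD A - ∑ A, shiftedY l A * yD A)
      (∑ A, shiftedY l A * aD A)

/-- The space of states of the intermediate system, tensor fields in the embedding space:
`x, Y^{(d)}, a†^A, c₀, c†, b†, ξ, μ, ν`. -/
abbrev AmbientStates (U : TopologicalSpace.Opens (Fin d → ℝ)) : Type :=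
  Fock U Unit (Fin (d + 1)) 6

/-- The operator `z = Y^{(d)} / l`. -/
def zM (l : ℝ) : Module.End ℝ (AmbientStates U) := l⁻¹ • yM ()

/-- The operator `∂/∂z = l ∂/∂Y^{(d)}`. -/
def zD (l : ℝ) : Module.End ℝ (AmbientStates U) := l • yD ()

/-- The operator `1 / (1 + z)`. -/
def zInv (l : ℝ) : Module.End ℝ (AmbientStates U) :=
  coefM (MvPowerSeries.invOfUnit (1 + l⁻¹ • MvPowerSeries.X ()) 1)

/-- The operator `w = a†^{(d)} / l`. -/
def wM (l : ℝ) : Module.End ℝ (AmbientStates U) := l⁻¹ • aM (Fin.last d)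

/-- The operator `∂/∂w = l ∂/∂a†^{(d)}`. -/
def wD (l : ℝ) : Module.End ℝ (AmbientStates U) := l • aD (Fin.last d)

/-- `𝒟_a = ∂_a - ω^B_{a C} a†^C ∂/∂a†^B`, with `∂_a = e^m_a ∂_m`, `ω_a = e^m_a ω_m`. -/
def ambientD (F : AdSFrame l U) (a : Fin d) : Module.End ℝ (AmbientStates U) :=
  ∑ m, F.einv a m • xD m -
    ∑ m, ∑ C, ∑ B, (F.einv a m * F.W m B C) • (aM C * aD B)

/-- `□̃ = (1+z)⁻² η^{ac} (δ^b_c 𝒟_a - ω^b_{a c}) 𝒟_b - l⁻² ∂_z ∂_z - d l⁻² (1+z)⁻¹ ∂_z`. -/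
def ambientBox (F : AdSFrame l U) : Module.End ℝ (AmbientStates U) :=
  zInv l * zInv l * ∑ a, etaT a • (ambientD F a * ambientD F a -
      ∑ b, (∑ m, F.einv a m * F.conn m b a) • ambientD F b)
    - (l ^ 2)⁻¹ • (zD l * zD l) - ((d : ℝ) * (l ^ 2)⁻¹) • (zInv l * zD l)

/-- The intermediate BRST operator `Ω̃`. -/
def ambientCharge (F : AdSFrame l U) : Module.End ℝ (AmbientStates U) :=
  constraintCharge ghosts
    (ambientBox F)
    (zInv l * ∑ a : Fin d, etaT a • (aD a.castSucc * ambientD F a) - (l ^ 2)⁻¹ • (wD l * zD l))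
    (zInv l * ∑ a : Fin d, aM a.castSucc * ambientD F a + wM l * zD l)
    (∑ A, eta A • (aD A * aD A))
    (∑ A, aM A * aD A - (1 + zM l) * zD l)
    ((1 + zM l) * wD l)

/-- States depending on `x, a†^a` and the first `k` ghosts: `c₀, c†, b†, ξ` for `k = 4` and
`c₀, c†, b†` for `k = 3`. -/
abbrev TensorStates (U : TopologicalSpace.Opens (Fin d → ℝ)) (k : ℕ) : Type :=
  Fock U Empty (Fin d) k

variable {k : ℕ}

/-- `D_a = ∂_a - ω^b_{a c} a†^c ∂/∂a†^b`. -/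
def covD (F : AdSFrame l U) (a : Fin d) : Module.End ℝ (TensorStates U k) :=
  ∑ m, F.einv a m • xD m -
    ∑ m, ∑ c, ∑ b, (F.einv a m * F.conn m b c) • (aM c * aD b)

/-- The covariant d'Alembertian `η^{ac} (δ^b_c D_a - ω^b_{a c}) D_b`. -/
def covBox (F : AdSFrame l U) : Module.End ℝ (TensorStates U k) :=
  ∑ a, etaT a • (covD F a * covD F a - ∑ b, (∑ m, F.einv a m * F.conn m b a) • covD F b)

/-- The divergence `∂/∂a†_a D_a`. -/
def divergence (F : AdSFrame l U) : Module.End ℝ (TensorStates U k) :=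
  ∑ a, etaT a • (aD a * covD F a)

/-- The symmetrized gradient `a†^a D_a`. -/
def gradient (F : AdSFrame l U) : Module.End ℝ (TensorStates U k) := ∑ a, aM a * covD F a

/-- The number operator `a†^a ∂/∂a†^a`. -/
def numA : Module.End ℝ (TensorStates U k) := ∑ a, aM a * aD a

/-- Multiplication by `a†^a a†_a`. -/
def aSq : Module.End ℝ (TensorStates U k) := ∑ a, etaT a • (aM a * aM a)

/-- The trace `∂/∂a†_a ∂/∂a†^a`. -/
def aTrace : Module.End ℝ (TensorStates U k) := ∑ a, etaT a • (aD a * aD a)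

/-- `□̂`; the terms with `ξ, ∂/∂ξ` are those of the ghost operators `g`. -/
def hatBox (F : AdSFrame l U) (g : GhostPairs (Module.End ℝ (TensorStates U k))) :
    Module.End ℝ (TensorStates U k) :=
  covBox F + (l ^ 2)⁻¹ • (numA + 2 * (g.c * g.dξ * gradient F) +
    (3 - (d : Module.End ℝ (TensorStates U k)) - numA - 2 * (g.b * g.db) - 2 * (g.ξ * g.dξ)) *
      (numA - 2 + 2 * (g.b * g.db) + 2 * (g.ξ * g.dξ)))

/-- `Ŝ`. -/
def hatS (F : AdSFrame l U) (g : GhostPairs (Module.End ℝ (TensorStates U k))) :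
    Module.End ℝ (TensorStates U k) :=
  divergence F + (l ^ 2)⁻¹ • (2 * (g.c₀ * g.dc *
    (2 * numA + (d : Module.End ℝ (TensorStates U k)) - 3 + 2 * (g.b * g.db) + 2 * (g.ξ * g.dξ))))

/-- `Ŝ†`. -/
def hatSd (F : AdSFrame l U) (g : GhostPairs (Module.End ℝ (TensorStates U k))) :
    Module.End ℝ (TensorStates U k) :=
  gradient F + (l ^ 2)⁻¹ • (aSq * (g.c * g.dξ + 2 * (g.c₀ * g.dc)))

/-- `𝒯̂`. -/
def hatT (l : ℝ) (g : GhostPairs (Module.End ℝ (TensorStates U k))) :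
    Module.End ℝ (TensorStates U k) :=
  aTrace - 2 * (g.db * g.dc) - (l ^ 2)⁻¹ • (2 * (g.c₀ * (1 - 2 * (g.c * g.dc)) * g.dξ))

/-- `Ω̂ = c₀ □̂ + c† Ŝ + Ŝ† ∂_{b†} - c† ∂_{b†} ∂_{c₀} + ξ 𝒯̂`. On states with `k = 3` ghosts,
where `ξ` and `∂/∂ξ` act as zero, this is `Ω̂` with all `ξ, ∂/∂ξ`-dependent terms dropped. -/
def hatCharge (F : AdSFrame l U) (k : ℕ) : Module.End ℝ (TensorStates U k) :=
  let g : GhostPairs (Module.End ℝ (TensorStates U k)) := ghosts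
  g.c₀ * hatBox F g + g.c * hatS F g + hatSd F g * g.db - g.c * g.db * g.dc₀ + g.ξ * hatT l g

/-- `𝒯̂₀ = ∂/∂a†_a ∂/∂a†^a - 2 ∂_{b†} ∂_{c†}`, as an operator linear over functions of `x`. -/
def traceLin (U : TopologicalSpace.Opens (Fin d → ℝ)) :
    Module.End (SmoothFn U) (TensorStates U 3) :=
  ∑ a, etaT a • (aDlin a * aDlin a) - (2 : ℝ) • (gDlin 2 * gDlin 1)

/-- `𝒯̂₀`. -/
def traceOp (U : TopologicalSpace.Opens (Fin d → ℝ)) : Module.End ℝ (TensorStates U 3) :=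
  (traceLin U).restrictScalars ℝ

/-- The modified operator `Ω_mod = Ω̂_{ξ=0=π} + l⁻² c₀ (a†^a a†_a + 4 c† b†) 𝒯̂₀`. -/
def modCharge (F : AdSFrame l U) : Module.End ℝ (TensorStates U 3) :=
  hatCharge F 3 + (l ^ 2)⁻¹ • (gM 0 * (aSq + 4 * (gM 1 * gM 2)) * traceOp U)

/-- The inclusion of states independent of `Y^a` and `θ^m`. -/
def inclAmbient (U : TopologicalSpace.Opens (Fin d → ℝ)) :
    AmbientStates U →ₗ[SmoothFn U] ParentStates U :=
  incl ⟨fun _ => Fin.last d, fun _ _ _ => rfl⟩ (Function.Embedding.refl _) (Nat.le_add_right 6 d)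

/-- The inclusion of states independent of `z, w, μ, ν`. -/
def inclTensor (U : TopologicalSpace.Opens (Fin d → ℝ)) :
    TensorStates U 4 →ₗ[SmoothFn U] AmbientStates U :=
  incl Function.Embedding.ofIsEmpty Fin.castSuccEmb (by norm_num)

/-- The inclusion of the `ξ`-independent states annihilated by `𝒯̂₀`. -/
def inclTraceless (U : TopologicalSpace.Opens (Fin d → ℝ)) :
    LinearMap.ker (traceLin U) →ₗ[SmoothFn U] TensorStates U 4 :=
  (incl (Function.Embedding.refl _) (Function.Embedding.refl _) (by norm_num)) ∘ₗ
    (LinearMap.ker (traceLin U)).subtype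

end Charges

/-- The hermitian triplet BRST charge on `AdS_D` of radius `L` (Buchbinder, Pashnev, Tsulaia;
Sagnotti, Tsulaia), for operators `l₀` (the mass-shell operator), `l₁, l₋₁` (divergence and
gradient), `N` (the number operator shifted by `D / 2`), `M`, `M†` (half of the contractions of two
annihilation, resp. creation operators), and ghost pairs `(c₀, b₀)`, `(c₁, b₋₁)`, `(c₋₁, b₁)`. -/
def tripletCharge {R : Type} [Ring R] [Algebra ℝ R] (D L : ℝ)
    (l₀ l₁ lm₁ N M Md c₀ b₀ c₁ bm₁ cm₁ b₁ : R) : R :=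
  let lt₀ : R := l₀ - (L ^ 2)⁻¹ • ((-D + D ^ 2 / 4) • 1 + 4 * (Md * M) - N * N + 2 * N)
  c₀ * (lt₀ - (L ^ 2)⁻¹ • (4 * N) + (6 / L ^ 2) • 1) + c₁ * lm₁ + cm₁ * l₁ - cm₁ * c₁ * b₀
    - (6 / L ^ 2) • (c₀ * cm₁ * b₁) - (6 / L ^ 2) • (c₀ * bm₁ * c₁)
    + (4 / L ^ 2) • (c₀ * cm₁ * b₁ * N) + (4 / L ^ 2) • (c₀ * bm₁ * c₁ * N)
    - (8 / L ^ 2) • (c₀ * cm₁ * bm₁ * M) + (8 / L ^ 2) • (c₀ * c₁ * b₁ * Md)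
    + (12 / L ^ 2) • (c₀ * cm₁ * bm₁ * c₁ * b₁)

end AdSHigherSpin

end

noncomputable section
namespace AdSHigherSpin

/-! ### States as arrays of coefficients, and gradings by additive weights. -/

section CoefficientCalculus

variable {d : ℕ} {U : TopologicalSpace.Opens (Fin d → ℝ)} {Y B : Type} {k : ℕ}

/-! Nilpotency of the parent operator is a statement about a flat connection. Since `e^a_m = l
ω^a_{m (d)}`, the term `-θ^m e^a_m ∂/∂Y^a` only shifts `Y` by `V` in the covariant derivative
(`parentNabla_add_parentSigma`). Hence `Ω^T = θ^m 𝔇_m + Q`, where `𝔇_m` is the covariant derivative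
of the `so(d-1,2)` connection acting linearly on `Y + V` and `a†`. Torsion and curvature of the
frame say that this connection is flat (`AdSFrame.W_flat`), so the `𝔇_m` commute. The constraints
are invariant contractions, so they commute with `𝔇_m`. They also close into a subalgebra of
`sp(4)`, so that `Q² = 0` (`constraintCharge_sq`). Together these give `parentCharge_sq`.

Every reduction is an instance of homological perturbation theory. One singles out a part `δ` of `Ω`
with a homotopy `η` contracting the space onto `E` (`Contraction`), and takes `G = im δη`, `F = im
ηδ`. The component `Ω^{GF}` is invertible as soon as `L = 1 + η(Ω - δ)` is, with inverse `L⁻¹η`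
(`Contraction.consistentReduction`). For the first two reductions `δ` is a Koszul differential, and
`L` is inverted by a geometric series (`exists_equiv_sub`). One weight that the perturbation
strictly raises makes the series finite to each order in `Y`; a second weight, never lowered, keeps
the sum polynomial in `a†`. If `Ω² = 0`, the lift `K : E → M` satisfies `Ω K = K Ω̃`
(`Contraction.Ω_lift`), so the reduced operator is nilpotent.

The series is never summed. A further weight shows that a lift `Φ` contains none of the eliminated
ghosts. By `Ω K = K Ω̃` the same holds for `ΩΦ`, so differentiating `ΩΦ` with respect to an
eliminated ghost gives zero, which is an equation for `Φ`. In the first reduction it reads `𝔇_m Φ =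
0`, and it fixes the first and second derivatives in `Y^a` at `Y^a = 0` in terms of `Φ` restricted
there (`resAmbient_parentCharge`). In the second, the equations for `μ` and `ν` are the constraints
`h` and `S̄†` completed by ghost terms, and they fix the `z` and `w` derivatives at `z = w = 0`
(`resTensor_ambientCharge`). These derivatives are all that is needed to compute the reduced
operator.

For the traceless reduction `δ = ξ 𝒯̂₀`. The trace is surjective because `∂²` in a single oscillator
is inverted by double integration and the rest of the trace is a locally nilpotent correction
(`exists_ghostTrace_inverse`). The perturbation now squares to zero and the lift is the inclusion
(`traceless_reduction`). Invariance of traceless states is the `ξ`-component of `Ω̂² = 0`.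

For the modified operator one needs the commutators of d'Alembertian, divergence, gradient and trace
on AdS. They are not computed from the curvature: they are the ghost coefficients of `Ω̂² = 0`, read
off with a ghost vacuum projector (`vac_hatCharge_sq`). Given them, nilpotency of `Ω_mod` and its
commutation with the trace follow by bringing all products to normal order (`modCharge_sq`,
`modCharge_mul_traceOp`). The comparison with the triplet charge needs normal ordering only. -/

theorem Fock.ext_coeff {φ ψ : Fock U Y B k} (h : ∀ S β n, φ.coeff S β n = ψ.coeff S β n) :
    φ = ψ :=
  funext fun S => MvPolynomial.ext _ _ fun β => MvPowerSeries.ext fun n => h S β n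

theorem Fock.coeff_real_smul (c : ℝ) (φ : Fock U Y B k) (S : Finset (Fin k)) (β : B →₀ ℕ)
    (n : Y →₀ ℕ) : (c • φ).coeff S β n = c • φ.coeff S β n := rfl

theorem Fock.coeff_neg (φ : Fock U Y B k) (S : Finset (Fin k)) (β : B →₀ ℕ) (n : Y →₀ ℕ) :
    (-φ).coeff S β n = -φ.coeff S β n := rfl

theorem Fock.coeff_sub (φ ψ : Fock U Y B k) (S : Finset (Fin k)) (β : B →₀ ℕ) (n : Y →₀ ℕ) :
    (φ - ψ).coeff S β n = φ.coeff S β n - ψ.coeff S β n := rfl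

/-- The coefficient of a state, as a linear map. -/
def Fock.coeffHom (S : Finset (Fin k)) (β : B →₀ ℕ) (n : Y →₀ ℕ) :
    Fock U Y B k →ₗ[SmoothFn U] SmoothFn U where
  toFun φ := φ.coeff S β n
  map_add' φ ψ := Fock.coeff_add φ ψ S β n
  map_smul' f φ := Fock.coeff_smul f φ S β n

theorem Fock.coeff_sum {ι : Type*} (s : Finset ι) (φ : ι → Fock U Y B k) (S : Finset (Fin k))
    (β : B →₀ ℕ) (n : Y →₀ ℕ) : (∑ i ∈ s, φ i).coeff S β n = ∑ i ∈ s, (φ i).coeff S β n :=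
  map_sum (Fock.coeffHom S β n) φ s

/-- States are polynomial in `a†` but only formal in `Y`, so finiteness is a condition on `β` alone.
It is the condition under which an array of coefficients defines a state in `ofCoeff`. -/
theorem Fock.finite_support (φ : Fock U Y B k) (S : Finset (Fin k)) :
    {β : B →₀ ℕ | ∃ n, φ.coeff S β n ≠ 0}.Finite := by
  refine (MvPolynomial.support (φ S)).finite_toSet.subset ?_
  rintro β ⟨n, hn⟩
  simp only [Finset.mem_coe, MvPolynomial.mem_support_iff]
  intro h
  exact hn (by rw [Fock.coeff, h]; rfl)

/-- The power series with prescribed coefficients. -/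
def coefOf (c : (Y →₀ ℕ) → SmoothFn U) : Coef U Y := c

/-- The state with prescribed coefficients. -/
def ofCoeff (c : Finset (Fin k) → (B →₀ ℕ) → (Y →₀ ℕ) → SmoothFn U)
    (h : ∀ S, {β : B →₀ ℕ | ∃ n, c S β n ≠ 0}.Finite) : Fock U Y B k :=
  fun S => ∑ β ∈ (h S).toFinset, MvPolynomial.monomial β (coefOf (c S β))

theorem coeff_ofCoeff (c : Finset (Fin k) → (B →₀ ℕ) → (Y →₀ ℕ) → SmoothFn U)
    (h : ∀ S, {β : B →₀ ℕ | ∃ n, c S β n ≠ 0}.Finite) (S : Finset (Fin k)) (β : B →₀ ℕ)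
    (n : Y →₀ ℕ) : (ofCoeff c h).coeff S β n = c S β n := by
  classical
  simp only [Fock.coeff, ofCoeff, MvPolynomial.coeff_sum, MvPolynomial.coeff_monomial,
    Finset.sum_ite_eq']
  split_ifs with hβ
  · rfl
  · simp only [Set.Finite.mem_toFinset, Set.mem_ofPred_eq, not_exists, not_not] at hβ
    rw [hβ n]; rfl

/-! ### Coefficients of the elementary operators -/

theorem coeff_fnM (f : SmoothFn U) (φ : Fock U Y B k) (S : Finset (Fin k)) (β : B →₀ ℕ)
    (n : Y →₀ ℕ) : (fnM f φ : Fock U Y B k).coeff S β n = f * φ.coeff S β n := rfl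

theorem coeff_mapCoef {R S : Type} [CommRing R] [CommRing S] [Algebra ℝ R] [Algebra ℝ S]
    (L : R →ₗ[ℝ] S) (p : MvPolynomial B R) (β : B →₀ ℕ) :
    MvPolynomial.coeff β (mapCoef L p) = L (MvPolynomial.coeff β p) := rfl

theorem coeff_xD (m : Fin d) (φ : Fock U Y B k) (S : Finset (Fin k)) (β : B →₀ ℕ)
    (n : Y →₀ ℕ) : (xD m φ).coeff S β n = pd m (φ.coeff S β n) := rfl

theorem coeff_yD (i : Y) (φ : Fock U Y B k) (S : Finset (Fin k)) (β : B →₀ ℕ) (n : Y →₀ ℕ) :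
    (yD i φ).coeff S β n = ((n i : ℝ) + 1) • φ.coeff S β (n + Finsupp.single i 1) := by
  change MvPowerSeries.coeff n (MvPowerSeries.pderiv (SmoothFn U) i
    (MvPolynomial.coeff β (φ S))) = _
  rw [MvPowerSeries.coeff_pderiv, Algebra.smul_def, mul_comm]
  simp [Fock.coeff]

theorem coeff_aD (i : B) (φ : Fock U Y B k) (S : Finset (Fin k)) (β : B →₀ ℕ) (n : Y →₀ ℕ) :
    (aD i φ).coeff S β n = ((β i : ℝ) + 1) • φ.coeff S (β + Finsupp.single i 1) n := by
  change MvPowerSeries.coeff n (MvPolynomial.coeff β (MvPolynomial.pderiv i (φ S))) = _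
  rw [MvPolynomial.coeff_pderiv, Algebra.smul_def, mul_comm]
  have : ((β i : Coef U Y) + 1) = MvPowerSeries.C ((β i : SmoothFn U) + 1) := by simp
  rw [this, MvPowerSeries.coeff_C_mul]
  simp [Fock.coeff]

theorem coeff_coefM (f : Coef U Y) (φ : Fock U Y B k) (S : Finset (Fin k)) (β : B →₀ ℕ)
    (n : Y →₀ ℕ) : (coefM f φ).coeff S β n =
      MvPowerSeries.coeff n (f * MvPolynomial.coeff β (φ S)) := by
  change MvPowerSeries.coeff n (MvPolynomial.coeff β (MvPolynomial.C f * φ S)) = _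
  rw [MvPolynomial.coeff_C_mul]

theorem coeff_yM (i : Y) (φ : Fock U Y B k) (S : Finset (Fin k)) (β : B →₀ ℕ) (n : Y →₀ ℕ) :
    (yM i φ).coeff S β n = if n i = 0 then 0 else φ.coeff S β (n - Finsupp.single i 1) := by
  rw [yM, coeff_coefM, MvPowerSeries.X, MvPowerSeries.coeff_monomial_mul]
  simp only [Finsupp.single_le_iff, Nat.one_le_iff_ne_zero, one_mul, ite_not]
  rfl

theorem coeff_aM (i : B) (φ : Fock U Y B k) (S : Finset (Fin k)) (β : B →₀ ℕ) (n : Y →₀ ℕ) :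
    (aM i φ).coeff S β n = if β i = 0 then 0 else φ.coeff S (β - Finsupp.single i 1) n := by
  classical
  change MvPowerSeries.coeff n (MvPolynomial.coeff β (MvPolynomial.X i * φ S)) = _
  rw [MvPolynomial.coeff_X_mul']
  simp only [Finsupp.mem_support_iff, ite_not]
  split_ifs <;> simp [Fock.coeff]

theorem coeff_gM (j : ℕ) (φ : Fock U Y B k) (S : Finset (Fin k)) (β : B →₀ ℕ) (n : Y →₀ ℕ) :
    (gM j φ).coeff S β n = if hj : j < k then
      if (⟨j, hj⟩ : Fin k) ∈ S then ghSign j S • φ.coeff (S.erase ⟨j, hj⟩) β n else 0 else 0 := by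
  change MvPowerSeries.coeff n (MvPolynomial.coeff β
    (if hn : j < k then _ else _ : MvPolynomial B (Coef U Y))) = _
  split_ifs <;> rfl

theorem coeff_gD (j : ℕ) (φ : Fock U Y B k) (S : Finset (Fin k)) (β : B →₀ ℕ) (n : Y →₀ ℕ) :
    (gD j φ).coeff S β n = if hj : j < k then
      if (⟨j, hj⟩ : Fin k) ∈ S then 0 else ghSign j S • φ.coeff (insert ⟨j, hj⟩ S) β n else 0 := by
  change MvPowerSeries.coeff n (MvPolynomial.coeff β
    (if hn : j < k then _ else _ : MvPolynomial B (Coef U Y))) = _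
  split_ifs <;> rfl

/-! ### Weights and diagonal operators -/

/-- An additive weight on the monomials of a space of states. -/
structure Weight (Y B : Type) where
  g : ℕ → ℤ
  a : B → ℤ
  y : Y → ℤ

/-- The weight of a monomial. -/
def Weight.eval (w : Weight Y B) (S : Finset (Fin k)) (β : B →₀ ℕ) (n : Y →₀ ℕ) : ℤ :=
  ∑ h ∈ S, w.g h.val + (β.sum fun i e => e * w.a i) + n.sum fun i e => e * w.y i

theorem Weight.eval_add_y (w : Weight Y B) (S : Finset (Fin k)) (β : B →₀ ℕ) (n : Y →₀ ℕ)
    (i : Y) : w.eval S β (n + Finsupp.single i 1) = w.eval S β n + w.y i := by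
  classical
  simp only [Weight.eval]
  rw [Finsupp.sum_add_index' (by simp) (by intros; push_cast; ring), Finsupp.sum_single_index]
  · push_cast; ring
  · simp

theorem Weight.eval_add_a (w : Weight Y B) (S : Finset (Fin k)) (β : B →₀ ℕ) (n : Y →₀ ℕ)
    (i : B) : w.eval S (β + Finsupp.single i 1) n = w.eval S β n + w.a i := by
  classical
  simp only [Weight.eval]
  rw [Finsupp.sum_add_index' (by simp) (by intros; push_cast; ring), Finsupp.sum_single_index]
  · push_cast; ring
  · simp

theorem Weight.eval_insert (w : Weight Y B) {S : Finset (Fin k)} (β : B →₀ ℕ) (n : Y →₀ ℕ)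
    {j : Fin k} (h : j ∉ S) : w.eval (insert j S) β n = w.eval S β n + w.g j.val := by
  simp only [Weight.eval]
  rw [Finset.sum_insert h]; ring

theorem Weight.eval_erase (w : Weight Y B) {S : Finset (Fin k)} (β : B →₀ ℕ) (n : Y →₀ ℕ)
    {j : Fin k} (h : j ∈ S) : w.eval S β n = w.eval (S.erase j) β n + w.g j.val := by
  rw [← w.eval_insert β n (Finset.notMem_erase j S), Finset.insert_erase h]

theorem Weight.eval_sub_y (w : Weight Y B) (S : Finset (Fin k)) (β : B →₀ ℕ) (n : Y →₀ ℕ)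
    (i : Y) (h : n i ≠ 0) : w.eval S β n = w.eval S β (n - Finsupp.single i 1) + w.y i := by
  rw [← w.eval_add_y, tsub_add_cancel_of_le]
  simpa [Finsupp.single_le_iff, Nat.one_le_iff_ne_zero] using h

theorem Weight.eval_sub_a (w : Weight Y B) (S : Finset (Fin k)) (β : B →₀ ℕ) (n : Y →₀ ℕ)
    (i : B) (h : β i ≠ 0) : w.eval S β n = w.eval S (β - Finsupp.single i 1) n + w.a i := by
  rw [← w.eval_add_a, tsub_add_cancel_of_le]
  simpa [Finsupp.single_le_iff, Nat.one_le_iff_ne_zero] using h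

/-- The operator multiplying each monomial by a function of its weight. -/
def fdiag (w : Weight Y B) (f : ℤ → ℝ) : Module.End ℝ (Fock U Y B k) where
  toFun φ := ofCoeff (fun S β n => f (w.eval S β n) • φ.coeff S β n) fun S =>
    (φ.finite_support S).subset fun β ⟨n, hn⟩ => ⟨n, fun h => hn (by rw [h, smul_zero])⟩
  map_add' φ ψ := Fock.ext_coeff fun S β n => by
    rw [coeff_ofCoeff, Fock.coeff_add, Fock.coeff_add, coeff_ofCoeff, coeff_ofCoeff, smul_add]
  map_smul' c φ := Fock.ext_coeff fun S β n => by
    rw [coeff_ofCoeff, Fock.coeff_real_smul, RingHom.id_apply, Fock.coeff_real_smul,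
      coeff_ofCoeff, smul_comm]

theorem coeff_fdiag (w : Weight Y B) (f : ℤ → ℝ) (φ : Fock U Y B k) (S : Finset (Fin k))
    (β : B →₀ ℕ) (n : Y →₀ ℕ) :
    (fdiag w f φ).coeff S β n = f (w.eval S β n) • φ.coeff S β n :=
  coeff_ofCoeff _ _ S β n

/-- The operator `A` is homogeneous of degree `r` for the weight `w`. -/
def Hom (w : Weight Y B) (r : ℤ) (A : Module.End ℝ (Fock U Y B k)) : Prop :=
  ∀ f : ℤ → ℝ, fdiag w f * A = A * fdiag w fun x => f (x + r)

theorem Hom.add {w : Weight Y B} {r : ℤ} {A A' : Module.End ℝ (Fock U Y B k)} (h : Hom w r A)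
    (h' : Hom w r A') : Hom w r (A + A') := fun f => by rw [mul_add, add_mul, h, h']

theorem Hom.neg {w : Weight Y B} {r : ℤ} {A : Module.End ℝ (Fock U Y B k)} (h : Hom w r A) :
    Hom w r (-A) := fun f => by rw [mul_neg, neg_mul, h]

theorem Hom.sub {w : Weight Y B} {r : ℤ} {A A' : Module.End ℝ (Fock U Y B k)} (h : Hom w r A)
    (h' : Hom w r A') : Hom w r (A - A') := fun f => by rw [mul_sub, sub_mul, h, h']

theorem Hom.mul {w : Weight Y B} {r r' s : ℤ} {A A' : Module.End ℝ (Fock U Y B k)}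
    (h : Hom w r A) (h' : Hom w r' A') (hs : r + r' = s) : Hom w s (A * A') := fun f => by
  rw [← mul_assoc, h, mul_assoc, h', mul_assoc]
  subst hs
  congr 3
  funext x
  ring_nf

theorem Hom.zero (w : Weight Y B) (r : ℤ) : Hom w r (0 : Module.End ℝ (Fock U Y B k)) :=
  fun f => by rw [mul_zero, zero_mul]

theorem Hom.one (w : Weight Y B) : Hom w 0 (1 : Module.End ℝ (Fock U Y B k)) :=
  fun f => by simp only [mul_one, one_mul, add_zero]

theorem Hom.smul {w : Weight Y B} {r : ℤ} {A : Module.End ℝ (Fock U Y B k)} (c : ℝ)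
    (h : Hom w r A) : Hom w r (c • A) := fun f => by
  rw [mul_smul_comm, h, smul_mul_assoc]

theorem Hom.sum {ι : Type*} {w : Weight Y B} {r : ℤ} {s : Finset ι}
    {A : ι → Module.End ℝ (Fock U Y B k)} (h : ∀ i ∈ s, Hom w r (A i)) :
    Hom w r (∑ i ∈ s, A i) := fun f => by
  rw [Finset.mul_sum, Finset.sum_mul]
  exact Finset.sum_congr rfl fun i hi => h i hi f

theorem Hom.fnM (w : Weight Y B) (f : SmoothFn U) :
    Hom w 0 (fnM f : Module.End ℝ (Fock U Y B k)) := fun g =>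
  LinearMap.ext fun φ => Fock.ext_coeff fun S β n => by
    simp only [Module.End.mul_apply, coeff_fdiag, coeff_fnM, add_zero, mul_smul_comm]

theorem fn_smul_eq (f : SmoothFn U) (A : Module.End ℝ (Fock U Y B k)) : f • A = fnM f * A := rfl

theorem Hom.fn_smul {w : Weight Y B} {r : ℤ} {A : Module.End ℝ (Fock U Y B k)} (f : SmoothFn U)
    (h : Hom w r A) : Hom w r (f • A) := (Hom.fnM w f).mul h (zero_add r)

theorem Hom.xD (w : Weight Y B) (m : Fin d) :
    Hom w 0 (xD m : Module.End ℝ (Fock U Y B k)) := fun g =>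
  LinearMap.ext fun φ => Fock.ext_coeff fun S β n => by
    simp only [Module.End.mul_apply, coeff_fdiag, coeff_xD, add_zero, map_smul]

theorem Hom.fdiag (w w' : Weight Y B) (f : ℤ → ℝ) :
    Hom w 0 (fdiag w' f : Module.End ℝ (Fock U Y B k)) := fun g =>
  LinearMap.ext fun φ => Fock.ext_coeff fun S β n => by
    simp only [Module.End.mul_apply, coeff_fdiag, add_zero]
    rw [smul_comm]

theorem Hom.yD (w : Weight Y B) (i : Y) :
    Hom w (-w.y i) (yD i : Module.End ℝ (Fock U Y B k)) := fun g =>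
  LinearMap.ext fun φ => Fock.ext_coeff fun S β n => by
    simp only [Module.End.mul_apply, coeff_fdiag, coeff_yD, w.eval_add_y, add_neg_cancel_right]
    rw [smul_comm]

theorem Hom.aD (w : Weight Y B) (i : B) :
    Hom w (-w.a i) (aD i : Module.End ℝ (Fock U Y B k)) := fun g =>
  LinearMap.ext fun φ => Fock.ext_coeff fun S β n => by
    simp only [Module.End.mul_apply, coeff_fdiag, coeff_aD, w.eval_add_a, add_neg_cancel_right]
    rw [smul_comm]

theorem Hom.yM (w : Weight Y B) (i : Y) :
    Hom w (w.y i) (yM i : Module.End ℝ (Fock U Y B k)) := fun g =>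
  LinearMap.ext fun φ => Fock.ext_coeff fun S β n => by
    simp only [Module.End.mul_apply, coeff_fdiag, coeff_yM]
    split_ifs with h
    · rw [smul_zero]
    · rw [w.eval_sub_y S β n i h]

theorem Hom.aM (w : Weight Y B) (i : B) :
    Hom w (w.a i) (aM i : Module.End ℝ (Fock U Y B k)) := fun g =>
  LinearMap.ext fun φ => Fock.ext_coeff fun S β n => by
    simp only [Module.End.mul_apply, coeff_fdiag, coeff_aM]
    split_ifs with h
    · rw [smul_zero]
    · rw [w.eval_sub_a S β n i h]

theorem Hom.gM (w : Weight Y B) (j : ℕ) :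
    Hom w (w.g j) (gM j : Module.End ℝ (Fock U Y B k)) := fun g =>
  LinearMap.ext fun φ => Fock.ext_coeff fun S β n => by
    simp only [Module.End.mul_apply, coeff_fdiag, coeff_gM]
    split_ifs with hj h
    · rw [w.eval_erase β n h, smul_comm]
    · rw [smul_zero]
    · rw [smul_zero]

theorem Hom.gD (w : Weight Y B) (j : ℕ) :
    Hom w (-w.g j) (gD j : Module.End ℝ (Fock U Y B k)) := fun g =>
  LinearMap.ext fun φ => Fock.ext_coeff fun S β n => by
    simp only [Module.End.mul_apply, coeff_fdiag, coeff_gD]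
    split_ifs with hj h
    · rw [smul_zero]
    · rw [w.eval_insert β n h, smul_comm, add_neg_cancel_right]
    · rw [smul_zero]

/-- The states all of whose monomials have weight at least `j`. -/
def wtFil (w : Weight Y B) (j : ℤ) : Submodule (SmoothFn U) (Fock U Y B k) where
  carrier := {φ | ∀ S β n, w.eval S β n < j → φ.coeff S β n = 0}
  add_mem' h h' S β n hn := by rw [Fock.coeff_add, h S β n hn, h' S β n hn, add_zero]
  zero_mem' S β n _ := Fock.coeff_zero S β n
  smul_mem' f φ h S β n hn := by rw [Fock.coeff_smul, h S β n hn, mul_zero]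

theorem real_smul_mem_of_mem {M : Type*} [AddCommGroup M] [Module (SmoothFn U) M] [Module ℝ M]
    [IsScalarTower ℝ (SmoothFn U) M] (N : Submodule (SmoothFn U) M) (c : ℝ) {x : M} (h : x ∈ N) :
    c • x ∈ N := by
  rw [← one_smul (SmoothFn U) x, ← smul_assoc]
  exact N.smul_mem _ h

theorem wtFil_mono (w : Weight Y B) {i j : ℤ} (h : i ≤ j) :
    wtFil (U := U) (k := k) w j ≤ wtFil w i :=
  fun _ hφ S β n hn => hφ S β n (hn.trans_le h)

/-- The operator `A` raises the weight `w` by at least `r`. -/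
def HasDeg (w : Weight Y B) (r : ℤ) (A : Module.End ℝ (Fock U Y B k)) : Prop :=
  ∀ j, ∀ φ ∈ wtFil w j, A φ ∈ wtFil w (j + r)

/-- Expressing the filtration as the kernel of a spectral projector makes it accessible to `Hom`,
whose defining identity holds for every function of the weight, in particular for the indicator of
`x < j`. -/
theorem mem_wtFil_iff (w : Weight Y B) (j : ℤ) (φ : Fock U Y B k) :
    φ ∈ wtFil w j ↔ fdiag w (fun x => if x < j then 1 else 0) φ = 0 := by
  constructor
  · intro h
    refine Fock.ext_coeff fun S β n => ?_
    rw [coeff_fdiag, Fock.coeff_zero]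
    split_ifs with hn
    · rw [h S β n hn, smul_zero]
    · rw [zero_smul]
  · intro h S β n hn
    have := congrArg (fun φ => Fock.coeff φ S β n) h
    simpa [coeff_fdiag, hn, Fock.coeff_zero] using this

theorem Hom.hasDeg {w : Weight Y B} {r : ℤ} {A : Module.End ℝ (Fock U Y B k)} (h : Hom w r A) :
    HasDeg w r A := fun j φ hφ => by
  rw [mem_wtFil_iff] at hφ ⊢
  rw [← Module.End.mul_apply, h, Module.End.mul_apply]
  simp only [add_lt_add_iff_right, hφ, map_zero]

theorem HasDeg.mono {w : Weight Y B} {r r' : ℤ} {A : Module.End ℝ (Fock U Y B k)}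
    (h : HasDeg w r A) (hr : r' ≤ r) : HasDeg w r' A :=
  fun j φ hφ => wtFil_mono w (by linarith) (h j φ hφ)

theorem HasDeg.add {w : Weight Y B} {r : ℤ} {A A' : Module.End ℝ (Fock U Y B k)}
    (h : HasDeg w r A) (h' : HasDeg w r A') : HasDeg w r (A + A') :=
  fun j φ hφ => Submodule.add_mem _ (h j φ hφ) (h' j φ hφ)

theorem HasDeg.neg {w : Weight Y B} {r : ℤ} {A : Module.End ℝ (Fock U Y B k)}
    (h : HasDeg w r A) : HasDeg w r (-A) :=
  fun j φ hφ => Submodule.neg_mem _ (h j φ hφ)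

theorem HasDeg.sub {w : Weight Y B} {r : ℤ} {A A' : Module.End ℝ (Fock U Y B k)}
    (h : HasDeg w r A) (h' : HasDeg w r A') : HasDeg w r (A - A') :=
  fun j φ hφ => Submodule.sub_mem _ (h j φ hφ) (h' j φ hφ)

theorem HasDeg.smul {w : Weight Y B} {r : ℤ} {A : Module.End ℝ (Fock U Y B k)} (c : ℝ)
    (h : HasDeg w r A) : HasDeg w r (c • A) :=
  fun j φ hφ => real_smul_mem_of_mem _ c (h j φ hφ)

theorem HasDeg.fn_smul {w : Weight Y B} {r : ℤ} {A : Module.End ℝ (Fock U Y B k)}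
    (f : SmoothFn U) (h : HasDeg w r A) : HasDeg w r (f • A) :=
  fun j φ hφ => Submodule.smul_mem _ f (h j φ hφ)

theorem HasDeg.mul {w : Weight Y B} {r r' s : ℤ} {A A' : Module.End ℝ (Fock U Y B k)}
    (h : HasDeg w r A) (h' : HasDeg w r' A') (hs : s ≤ r + r') : HasDeg w s (A * A') :=
  fun j φ hφ => wtFil_mono w (by linarith) (h _ _ (h' j φ hφ))

theorem HasDeg.one (w : Weight Y B) : HasDeg w 0 (1 : Module.End ℝ (Fock U Y B k)) :=
  (Hom.one w).hasDeg

theorem HasDeg.sum {ι : Type*} {w : Weight Y B} {r : ℤ} {s : Finset ι}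
    {A : ι → Module.End ℝ (Fock U Y B k)} (h : ∀ i ∈ s, HasDeg w r (A i)) :
    HasDeg w r (∑ i ∈ s, A i) := fun j φ hφ => by
  rw [LinearMap.sum_apply]
  exact Submodule.sum_mem _ fun i hi => h i hi j φ hφ

theorem HasDeg.pow {w : Weight Y B} {r : ℤ} {A : Module.End ℝ (Fock U Y B k)}
    (h : HasDeg w r A) (m : ℕ) : HasDeg w (m * r) (A ^ m) := by
  induction m with
  | zero => simpa using HasDeg.one w
  | succ m ih => rw [pow_succ]; exact ih.mul h (by push_cast; linarith)

/-- A power series is a sum of terms of various weights, so multiplication by it is in general not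
homogeneous; with nonnegative weights for `Y` it still cannot lower the weight. This covers `(1 +
z)⁻¹`. -/
theorem HasDeg.coefM {w : Weight Y B} (hw : ∀ i, 0 ≤ w.y i) (f : Coef U Y) :
    HasDeg w 0 (coefM f : Module.End ℝ (Fock U Y B k)) := fun j φ hφ S β n hn => by
  classical
  rw [coeff_coefM, MvPowerSeries.coeff_mul]
  refine Finset.sum_eq_zero fun p hp => ?_
  rw [Finset.HasAntidiagonal.mem_antidiagonal] at hp
  have : φ.coeff S β p.2 = 0 := by
    refine hφ S β p.2 (lt_of_le_of_lt ?_ (by simpa using hn))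
    rw [← hp]
    simp only [Weight.eval]
    rw [Finsupp.sum_add_index' (by simp) (by intros; push_cast; ring)]
    have : 0 ≤ p.1.sum fun i e => (e : ℤ) * w.y i :=
      Finsupp.sum_nonneg fun i _ => mul_nonneg (by positivity) (hw i)
    linarith
  rw [Fock.coeff] at this
  rw [this, mul_zero]

end CoefficientCalculus

end AdSHigherSpin

end

noncomputable section
namespace AdSHigherSpin

/-! ### Leibniz rule and symmetry of second derivatives for functions on `U`. -/

section Derivatives

variable {d : ℕ} {U : TopologicalSpace.Opens (Fin d → ℝ)}

theorem pd_apply_eq (m : Fin d) (f : SmoothFn U) (x : U) :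
    ((show smoothFn U from pd m f) : U → ℝ) x =
      fderiv ℝ (extendFn (show smoothFn U from f)) x (Pi.single m 1) := rfl

theorem SmoothFn.ext {f g : SmoothFn U}
    (h : ∀ x, ((show smoothFn U from f) : U → ℝ) x = ((show smoothFn U from g) : U → ℝ) x) :
    f = g := Subtype.ext (funext h)

theorem pd_mul (m : Fin d) (f g : SmoothFn U) : pd m (f * g) = pd m f * g + f * pd m g := by
  refine SmoothFn.ext fun x => ?_
  change fderiv ℝ (extendFn ((show smoothFn U from f) * (show smoothFn U from g))) x _ =
    fderiv ℝ (extendFn (show smoothFn U from f)) x (Pi.single m 1) *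
      (show smoothFn U from g : U → ℝ) x +
      (show smoothFn U from f : U → ℝ) x *
        fderiv ℝ (extendFn (show smoothFn U from g)) x (Pi.single m 1)
  generalize (show smoothFn U from f) = f
  generalize (show smoothFn U from g) = g
  -- The extensions by zero need not be smooth on the boundary of `U`. Equality near the point `x`
  -- of the open set `U` is enough to identify derivatives.
  have h : extendFn (f * g) =ᶠ[nhds (x : Fin d → ℝ)] fun y => extendFn f y * extendFn g y := by
    filter_upwards [U.isOpen.mem_nhds x.2] with y hy
    have h1 := extendFn_apply (f * g) ⟨y, hy⟩
    have h2 := extendFn_apply f ⟨y, hy⟩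
    have h3 := extendFn_apply g ⟨y, hy⟩
    simp only at h1 h2 h3
    simp [h1, h2, h3]
  rw [h.fderiv_eq, fderiv_fun_mul (differentiableAt_extendFn f x) (differentiableAt_extendFn g x)]
  simp only [extendFn_apply]
  simp
  ring

theorem pd_comm (m n : Fin d) (f : SmoothFn U) : pd m (pd n f) = pd n (pd m f) := by
  refine SmoothFn.ext fun x => ?_
  have key : ∀ (i j : Fin d), ((show smoothFn U from pd i (pd j f)) : U → ℝ) x =
      fderiv ℝ (fderiv ℝ (extendFn (show smoothFn U from f))) x (Pi.single i 1)
        (Pi.single j 1) := by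
    intro i j
    rw [pd_apply_eq]
    have h : extendFn (show smoothFn U from pd j f) =ᶠ[nhds (x : Fin d → ℝ)]
        fun y => fderiv ℝ (extendFn (show smoothFn U from f)) y (Pi.single j 1) := by
      filter_upwards [U.isOpen.mem_nhds x.2] with y hy
      exact (extendFn_apply _ ⟨y, hy⟩).trans (pd_apply_eq j f ⟨y, hy⟩)
    have hd : DifferentiableAt ℝ (fderiv ℝ (extendFn (show smoothFn U from f))) x :=
      (((contDiffOn_extendFn (show smoothFn U from f)).fderiv_of_isOpen (m := 1) U.isOpen
        (by norm_cast)).differentiableOn (by simp)).differentiableAt (U.isOpen.mem_nhds x.2)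
    rw [h.fderiv_eq, fderiv_clm_apply hd (differentiableAt_const _)]
    simp
  rw [key, key]
  have hs : IsSymmSndFDerivAt ℝ (extendFn (show smoothFn U from f)) (x : Fin d → ℝ) :=
    ((contDiffOn_extendFn (show smoothFn U from f)).contDiffAt
      (U.isOpen.mem_nhds x.2)).isSymmSndFDerivAt (by simp; norm_cast)
  exact hs _ _

end Derivatives

/-! ### Commutation relations of the elementary operators. -/

section Relations

variable {d : ℕ} {U : TopologicalSpace.Opens (Fin d → ℝ)} {Y B : Type} {k : ℕ}

local notation "𝓔" => Module.End ℝ (Fock U Y B k)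

/-! ### Functions of `x` -/

theorem fnM_mul (f g : SmoothFn U) : (fnM (f * g) : 𝓔) = fnM f * fnM g :=
  LinearMap.ext fun φ => mul_smul f g φ

theorem fnM_add (f g : SmoothFn U) : (fnM (f + g) : 𝓔) = fnM f + fnM g :=
  LinearMap.ext fun φ => add_smul f g φ

theorem fnM_real_smul (c : ℝ) (f : SmoothFn U) : (fnM (c • f) : 𝓔) = c • fnM f :=
  LinearMap.ext fun φ => smul_assoc c f φ

theorem fnM_one : (fnM (1 : SmoothFn U) : 𝓔) = 1 := LinearMap.ext fun φ => one_smul (SmoothFn U) φ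

theorem fnM_zero : (fnM (0 : SmoothFn U) : 𝓔) = 0 := LinearMap.ext fun φ => zero_smul (SmoothFn U) φ

/-- Multiplication by functions, as a ring homomorphism. -/
def fnHom : SmoothFn U →+* 𝓔 where
  toFun f := fnM f
  map_one' := fnM_one
  map_mul' := fnM_mul
  map_zero' := fnM_zero
  map_add' := fnM_add

theorem fnM_sum {ι : Type*} (s : Finset ι) (f : ι → SmoothFn U) :
    (fnM (∑ i ∈ s, f i) : 𝓔) = ∑ i ∈ s, fnM (f i) := map_sum fnHom f s

theorem fnM_neg (f : SmoothFn U) : (fnM (-f) : 𝓔) = -fnM f := map_neg fnHom f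

theorem fnM_sub (f g : SmoothFn U) : (fnM (f - g) : 𝓔) = fnM f - fnM g := map_sub fnHom f g

/-- The operator `A` commutes with multiplication by functions. -/
def FnLinear (A : 𝓔) : Prop := ∀ f : SmoothFn U, Commute A (fnM f)

theorem fnLinear_of (A : 𝓔) (h : ∀ (f : SmoothFn U) φ, A (f • φ) = f • A φ) : FnLinear A :=
  fun f => LinearMap.ext fun φ => h f φ

theorem FnLinear.map_smul {A : 𝓔} (h : FnLinear A) (f : SmoothFn U) (φ : Fock U Y B k) :
    A (f • φ) = f • A φ := LinearMap.congr_fun (h f) φ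

theorem FnLinear.add {A A' : 𝓔} (h : FnLinear A) (h' : FnLinear A') : FnLinear (A + A') :=
  fun f => (h f).add_left (h' f)

theorem FnLinear.neg {A : 𝓔} (h : FnLinear A) : FnLinear (-A) := fun f => (h f).neg_left

theorem FnLinear.mul {A A' : 𝓔} (h : FnLinear A) (h' : FnLinear A') : FnLinear (A * A') :=
  fun f => (h f).mul_left (h' f)

theorem FnLinear.real_smul (c : ℝ) {A : 𝓔} (h : FnLinear A) : FnLinear (c • A) :=
  fun f => (h f).smul_left c

theorem FnLinear.sum {ι : Type*} {s : Finset ι} {A : ι → 𝓔} (h : ∀ i ∈ s, FnLinear (A i)) :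
    FnLinear (∑ i ∈ s, A i) := fun f => Commute.sum_left _ _ _ fun i hi => h i hi f

theorem FnLinear.fnM (g : SmoothFn U) : FnLinear (fnM g : 𝓔) := fun f => by
  rw [Commute, SemiconjBy, ← fnM_mul, ← fnM_mul, mul_comm]

theorem FnLinear.coefM (g : Coef U Y) : FnLinear (coefM g : 𝓔) := fnLinear_of _ fun f _ =>
  funext fun _ => mul_smul_comm (α := SmoothFn U) (β := MvPolynomial B (Coef U Y)) f _ _

theorem FnLinear.yM (i : Y) : FnLinear (yM i : 𝓔) := FnLinear.coefM _

theorem FnLinear.aM (i : B) : FnLinear (aM i : 𝓔) := fnLinear_of _ fun f _ =>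
  funext fun _ => mul_smul_comm (α := SmoothFn U) (β := MvPolynomial B (Coef U Y)) f _ _

theorem FnLinear.yD (i : Y) : FnLinear (yD i : 𝓔) := fnLinear_of _ fun f φ =>
  Fock.ext_coeff fun S β n => by
    simp only [coeff_yD, Fock.coeff_smul]
    rw [mul_smul_comm]

theorem FnLinear.aD (i : B) : FnLinear (aD i : 𝓔) := fnLinear_of _ fun f φ =>
  (aDlin i).map_smul f φ

theorem FnLinear.gD (j : ℕ) : FnLinear (gD j : 𝓔) := fnLinear_of _ fun f φ =>
  (gDlin j).map_smul f φ

theorem FnLinear.gM (j : ℕ) : FnLinear (gM j : 𝓔) := fnLinear_of _ fun f φ =>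
  Fock.ext_coeff fun S β n => by
    simp only [coeff_gM, Fock.coeff_smul]
    split_ifs
    · rw [mul_smul_comm]
    · rw [mul_zero]
    · rw [mul_zero]

theorem FnLinear.fdiag (w : Weight Y B) (g : ℤ → ℝ) : FnLinear (fdiag w g : 𝓔) :=
  fnLinear_of _ fun f φ => Fock.ext_coeff fun S β n => by
    simp only [coeff_fdiag, Fock.coeff_smul]
    rw [mul_smul_comm]

theorem xD_mul_fnM (m : Fin d) (f : SmoothFn U) :
    (xD m * fnM f : 𝓔) = fnM f * xD m + fnM (pd m f) :=
  LinearMap.ext fun φ => Fock.ext_coeff fun S β n => by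
    simp only [Module.End.mul_apply, LinearMap.add_apply, Fock.coeff_add, coeff_xD, coeff_fnM,
      pd_mul]
    ring

/-! ### Commuting variables -/

theorem xD_comm (m n : Fin d) : Commute (xD m : 𝓔) (xD n) :=
  LinearMap.ext fun φ => Fock.ext_coeff fun S β p => by
    simp only [Module.End.mul_apply, coeff_xD, pd_comm m n]

theorem coefM_mul (f g : Coef U Y) : (coefM (f * g) : 𝓔) = coefM f * coefM g :=
  LinearMap.ext fun φ => funext fun S => by
    change MvPolynomial.C (f * g) * φ S = MvPolynomial.C f * (MvPolynomial.C g * φ S)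
    rw [map_mul, mul_assoc]

theorem coefM_one : (coefM 1 : 𝓔) = 1 :=
  LinearMap.ext fun φ => funext fun S => by
    change MvPolynomial.C 1 * φ S = φ S
    rw [map_one, one_mul]

theorem coefM_add (f g : Coef U Y) : (coefM (f + g) : 𝓔) = coefM f + coefM g :=
  LinearMap.ext fun φ => funext fun S => by
    change MvPolynomial.C (f + g) * φ S = MvPolynomial.C f * φ S + MvPolynomial.C g * φ S
    rw [map_add, add_mul]

theorem coefM_real_smul (c : ℝ) (f : Coef U Y) : (coefM (c • f) : 𝓔) = c • coefM f :=
  LinearMap.ext fun φ => Fock.ext_coeff fun S β n => by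
    rw [LinearMap.smul_apply, Fock.coeff_real_smul, coeff_coefM, coeff_coefM, smul_mul_assoc]
    rfl

theorem coefM_zero : (coefM 0 : 𝓔) = 0 := by
  simpa using coefM_real_smul (k := k) (B := B) 0 (0 : Coef U Y)

theorem coefM_comm (f g : Coef U Y) : Commute (coefM f : 𝓔) (coefM g) := by
  rw [Commute, SemiconjBy, ← coefM_mul, ← coefM_mul, mul_comm]

theorem yM_comm (i j : Y) : Commute (yM i : 𝓔) (yM j) := coefM_comm _ _

theorem yD_comm (i j : Y) : Commute (yD i : 𝓔) (yD j) :=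
  LinearMap.ext fun φ => Fock.ext_coeff fun S β n => by
    classical
    simp only [Module.End.mul_apply, coeff_yD, Finsupp.add_apply, Finsupp.single_apply,
      smul_smul, add_right_comm n (Finsupp.single i 1)]
    by_cases h : i = j
    · subst h; rfl
    · simp [h, Ne.symm h, mul_comm]

theorem aD_comm (i j : B) : Commute (aD i : 𝓔) (aD j) :=
  LinearMap.ext fun φ => Fock.ext_coeff fun S β n => by
    classical
    simp only [Module.End.mul_apply, coeff_aD, Finsupp.add_apply, Finsupp.single_apply,
      smul_smul, add_right_comm β (Finsupp.single i 1)]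
    by_cases h : i = j
    · subst h; rfl
    · simp [h, Ne.symm h, mul_comm]

theorem aM_comm (i j : B) : Commute (aM i : 𝓔) (aM j) :=
  LinearMap.ext fun φ => funext fun S =>
    mul_left_comm (MvPolynomial.X i) (MvPolynomial.X j) (φ S : MvPolynomial B (Coef U Y))

theorem aM_comm_coefM (i : B) (f : Coef U Y) : Commute (aM i : 𝓔) (coefM f) :=
  LinearMap.ext fun φ => funext fun S =>
    mul_left_comm (MvPolynomial.X i) (MvPolynomial.C f) (φ S : MvPolynomial B (Coef U Y))

theorem aM_comm_yM (i : B) (j : Y) : Commute (aM i : 𝓔) (yM j) := aM_comm_coefM i _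

theorem aM_comm_yD (i : B) (j : Y) : Commute (aM i : 𝓔) (yD j) :=
  LinearMap.ext fun φ => Fock.ext_coeff fun S β n => by
    simp only [Module.End.mul_apply, coeff_aM, coeff_yD]
    split_ifs <;> simp

theorem aM_comm_xD (i : B) (m : Fin d) : Commute (aM i : 𝓔) (xD m) :=
  LinearMap.ext fun φ => Fock.ext_coeff fun S β n => by
    simp only [Module.End.mul_apply, coeff_aM, coeff_xD]
    split_ifs <;> simp

theorem aD_comm_coefM (i : B) (f : Coef U Y) : Commute (aD i : 𝓔) (coefM f) :=
  LinearMap.ext fun φ => funext fun S => by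
    have h : MvPolynomial.pderiv i (MvPolynomial.C f * φ S) =
        MvPolynomial.C f * MvPolynomial.pderiv i (φ S) := by
      rw [MvPolynomial.pderiv_C_mul]
    exact h

theorem aD_comm_yM (i : B) (j : Y) : Commute (aD i : 𝓔) (yM j) := aD_comm_coefM i _

theorem aD_comm_yD (i : B) (j : Y) : Commute (aD i : 𝓔) (yD j) :=
  LinearMap.ext fun φ => Fock.ext_coeff fun S β n => by
    simp only [Module.End.mul_apply, coeff_aD, coeff_yD]
    rw [smul_comm]

theorem aD_comm_xD (i : B) (m : Fin d) : Commute (aD i : 𝓔) (xD m) :=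
  LinearMap.ext fun φ => Fock.ext_coeff fun S β n => by
    simp only [Module.End.mul_apply, coeff_aD, coeff_xD, map_smul]

theorem yD_comm_xD (i : Y) (m : Fin d) : Commute (yD i : 𝓔) (xD m) :=
  LinearMap.ext fun φ => Fock.ext_coeff fun S β n => by
    simp only [Module.End.mul_apply, coeff_yD, coeff_xD, map_smul]

theorem yM_comm_xD (i : Y) (m : Fin d) : Commute (yM i : 𝓔) (xD m) :=
  LinearMap.ext fun φ => Fock.ext_coeff fun S β n => by
    simp only [Module.End.mul_apply, coeff_yM, coeff_xD]
    split_ifs <;> simp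

theorem aD_mul_aM [DecidableEq B] (i j : B) :
    (aD i * aM j : 𝓔) = aM j * aD i + if i = j then 1 else 0 :=
  LinearMap.ext fun φ => funext fun S => by
    have h : MvPolynomial.pderiv i (MvPolynomial.X j * φ S) =
        MvPolynomial.X j * MvPolynomial.pderiv i (φ S) +
          if i = j then (φ S : MvPolynomial B (Coef U Y)) else 0 := by
      rw [Derivation.leibniz, MvPolynomial.pderiv_X, smul_eq_mul, smul_eq_mul]
      by_cases hij : i = j
      · subst hij; simp
      · simp [hij, eq_comm]
    refine h.trans ?_
    by_cases hij : i = j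
    · simp only [hij, if_true]; rfl
    · simp only [hij, if_false]; rfl

theorem yD_mul_coefM (i : Y) (f : Coef U Y) :
    (yD i * coefM f : 𝓔) = coefM f * yD i + coefM (MvPowerSeries.pderiv (SmoothFn U) i f) :=
  LinearMap.ext fun φ => funext fun S => MvPolynomial.ext _ _ fun β => by
    change MvPowerSeries.pderiv (SmoothFn U) i
      (MvPolynomial.coeff β (MvPolynomial.C f * φ S)) =
      MvPolynomial.coeff β (MvPolynomial.C f * mapCoef
        ((MvPowerSeries.pderiv (SmoothFn U) i).toLinearMap.restrictScalars ℝ) (φ S)) +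
      MvPolynomial.coeff β (MvPolynomial.C (MvPowerSeries.pderiv (SmoothFn U) i f) * φ S)
    rw [MvPolynomial.coeff_C_mul, MvPolynomial.coeff_C_mul, MvPolynomial.coeff_C_mul,
      coeff_mapCoef, Derivation.leibniz, smul_eq_mul, smul_eq_mul]
    have h : ∀ g : Coef U Y, ((MvPowerSeries.pderiv (SmoothFn U) i).toLinearMap.restrictScalars ℝ) g =
      MvPowerSeries.pderiv (SmoothFn U) i g := fun _ => rfl
    rw [h]
    ring

theorem yD_mul_yM [DecidableEq Y] (i j : Y) :
    (yD i * yM j : 𝓔) = yM j * yD i + if i = j then 1 else 0 := by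
  rw [yM, yD_mul_coefM]
  congr 1
  by_cases hij : i = j
  · subst hij; rw [MvPowerSeries.pderiv_X_self, coefM_one, if_pos rfl]
  · rw [MvPowerSeries.pderiv_X_of_ne (Ne.symm hij), coefM_zero, if_neg hij]

/-! ### Ghosts -/

theorem ghSign_mul_self (j : ℕ) (S : Finset (Fin k)) : ghSign j S * ghSign j S = 1 := by
  rw [ghSign, ← mul_pow]; simp

theorem ghSign_insert {i j : ℕ} (hi : i < k) {S : Finset (Fin k)} (h : (⟨i, hi⟩ : Fin k) ∉ S) :
    ghSign j (insert ⟨i, hi⟩ S) = if i < j then -ghSign j S else ghSign j S := by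
  rw [ghSign, ghSign, Finset.filter_insert]
  split_ifs
  · rw [Finset.card_insert_of_notMem (by simp [h]), pow_succ]; ring
  · rfl

theorem ghSign_erase {i j : ℕ} (hi : i < k) {S : Finset (Fin k)} (h : (⟨i, hi⟩ : Fin k) ∈ S) :
    ghSign j (S.erase ⟨i, hi⟩) = if i < j then -ghSign j S else ghSign j S := by
  have := ghSign_insert (j := j) hi (Finset.notMem_erase (⟨i, hi⟩ : Fin k) S)
  rw [Finset.insert_erase h] at this
  split_ifs at this ⊢ <;> simp [this]

theorem gM_sq (i : ℕ) : (gM i * gM i : 𝓔) = 0 :=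
  LinearMap.ext fun φ => Fock.ext_coeff fun S β n => by
    simp only [Module.End.mul_apply, coeff_gM, Finset.notMem_erase, if_false]
    split_ifs <;> simp [Fock.coeff_zero]

theorem gD_sq (i : ℕ) : (gD i * gD i : 𝓔) = 0 :=
  LinearMap.ext fun φ => Fock.ext_coeff fun S β n => by
    simp only [Module.End.mul_apply, coeff_gD, Finset.mem_insert_self, if_true]
    split_ifs <;> simp [Fock.coeff_zero]

/-- Removing both ghosts in either order leaves the same set. Only the sign of the ghost with the
larger number depends on whether the other one is still present, so the two products of signs differ
by exactly `-1`. -/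
theorem gM_anticomm (i j : ℕ) : (gM i * gM j : 𝓔) = -(gM j * gM i) := by
  rcases eq_or_ne i j with rfl | hne
  · rw [gM_sq, neg_zero]
  refine LinearMap.ext fun φ => Fock.ext_coeff fun S β n => ?_
  simp only [LinearMap.neg_apply, Fock.coeff_neg, Module.End.mul_apply, coeff_gM,
    Finset.mem_erase, ne_eq, Fin.mk.injEq, hne, hne.symm, not_false_eq_true, true_and]
  by_cases hi : i < k <;> by_cases hj : j < k <;> simp only [hi, hj, dif_pos, dif_neg,
    not_false_eq_true, smul_zero, neg_zero, ite_self]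
  by_cases h : (⟨i, hi⟩ : Fin k) ∈ S <;> by_cases h' : (⟨j, hj⟩ : Fin k) ∈ S <;>
    simp only [h, h', if_true, if_false, smul_zero, neg_zero]
  rw [ghSign_erase hi h, ghSign_erase hj h', Finset.erase_right_comm, smul_smul, smul_smul,
    ← neg_smul]
  congr 1
  rcases lt_or_gt_of_ne hne with hl | hl
  · simp [hl, hl.not_gt]; ring
  · simp [hl, hl.not_gt]; ring

theorem gD_anticomm (i j : ℕ) : (gD i * gD j : 𝓔) = -(gD j * gD i) := by
  rcases eq_or_ne i j with rfl | hne
  · rw [gD_sq, neg_zero]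
  refine LinearMap.ext fun φ => Fock.ext_coeff fun S β n => ?_
  simp only [LinearMap.neg_apply, Fock.coeff_neg, Module.End.mul_apply, coeff_gD,
    Finset.mem_insert, Fin.mk.injEq, hne, hne.symm, false_or]
  by_cases hi : i < k <;> by_cases hj : j < k <;> simp only [hi, hj, dif_pos, dif_neg,
    not_false_eq_true, smul_zero, neg_zero, ite_self]
  by_cases h : (⟨i, hi⟩ : Fin k) ∈ S <;> by_cases h' : (⟨j, hj⟩ : Fin k) ∈ S <;>
    simp only [h, h', if_true, if_false, smul_zero, neg_zero]
  rw [ghSign_insert hi h, ghSign_insert hj h', Finset.insert_comm, smul_smul, smul_smul,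
    ← neg_smul]
  congr 1
  rcases lt_or_gt_of_ne hne with hl | hl
  · simp [hl, hl.not_gt]; ring
  · simp [hl, hl.not_gt]; ring

theorem gD_mul_gM_of_ne {i j : ℕ} (hne : i ≠ j) : (gD i * gM j : 𝓔) = -(gM j * gD i) := by
  refine LinearMap.ext fun φ => Fock.ext_coeff fun S β n => ?_
  simp only [LinearMap.neg_apply, Fock.coeff_neg, Module.End.mul_apply, coeff_gD, coeff_gM,
    Finset.mem_insert, Finset.mem_erase, ne_eq, Fin.mk.injEq, hne, hne.symm, false_or,
    not_false_eq_true, true_and]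
  by_cases hi : i < k <;> by_cases hj : j < k <;> simp only [hi, hj, dif_pos, dif_neg,
    not_false_eq_true, smul_zero, neg_zero, ite_self]
  by_cases h : (⟨i, hi⟩ : Fin k) ∈ S <;> by_cases h' : (⟨j, hj⟩ : Fin k) ∈ S <;>
    simp only [h, h', if_true, if_false, smul_zero, neg_zero]
  rw [ghSign_insert hi h, ghSign_erase hj h', Finset.erase_insert_of_ne (by simp [hne]),
    smul_smul, smul_smul, ← neg_smul]
  congr 1
  rcases lt_or_gt_of_ne hne with hl | hl
  · simp [hl, hl.not_gt]; ring
  · simp [hl, hl.not_gt]; ring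

theorem gD_mul_gM_self {i : ℕ} (hi : i < k) : (gD i * gM i : 𝓔) = 1 - gM i * gD i := by
  refine LinearMap.ext fun φ => Fock.ext_coeff fun S β n => ?_
  simp only [LinearMap.sub_apply, Module.End.one_apply, Fock.coeff_sub, Module.End.mul_apply,
    coeff_gD, coeff_gM, hi, dif_pos]
  by_cases h : (⟨i, hi⟩ : Fin k) ∈ S
  · simp only [h, if_true, Finset.notMem_erase, if_false]
    rw [ghSign_erase hi h, Finset.insert_erase h, smul_smul]
    simp [ghSign_mul_self]
  · simp only [h, if_false, Finset.mem_insert_self, if_true]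
    rw [ghSign_insert hi h, Finset.erase_insert h, smul_smul]
    simp [ghSign_mul_self]

theorem gM_eq_zero {i : ℕ} (hi : k ≤ i) : (gM i : 𝓔) = 0 :=
  LinearMap.ext fun φ => Fock.ext_coeff fun S β n => by
    rw [coeff_gM, dif_neg (by lia)]; rfl

theorem gD_eq_zero {i : ℕ} (hi : k ≤ i) : (gD i : 𝓔) = 0 :=
  LinearMap.ext fun φ => Fock.ext_coeff fun S β n => by
    rw [coeff_gD, dif_neg (by lia)]; rfl

/-- The operator `A` commutes with all ghosts and ghost derivatives. -/
def Bosonic (A : 𝓔) : Prop := ∀ j, Commute A (gM j) ∧ Commute A (gD j)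

/-- Ghost operators permute the components of a state and multiply them by signs or zero; a linear
map applied to every component alike commutes with that. -/
theorem Bosonic.compLeft (L : Module.End ℝ (MvPolynomial B (Coef U Y))) :
    Bosonic (L.compLeft (Finset (Fin k)) : 𝓔) := by
  refine fun j => ⟨LinearMap.ext fun φ => funext fun S => ?_,
    LinearMap.ext fun φ => funext fun S => ?_⟩
  · change L (if hn : j < k then _ else _ : MvPolynomial B (Coef U Y)) =
      (if hn : j < k then _ else _ : MvPolynomial B (Coef U Y))
    split_ifs
    · exact L.map_smul _ _
    · exact L.map_zero
    · exact L.map_zero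
  · change L (if hn : j < k then _ else _ : MvPolynomial B (Coef U Y)) =
      (if hn : j < k then _ else _ : MvPolynomial B (Coef U Y))
    split_ifs
    · exact L.map_zero
    · exact L.map_smul _ _
    · exact L.map_zero

theorem Bosonic.xD (m : Fin d) : Bosonic (xD m : 𝓔) := Bosonic.compLeft _
theorem Bosonic.coefM (f : Coef U Y) : Bosonic (coefM f : 𝓔) := Bosonic.compLeft _
theorem Bosonic.yM (i : Y) : Bosonic (yM i : 𝓔) := Bosonic.compLeft _
theorem Bosonic.yD (i : Y) : Bosonic (yD i : 𝓔) := Bosonic.compLeft _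
theorem Bosonic.aM (i : B) : Bosonic (aM i : 𝓔) := Bosonic.compLeft _
theorem Bosonic.aD (i : B) : Bosonic (aD i : 𝓔) := Bosonic.compLeft
  ((MvPolynomial.pderiv i).toLinearMap.restrictScalars ℝ)
theorem Bosonic.fnM (f : SmoothFn U) : Bosonic (fnM f : 𝓔) :=
  fun j => ⟨(FnLinear.gM j f).symm, (FnLinear.gD j f).symm⟩

theorem Bosonic.one : Bosonic (1 : 𝓔) := fun _ => ⟨Commute.one_left _, Commute.one_left _⟩

theorem Bosonic.add {A A' : 𝓔} (h : Bosonic A) (h' : Bosonic A') : Bosonic (A + A') :=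
  fun j => ⟨(h j).1.add_left (h' j).1, (h j).2.add_left (h' j).2⟩

theorem Bosonic.sub {A A' : 𝓔} (h : Bosonic A) (h' : Bosonic A') : Bosonic (A - A') :=
  fun j => ⟨(h j).1.sub_left (h' j).1, (h j).2.sub_left (h' j).2⟩

theorem Bosonic.mul {A A' : 𝓔} (h : Bosonic A) (h' : Bosonic A') : Bosonic (A * A') :=
  fun j => ⟨(h j).1.mul_left (h' j).1, (h j).2.mul_left (h' j).2⟩

theorem Bosonic.real_smul (c : ℝ) {A : 𝓔} (h : Bosonic A) : Bosonic (c • A) :=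
  fun j => ⟨(h j).1.smul_left c, (h j).2.smul_left c⟩

theorem Bosonic.fn_smul (f : SmoothFn U) {A : 𝓔} (h : Bosonic A) : Bosonic (f • A) :=
  (Bosonic.fnM f).mul h

theorem Bosonic.sum {ι : Type*} {s : Finset ι} {A : ι → 𝓔} (h : ∀ i ∈ s, Bosonic (A i)) :
    Bosonic (∑ i ∈ s, A i) :=
  fun j => ⟨Commute.sum_left _ _ _ fun i hi => (h i hi j).1,
    Commute.sum_left _ _ _ fun i hi => (h i hi j).2⟩

/-! ### Number operators and the ghost number -/

/-- The weight of the ghost number. -/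
def ghWeight : Weight Y B := ⟨fun n => if n = 2 then -1 else 1, fun _ => 0, fun _ => 0⟩

theorem coeff_gM_gD {j : ℕ} (hj : j < k) (φ : Fock U Y B k) (S : Finset (Fin k)) (β : B →₀ ℕ)
    (n : Y →₀ ℕ) : ((gM j * gD j : 𝓔) φ).coeff S β n =
      if (⟨j, hj⟩ : Fin k) ∈ S then φ.coeff S β n else 0 := by
  simp only [Module.End.mul_apply, coeff_gM, coeff_gD, hj, dif_pos, Finset.notMem_erase, if_false]
  split_ifs with h
  · rw [ghSign_erase hj h, Finset.insert_erase h, smul_smul]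
    simp [ghSign_mul_self]
  · rfl

theorem coeff_yM_yD (i : Y) (φ : Fock U Y B k) (S : Finset (Fin k)) (β : B →₀ ℕ)
    (n : Y →₀ ℕ) : ((yM i * yD i : 𝓔) φ).coeff S β n = (n i : ℝ) • φ.coeff S β n := by
  simp only [Module.End.mul_apply, coeff_yM, coeff_yD]
  split_ifs with h
  · simp [h]
  · have h1 : Finsupp.single i 1 ≤ n := by
      simpa [Finsupp.single_le_iff, Nat.one_le_iff_ne_zero] using h
    rw [tsub_add_cancel_of_le h1, Finsupp.tsub_apply, Finsupp.single_eq_same,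
      Nat.cast_sub (Nat.one_le_iff_ne_zero.2 h)]
    simp

theorem coeff_aM_aD (i : B) (φ : Fock U Y B k) (S : Finset (Fin k)) (β : B →₀ ℕ)
    (n : Y →₀ ℕ) : ((aM i * aD i : 𝓔) φ).coeff S β n = (β i : ℝ) • φ.coeff S β n := by
  simp only [Module.End.mul_apply, coeff_aM, coeff_aD]
  split_ifs with h
  · simp [h]
  · have h1 : Finsupp.single i 1 ≤ β := by
      simpa [Finsupp.single_le_iff, Nat.one_le_iff_ne_zero] using h
    rw [tsub_add_cancel_of_le h1, Finsupp.tsub_apply, Finsupp.single_eq_same,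
      Nat.cast_sub (Nat.one_le_iff_ne_zero.2 h)]
    simp

theorem ghostNumber_eq_fdiag : (ghostNumber : 𝓔) = fdiag ghWeight fun x => (x : ℝ) := by
  refine LinearMap.ext fun φ => Fock.ext_coeff fun S β n => ?_
  have h : (fdiag ghWeight (fun x => (x : ℝ)) φ).coeff S β n =
      ∑ h ∈ S, (if h.val = 2 then (-1 : ℝ) else 1) • φ.coeff S β n := by
    rw [coeff_fdiag, ← Finset.sum_smul]
    congr 1
    simp [Weight.eval, ghWeight]
  rw [h, ghostNumber, LinearMap.sum_apply, Fock.coeff_sum, Finset.sum_range,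
    ← Finset.sum_subset (Finset.subset_univ S)]
  · refine Finset.sum_congr rfl fun i hi => ?_
    rw [LinearMap.smul_apply, Fock.coeff_real_smul, coeff_gM_gD i.2, if_pos hi]
  · intro i _ hi
    rw [LinearMap.smul_apply, Fock.coeff_real_smul, coeff_gM_gD i.2, if_neg hi, smul_zero]

/-- The ghost number is the diagonal operator of the identity function, so this is homogeneity for
`f x = x`. -/
theorem Hom.ghost_comm {r : ℤ} {A : 𝓔} (h : Hom ghWeight r A) :
    ghostNumber * A - A * ghostNumber = (r : ℝ) • A := by
  rw [ghostNumber_eq_fdiag, h, ← mul_sub]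
  have : ((AdSHigherSpin.fdiag ghWeight fun x : ℤ => ((x + r : ℤ) : ℝ)) -
      AdSHigherSpin.fdiag ghWeight fun x : ℤ => (x : ℝ) : 𝓔) =
      (r : ℝ) • 1 := by
    refine LinearMap.ext fun φ => Fock.ext_coeff fun S β n => ?_
    rw [LinearMap.sub_apply, Fock.coeff_sub, coeff_fdiag, coeff_fdiag, ← sub_smul]
    simp [Fock.coeff_real_smul]
  rw [this, mul_smul_comm, mul_one]

end Relations

end AdSHigherSpin

end

noncomputable section
namespace AdSHigherSpin

set_option linter.unusedSectionVars false

/-! ### Differential operators of finite order and continuity. -/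

section DifferentialOperators

variable {A : Type} [CommRing A] [Algebra ℝ A]
variable {M : Type} [AddCommGroup M] [Module A M] [Module ℝ M] [IsScalarTower ℝ A M]
variable {N : Type} [AddCommGroup N] [Module A N] [Module ℝ N] [IsScalarTower ℝ A N]
variable {P : Type} [AddCommGroup P] [Module A P] [Module ℝ P] [IsScalarTower ℝ A P]

theorem real_smul_mem_submodule (N' : Submodule A N) (c : ℝ) {x : N} (h : x ∈ N') :
    c • x ∈ N' := by
  rw [← one_smul A x, ← smul_assoc]
  exact N'.smul_mem _ h

theorem fnM_apply (f : A) (x : M) : (fnM f : M →ₗ[ℝ] M) x = f • x := rfl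

theorem OrderLE.zero {N' : Submodule A N} (n : ℕ) : OrderLE N' n (0 : M →ₗ[ℝ] N) := by
  induction n with
  | zero => intro f φ; simp
  | succ n ih => intro f; simpa using ih

theorem OrderLE.add {N' : Submodule A N} {n : ℕ} {O O' : M →ₗ[ℝ] N} (h : OrderLE N' n O)
    (h' : OrderLE N' n O') : OrderLE N' n (O + O') := by
  induction n generalizing O O' with
  | zero =>
    intro f φ
    convert N'.add_mem (h f φ) (h' f φ) using 1
    simp only [LinearMap.add_apply, smul_add]; abel
  | succ n ih =>
    intro f
    convert ih (h f) (h' f) using 1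
    rw [LinearMap.add_comp, LinearMap.comp_add]; abel

theorem OrderLE.real_smul {N' : Submodule A N} {n : ℕ} (c : ℝ) {O : M →ₗ[ℝ] N}
    (h : OrderLE N' n O) : OrderLE N' n (c • O) := by
  induction n generalizing O with
  | zero =>
    intro f φ
    convert real_smul_mem_submodule N' c (h f φ) using 1
    have : f • c • O φ = c • f • O φ := (fnM f : N →ₗ[ℝ] N).map_smul c (O φ)
    rw [LinearMap.smul_apply, LinearMap.smul_apply, smul_sub, this]
  | succ n ih =>
    intro f
    convert ih (h f) using 1
    rw [LinearMap.smul_comp, LinearMap.comp_smul, smul_sub]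

theorem OrderLE.succ {N' : Submodule A N} {n : ℕ} {O : M →ₗ[ℝ] N} (h : OrderLE N' n O) :
    OrderLE N' (n + 1) O := by
  induction n generalizing O with
  | zero =>
    intro f g φ
    have h1 := h g (f • φ)
    have h2 := N'.smul_mem f (h g φ)
    convert N'.sub_mem h1 h2 using 1
    simp only [LinearMap.sub_apply, LinearMap.comp_apply, fnM_apply, smul_sub,
      smul_comm f g (O φ), smul_comm f g φ]
    abel
  | succ n ih => intro f; exact ih (h f)

theorem OrderLE.mono {N' : Submodule A N} {n m : ℕ} {O : M →ₗ[ℝ] N} (h : OrderLE N' n O)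
    (hnm : n ≤ m) : OrderLE N' m O := by
  induction m, hnm using Nat.le_induction with
  | base => exact h
  | succ m _ ih => exact ih.succ

theorem OrderLE.mono_submodule {N' N'' : Submodule A N} (hN : N' ≤ N'') {n : ℕ}
    {O : M →ₗ[ℝ] N} (h : OrderLE N' n O) : OrderLE N'' n O := by
  induction n generalizing O with
  | zero => intro f φ; exact hN (h f φ)
  | succ n ih => intro f; exact ih (h f)

theorem OrderLE.of_range {N' : Submodule A N} {O : M →ₗ[ℝ] N} (h : ∀ φ, O φ ∈ N') :
    OrderLE N' 0 O := fun f φ => N'.sub_mem (h _) (N'.smul_mem f (h φ))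

theorem OrderLE.of_linear {O : M →ₗ[ℝ] N} (h : ∀ (f : A) φ, O (f • φ) = f • O φ) :
    OrderLE (⊥ : Submodule A N) 0 O := fun f φ => by rw [h, sub_self]; exact zero_mem _

theorem OrderLE.comp_linear {N' : Submodule A N} {n : ℕ} {O : M →ₗ[ℝ] N} (h : OrderLE N' n O)
    (L : P →ₗ[A] M) : OrderLE N' n (O ∘ₗ L.restrictScalars ℝ) := by
  induction n generalizing O with
  | zero =>
    intro f φ
    simpa using h f (L φ)
  | succ n ih =>
    intro f
    convert ih (h f) using 1
    ext φ
    simp [fnM_apply]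

/-- Induction on the total order: the commutator with a function is a derivation of composition, so
each of the two resulting terms has one factor of lower order, or vanishes if that factor had order
zero. The orders are taken modulo `⊥`, because the outer operator need not respect a nonzero
submodule. -/
theorem OrderLE.comp {n m : ℕ} {O : N →ₗ[ℝ] P} {O' : M →ₗ[ℝ] N}
    (h : OrderLE (⊥ : Submodule A P) n O) (h' : OrderLE (⊥ : Submodule A N) m O') :
    OrderLE (⊥ : Submodule A P) (n + m) (O ∘ₗ O') := by
  induction hs : n + m generalizing n m O O' with
  | zero =>
    obtain ⟨rfl, rfl⟩ : n = 0 ∧ m = 0 := by lia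
    refine OrderLE.of_linear fun f φ => ?_
    have h1 : O' (f • φ) = f • O' φ := sub_eq_zero.1 (by simpa using h' f φ)
    have h2 : O (f • O' φ) = f • O (O' φ) := sub_eq_zero.1 (by simpa using h f (O' φ))
    rw [LinearMap.comp_apply, h1, h2, LinearMap.comp_apply]
  | succ s ih =>
    intro f
    have key : (O ∘ₗ O') ∘ₗ fnM f - fnM f ∘ₗ (O ∘ₗ O') =
        O ∘ₗ (O' ∘ₗ fnM f - fnM f ∘ₗ O') + (O ∘ₗ fnM f - fnM f ∘ₗ O) ∘ₗ O' := by
      ext φ; simp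
    rw [key]
    refine OrderLE.add ?_ ?_
    · cases m with
      | zero =>
        have : O' ∘ₗ fnM f - fnM f ∘ₗ O' = 0 := by
          ext φ; simpa [fnM_apply] using h' f φ
        rw [this, LinearMap.comp_zero]
        exact OrderLE.zero _
      | succ m => exact ih h (h' f) (by lia)
    · cases n with
      | zero =>
        have : O ∘ₗ fnM f - fnM f ∘ₗ O = 0 := by
          ext φ; simpa [fnM_apply] using h f φ
        rw [this, LinearMap.zero_comp]
        exact OrderLE.zero _
      | succ n => exact ih (h f) h' (by lia)

/-- The operator `O` is a differential operator of finite order. -/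
def FinOrder (A : Type) [CommRing A] [Algebra ℝ A] [Module A M] [IsScalarTower ℝ A M]
    (O : Module.End ℝ M) : Prop := ∃ n, OrderLE (⊥ : Submodule A M) n O

theorem FinOrder.add {O O' : Module.End ℝ M} (h : FinOrder A O) (h' : FinOrder A O') :
    FinOrder A (O + O') := by
  obtain ⟨n, hn⟩ := h
  obtain ⟨m, hm⟩ := h'
  exact ⟨max n m, (hn.mono (le_max_left _ _)).add (hm.mono (le_max_right _ _))⟩

theorem FinOrder.mul {O O' : Module.End ℝ M} (h : FinOrder A O) (h' : FinOrder A O') :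
    FinOrder A (O * O') := by
  obtain ⟨n, hn⟩ := h
  obtain ⟨m, hm⟩ := h'
  exact ⟨n + m, hn.comp hm⟩

theorem FinOrder.real_smul (c : ℝ) {O : Module.End ℝ M} (h : FinOrder A O) :
    FinOrder A (c • O) := by
  obtain ⟨n, hn⟩ := h
  exact ⟨n, hn.real_smul c⟩

theorem FinOrder.of_linear {O : Module.End ℝ M} (h : ∀ (f : A) φ, O (f • φ) = f • O φ) :
    FinOrder A O := ⟨0, OrderLE.of_linear h⟩

variable {fM : ℕ → Submodule A M} {fN : ℕ → Submodule A N} {fP : ℕ → Submodule A P}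

theorem FilContinuous.comp {O : N →ₗ[ℝ] P} {O' : M →ₗ[ℝ] N} (h : FilContinuous fN fP O)
    (h' : FilContinuous fM fN O') : FilContinuous fM fP (O ∘ₗ O') := fun k => by
  obtain ⟨m, hm⟩ := h k
  obtain ⟨m', hm'⟩ := h' m
  exact ⟨m', fun φ hφ => hm _ (hm' φ hφ)⟩

theorem FilContinuous.add (hf : Antitone fM) {O O' : M →ₗ[ℝ] N} (h : FilContinuous fM fN O)
    (h' : FilContinuous fM fN O') : FilContinuous fM fN (O + O') := fun k => by
  obtain ⟨m, hm⟩ := h k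
  obtain ⟨m', hm'⟩ := h' k
  exact ⟨max m m', fun φ hφ => Submodule.add_mem _ (hm φ (hf (le_max_left m m') hφ))
    (hm' φ (hf (le_max_right m m') hφ))⟩

end DifferentialOperators

/-! ### Homological perturbation: from a contraction to a consistent reduction. -/

section Contractions

variable {A : Type} [CommRing A] [Algebra ℝ A]
variable {M : Type} [AddCommGroup M] [Module A M] [Module ℝ M] [IsScalarTower ℝ A M]
variable {E : Type} [AddCommGroup E] [Module A E] [Module ℝ E] [IsScalarTower ℝ A E]

/-- A contraction of the complex `(M, δ)` to its subspace `E`, with homotopy `η`. -/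
structure Contraction (gh : Module.End ℝ M) (ι : E →ₗ[A] M) (π : M →ₗ[A] E)
    (δ η : M →ₗ[A] M) : Prop where
  π_ι : ∀ φ, π (ι φ) = φ
  decomp : ∀ φ, ι (π φ) + δ (η φ) + η (δ φ) = φ
  δ_δ : ∀ φ, δ (δ φ) = 0
  η_η : ∀ φ, η (η φ) = 0
  η_δ_η : ∀ φ, η (δ (η φ)) = η φ
  δ_η_δ : ∀ φ, δ (η (δ φ)) = δ φ
  η_ι : ∀ φ, η (ι φ) = 0
  π_η : ∀ φ, π (η φ) = 0
  gh_δ : ∀ φ, gh (δ φ) = δ (gh φ) + δ φ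
  gh_η : ∀ φ, gh (η φ) = η (gh φ) - η φ

variable {gh Ω : Module.End ℝ M} {ι : E →ₗ[A] M} {π : M →ₗ[A] E} {δ η : M →ₗ[A] M}

/-- The lift of states of the reduced system, for the perturbation `L = 1 + η (Ω - δ)`. -/
def reductionLift (Ω : Module.End ℝ M) (ι : E →ₗ[A] M) (η : M →ₗ[A] M) (L : M ≃ₗ[ℝ] M) :
    E →ₗ[ℝ] M :=
  ι.restrictScalars ℝ -
    (L.symm : M →ₗ[ℝ] M) ∘ₗ η.restrictScalars ℝ ∘ₗ Ω ∘ₗ ι.restrictScalars ℝ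

theorem reductionLift_apply (L : M ≃ₗ[ℝ] M) (φ : E) :
    reductionLift Ω ι η L φ = ι φ - L.symm (η (Ω (ι φ))) := rfl

namespace Contraction

variable (hC : Contraction gh ι π δ η) {L : M ≃ₗ[ℝ] M} (hL : ∀ φ, L φ = φ + η (Ω φ - δ φ))
include hC hL

/-- `L` differs from the identity by an operator with values in the image of `η`, so `L⁻¹` maps that
image to itself; on it `ηδ` acts as the identity. -/
theorem symm_mem (φ : M) : η (δ (L.symm (η φ))) = L.symm (η φ) := by
  have h : L.symm (η φ) = η φ - η (Ω (L.symm (η φ)) - δ (L.symm (η φ))) := by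
    rw [eq_sub_iff_add_eq, ← hL, L.apply_symm_apply]
  rw [h, map_sub, map_sub, hC.η_δ_η, hC.η_δ_η]

/-- On the image of `η` one has `ηδ = 1`, and `L = 1 + η(Ω - δ)` becomes `ηΩ`. Thus inverting `L`
inverts `ηΩ` there. -/
theorem η_Ω_symm (φ : M) : η (Ω (L.symm (η φ))) = η φ := by
  have h : L (L.symm (η φ)) = η φ := L.apply_symm_apply _
  rw [hL, map_sub, hC.symm_mem hL] at h
  simpa using h

/-- `δ` and `η` are inverse isomorphisms between `F = im ηδ` and `G = im δη`. On `F` the component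
`Ω^{GF} = δη Ω` is `δ` after `ηΩ`, and `ηΩ` agrees there with `L`; its inverse is therefore `L⁻¹η`.
-/
theorem consistentReduction {fM : ℕ → Submodule A M} {fE : ℕ → Submodule A E}
    {Ω' : Module.End ℝ E} (hι : FilContinuous fE fM (ι.restrictScalars ℝ))
    (hπ : FilContinuous fM fE (π.restrictScalars ℝ))
    (hδ : FilContinuous fM fM (δ.restrictScalars ℝ))
    (hη : FilContinuous fM fM (η.restrictScalars ℝ))
    (hLi : IsGradedDiffOp fM fM (L.symm : M →ₗ[ℝ] M))
    (hΩ' : ∀ φ, Ω' φ = π (Ω (reductionLift Ω ι η L φ))) :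
    ConsistentReduction fM gh Ω fE ι Ω' := by
  have hPG : ∀ φ, δ (η (gh φ)) = gh (δ (η φ)) := fun φ => by
    rw [hC.gh_δ, hC.gh_η, map_sub, sub_add_cancel]
  have hPF : ∀ φ, η (δ (gh φ)) = gh (η (δ φ)) := fun φ => by
    rw [hC.gh_η, hC.gh_δ, map_add, add_sub_cancel_right]
  -- The data are `P_G = δη`, `P_F = ηδ` and `R = L⁻¹η`.
  refine ⟨π, δ ∘ₗ η, η ∘ₗ δ, (L.symm : M →ₗ[ℝ] M) ∘ₗ η.restrictScalars ℝ,
    ⟨LinearMap.ext hC.π_ι, ?_, ?_, ?_, ?_, LinearMap.ext hC.decomp⟩,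
    ⟨hι, hπ, hδ.comp hη, hη.comp hδ⟩, ?_, ⟨⟨hLi.1.comp hη, ?_⟩, ?_, ?_, ?_⟩, ?_⟩
  · ext φ; simp [hC.η_δ_η]
  · ext φ; simp [hC.δ_η_δ]
  · ext φ; simp [hC.η_η]
  · ext φ; simp [hC.δ_δ]
  · intro φ
    refine ⟨?_, hPG φ, hPF φ⟩
    -- The projector `ιπ` is the complement of the two others, which commute with the ghost number
    -- because the shifts by `δ` and `η` cancel.
    have h1 := hC.decomp (gh φ)
    have h2 := congrArg gh (hC.decomp φ)
    rw [map_add, map_add, ← hPG, ← hPF] at h2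
    exact add_right_cancel (add_right_cancel (h1.trans h2.symm))
  · intro k
    obtain ⟨n, hn⟩ := hLi.2 k
    exact ⟨n, hn.comp_linear η⟩
  · intro φ
    simp only [LinearMap.comp_apply, LinearMap.restrictScalars_apply, hC.η_δ_η]
    exact hC.symm_mem hL φ
  · intro φ
    simp only [LinearMap.comp_apply, LinearMap.restrictScalars_apply, hC.η_δ_η]
    refine L.symm_apply_eq.2 ?_
    rw [hL, map_sub, hC.δ_η_δ]
    simp
  · intro φ
    simp only [LinearMap.comp_apply, LinearMap.restrictScalars_apply]
    have h := hC.symm_mem hL φ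
    change δ (η (Ω (η (δ (L.symm (η φ)))))) = _
    rw [h, hC.η_Ω_symm hL]
  · intro φ
    rw [hΩ', reductionLift_apply, map_sub, map_sub]
    simp only [LinearMap.comp_apply, LinearMap.restrictScalars_apply, hC.η_δ_η]
    congr 3
    exact (hC.symm_mem hL _).symm

theorem π_lift (φ : E) : π (reductionLift Ω ι η L φ) = φ := by
  rw [reductionLift_apply, ← hC.symm_mem hL, map_sub, hC.π_ι, hC.π_η, sub_zero]

theorem η_lift (φ : E) : η (reductionLift Ω ι η L φ) = 0 := by
  rw [reductionLift_apply, ← hC.symm_mem hL, map_sub, hC.η_ι, hC.η_η, sub_zero]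

theorem η_Ω_lift (φ : E) : η (Ω (reductionLift Ω ι η L φ)) = 0 := by
  rw [reductionLift_apply, map_sub, map_sub, hC.η_Ω_symm hL, sub_self]

/-- The image of the lift is cut out by `ηψ = 0` and `ηΩψ = 0`. Both hold for `ψ = ΩKφ`, the second
because `Ω² = 0`. So the difference `χ = ψ - Kπψ` satisfies `πχ = ηχ = ηΩχ = 0`; it then lies in
`F`, where `L = ηΩ`, and injectivity of `L` gives `χ = 0`. -/
theorem Ω_lift (hΩ : Ω * Ω = 0) (φ : E) :
    Ω (reductionLift Ω ι η L φ) =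
      reductionLift Ω ι η L (π (Ω (reductionLift Ω ι η L φ))) := by
  have hΩ2 : ∀ φ, Ω (Ω φ) = 0 := fun φ => LinearMap.congr_fun hΩ φ
  set ψ := Ω (reductionLift Ω ι η L φ) with hψ
  set χ := ψ - reductionLift Ω ι η L (π ψ) with hχ
  have h1 : π χ = 0 := by rw [hχ, map_sub, hC.π_lift hL, sub_self]
  have h2 : η χ = 0 := by rw [hχ, map_sub, hC.η_lift hL, hψ, hC.η_Ω_lift hL, sub_self]
  have h3 : η (Ω χ) = 0 := by
    rw [hχ, map_sub, map_sub, hC.η_Ω_lift hL, hψ, hΩ2, map_zero, sub_zero]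
  have h4 : η (δ χ) = χ := by simpa [h1, h2] using hC.decomp χ
  have h5 : L χ = 0 := by rw [hL, map_sub, h3, h4]; simp
  exact sub_eq_zero.1 (L.map_eq_zero_iff.1 h5)

theorem nilpotent {Ω' : Module.End ℝ E} (hΩ : Ω * Ω = 0)
    (hΩ' : ∀ φ, Ω' φ = π (Ω (reductionLift Ω ι η L φ))) : Ω' * Ω' = 0 := by
  refine LinearMap.ext fun φ => ?_
  rw [Module.End.mul_apply, hΩ', hΩ', ← hC.Ω_lift hL hΩ]
  have := LinearMap.congr_fun hΩ (reductionLift Ω ι η L φ)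
  rw [Module.End.mul_apply] at this
  rw [this]; simp

end Contraction

end Contractions

end AdSHigherSpin

end

noncomputable section
namespace AdSHigherSpin

/-! ### Convergence of the geometric series inverting `1 - T`. -/

section GeometricSeries

variable {d : ℕ} {U : TopologicalSpace.Opens (Fin d → ℝ)} {Y B : Type} {k : ℕ}

local notation "𝓔" => Module.End ℝ (Fock U Y B k)

theorem fil_antitone : Antitone (fil : ℕ → Submodule (SmoothFn U) (Fock U Y B k)) :=
  fun _ _ h _ hφ S β n hn => hφ S β n (hn.trans_le h)

theorem eq_zero_of_mem_fil {φ : Fock U Y B k} (h : ∀ m, φ ∈ fil m) : φ = 0 :=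
  Fock.ext_coeff fun S β n => h (n.degree + 1) S β n (Nat.lt_succ_self _)

/-- The weight counting the order in the variables `Y`. -/
def orderWeight : Weight Y B := ⟨fun _ => 0, fun _ => 0, fun _ => 1⟩

theorem orderWeight_eval (S : Finset (Fin k)) (β : B →₀ ℕ) (n : Y →₀ ℕ) :
    (orderWeight : Weight Y B).eval S β n = n.degree := by
  simp [Weight.eval, orderWeight, Finsupp.degree_apply, Finsupp.sum]

theorem mem_fil_iff (m : ℕ) (φ : Fock U Y B k) : φ ∈ fil m ↔ φ ∈ wtFil orderWeight (m : ℤ) := by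
  constructor
  · intro h S β n hn
    rw [orderWeight_eval] at hn
    exact h S β n (by exact_mod_cast hn)
  · intro h S β n hn
    exact h S β n (by rw [orderWeight_eval]; exact_mod_cast hn)

theorem HasDeg.filContinuous {r : ℤ} {A : 𝓔} (h : HasDeg orderWeight r A) :
    FilContinuous fil fil A := fun j => ⟨j + r.natAbs, fun φ hφ => by
  rw [mem_fil_iff] at hφ ⊢
  exact wtFil_mono _ (by omega) (h _ φ hφ)⟩

/-- A bound of the contribution of the ghosts to a weight. -/
def Weight.ghostBound (w : Weight Y B) (k : ℕ) : ℕ := ∑ h : Fin k, (w.g h.val).natAbs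

theorem Weight.abs_ghosts_le (w : Weight Y B) (S : Finset (Fin k)) :
    |∑ h ∈ S, w.g h.val| ≤ w.ghostBound k := by
  refine (Finset.abs_sum_le_sum_abs _ _).trans ?_
  rw [Weight.ghostBound, Nat.cast_sum]
  simp only [Int.natCast_natAbs]
  exact Finset.sum_le_sum_of_subset_of_nonneg (Finset.subset_univ S) fun _ _ _ => abs_nonneg _

/-- A weight blind to `Y` sees only the finitely many monomials in `a†` and the ghosts that occur in
the state. -/
theorem exists_mem_wtFil {w : Weight Y B} (hw : ∀ i, w.y i = 0) (φ : Fock U Y B k) :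
    ∃ j, φ ∈ wtFil w j := by
  have hfin : (⋃ S : Finset (Fin k), (fun β => w.eval S β 0) ''
      {β : B →₀ ℕ | ∃ n, φ.coeff S β n ≠ 0}).Finite :=
    Set.finite_iUnion fun S => (φ.finite_support S).image _
  obtain ⟨j, hj⟩ := hfin.bddBelow
  refine ⟨j, fun S β n hn => ?_⟩
  by_contra hne
  have h1 := hj (Set.mem_iUnion.2 ⟨S, β, ⟨n, hne⟩, rfl⟩)
  have h2 : w.eval S β n = w.eval S β 0 := by
    simp [Weight.eval, hw]
  simp only at h1
  lia

variable {T : Module.End ℝ (Fock U Y B k)} {w₁ w₂ : Weight Y B} {c : ℕ}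

/-- Let `B` bound the ghost contribution. The weight `w₁` is blind to `a†` and nonnegative on `Y`,
so every state has weight at least `-B`, and `T^m φ` at least `m - B`. A monomial of order below `j`
in `Y` has weight at most `B + c j`, so it cannot occur once `m > c j + 2B`. -/
theorem pow_mem_fil (h₁ : HasDeg w₁ 1 T) (ha : ∀ i, w₁.a i = 0) (hy : ∀ i, 0 ≤ w₁.y i)
    (hyc : ∀ i, w₁.y i ≤ c) {m j : ℕ} (hm : c * j + 2 * w₁.ghostBound k < m)
    (φ : Fock U Y B k) : (T ^ m) φ ∈ fil j := by
  intro S β n hn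
  have heval : ∀ (S : Finset (Fin k)) (β : B →₀ ℕ) (n : Y →₀ ℕ),
      w₁.eval S β n = ∑ h ∈ S, w₁.g h.val + n.sum fun i e => (e : ℤ) * w₁.y i := by
    intro S β n
    simp [Weight.eval, ha]
  have h0 : φ ∈ wtFil w₁ (-(w₁.ghostBound k : ℤ)) := by
    intro S β n hn
    rw [heval] at hn
    have h1 := neg_le_of_abs_le (w₁.abs_ghosts_le S)
    have h2 : 0 ≤ n.sum fun i e => (e : ℤ) * w₁.y i :=
      Finsupp.sum_nonneg fun i _ => mul_nonneg (by positivity) (hy i)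
    lia
  refine h₁.pow m _ φ h0 S β n ?_
  rw [heval]
  have h1 := le_of_abs_le (w₁.abs_ghosts_le S)
  have h2 : (n.sum fun i e => (e : ℤ) * w₁.y i) ≤ c * n.degree := by
    rw [Finsupp.degree_apply, Finsupp.sum, Nat.cast_sum, Finset.mul_sum]
    refine Finset.sum_le_sum fun i _ => ?_
    rw [mul_comm (c : ℤ)]
    exact mul_le_mul_of_nonneg_left (hyc i) (by positivity)
  have h3 : (c : ℤ) * n.degree ≤ c * j :=
    mul_le_mul_of_nonneg_left (by exact_mod_cast hn.le) (by positivity)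
  zify at hm
  lia

/-- The sum is defined coefficient by coefficient, each coefficient being a finite sum. What has to
be checked is that the result is still polynomial in `a†`. As `w₂` is not lowered by `T`, ignores
`Y`, and counts each oscillator with weight at most `-1`, the degrees in `a†` of all `T^m φ` have a
common bound. -/
theorem exists_geometric_sum [Finite B] (h₂ : HasDeg w₂ 0 T) (hy₂ : ∀ i, w₂.y i = 0)
    (ha₂ : ∀ i, w₂.a i ≤ -1) {K : ℕ → ℕ} (hK : Monotone K)
    (hT : ∀ m j, K j ≤ m → ∀ φ, (T ^ m) φ ∈ fil j) (φ : Fock U Y B k) :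
    ∃ ψ : Fock U Y B k, ∀ j, ψ - ∑ m ∈ Finset.range (K j), (T ^ m) φ ∈ fil j := by
  obtain ⟨j₀, hj₀⟩ := exists_mem_wtFil hy₂ φ
  have hpow : ∀ m, (T ^ m) φ ∈ wtFil w₂ j₀ := fun m => by
    simpa using h₂.pow m _ φ hj₀
  -- Membership in `fil j` kills coefficients of order strictly below `j`, so the coefficient at `n`
  -- is final after `K (n.degree + 1)` terms.
  have hfin : ∀ S : Finset (Fin k), {β : B →₀ ℕ | ∃ n : Y →₀ ℕ,
      ∑ m ∈ Finset.range (K (n.degree + 1)), ((T ^ m) φ).coeff S β n ≠ 0}.Finite := by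
    intro S
    refine (Finsupp.finite_of_degree_le (w₂.ghostBound k - j₀).toNat).subset ?_
    rintro β ⟨n, hn⟩
    obtain ⟨m, -, hm⟩ := Finset.exists_ne_zero_of_sum_ne_zero hn
    have h1 : j₀ ≤ w₂.eval S β n := by
      by_contra hlt
      exact hm (hpow m S β n (by lia))
    have h2 : (β.sum fun i e => (e : ℤ) * w₂.a i) ≤ -(β.degree : ℤ) := by
      rw [Finsupp.degree_apply, Finsupp.sum, Nat.cast_sum, ← Finset.sum_neg_distrib]
      refine Finset.sum_le_sum fun i _ => ?_
      have := mul_le_mul_of_nonneg_left (ha₂ i) (show (0 : ℤ) ≤ β i by positivity)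
      lia
    have h3 := le_of_abs_le (w₂.abs_ghosts_le S)
    have h4 : w₂.eval S β n = ∑ h ∈ S, w₂.g h.val + β.sum fun i e => (e : ℤ) * w₂.a i := by
      simp [Weight.eval, hy₂]
    change β.degree ≤ _
    lia
  refine ⟨ofCoeff _ hfin, fun j S β n hn => ?_⟩
  rw [Fock.coeff_sub, coeff_ofCoeff, Fock.coeff_sum, sub_eq_zero]
  refine Finset.sum_subset (Finset.range_mono (hK hn)) fun m _ hm => ?_
  exact hT m (n.degree + 1) (by simpa using hm) φ S β n (Nat.lt_succ_self _)

theorem sub_geometric_sum (T : 𝓔) (m : ℕ) (ψ : Fock U Y B k) :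
    ∑ i ∈ Finset.range m, (T ^ i) (ψ - T ψ) = ψ - (T ^ m) ψ := by
  have h := LinearMap.congr_fun (geom_sum_mul_neg T m) ψ
  simpa [LinearMap.sum_apply] using h

/-- Modulo `fil j` the inverse is a partial sum of the series, and this gives everything at once:
injectivity (a fixed point of `T` lies in every `fil j`), surjectivity, graded finite order, and
preservation of any weight filtration that `T` preserves. The last property later excludes
eliminated ghosts from the lifts. -/
theorem exists_equiv_sub [Finite B] (hT : FilContinuous fil fil T)
    (hTo : FinOrder (SmoothFn U) T) (h₁ : HasDeg w₁ 1 T) (ha : ∀ i, w₁.a i = 0)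
    (hy : ∀ i, 0 ≤ w₁.y i) (hyc : ∀ i, w₁.y i ≤ c) (h₂ : HasDeg w₂ 0 T)
    (hy₂ : ∀ i, w₂.y i = 0) (ha₂ : ∀ i, w₂.a i ≤ -1) :
    ∃ L : Fock U Y B k ≃ₗ[ℝ] Fock U Y B k, (∀ φ, L φ = φ - T φ) ∧
      IsGradedDiffOp fil fil (L.symm : Fock U Y B k →ₗ[ℝ] Fock U Y B k) ∧
      ∀ (w : Weight Y B) (j : ℤ), HasDeg w 0 T → ∀ φ ∈ wtFil w j, L.symm φ ∈ wtFil w j := by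
  -- `pow_mem_fil` needs a strict inequality, whence the `+ 1`.
  set K : ℕ → ℕ := fun j => c * j + 2 * w₁.ghostBound k + 1 with hKdef
  have hK : Monotone K := fun a b h => by
    have := Nat.mul_le_mul_left c h
    simp only [hKdef]; lia
  have hpow : ∀ m j, K j ≤ m → ∀ φ, (T ^ m) φ ∈ fil j := fun m j hm φ =>
    pow_mem_fil h₁ ha hy hyc (by simp only [hKdef] at hm; lia) φ
  have hinj : Function.Injective ((1 : 𝓔) - T) := by
    rw [← LinearMap.ker_eq_bot, LinearMap.ker_eq_bot']
    intro φ hφ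
    have hφ' : φ - T φ = 0 := hφ
    refine eq_zero_of_mem_fil fun j => ?_
    have h := sub_geometric_sum T (K j) φ
    simp only [hφ', map_zero, Finset.sum_const_zero] at h
    rw [sub_eq_zero.1 h.symm]
    exact hpow _ j le_rfl φ
  have hsurj : Function.Surjective ((1 : 𝓔) - T) := by
    intro φ
    obtain ⟨ψ, hψ⟩ := exists_geometric_sum h₂ hy₂ ha₂ hK hpow φ
    refine ⟨ψ, sub_eq_zero.1 (eq_zero_of_mem_fil fun j => ?_)⟩
    -- The partial sum must approximate `ψ` to order `max J j`, so that after applying `T` the error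
    -- is still of order `j`.
    obtain ⟨J, hJ⟩ := hT j
    set s := ∑ m ∈ Finset.range (K (max J j)), (T ^ m) φ with hs
    have h1 : s - T s = φ - (T ^ K (max J j)) φ := by
      have := LinearMap.congr_fun (mul_neg_geom_sum T (K (max J j))) φ
      simpa [LinearMap.sum_apply, hs] using this
    have h2 := hψ (max J j)
    have h3 : ((1 : 𝓔) - T) ψ - φ = (ψ - s) - T (ψ - s) - (T ^ K (max J j)) φ := by
      have : ((1 : 𝓔) - T) ψ = ψ - T ψ := rfl
      have h4 : φ = s - T s + (T ^ K (max J j)) φ := by rw [h1, sub_add_cancel]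
      rw [this, map_sub]
      generalize (T ^ K (max J j)) φ = r at h4 ⊢
      rw [h4]; abel
    rw [h3]
    exact Submodule.sub_mem _ (Submodule.sub_mem _ (fil_antitone (le_max_right J j) h2)
      (hJ _ (fil_antitone (le_max_left J j) h2)))
      (fil_antitone (le_max_right J j) (hpow _ _ le_rfl φ))
  let L := LinearEquiv.ofBijective ((1 : 𝓔) - T) ⟨hinj, hsurj⟩
  have hL : ∀ φ, L φ = φ - T φ := fun φ => rfl
  have hexp : ∀ m φ, L.symm φ = ∑ i ∈ Finset.range m, (T ^ i) φ + (T ^ m) (L.symm φ) := by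
    intro m φ
    have h := sub_geometric_sum T m (L.symm φ)
    rw [← hL, L.apply_symm_apply] at h
    rw [h, sub_add_cancel]
  have hcpow : ∀ i, FilContinuous fil fil (T ^ i) := fun i => by
    induction i with
    | zero => exact fun j => ⟨j, fun φ hφ => hφ⟩
    | succ i ih => rw [pow_succ]; exact ih.comp hT
  have hopow : ∀ i, FinOrder (SmoothFn U) (T ^ i) := fun i => by
    induction i with
    | zero => exact FinOrder.of_linear fun f φ => rfl
    | succ i ih => rw [pow_succ]; exact ih.mul hTo
  have hcsum : ∀ m, FilContinuous fil fil (∑ i ∈ Finset.range m, T ^ i) := fun m => by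
    induction m with
    | zero => exact fun j => ⟨j, fun φ _ => zero_mem _⟩
    | succ m ih => rw [Finset.sum_range_succ]; exact ih.add fil_antitone (hcpow m)
  have hosum : ∀ m, FinOrder (SmoothFn U) (∑ i ∈ Finset.range m, T ^ i) := fun m => by
    induction m with
    | zero => exact FinOrder.of_linear fun f φ => by simp
    | succ m ih => rw [Finset.sum_range_succ]; exact ih.add (hopow m)
  refine ⟨L, hL, ⟨fun j => ?_, fun j => ?_⟩, fun w j hw φ hφ S β n hn => ?_⟩
  · obtain ⟨m, hm⟩ := hcsum (K j) j
    refine ⟨m, fun φ hφ => ?_⟩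
    rw [LinearEquiv.coe_coe, hexp (K j) φ, ← LinearMap.sum_apply]
    exact Submodule.add_mem _ (hm φ hφ) (hpow _ _ le_rfl _)
  · obtain ⟨o, ho⟩ := hosum (K j)
    refine ⟨o, ?_⟩
    -- The remainder takes values in `fil j`, so it counts as an operator of order zero modulo `fil
    -- j`; the partial sum has honest finite order, depending on `j`.
    have : (L.symm : Fock U Y B k →ₗ[ℝ] Fock U Y B k) =
        ∑ i ∈ Finset.range (K j), T ^ i + (T ^ K j) ∘ₗ (L.symm : _ →ₗ[ℝ] _) := by
      refine LinearMap.ext fun φ => ?_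
      rw [LinearEquiv.coe_coe, hexp (K j) φ, LinearMap.add_apply, LinearMap.sum_apply]
      rfl
    rw [this]
    exact (ho.mono_submodule bot_le).add
      ((OrderLE.of_range fun φ => hpow _ _ le_rfl (L.symm φ)).mono (Nat.zero_le _))
  · rw [hexp (K (n.degree + 1)) φ, Fock.coeff_add, Fock.coeff_sum,
      hpow _ _ le_rfl _ S β n (Nat.lt_succ_self _), add_zero]
    refine Finset.sum_eq_zero fun i _ => ?_
    have := hw.pow i _ φ hφ
    simp only [mul_zero, add_zero] at this
    exact this S β n hn

theorem FnLinear.finOrder {A : 𝓔} (h : FnLinear A) : FinOrder (SmoothFn U) A :=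
  FinOrder.of_linear h.map_smul

theorem xD_finOrder (m : Fin d) : FinOrder (SmoothFn U) (xD m : 𝓔) := by
  refine ⟨1, fun f => ?_⟩
  have : (xD m : 𝓔) ∘ₗ fnM f - fnM f ∘ₗ (xD m : 𝓔) = fnM (pd m f) :=
    sub_eq_iff_eq_add'.2 (xD_mul_fnM m f)
  rw [this]
  exact OrderLE.of_linear (FnLinear.fnM (pd m f)).map_smul

end GeometricSeries

end AdSHigherSpin

end

noncomputable section
namespace AdSHigherSpin

/-! ### Nilpotency of the charge built from the constraints. -/

section ConstraintCharge

variable {d : ℕ} {U : TopologicalSpace.Opens (Fin d → ℝ)} {Y B : Type} {k : ℕ}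

local notation "𝓔" => Module.End ℝ (Fock U Y B k)

/-- The inequality orients anticommutation, so that `simp` sorts ghost monomials by number. Together
with the rules moving derivatives to the right, this defines the normal order used in all the
expansions below. -/
theorem gM_swap {i j : ℕ} (_ : j < i) : (gM i * gM j : 𝓔) = -(gM j * gM i) := gM_anticomm i j

theorem gM_swap_assoc {i j : ℕ} (_ : j < i) (A : 𝓔) :
    gM i * (gM j * A) = -(gM j * (gM i * A)) := by
  rw [← mul_assoc, gM_anticomm, neg_mul, mul_assoc]

theorem gM_sq_assoc (i : ℕ) (A : 𝓔) : gM i * (gM i * A) = 0 := by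
  rw [← mul_assoc, gM_sq, zero_mul]

theorem gD_swap {i j : ℕ} (_ : j < i) : (gD i * gD j : 𝓔) = -(gD j * gD i) := gD_anticomm i j

theorem gD_swap_assoc {i j : ℕ} (_ : j < i) (A : 𝓔) :
    gD i * (gD j * A) = -(gD j * (gD i * A)) := by
  rw [← mul_assoc, gD_anticomm, neg_mul, mul_assoc]

theorem gD_sq_assoc (i : ℕ) (A : 𝓔) : gD i * (gD i * A) = 0 := by
  rw [← mul_assoc, gD_sq, zero_mul]

theorem gD_gM_swap_assoc {i j : ℕ} (h : i ≠ j) (A : 𝓔) :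
    gD i * (gM j * A) = -(gM j * (gD i * A)) := by
  rw [← mul_assoc, gD_mul_gM_of_ne h, neg_mul, mul_assoc]

theorem gD_gM_self_assoc {i : ℕ} (h : i < k) (A : 𝓔) :
    gD i * (gM i * A) = A - gM i * (gD i * A) := by
  rw [← mul_assoc, gD_mul_gM_self h, sub_mul, one_mul, mul_assoc]

theorem Bosonic.mul_gM {A : 𝓔} (h : Bosonic A) (j : ℕ) : A * gM j = gM j * A := (h j).1

theorem Bosonic.mul_gD {A : 𝓔} (h : Bosonic A) (j : ℕ) : A * gD j = gD j * A := (h j).2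

theorem Bosonic.mul_gM_assoc {A : 𝓔} (h : Bosonic A) (j : ℕ) (C : 𝓔) :
    A * (gM j * C) = gM j * (A * C) := (h j).1.left_comm C

theorem Bosonic.mul_gD_assoc {A : 𝓔} (h : Bosonic A) (j : ℕ) (C : 𝓔) :
    A * (gD j * C) = gD j * (A * C) := (h j).2.left_comm C

theorem two_mul_eq_smul (A : 𝓔) : 2 * A = (2 : ℝ) • A := by rw [two_mul, two_smul]

set_option maxHeartbeats 4000000 in
-- The relations say that `Sd`, `h`, `Sb` span an `sl(2)` under which the mutually commuting `Box`,
-- `S`, `T` form a triplet, a subalgebra of `sp(4)`. The charge is its BRST operator, with the ghost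
-- of `Sd` represented by `∂/∂b†`, and its square vanishes by the Jacobi identity. In the proof all
-- products are brought to normal order, after which the terms cancel linearly.
theorem constraintCharge_sq (hk : 6 ≤ k) {Box S Sd T h Sb : 𝓔}
    (bBox : Bosonic Box) (bS : Bosonic S) (bSd : Bosonic Sd) (bT : Bosonic T) (bh : Bosonic h)
    (bSb : Bosonic Sb)
    (r1 : S * Box = Box * S) (r2 : Sd * Box = Box * Sd) (r3 : T * Box = Box * T)
    (r4 : S * Sd = Sd * S + Box) (r5 : T * S = S * T) (r6 : T * Sd = Sd * T + (2 : ℝ) • S)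
    (r7 : h * Box = Box * h + (2 : ℝ) • Box) (r8 : h * S = S * h)
    (r9 : h * Sd = Sd * h + (2 : ℝ) • Sd) (r10 : h * T = T * h - (2 : ℝ) • T)
    (r11 : Sb * h = h * Sb + (2 : ℝ) • Sb) (r12 : Sb * Box = Box * Sb - (2 : ℝ) • S)
    (r13 : Sb * S = S * Sb - T) (r14 : Sb * Sd = Sd * Sb - h) (r15 : Sb * T = T * Sb) :
    constraintCharge ghosts Box S Sd T h Sb * constraintCharge ghosts Box S Sd T h Sb = 0 := by
  have h0 : 0 < k := by lia
  have h1 : 1 < k := by lia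
  have h2 : 2 < k := by lia
  have h3 : 3 < k := by lia
  have h4 : 4 < k := by lia
  have h5 : 5 < k := by lia
  simp only [constraintCharge, ghosts, two_mul_eq_smul, mul_assoc, mul_add, add_mul, mul_sub,
    sub_mul, smul_mul_assoc, mul_smul_comm, bBox.mul_gM, bBox.mul_gD, bBox.mul_gM_assoc,
    bBox.mul_gD_assoc, bS.mul_gM, bS.mul_gD, bS.mul_gM_assoc,
    bS.mul_gD_assoc, bSd.mul_gM, bSd.mul_gD, bSd.mul_gM_assoc,
    bSd.mul_gD_assoc, bT.mul_gM, bT.mul_gD, bT.mul_gM_assoc,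
    bT.mul_gD_assoc, bh.mul_gM, bh.mul_gD, bh.mul_gM_assoc,
    bh.mul_gD_assoc, bSb.mul_gM, bSb.mul_gD, bSb.mul_gM_assoc,
    bSb.mul_gD_assoc, gM_swap, gM_swap_assoc, gM_sq, gM_sq_assoc, gD_swap, gD_swap_assoc, gD_sq,
    gD_sq_assoc, gD_gM_swap_assoc, gD_mul_gM_of_ne, gD_mul_gM_self, gD_gM_self_assoc, h0, h1, h2,
    h3, h4, h5, r1, r2, r3, r4, r5, r6, r7, r8, r9, r10, r11, r12, r13, r14, r15, mul_neg, neg_mul,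
    neg_neg, smul_neg, mul_zero, zero_mul, smul_zero, neg_zero, add_zero, zero_add, sub_zero,
    zero_sub, mul_one, one_mul, Nat.reduceLT, ne_eq, Nat.reduceEqDiff, not_false_eq_true,
    OfNat.ofNat_ne_zero, OfNat.zero_ne_ofNat, OfNat.ofNat_ne_one, OfNat.one_ne_ofNat, zero_ne_one, one_ne_zero, smul_smul, smul_add,
    smul_sub, Nat.ofNat_pos, Nat.one_lt_ofNat, Nat.lt_one_iff, zero_lt_one]
  module

end ConstraintCharge

end AdSHigherSpin

end

noncomputable section
namespace AdSHigherSpin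

set_option linter.unusedSimpArgs false

/-! ### Degree and parity of the charge. -/

section ConstraintChargeProperties

variable {d : ℕ} {U : TopologicalSpace.Opens (Fin d → ℝ)} {Y B : Type} {k : ℕ}

local notation "𝓔" => Module.End ℝ (Fock U Y B k)

theorem HasDeg.gM (w : Weight Y B) (j : ℕ) : HasDeg w (w.g j) (gM j : 𝓔) := (Hom.gM w j).hasDeg

theorem HasDeg.gD (w : Weight Y B) (j : ℕ) : HasDeg w (-w.g j) (gD j : 𝓔) := (Hom.gD w j).hasDeg

/-- The inequalities `h1` to `h6` bound the degrees of the terms cubic in the ghosts; all cubic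
terms consisting of `μ` and a ghost number operator have the degree of `μ`, which is `h3`. -/
theorem constraintCharge_hasDeg {w : Weight Y B} {r : ℤ} {Box S Sd T h Sb : 𝓔}
    (hBox : HasDeg w (r - w.g 0) Box) (hS : HasDeg w (r - w.g 1) S)
    (hSd : HasDeg w (r + w.g 2) Sd) (hT : HasDeg w (r - w.g 3) T)
    (hh : HasDeg w (r - w.g 4) h) (hSb : HasDeg w (r - w.g 5) Sb)
    (h1 : r ≤ w.g 1 - w.g 2 - w.g 0) (h2 : r ≤ w.g 3 - w.g 2 - w.g 1) (h3 : r ≤ w.g 4)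
    (h4 : r ≤ w.g 5 + w.g 0 - w.g 1) (h5 : r ≤ w.g 5 + w.g 1 - w.g 3)
    (h6 : r ≤ w.g 5 - w.g 2 - w.g 4) :
    HasDeg w r (constraintCharge ghosts Box S Sd T h Sb) := by
  simp only [constraintCharge, ghosts, two_mul_eq_smul]
  have m := fun j => HasDeg.gM (U := U) (k := k) w j
  have D := fun j => HasDeg.gD (U := U) (k := k) w j
  refine .add (.add (.add (.add (.add (.sub (.sub (.sub (.sub (.add (.add (.add (.add (.add
    ((m 0).mul hBox (by lia)) ((m 1).mul hS (by lia))) (hSd.mul (D 2) (by lia)))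
    ((m 3).mul hT (by lia))) ((m 4).mul hh (by lia))) ((m 5).mul hSb (by lia)))
    (((m 1).mul (D 2) le_rfl).mul (D 0) (by lia)))
    (.smul 2 (((m 3).mul (D 2) le_rfl).mul (D 1) (by lia))))
    (.smul 2 (((m 4).mul (m 0) le_rfl).mul (D 0) (by lia))))
    (.smul 2 (((m 4).mul (D 2) le_rfl).mul (m 2) (by lia))))
    (.smul 2 (((m 4).mul (m 3) le_rfl).mul (D 3) (by lia))))
    (.smul 2 (((m 5).mul (m 0) le_rfl).mul (D 1) (by lia))))
    (.smul 2 (((m 4).mul (m 5) le_rfl).mul (D 5) (by lia))))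
    (((m 5).mul (m 1) le_rfl).mul (D 3) (by lia)))
    (((m 5).mul (D 2) le_rfl).mul (D 4) (by lia))

theorem FinOrder.neg {A : 𝓔} (h : FinOrder (SmoothFn U) A) : FinOrder (SmoothFn U) (-A) := by
  simpa using h.real_smul (-1)

theorem FinOrder.sub {A A' : 𝓔} (h : FinOrder (SmoothFn U) A)
    (h' : FinOrder (SmoothFn U) A') : FinOrder (SmoothFn U) (A - A') := by
  rw [sub_eq_add_neg]; exact h.add h'.neg

theorem constraintCharge_commute {Box S Sd T h Sb A : 𝓔} (bA : Bosonic A)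
    (hBox : Commute A Box) (hS : Commute A S) (hSd : Commute A Sd) (hT : Commute A T)
    (hh : Commute A h) (hSb : Commute A Sb) :
    Commute A (constraintCharge ghosts Box S Sd T h Sb) := by
  simp only [constraintCharge, ghosts, two_mul_eq_smul]
  have m := fun j => (bA j).1
  have D := fun j => (bA j).2
  exact .add_right (.add_right (.add_right (.add_right (.add_right (.sub_right (.sub_right
    (.sub_right (.sub_right (.add_right (.add_right (.add_right (.add_right (.add_right
    ((m 0).mul_right hBox) ((m 1).mul_right hS)) (hSd.mul_right (D 2)))
    ((m 3).mul_right hT)) ((m 4).mul_right hh)) ((m 5).mul_right hSb))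
    (((m 1).mul_right (D 2)).mul_right (D 0)))
    (.smul_right (((m 3).mul_right (D 2)).mul_right (D 1)) (2 : ℝ)))
    (.smul_right (((m 4).mul_right (m 0)).mul_right (D 0)) (2 : ℝ)))
    (.smul_right (((m 4).mul_right (D 2)).mul_right (m 2)) (2 : ℝ)))
    (.smul_right (((m 4).mul_right (m 3)).mul_right (D 3)) (2 : ℝ)))
    (.smul_right (((m 5).mul_right (m 0)).mul_right (D 1)) (2 : ℝ)))
    (.smul_right (((m 4).mul_right (m 5)).mul_right (D 5)) (2 : ℝ)))
    (((m 5).mul_right (m 1)).mul_right (D 3)))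
    (((m 5).mul_right (D 2)).mul_right (D 4))

/-- The charge is odd and involves only ghosts with numbers below `6`, hence anticommutes with the
`θ^m`. -/
theorem constraintCharge_mul_gM (hk : 2 < k) {Box S Sd T h Sb : 𝓔} (bBox : Bosonic Box) (bS : Bosonic S)
    (bSd : Bosonic Sd) (bT : Bosonic T) (bh : Bosonic h) (bSb : Bosonic Sb) {j : ℕ} (hj : 6 ≤ j) :
    constraintCharge ghosts Box S Sd T h Sb * gM j =
      -(gM j * constraintCharge ghosts Box S Sd T h Sb) := by
  have e0 : 0 < j := by lia
  have e1 : 1 < j := by lia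
  have e2 : 2 < j := by lia
  have e3 : 3 < j := by lia
  have e4 : 4 < j := by lia
  have e5 : 5 < j := by lia
  simp only [constraintCharge, ghosts, two_mul_eq_smul, mul_assoc, mul_add, add_mul, mul_sub,
    sub_mul, smul_mul_assoc, mul_smul_comm, bBox.mul_gM, bS.mul_gM, bSd.mul_gM, bT.mul_gM,
    bh.mul_gM, bSb.mul_gM, bBox.mul_gM_assoc, bS.mul_gM_assoc, bSd.mul_gM_assoc,
    bT.mul_gM_assoc, bh.mul_gM_assoc, bSb.mul_gM_assoc, gM_swap, gM_swap_assoc, e0, e1, e2, e3,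
    e4, e5, e0.ne, e1.ne, e2.ne, e3.ne, e4.ne, e5.ne, ne_eq, not_false_eq_true,
    gD_gM_swap_assoc, gD_mul_gM_of_ne, gD_mul_gM_self hk,
    gD_gM_self_assoc hk, mul_one, mul_neg, neg_mul, neg_neg, smul_neg]
  module

theorem gD_mul_constraintCharge {Box S Sd T h Sb : 𝓔} (bBox : Bosonic Box) (bS : Bosonic S)
    (bSd : Bosonic Sd) (bT : Bosonic T) (bh : Bosonic h) (bSb : Bosonic Sb) {j : ℕ} (hj : 6 ≤ j) :
    gD j * constraintCharge ghosts Box S Sd T h Sb =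
      -(constraintCharge ghosts Box S Sd T h Sb * gD j) := by
  have e0 : 0 < j := by lia
  have e1 : 1 < j := by lia
  have e2 : 2 < j := by lia
  have e3 : 3 < j := by lia
  have e4 : 4 < j := by lia
  have e5 : 5 < j := by lia
  simp only [constraintCharge, ghosts, two_mul_eq_smul, mul_assoc, mul_add, add_mul, mul_sub,
    sub_mul, smul_mul_assoc, mul_smul_comm, bBox.mul_gD, bS.mul_gD, bSd.mul_gD, bT.mul_gD,
    bh.mul_gD, bSb.mul_gD, bBox.mul_gD_assoc, bS.mul_gD_assoc, bSd.mul_gD_assoc,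
    bT.mul_gD_assoc, bh.mul_gD_assoc, bSb.mul_gD_assoc, gD_swap, gD_swap_assoc, e0, e1, e2, e3,
    e4, e5, e0.ne', e1.ne', e2.ne', e3.ne', e4.ne', e5.ne', ne_eq, not_false_eq_true,
    gD_gM_swap_assoc, gD_mul_gM_of_ne, mul_neg, neg_mul, neg_neg, smul_neg]
  module

end ConstraintChargeProperties

/-! ### Covariant derivatives and invariance of contractions. -/

section Connections

variable {d : ℕ} {U : TopologicalSpace.Opens (Fin d → ℝ)} {Y B : Type} {k : ℕ}
variable {κ : Type} [Fintype κ]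

local notation "𝓔" => Module.End ℝ (Fock U Y B k)

/-- The operators `v C` transform as the components of a covector under `D`, with connection
coefficients `W`. -/
def IsCovector (D : Module.End ℝ (Fock U Y B k)) (W : κ → κ → SmoothFn U)
    (v : κ → Module.End ℝ (Fock U Y B k)) : Prop :=
  ∀ C, D * v C = v C * D + ∑ A, fnM (W A C) * v A

/-- The operators `u C` transform as the components of a vector under `D`, with connection
coefficients `W`. -/
def IsVector (D : Module.End ℝ (Fock U Y B k)) (W : κ → κ → SmoothFn U)
    (u : κ → Module.End ℝ (Fock U Y B k)) : Prop :=
  ∀ C, D * u C = u C * D - ∑ A, fnM (W C A) * u A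

variable {D : Module.End ℝ (Fock U Y B k)} {W : κ → κ → SmoothFn U}
  {u u' v v' : κ → Module.End ℝ (Fock U Y B k)}

/-- The connection terms of the vector and of the covector cancel after renaming the summation
indices. Linearity over functions is needed to move `u` past the connection coefficients. -/
theorem IsVector.commute_contract (hu : IsVector D W u) (hv : IsCovector D W v)
    (lu : ∀ C, FnLinear (u C)) : Commute D (∑ C, u C * v C) := by
  have key : ∑ C, ∑ A, u C * (fnM (W A C) * v A) = ∑ C, ∑ A, fnM (W C A) * (u A * v C) := by
    rw [Finset.sum_comm]
    refine Finset.sum_congr rfl fun C _ => Finset.sum_congr rfl fun A _ => ?_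
    exact (lu A _).left_comm _
  simp only [Commute, SemiconjBy, Finset.mul_sum, Finset.sum_mul]
  have step : ∀ C, D * (u C * v C) = u C * v C * D + (∑ A, u C * (fnM (W A C) * v A) -
      ∑ A, fnM (W C A) * (u A * v C)) := fun C => by
    rw [← mul_assoc, hu C, sub_mul, mul_assoc, hv C, mul_add, Finset.sum_mul, Finset.mul_sum]
    simp only [mul_assoc]
    abel
  simp only [step, Finset.sum_add_distrib, Finset.sum_sub_distrib, key, sub_self, add_zero]

/-- The connection preserves the metric: `η_C W^A_C` is antisymmetric, so the two connection terms
cancel in pairs. -/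
theorem IsCovector.commute_metric {η : κ → ℝ} (hW : ∀ A C, η C • W A C + η A • W C A = 0)
    (hv : IsCovector D W v) (hv' : IsCovector D W v') (lv : ∀ C, FnLinear (v C)) :
    Commute D (∑ C, η C • (v C * v' C)) := by
  have key : ∑ C, ∑ A, fnM (η C • W A C) * (v A * v' C) +
      ∑ C, ∑ A, fnM (η C • W A C) * (v C * v' A) = 0 := by
    rw [Finset.sum_comm, ← Finset.sum_add_distrib]
    refine Finset.sum_eq_zero fun A _ => ?_
    rw [← Finset.sum_add_distrib]
    refine Finset.sum_eq_zero fun C _ => ?_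
    rw [← add_mul, ← fnM_add, hW, fnM_zero, zero_mul]
  simp only [Commute, SemiconjBy, Finset.mul_sum, Finset.sum_mul]
  have step : ∀ C, D * (η C • (v C * v' C)) = η C • (v C * v' C) * D +
      (∑ A, fnM (η C • W A C) * (v A * v' C) + ∑ A, fnM (η C • W A C) * (v C * v' A)) :=
      fun C => by
    rw [mul_smul_comm, ← mul_assoc, hv C, add_mul, mul_assoc, hv' C, mul_add, Finset.sum_mul,
      Finset.mul_sum, smul_mul_assoc, smul_add, smul_add, Finset.smul_sum, Finset.smul_sum]
    simp only [mul_assoc, fnM_real_smul, smul_mul_assoc, (lv C _).left_comm]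
    abel
  simp only [step, Finset.sum_add_distrib]
  rw [key, add_zero]

/-- The operators `u A`, `v C` are conjugate variables. -/
def IsConjugate [DecidableEq κ] (u v : κ → Module.End ℝ (Fock U Y B k)) : Prop :=
  (∀ A C, v C * u A = u A * v C + if C = A then 1 else 0) ∧
    (∀ A C, Commute (u A) (u C)) ∧ ∀ A C, Commute (v A) (v C)

theorem IsConjugate.mul_commutator_u [DecidableEq κ] (h : IsConjugate u v) (A C E : κ) :
    u A * v C * u E = u E * (u A * v C) + if C = E then u A else 0 := by
  rw [mul_assoc, h.1, mul_add, ← mul_assoc, (h.2.1 A E).eq, mul_assoc]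
  split_ifs <;> simp

theorem IsConjugate.mul_commutator_v [DecidableEq κ] (h : IsConjugate u v) (A C E : κ) :
    u A * v C * v E = v E * (u A * v C) - if E = A then v C else 0 := by
  rw [← mul_assoc, h.1, add_mul, mul_assoc, mul_assoc, (h.2.2 C E).eq]
  split_ifs <;> simp

end Connections

end AdSHigherSpin

end

noncomputable section
namespace AdSHigherSpin

set_option linter.unusedSimpArgs false

/-! ### Matrices of functions acting through elementary-matrix operators; curvature. -/

section MatrixRepresentations

variable {d : ℕ} {U : TopologicalSpace.Opens (Fin d → ℝ)} {Y B : Type} {k : ℕ}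
variable {κ : Type} [Fintype κ] [DecidableEq κ]

local notation "𝓔" => Module.End ℝ (Fock U Y B k)

/-- The operator by which a matrix of functions acts, for operators `E A B` representing the
elementary matrices. -/
def matrixOp (E : κ → κ → Module.End ℝ (Fock U Y B k)) (W : κ → κ → SmoothFn U) :
    Module.End ℝ (Fock U Y B k) :=
  ∑ A, ∑ C, fnM (W C A) * E A C

/-- The operators `E A B` act on the components of covectors `v`. -/
def ActsOnCovector (E : κ → κ → Module.End ℝ (Fock U Y B k))
    (v : κ → Module.End ℝ (Fock U Y B k)) : Prop :=
  ∀ A A' C, E A A' * v C = v C * E A A' - if C = A then v A' else 0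

/-- The operators `E A B` act on the components of vectors `u`. -/
def ActsOnVector (E : κ → κ → Module.End ℝ (Fock U Y B k))
    (u : κ → Module.End ℝ (Fock U Y B k)) : Prop :=
  ∀ A A' C, E A A' * u C = u C * E A A' + if A' = C then u A else 0

variable {E : κ → κ → Module.End ℝ (Fock U Y B k)} {X : Module.End ℝ (Fock U Y B k)}
  {u v : κ → Module.End ℝ (Fock U Y B k)}

theorem ActsOnCovector.isCovector (hE : ActsOnCovector E v) (hX : ∀ C, Commute X (v C))
    (lv : ∀ C, FnLinear (v C)) (W : κ → κ → SmoothFn U) :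
    IsCovector (X - matrixOp E W) W v := fun C => by
  have h1 : matrixOp E W * v C = v C * matrixOp E W - ∑ A, fnM (W A C) * v A := by
    simp only [matrixOp, Finset.sum_mul, Finset.mul_sum, mul_assoc, hE _ _ C, mul_sub,
      Finset.sum_sub_distrib, (lv C _).left_comm]
    congr 1
    rw [Finset.sum_comm]
    refine Finset.sum_congr rfl fun A _ => ?_
    simp [mul_ite]
  rw [sub_mul, h1, (hX C).eq, mul_sub]
  abel

theorem ActsOnVector.isVector (hE : ActsOnVector E u) (hX : ∀ C, Commute X (u C))
    (lu : ∀ C, FnLinear (u C)) (W : κ → κ → SmoothFn U) :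
    IsVector (X - matrixOp E W) W u := fun C => by
  have h1 : matrixOp E W * u C = u C * matrixOp E W + ∑ A, fnM (W C A) * u A := by
    simp only [matrixOp, Finset.sum_mul, Finset.mul_sum, mul_assoc, hE _ _ C, mul_add,
      Finset.sum_add_distrib, (lu C _).left_comm]
    congr 1
    refine Finset.sum_congr rfl fun A _ => ?_
    simp [mul_ite]
  rw [sub_mul, h1, (hX C).eq, mul_sub]
  abel

theorem matrixOp_add (W W' : κ → κ → SmoothFn U) :
    matrixOp E (fun A C => W A C + W' A C) = matrixOp E W + matrixOp E W' := by
  simp only [matrixOp, fnM_add, add_mul, Finset.sum_add_distrib]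

theorem matrixOp_sub (W W' : κ → κ → SmoothFn U) :
    matrixOp E (fun A C => W A C - W' A C) = matrixOp E W - matrixOp E W' := by
  simp only [matrixOp, fnM_sub, sub_mul, Finset.sum_sub_distrib]

theorem matrixOp_fnLinear (lE : ∀ A C, FnLinear (E A C)) (W : κ → κ → SmoothFn U) :
    FnLinear (matrixOp E W) :=
  FnLinear.sum fun A _ => FnLinear.sum fun C _ => (FnLinear.fnM _).mul (lE A C)

theorem matrixOp_mul_basis
    (hE : ∀ A A' C C', E A A' * E C C' = E C C' * E A A' + (if A' = C then E A C' else 0) -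
      if A = C' then E C A' else 0) (lE : ∀ A C, FnLinear (E A C)) (W : κ → κ → SmoothFn U)
    (C C' : κ) : matrixOp E W * E C C' = E C C' * matrixOp E W +
      (∑ A, fnM (W C A) * E A C' - ∑ A, fnM (W A C') * E C A) := by
  have h : ∀ A A', fnM (W A' A) * E A A' * E C C' = E C C' * (fnM (W A' A) * E A A') +
      ((if A' = C then fnM (W A' A) * E A C' else 0) -
        if A = C' then fnM (W A' A) * E C A' else 0) := by
    intro A A'
    rw [mul_assoc, hE, (lE C C' _).left_comm]
    split_ifs <;> simp [mul_add, mul_sub] <;> abel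
  simp only [matrixOp, Finset.sum_mul, Finset.mul_sum, h, Finset.sum_add_distrib,
    Finset.sum_sub_distrib, Finset.sum_ite_eq', Finset.mem_univ, if_true]
  rw [Finset.sum_comm (f := fun A A' => if A = C' then fnM (W A' A) * E C A' else 0)]
  simp only [Finset.sum_ite_eq', Finset.mem_univ, if_true]

/-- The operator `E A C` carries the transposed entry `W C A`, so `W ↦ matrixOp E W` reverses
commutators: the result is the operator of `[W', W]`. -/
theorem matrixOp_commutator
    (hE : ∀ A A' C C', E A A' * E C C' = E C C' * E A A' + (if A' = C then E A C' else 0) -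
      if A = C' then E C A' else 0) (lE : ∀ A C, FnLinear (E A C)) (W W' : κ → κ → SmoothFn U) :
    matrixOp E W * matrixOp E W' - matrixOp E W' * matrixOp E W =
      matrixOp E (fun C A => ∑ D, (W' C D * W D A - W C D * W' D A)) := by
  have h1 := matrixOp_mul_basis hE lE W
  have lW := matrixOp_fnLinear lE W
  have h2 : matrixOp E W * matrixOp E W' = matrixOp E W' * matrixOp E W +
      (∑ C, ∑ C', ∑ A, fnM (W' C' C * W C A) * E A C' -
        ∑ C, ∑ C', ∑ A, fnM (W A C' * W' C' C) * E C A) := by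
    have h3 : ∀ C C', matrixOp E W * (fnM (W' C' C) * E C C') =
        fnM (W' C' C) * E C C' * matrixOp E W +
          (∑ A, fnM (W' C' C * W C A) * E A C' - ∑ A, fnM (W A C' * W' C' C) * E C A) := by
      intro C C'
      rw [(lW _).left_comm, h1, mul_add, mul_sub, Finset.mul_sum, Finset.mul_sum, mul_assoc]
      simp only [mul_comm (W _ C'), fnM_mul, mul_assoc]
    have h4 : matrixOp E W * matrixOp E W' =
        ∑ C, ∑ C', matrixOp E W * (fnM (W' C' C) * E C C') := by
      rw [matrixOp.eq_1 E W', Finset.mul_sum]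
      simp only [Finset.mul_sum]
    have h5 : matrixOp E W' * matrixOp E W =
        ∑ C, ∑ C', fnM (W' C' C) * E C C' * matrixOp E W := by
      rw [matrixOp.eq_1 E W', Finset.sum_mul]
      simp only [Finset.sum_mul]
    rw [h4, h5]
    simp only [h3, Finset.sum_add_distrib, Finset.sum_sub_distrib]
  have e1 : ∀ G : κ → κ → κ → 𝓔, ∑ C, ∑ C', ∑ A, G C C' A = ∑ A, ∑ C', ∑ C, G C C' A := by
    intro G
    rw [Finset.sum_comm, Finset.sum_congr rfl fun C' _ =>
      Finset.sum_comm (f := fun C A => G C C' A), Finset.sum_comm]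
  have e2 : ∀ G : κ → κ → κ → 𝓔, ∑ C, ∑ C', ∑ A, G C C' A = ∑ C, ∑ A, ∑ C', G C C' A :=
    fun G => Finset.sum_congr rfl fun C _ => Finset.sum_comm
  rw [h2, add_sub_cancel_left, e1, e2 fun C C' A => fnM (W A C' * W' C' C) * E C A]
  simp only [matrixOp, Finset.sum_sub_distrib, fnM_sub, fnM_sum, sub_mul, Finset.sum_mul]

theorem xD_mul_matrixOp (m : Fin d) (hx : ∀ A C, Commute (xD m) (E A C))
    (W : κ → κ → SmoothFn U) : xD m * matrixOp E W =
      matrixOp E W * xD m + matrixOp E (fun A C => pd m (W A C)) := by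
  simp only [matrixOp, Finset.sum_mul, Finset.mul_sum, ← mul_assoc, xD_mul_fnM, add_mul,
    Finset.sum_add_distrib]
  simp only [mul_assoc, (hx _ _).eq]

/-- Because `matrixOp` reverses commutators, the commutator of the two covariant derivatives is
minus the operator of the curvature `∂_m W_n - ∂_n W_m + [W_m, W_n]`. -/
theorem commute_of_flat
    (hE : ∀ A A' C C', E A A' * E C C' = E C C' * E A A' + (if A' = C then E A C' else 0) -
      if A = C' then E C A' else 0) (lE : ∀ A C, FnLinear (E A C))
    (hx : ∀ m A C, Commute (xD m) (E A C)) (W : Fin d → κ → κ → SmoothFn U) (m n : Fin d)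
    (hW : ∀ C A, pd m (W n C A) - pd n (W m C A) +
      ∑ D, (W m C D * W n D A - W n C D * W m D A) = 0) :
    Commute (xD m - matrixOp E (W m)) (xD n - matrixOp E (W n)) := by
  have h1 := xD_mul_matrixOp m (hx m) (W n)
  have h2 := xD_mul_matrixOp n (hx n) (W m)
  have h3 := matrixOp_commutator hE lE (W n) (W m)
  have h4 : matrixOp E (fun C A => pd m (W n C A)) - matrixOp E (fun C A => pd n (W m C A)) +
      matrixOp E (fun C A => ∑ D, (W m C D * W n D A - W n C D * W m D A)) = 0 := by
    rw [← matrixOp_sub, ← matrixOp_add]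
    simp only [hW, matrixOp, fnM_zero, zero_mul, Finset.sum_const_zero]
  rw [Commute, SemiconjBy, sub_mul, sub_mul, mul_sub, mul_sub, mul_sub, mul_sub, h1, h2,
    (xD_comm m n).eq]
  rw [← h3] at h4
  rw [← sub_eq_zero]
  rw [← neg_eq_zero, ← h4]
  abel

end MatrixRepresentations

end AdSHigherSpin

end

noncomputable section
namespace AdSHigherSpin

set_option linter.unusedSimpArgs false

/-! ### The flat `so(d-1,2)` connection and its action on `Y + V` and `a†`. -/

section ParentSystem

variable {d : ℕ} {l : ℝ} {U : TopologicalSpace.Opens (Fin d → ℝ)} (F : AdSFrame l U)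

theorem AdSFrame.W_castSucc_castSucc (m a b : Fin d) :
    F.W m a.castSucc b.castSucc = F.conn m a b := by simp [AdSFrame.W]

theorem AdSFrame.W_castSucc_last (m a : Fin d) :
    F.W m a.castSucc (Fin.last d) = l⁻¹ • F.e m a := by simp [AdSFrame.W]

theorem AdSFrame.W_last_castSucc (m b : Fin d) :
    F.W m (Fin.last d) b.castSucc = (l⁻¹ * etaT b) • F.e m b := by simp [AdSFrame.W]

theorem AdSFrame.W_last_last (m : Fin d) : F.W m (Fin.last d) (Fin.last d) = 0 := by
  simp [AdSFrame.W]

theorem eta_mul_self (A : Fin (d + 1)) : eta A * eta A = 1 := by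
  unfold eta; split_ifs <;> norm_num

theorem eta_last : eta (Fin.last d) = -1 := by simp [eta]

theorem etaT_mul_self (a : Fin d) : etaT a * etaT a = 1 := eta_mul_self _

theorem AdSFrame.W_metric (m : Fin d) (A C : Fin (d + 1)) :
    eta A • F.W m A C + eta C • F.W m C A = 0 := by
  induction A using Fin.lastCases with
  | last =>
    induction C using Fin.lastCases with
    | last => simp [F.W_last_last]
    | cast b =>
      rw [F.W_last_castSucc, F.W_castSucc_last, eta_last, etaT, smul_smul, smul_smul, ← add_smul]
      ring_nf; simp
  | cast a =>
    induction C using Fin.lastCases with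
    | last =>
      rw [F.W_last_castSucc, F.W_castSucc_last, eta_last, etaT, smul_smul, smul_smul, ← add_smul]
      ring_nf; simp
    | cast b => simpa [F.W_castSucc_castSucc, etaT] using F.metric m a b

theorem AdSFrame.W_metric' (m : Fin d) (A C : Fin (d + 1)) :
    eta C • F.W m A C + eta A • F.W m C A = 0 := by
  have h := congrArg (fun f => (eta A * eta C) • f) (F.W_metric m A C)
  simp only [smul_add, smul_smul, smul_zero] at h
  have h1 : eta A * eta C * eta A = eta C := by
    rw [mul_right_comm, eta_mul_self, one_mul]
  have h2 : eta A * eta C * eta C = eta A := by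
    rw [mul_assoc, eta_mul_self, mul_one]
  rwa [h1, h2] at h

theorem AdSFrame.conn_metric' (m a b : Fin d) :
    etaT b • F.conn m a b + etaT a • F.conn m b a = 0 := by
  simpa [F.W_castSucc_castSucc, etaT] using F.W_metric' m a.castSucc b.castSucc

theorem AdSFrame.conn_eq (m a b : Fin d) :
    F.conn m a b = -((etaT a * etaT b) • F.conn m b a) := by
  have h := congrArg (fun f => etaT b • f) (F.conn_metric' m a b)
  simp only [smul_add, smul_smul, smul_zero, etaT_mul_self, one_smul] at h
  rw [eq_neg_iff_add_eq_zero, mul_comm (etaT a)]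
  exact h

/-- The equation splits into blocks. In the Lorentz block the product `ω^a_{(d)} ω^{(d)}_b` supplies
`l⁻² e^a e_b`, which compensates the constant curvature. The two mixed blocks are the torsion
equation, once directly and once with an index lowered. The `(d)(d)` entry vanishes because the
products of `e` and its lowered version cancel under antisymmetrization in `m`, `n`. -/
theorem AdSFrame.W_flat (m n : Fin d) (C A : Fin (d + 1)) :
    pd m (F.W n C A) - pd n (F.W m C A) +
      ∑ D, (F.W m C D * F.W n D A - F.W n C D * F.W m D A) = 0 := by
  rw [Fin.sum_univ_castSucc]
  induction C using Fin.lastCases with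
  | last =>
    induction A using Fin.lastCases with
    | last =>
      simp only [F.W_last_last, F.W_last_castSucc, F.W_castSucc_last, map_zero, sub_zero, mul_zero,
        add_zero, zero_add]
      refine Finset.sum_eq_zero fun a _ => ?_
      simp only [smul_mul_smul_comm]
      rw [← smul_sub, mul_comm (F.e n a), sub_self, smul_zero]
    | cast b =>
      simp only [F.W_last_last, F.W_last_castSucc, F.W_castSucc_castSucc, map_smul, zero_mul,
        sub_zero, add_zero]
      have h := congrArg (fun f => (l⁻¹ * etaT b) • f) (F.torsion m n b)
      simp only [smul_add, smul_sub, smul_zero, Finset.smul_sum] at h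
      rw [← h]
      congr 1
      refine Finset.sum_congr rfl fun a _ => ?_
      rw [F.conn_eq n a b, F.conn_eq m a b]
      simp only [mul_neg, smul_mul_smul_comm]
      have h1 : l⁻¹ * etaT a * (etaT a * etaT b) = l⁻¹ * etaT b := by
        linear_combination l⁻¹ * etaT b * etaT_mul_self a
      rw [h1, mul_comm (F.e m a), mul_comm (F.e n a)]
      abel
  | cast c =>
    induction A using Fin.lastCases with
    | last =>
      simp only [F.W_last_last, F.W_castSucc_last, F.W_castSucc_castSucc, map_smul, mul_zero,
        sub_zero, add_zero]
      have h := congrArg (fun f => l⁻¹ • f) (F.torsion m n c)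
      simp only [smul_add, smul_sub, smul_zero, Finset.smul_sum] at h
      simpa only [mul_smul_comm] using h
    | cast b =>
      simp only [F.W_castSucc_last, F.W_castSucc_castSucc, F.W_last_castSucc]
      rw [← add_assoc, F.curvature]
      simp only [smul_mul_smul_comm, smul_sub, smul_smul, neg_smul]
      have h1 : l⁻¹ * (l⁻¹ * etaT b) = (l ^ 2)⁻¹ * etaT b := by
        rw [← mul_assoc, ← mul_inv, pow_two]
      rw [h1]
      abel_nf
      simp

/-- The operators `(Y^A + V^A) ∂/∂Y^C + a†^A ∂/∂a†^C`. -/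
def parentE (l : ℝ) (A C : Fin (d + 1)) : Module.End ℝ (ParentStates U) :=
  shiftedY l A * yD C + aM A * aD C

/-- The covariant derivative `∂_m - ω^B_{m A} ((Y^A + V^A) ∂/∂Y^B + a†^A ∂/∂a†^B)`. -/
def parentD (m : Fin d) : Module.End ℝ (ParentStates U) :=
  xD m - matrixOp (parentE l) (F.W m)

theorem shiftedY_fnLinear (A : Fin (d + 1)) :
    FnLinear (shiftedY l A : Module.End ℝ (ParentStates U)) := fun f =>
  ((FnLinear.yM A).add fun f => (Commute.one_left _).smul_left _) f

theorem parentE_fnLinear (A C : Fin (d + 1)) :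
    FnLinear (parentE l A C : Module.End ℝ (ParentStates U)) :=
  ((shiftedY_fnLinear A).mul (.yD C)).add ((FnLinear.aM A).mul (.aD C))

theorem shiftedY_bosonic (A : Fin (d + 1)) :
    Bosonic (shiftedY l A : Module.End ℝ (ParentStates U)) :=
  (Bosonic.yM A).add (Bosonic.one.real_smul _)

theorem parentD_bosonic (m : Fin d) : Bosonic (parentD F m) :=
  (Bosonic.xD m).sub (Bosonic.sum fun _ _ => Bosonic.sum fun _ _ => Bosonic.fn_smul _
    (((shiftedY_bosonic _).mul (.yD _)).add ((Bosonic.aM _).mul (.aD _))))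

theorem commute_shiftedY {X : Module.End ℝ (ParentStates U)} {A : Fin (d + 1)}
    (h : Commute X (yM A)) : Commute X (shiftedY l A) :=
  h.add_right ((Commute.one_right X).smul_right _)

theorem yD_mul_shiftedY (A C : Fin (d + 1)) :
    (yD C * shiftedY l A : Module.End ℝ (ParentStates U)) =
      shiftedY l A * yD C + if C = A then 1 else 0 := by
  rw [shiftedY, mul_add, add_mul, yD_mul_yM]
  simp only [mul_smul_comm, smul_mul_assoc, mul_one, one_mul]
  abel

theorem shiftedY_conjugate :
    IsConjugate (shiftedY l : Fin (d + 1) → Module.End ℝ (ParentStates U)) yD :=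
  ⟨fun A C => yD_mul_shiftedY A C,
    fun A C => commute_shiftedY (commute_shiftedY (yM_comm C A)).symm, yD_comm⟩

theorem aM_conjugate {Y B : Type} [DecidableEq B] {k : ℕ} :
    IsConjugate (aM : B → Module.End ℝ (Fock U Y B k)) aD :=
  ⟨fun A C => aD_mul_aM C A, aM_comm, aD_comm⟩

theorem parentE_mul_yD : ActsOnCovector (parentE (U := U) l) yD := fun A A' C => by
  have h : Commute (aM A * aD A') (yD C : Module.End ℝ (ParentStates U)) :=
    (aM_comm_yD A C).mul_left (aD_comm_yD A' C)
  rw [parentE, add_mul, shiftedY_conjugate.mul_commutator_v, mul_add, h.eq]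
  abel

theorem parentE_mul_aD : ActsOnCovector (parentE (U := U) l) aD := fun A A' C => by
  have h : Commute (shiftedY l A * yD A') (aD C : Module.End ℝ (ParentStates U)) :=
    (commute_shiftedY (aD_comm_yM C A)).symm.mul_left (aD_comm_yD C A').symm
  rw [parentE, add_mul, aM_conjugate.mul_commutator_v, mul_add, h.eq]
  abel

theorem parentE_mul_shiftedY : ActsOnVector (parentE (U := U) l) (shiftedY l) := fun A A' C => by
  have h : Commute (aM A * aD A') (shiftedY l C : Module.End ℝ (ParentStates U)) :=
    (commute_shiftedY (aM_comm_yM A C)).mul_left (commute_shiftedY (aD_comm_yM A' C))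
  rw [parentE, add_mul, shiftedY_conjugate.mul_commutator_u, mul_add, h.eq]
  abel

theorem parentE_mul_aM : ActsOnVector (parentE (U := U) l) aM := fun A A' C => by
  have h : Commute (shiftedY l A * yD A') (aM C : Module.End ℝ (ParentStates U)) :=
    (commute_shiftedY (aM_comm_yM C A)).symm.mul_left (aM_comm_yD C A').symm
  rw [parentE, add_mul, aM_conjugate.mul_commutator_u, mul_add, h.eq]
  abel

theorem xD_comm_shiftedY (m : Fin d) (A : Fin (d + 1)) :
    Commute (xD m : Module.End ℝ (ParentStates U)) (shiftedY l A) :=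
  commute_shiftedY (yM_comm_xD A m).symm

theorem xD_comm_parentE (m : Fin d) (A C : Fin (d + 1)) :
    Commute (xD m : Module.End ℝ (ParentStates U)) (parentE l A C) :=
  ((xD_comm_shiftedY m A).mul_right (yD_comm_xD C m).symm).add_right
    ((aM_comm_xD A m).symm.mul_right (aD_comm_xD C m).symm)

/-- These are the relations of elementary matrices. They follow from the action of `E A A'` on the
vector and covector factors of `E C C'`, a commutator being a derivation. -/
theorem parentE_mul_parentE (A A' C C' : Fin (d + 1)) :
    (parentE l A A' * parentE l C C' : Module.End ℝ (ParentStates U)) =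
      parentE l C C' * parentE l A A' + (if A' = C then parentE l A C' else 0) -
        if A = C' then parentE l C A' else 0 := by
  have h1 := parentE_mul_shiftedY (U := U) (l := l) A A' C
  have h2 := parentE_mul_yD (U := U) (l := l) A A' C'
  have h3 := parentE_mul_aM (U := U) (l := l) A A' C
  have h4 := parentE_mul_aD (U := U) (l := l) A A' C'
  conv_lhs => rw [parentE.eq_1 l C C']
  rw [mul_add, ← mul_assoc, ← mul_assoc, h1, h3, add_mul, add_mul, mul_assoc, mul_assoc, h2, h4]
  simp only [parentE.eq_1 l C C', parentE.eq_1 l A C', parentE.eq_1 l C A', eq_comm (a := A)]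
  split_ifs <;> simp only [mul_sub, add_mul, mul_assoc, mul_zero, zero_mul, sub_zero, add_zero] <;>
    abel

theorem parentD_comm (m n : Fin d) : Commute (parentD F m) (parentD F n) :=
  commute_of_flat parentE_mul_parentE parentE_fnLinear xD_comm_parentE F.W m n (F.W_flat m n)

theorem parentD_yD (m : Fin d) : IsCovector (parentD F m) (F.W m) yD :=
  parentE_mul_yD.isCovector (fun C => (yD_comm_xD C m).symm) .yD _

theorem parentD_aD (m : Fin d) : IsCovector (parentD F m) (F.W m) aD :=
  parentE_mul_aD.isCovector (fun C => (aD_comm_xD C m).symm) .aD _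

theorem parentD_shiftedY (m : Fin d) : IsVector (parentD F m) (F.W m) (shiftedY l) :=
  parentE_mul_shiftedY.isVector (xD_comm_shiftedY m) shiftedY_fnLinear _

theorem parentD_aM (m : Fin d) : IsVector (parentD F m) (F.W m) aM :=
  parentE_mul_aM.isVector (fun C => (aM_comm_xD C m).symm) .aM _

/-- Only `V^{(d)} = l` is nonzero, and `l ω^a_{m (d)} = e^a_m` while `ω^{(d)}_{m (d)} = 0`. So the
term of the shifted derivative linear in `V` is exactly `σ`. -/
theorem parentNabla_add_parentSigma (hl : l ≠ 0) :
    parentNabla F + parentSigma F = ∑ m : Fin d, gM (6 + m.val) * parentD F m := by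
  have h : ∀ m : Fin d, ∑ C, (if C = Fin.last d then l else 0) •
      ∑ A, F.W m A C • (gM (6 + m.val) * yD A : Module.End ℝ (ParentStates U)) =
        ∑ a : Fin d, F.e m a • (gM (6 + m.val) * yD a.castSucc) := by
    intro m
    simp only [ite_smul, zero_smul, Finset.sum_ite_eq', Finset.mem_univ, if_true]
    rw [Fin.sum_univ_castSucc, F.W_last_last, zero_smul, add_zero, Finset.smul_sum]
    refine Finset.sum_congr rfl fun a _ => ?_
    rw [F.W_castSucc_last, fn_smul_eq, fn_smul_eq, fnM_real_smul, smul_mul_assoc, smul_smul,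
      mul_inv_cancel₀ hl, one_smul]
  simp only [parentNabla, parentSigma, ← h]
  rw [← sub_eq_add_neg, sub_sub, ← Finset.sum_add_distrib, ← Finset.sum_sub_distrib]
  refine Finset.sum_congr rfl fun m _ => ?_
  rw [parentD, mul_sub]
  congr 1
  rw [← Finset.sum_add_distrib, matrixOp, Finset.mul_sum]
  refine Finset.sum_congr rfl fun A _ => ?_
  rw [Finset.mul_sum, Finset.smul_sum, ← Finset.sum_add_distrib]
  refine Finset.sum_congr rfl fun C _ => ?_
  have hg : Commute (gM (6 + m.val) : Module.End ℝ (ParentStates U)) (fnM (F.W m C A)) :=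
    FnLinear.gM _ _
  rw [parentE, shiftedY, fn_smul_eq, fn_smul_eq, hg.left_comm]
  simp only [mul_add, add_mul, smul_mul_assoc, mul_smul_comm, one_mul]
  abel

end ParentSystem

end AdSHigherSpin

end

noncomputable section
namespace AdSHigherSpin

set_option linter.unusedSimpArgs false

/-! ### Commutators of the quadratic constraints. -/

section Sp4Relations

variable {R : Type*} [Ring R] [Algebra ℝ R] {κ : Type} [Fintype κ] [DecidableEq κ]

/-- Two pairs of mutually commuting conjugate variables. -/
structure ConjugatePairs (x p a b : κ → R) : Prop where
  p_x : ∀ A C, p C * x A = x A * p C + if C = A then 1 else 0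
  b_a : ∀ A C, b C * a A = a A * b C + if C = A then 1 else 0
  x_x : ∀ A C, Commute (x A) (x C)
  p_p : ∀ A C, Commute (p A) (p C)
  a_a : ∀ A C, Commute (a A) (a C)
  b_b : ∀ A C, Commute (b A) (b C)
  a_x : ∀ A C, Commute (a A) (x C)
  a_p : ∀ A C, Commute (a A) (p C)
  b_x : ∀ A C, Commute (b A) (x C)
  b_p : ∀ A C, Commute (b A) (p C)

/-- Leibniz rule for a bilinear of which only the first factor fails to commute with `z`; the next
lemma treats the second factor. They give the action of the quadratic operators on single variables,
from which the relations among the constraints follow. -/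
theorem sum_mul_of_commutator {f g : κ → R} {z c : R} {δ : κ → R}
    (hf : ∀ A, f A * z = z * f A + δ A) (hg : ∀ A, Commute (g A) z)
    (hc : ∑ A, δ A * g A = c) : (∑ A, f A * g A) * z = z * (∑ A, f A * g A) + c := by
  rw [← hc, Finset.sum_mul, Finset.mul_sum, ← Finset.sum_add_distrib]
  refine Finset.sum_congr rfl fun A _ => ?_
  rw [mul_assoc, (hg A).eq, ← mul_assoc, hf, add_mul, mul_assoc]

theorem sum_mul_of_commutator' {f g : κ → R} {z c : R} {δ : κ → R}
    (hg : ∀ A, g A * z = z * g A + δ A) (hf : ∀ A, Commute (f A) z)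
    (hc : ∑ A, f A * δ A = c) : (∑ A, f A * g A) * z = z * (∑ A, f A * g A) + c := by
  rw [← hc, Finset.sum_mul, Finset.mul_sum, ← Finset.sum_add_distrib]
  refine Finset.sum_congr rfl fun A _ => ?_
  rw [mul_assoc, hg, mul_add, ← mul_assoc, (hf A).eq, mul_assoc]

namespace ConjugatePairs

variable {x p a b : κ → R} (H : ConjugatePairs x p a b) (η : κ → ℝ)
include H

theorem x_p (A C : κ) : x A * p C = p C * x A - if C = A then 1 else 0 := by
  rw [H.p_x]; abel

theorem a_b (A C : κ) : a A * b C = b C * a A - if C = A then 1 else 0 := by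
  rw [H.b_a]; abel

theorem S_a (C : κ) : (∑ A, η A • (b A * p A)) * a C =
    a C * (∑ A, η A • (b A * p A)) + η C • p C := by
  simp only [← smul_mul_assoc]
  refine sum_mul_of_commutator (δ := fun A => if A = C then η A • 1 else 0)
    (fun A => ?_) (fun A => (H.a_p C A).symm) ?_
  · rw [smul_mul_assoc, H.b_a, smul_add, mul_smul_comm]; split_ifs <;> simp
  · simp [ite_mul]

theorem T_a (C : κ) : (∑ A, η A • (b A * b A)) * a C =
    a C * (∑ A, η A • (b A * b A)) + (2 : ℝ) • η C • b C := by
  rw [Finset.sum_mul, Finset.mul_sum]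
  have h : ∀ A, η A • (b A * b A) * a C = a C * η A • (b A * b A) +
      if A = C then (2 : ℝ) • η C • b C else 0 := by
    intro A
    rw [smul_mul_assoc, mul_smul_comm, mul_assoc, H.b_a, mul_add, ← mul_assoc, H.b_a, add_mul,
      mul_assoc]
    split_ifs with hAC
    · subst hAC
      simp only [one_mul, mul_one, smul_add, two_smul]; abel
    · simp
  simp [h, Finset.sum_add_distrib]

theorem N_a (C : κ) : (∑ A, a A * b A) * a C = a C * (∑ A, a A * b A) + a C := by
  refine sum_mul_of_commutator' (δ := fun A => if A = C then 1 else 0)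
    (fun A => H.b_a C A) (fun A => H.a_a A C) ?_
  simp

theorem N_b (C : κ) : (∑ A, a A * b A) * b C = b C * (∑ A, a A * b A) + -b C := by
  refine sum_mul_of_commutator (δ := fun A => if A = C then -1 else 0)
    (fun A => ?_) (fun A => H.b_b A C) ?_
  · rw [H.a_b, sub_eq_add_neg]; simp only [eq_comm (a := A)]; split_ifs <;> simp
  · simp

theorem Nx_x (C : κ) : (∑ A, x A * p A) * x C = x C * (∑ A, x A * p A) + x C := by
  refine sum_mul_of_commutator' (δ := fun A => if A = C then 1 else 0)
    (fun A => H.p_x C A) (fun A => H.x_x A C) ?_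
  simp

theorem Nx_p (C : κ) : (∑ A, x A * p A) * p C = p C * (∑ A, x A * p A) + -p C := by
  refine sum_mul_of_commutator (δ := fun A => if A = C then -1 else 0)
    (fun A => ?_) (fun A => H.p_p A C) ?_
  · rw [H.x_p, sub_eq_add_neg]; simp only [eq_comm (a := A)]; split_ifs <;> simp
  · simp

theorem Sb_p (C : κ) : (∑ A, x A * b A) * p C = p C * (∑ A, x A * b A) + -b C := by
  refine sum_mul_of_commutator (δ := fun A => if A = C then -1 else 0)
    (fun A => ?_) (fun A => H.b_p A C) ?_
  · rw [H.x_p, sub_eq_add_neg]; simp only [eq_comm (a := A)]; split_ifs <;> simp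
  · simp

theorem Sb_a (C : κ) : (∑ A, x A * b A) * a C = a C * (∑ A, x A * b A) + x C := by
  refine sum_mul_of_commutator' (δ := fun A => if A = C then 1 else 0)
    (fun A => H.b_a C A) (fun A => (H.a_x C A).symm) ?_
  simp

theorem commute_h_left {z : R} (hz : ∀ A, Commute (a A) z) (hz' : ∀ A, Commute (b A) z) :
    Commute (∑ A, a A * b A) z := Commute.sum_left _ _ _ fun A _ => (hz A).mul_left (hz' A)

theorem commute_h_right {z : R} (hz : ∀ A, Commute (x A) z) (hz' : ∀ A, Commute (p A) z) :
    Commute (∑ A, x A * p A) z := Commute.sum_left _ _ _ fun A _ => (hz A).mul_left (hz' A)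

theorem h_a (C : κ) : (∑ A, a A * b A - ∑ A, x A * p A) * a C =
    a C * (∑ A, a A * b A - ∑ A, x A * p A) + a C := by
  rw [sub_mul, H.N_a, (H.commute_h_right (fun A => (H.a_x C A).symm)
    fun A => (H.a_p C A).symm).eq, mul_sub]
  abel

theorem h_b (C : κ) : (∑ A, a A * b A - ∑ A, x A * p A) * b C =
    b C * (∑ A, a A * b A - ∑ A, x A * p A) + -b C := by
  rw [sub_mul, H.N_b, (H.commute_h_right (fun A => (H.b_x C A).symm)
    fun A => (H.b_p C A).symm).eq, mul_sub]
  abel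

theorem h_x (C : κ) : (∑ A, a A * b A - ∑ A, x A * p A) * x C =
    x C * (∑ A, a A * b A - ∑ A, x A * p A) + -x C := by
  rw [sub_mul, H.Nx_x, (H.commute_h_left (fun A => H.a_x A C) fun A => H.b_x A C).eq, mul_sub]
  abel

theorem h_p (C : κ) : (∑ A, a A * b A - ∑ A, x A * p A) * p C =
    p C * (∑ A, a A * b A - ∑ A, x A * p A) + p C := by
  rw [sub_mul, H.Nx_p, (H.commute_h_left (fun A => H.a_p A C) fun A => H.b_p A C).eq, mul_sub]
  abel

theorem S_Box : (∑ A, η A • (b A * p A)) * (∑ A, η A • (p A * p A)) =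
    (∑ A, η A • (p A * p A)) * ∑ A, η A • (b A * p A) :=
  Commute.sum_left _ _ _ fun A _ => (Commute.sum_right _ _ _ fun C _ =>
    (((H.b_p A C).mul_right (H.b_p A C)).mul_left
      ((H.p_p A C).mul_right (H.p_p A C))).smul_right _).smul_left _

theorem Sd_Box : (∑ A, a A * p A) * (∑ A, η A • (p A * p A)) =
    (∑ A, η A • (p A * p A)) * ∑ A, a A * p A :=
  Commute.sum_left _ _ _ fun A _ => Commute.sum_right _ _ _ fun C _ =>
    (((H.a_p A C).mul_right (H.a_p A C)).mul_left
      ((H.p_p A C).mul_right (H.p_p A C))).smul_right _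

theorem T_Box : (∑ A, η A • (b A * b A)) * (∑ A, η A • (p A * p A)) =
    (∑ A, η A • (p A * p A)) * ∑ A, η A • (b A * b A) :=
  Commute.sum_left _ _ _ fun A _ => (Commute.sum_right _ _ _ fun C _ =>
    (((H.b_p A C).mul_right (H.b_p A C)).mul_left
      ((H.b_p A C).mul_right (H.b_p A C))).smul_right _).smul_left _

theorem T_S : (∑ A, η A • (b A * b A)) * (∑ A, η A • (b A * p A)) =
    (∑ A, η A • (b A * p A)) * ∑ A, η A • (b A * b A) :=
  Commute.sum_left _ _ _ fun A _ => (Commute.sum_right _ _ _ fun C _ =>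
    (((H.b_b A C).mul_right (H.b_p A C)).mul_left
      ((H.b_b A C).mul_right (H.b_p A C))).smul_right _).smul_left _

theorem S_Sd : (∑ A, η A • (b A * p A)) * (∑ A, a A * p A) =
    (∑ A, a A * p A) * (∑ A, η A • (b A * p A)) + ∑ A, η A • (p A * p A) := by
  rw [Finset.mul_sum, Finset.sum_mul, ← Finset.sum_add_distrib]
  refine Finset.sum_congr rfl fun C _ => ?_
  have h : Commute (∑ A, η A • (b A * p A)) (p C) := Commute.sum_left _ _ _ fun A _ =>
    ((H.b_p A C).mul_left (H.p_p A C)).smul_left _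
  rw [← mul_assoc, H.S_a, add_mul, mul_assoc, h.eq, mul_assoc, smul_mul_assoc]

theorem T_Sd : (∑ A, η A • (b A * b A)) * (∑ A, a A * p A) =
    (∑ A, a A * p A) * (∑ A, η A • (b A * b A)) + (2 : ℝ) • ∑ A, η A • (b A * p A) := by
  rw [Finset.mul_sum, Finset.sum_mul, Finset.smul_sum, ← Finset.sum_add_distrib]
  refine Finset.sum_congr rfl fun C _ => ?_
  have h : Commute (∑ A, η A • (b A * b A)) (p C) := Commute.sum_left _ _ _ fun A _ =>
    ((H.b_p A C).mul_left (H.b_p A C)).smul_left _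
  rw [← mul_assoc, H.T_a, add_mul, mul_assoc, h.eq, mul_assoc, smul_mul_assoc, smul_mul_assoc]

theorem h_Box : (∑ A, a A * b A - ∑ A, x A * p A) * (∑ A, η A • (p A * p A)) =
    (∑ A, η A • (p A * p A)) * (∑ A, a A * b A - ∑ A, x A * p A) +
      (2 : ℝ) • ∑ A, η A • (p A * p A) := by
  rw [Finset.mul_sum, Finset.sum_mul, Finset.smul_sum, ← Finset.sum_add_distrib]
  refine Finset.sum_congr rfl fun C _ => ?_
  rw [mul_smul_comm, ← mul_assoc, H.h_p, add_mul, mul_assoc, H.h_p, mul_add, two_smul,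
    smul_mul_assoc, smul_add, smul_add, mul_assoc]
  abel

theorem h_S : (∑ A, a A * b A - ∑ A, x A * p A) * (∑ A, η A • (b A * p A)) =
    (∑ A, η A • (b A * p A)) * (∑ A, a A * b A - ∑ A, x A * p A) := by
  rw [Finset.mul_sum, Finset.sum_mul]
  refine Finset.sum_congr rfl fun C _ => ?_
  rw [mul_smul_comm, ← mul_assoc, H.h_b, add_mul, mul_assoc, H.h_p, mul_add,
    smul_mul_assoc, neg_mul, mul_assoc, add_neg_cancel_right]

theorem h_Sd : (∑ A, a A * b A - ∑ A, x A * p A) * (∑ A, a A * p A) =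
    (∑ A, a A * p A) * (∑ A, a A * b A - ∑ A, x A * p A) + (2 : ℝ) • ∑ A, a A * p A := by
  rw [Finset.mul_sum, Finset.sum_mul, Finset.smul_sum, ← Finset.sum_add_distrib]
  refine Finset.sum_congr rfl fun C _ => ?_
  rw [← mul_assoc, H.h_a, add_mul, mul_assoc, H.h_p, mul_add, two_smul, mul_assoc]
  abel

theorem h_T : (∑ A, a A * b A - ∑ A, x A * p A) * (∑ A, η A • (b A * b A)) =
    (∑ A, η A • (b A * b A)) * (∑ A, a A * b A - ∑ A, x A * p A) -
      (2 : ℝ) • ∑ A, η A • (b A * b A) := by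
  rw [eq_sub_iff_add_eq, Finset.mul_sum, Finset.sum_mul, Finset.smul_sum,
    ← Finset.sum_add_distrib]
  refine Finset.sum_congr rfl fun C _ => ?_
  rw [mul_smul_comm, ← mul_assoc, H.h_b, add_mul, mul_assoc, H.h_b, mul_add, two_smul,
    smul_mul_assoc, neg_mul, mul_neg, smul_add, smul_add, mul_assoc, smul_neg]
  module

theorem h_Sb : (∑ A, a A * b A - ∑ A, x A * p A) * (∑ A, x A * b A) =
    (∑ A, x A * b A) * (∑ A, a A * b A - ∑ A, x A * p A) - (2 : ℝ) • ∑ A, x A * b A := by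
  rw [eq_sub_iff_add_eq, Finset.mul_sum, Finset.sum_mul, Finset.smul_sum,
    ← Finset.sum_add_distrib]
  refine Finset.sum_congr rfl fun C _ => ?_
  rw [← mul_assoc, H.h_x, add_mul, mul_assoc, H.h_b, mul_add, two_smul, neg_mul, mul_neg,
    mul_assoc]
  abel

theorem Sb_h : (∑ A, x A * b A) * (∑ A, a A * b A - ∑ A, x A * p A) =
    (∑ A, a A * b A - ∑ A, x A * p A) * (∑ A, x A * b A) + (2 : ℝ) • ∑ A, x A * b A := by
  rw [H.h_Sb, sub_add_cancel]

theorem Sb_Box : (∑ A, x A * b A) * (∑ A, η A • (p A * p A)) =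
    (∑ A, η A • (p A * p A)) * (∑ A, x A * b A) - (2 : ℝ) • ∑ A, η A • (b A * p A) := by
  rw [Finset.mul_sum, Finset.sum_mul, Finset.smul_sum, ← Finset.sum_sub_distrib]
  refine Finset.sum_congr rfl fun C _ => ?_
  rw [mul_smul_comm, ← mul_assoc, H.Sb_p, add_mul, mul_assoc, H.Sb_p, mul_add, two_smul,
    smul_mul_assoc, neg_mul, mul_neg, smul_add, smul_add, mul_assoc, smul_neg, (H.b_p C C).eq]
  module

theorem Sb_S : (∑ A, x A * b A) * (∑ A, η A • (b A * p A)) =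
    (∑ A, η A • (b A * p A)) * (∑ A, x A * b A) - ∑ A, η A • (b A * b A) := by
  rw [Finset.mul_sum, Finset.sum_mul, ← Finset.sum_sub_distrib]
  refine Finset.sum_congr rfl fun C _ => ?_
  have h : Commute (∑ A, x A * b A) (b C) := Commute.sum_left _ _ _ fun A _ =>
    (H.b_x C A).symm.mul_left (H.b_b A C)
  rw [mul_smul_comm, ← mul_assoc, h.eq, mul_assoc, H.Sb_p, mul_add, smul_mul_assoc, smul_add,
    mul_neg, mul_assoc, smul_neg]
  abel

theorem Sb_Sd : (∑ A, x A * b A) * (∑ A, a A * p A) =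
    (∑ A, a A * p A) * (∑ A, x A * b A) - (∑ A, a A * b A - ∑ A, x A * p A) := by
  rw [Finset.mul_sum, Finset.sum_mul, ← Finset.sum_sub_distrib, ← Finset.sum_sub_distrib]
  refine Finset.sum_congr rfl fun C _ => ?_
  rw [← mul_assoc, H.Sb_a, add_mul, mul_assoc, H.Sb_p, mul_add, mul_neg, mul_assoc]
  abel

theorem Sb_T : (∑ A, x A * b A) * (∑ A, η A • (b A * b A)) =
    (∑ A, η A • (b A * b A)) * ∑ A, x A * b A :=
  Commute.sum_left _ _ _ fun A _ => Commute.sum_right _ _ _ fun C _ =>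
    (((H.b_x C A).symm.mul_right (H.b_x C A).symm).mul_left
      ((H.b_b A C).mul_right (H.b_b A C))).smul_right _

end ConjugatePairs

end Sp4Relations

/-! ### Bookkeeping of order, filtration degree and ghost number. -/

section Tame

variable {d : ℕ} {U : TopologicalSpace.Opens (Fin d → ℝ)} {Y B : Type} {k : ℕ}

local notation "𝓔" => Module.End ℝ (Fock U Y B k)

theorem Hom.coefM {w : Weight Y B} (hw : ∀ i, w.y i = 0) (f : Coef U Y) :
    Hom w 0 (coefM f : 𝓔) := fun g =>
  LinearMap.ext fun φ => Fock.ext_coeff fun S β n => by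
    classical
    have he : ∀ n : Y →₀ ℕ, w.eval S β n = w.eval S β 0 := fun n => by simp [Weight.eval, hw]
    have h : ∀ m : Y →₀ ℕ, MvPowerSeries.coeff m (MvPolynomial.coeff β
        (AdSHigherSpin.fdiag w g φ S)) =
        g (w.eval S β 0) • MvPowerSeries.coeff m (MvPolynomial.coeff β (φ S)) := fun m => by
      have := coeff_fdiag w g φ S β m
      rwa [he] at this
    simp only [Module.End.mul_apply, coeff_fdiag, coeff_coefM, add_zero, MvPowerSeries.coeff_mul,
      h, he n, Finset.smul_sum, mul_smul_comm]

/-- Differential operators of finite order with a bounded degree in the formal variables and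
ghost number `s`. -/
structure Tame (s : ℤ) (A : Module.End ℝ (Fock U Y B k)) : Prop where
  finOrder : FinOrder (SmoothFn U) A
  hasDeg : ∃ r, HasDeg orderWeight r A
  hom : Hom ghWeight s A

namespace Tame

variable {s s' t : ℤ} {A A' : Module.End ℝ (Fock U Y B k)}

theorem add (h : Tame s A) (h' : Tame s A') : Tame s (A + A') := by
  obtain ⟨r, hr⟩ := h.hasDeg
  obtain ⟨r', hr'⟩ := h'.hasDeg
  exact ⟨h.finOrder.add h'.finOrder, ⟨min r r', (hr.mono (min_le_left _ _)).add
    (hr'.mono (min_le_right _ _))⟩, h.hom.add h'.hom⟩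

theorem real_smul (c : ℝ) (h : Tame s A) : Tame s (c • A) :=
  ⟨h.finOrder.real_smul c, h.hasDeg.imp fun _ h => h.smul c, h.hom.smul c⟩

theorem neg (h : Tame s A) : Tame s (-A) := by simpa using h.real_smul (-1)

theorem sub (h : Tame s A) (h' : Tame s A') : Tame s (A - A') := by
  rw [sub_eq_add_neg]; exact h.add h'.neg

theorem mul (h : Tame s A) (h' : Tame s' A') (ht : s + s' = t) : Tame t (A * A') := by
  obtain ⟨r, hr⟩ := h.hasDeg
  obtain ⟨r', hr'⟩ := h'.hasDeg
  exact ⟨h.finOrder.mul h'.finOrder, ⟨r + r', hr.mul hr' le_rfl⟩, h.hom.mul h'.hom ht⟩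

theorem mul₀ (h : Tame 0 A) (h' : Tame 0 A') : Tame 0 (A * A') := h.mul h' (zero_add 0)

theorem of_linear {r : ℤ} (h : FnLinear A) (h' : HasDeg orderWeight r A)
    (h'' : Hom ghWeight s A) : Tame s A := ⟨h.finOrder, ⟨r, h'⟩, h''⟩

theorem one : Tame 0 (1 : 𝓔) :=
  of_linear (fun f => Commute.one_left _) (HasDeg.one _) (Hom.one _)

theorem zero : Tame s (0 : 𝓔) := 
  of_linear (fun f => Commute.zero_left _) (Hom.zero _ 0).hasDeg (Hom.zero _ _)

theorem sum {ι : Type*} {σ : Finset ι} {A : ι → 𝓔} (h : ∀ i ∈ σ, Tame s (A i)) :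
    Tame s (∑ i ∈ σ, A i) := Finset.sum_induction A (Tame s) (fun _ _ => Tame.add) zero h

theorem fnM (f : SmoothFn U) : Tame 0 (fnM f : 𝓔) :=
  of_linear (.fnM f) (Hom.fnM _ f).hasDeg (.fnM _ f)

theorem fn_smul (f : SmoothFn U) (h : Tame s A) : Tame s (f • A) :=
  (Tame.fnM f).mul h (zero_add s)

theorem xD (m : Fin d) : Tame 0 (xD m : 𝓔) :=
  ⟨xD_finOrder m, ⟨0, (Hom.xD _ m).hasDeg⟩, .xD _ m⟩

theorem coefM (f : Coef U Y) : Tame 0 (coefM f : 𝓔) :=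
  of_linear (.coefM f) (HasDeg.coefM (fun _ => zero_le_one) f) (.coefM (fun _ => rfl) f)

theorem yM (i : Y) : Tame 0 (yM i : 𝓔) := Tame.coefM _

theorem yD (i : Y) : Tame 0 (yD i : 𝓔) := of_linear (.yD i) (Hom.yD _ i).hasDeg (.yD _ i)

theorem aM (i : B) : Tame 0 (aM i : 𝓔) := of_linear (.aM i) (Hom.aM _ i).hasDeg (.aM _ i)

theorem aD (i : B) : Tame 0 (aD i : 𝓔) := of_linear (.aD i) (Hom.aD _ i).hasDeg (.aD _ i)

theorem gM {j : ℕ} (h : (if j = 2 then -1 else 1) = s) : Tame s (gM j : 𝓔) := by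
  subst h; exact of_linear (.gM j) (Hom.gM _ j).hasDeg (.gM _ j)

theorem gD {j : ℕ} (h : -(if j = 2 then -1 else 1) = s) : Tame s (gD j : 𝓔) := by
  subst h; exact of_linear (.gD j) (Hom.gD _ j).hasDeg (.gD _ j)

theorem constraintCharge {Box S Sd T h Sb : 𝓔} (hBox : Tame 0 Box) (hS : Tame 0 S)
    (hSd : Tame 0 Sd) (hT : Tame 0 T) (hh : Tame 0 h) (hSb : Tame 0 Sb) :
    Tame 1 (constraintCharge ghosts Box S Sd T h Sb) := by
  simp only [AdSHigherSpin.constraintCharge, ghosts, two_mul_eq_smul]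
  have m := fun j => Tame.gM (U := U) (Y := Y) (B := B) (k := k) (j := j) rfl
  have D := fun j => Tame.gD (U := U) (Y := Y) (B := B) (k := k) (j := j) rfl
  refine .add (.add (.add (.add (.add (.sub (.sub (.sub (.sub (.add (.add (.add (.add (.add
    ((m 0).mul hBox rfl) ((m 1).mul hS rfl)) (hSd.mul (D 2) rfl)) ((m 3).mul hT rfl))
    ((m 4).mul hh rfl)) ((m 5).mul hSb rfl)) ?_) ?_) ?_) ?_) ?_) ?_) ?_) ?_) ?_
  · exact ((m 1).mul (D 2) rfl).mul (D 0) rfl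
  · exact .real_smul _ (((m 3).mul (D 2) rfl).mul (D 1) rfl)
  · exact .real_smul _ (((m 4).mul (m 0) rfl).mul (D 0) rfl)
  · exact .real_smul _ (((m 4).mul (D 2) rfl).mul (m 2) rfl)
  · exact .real_smul _ (((m 4).mul (m 3) rfl).mul (D 3) rfl)
  · exact .real_smul _ (((m 5).mul (m 0) rfl).mul (D 1) rfl)
  · exact .real_smul _ (((m 4).mul (m 5) rfl).mul (D 5) rfl)
  · exact ((m 5).mul (m 1) rfl).mul (D 3) rfl
  · exact ((m 5).mul (D 2) rfl).mul (D 4) rfl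

/-- Finite order, continuity and ghost number are inherited from the building blocks, so for each
system only nilpotency remains to be proved. -/
theorem isBRSTSystem {Ω : 𝓔} (h : Tame 1 Ω) (hΩ : Ω * Ω = 0) :
    IsBRSTSystem (fil : ℕ → Submodule (SmoothFn U) (Fock U Y B k)) ghostNumber Ω where
  finite_order := h.finOrder
  continuous := h.hasDeg.choose_spec.filContinuous
  nilpotent := hΩ
  ghost := by simpa using h.hom.ghost_comm

end Tame

end Tame

/-! ### The parent system is a BRST system. -/

section ParentBRST

variable {d : ℕ} {l : ℝ} {U : TopologicalSpace.Opens (Fin d → ℝ)} (F : AdSFrame l U)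

theorem parent_conjugatePairs : ConjugatePairs
    (shiftedY l : Fin (d + 1) → Module.End ℝ (ParentStates U)) yD aM aD where
  p_x A C := yD_mul_shiftedY A C
  b_a A C := aD_mul_aM C A
  x_x := shiftedY_conjugate.2.1
  p_p := yD_comm
  a_a := aM_comm
  b_b := aD_comm
  a_x A C := commute_shiftedY (aM_comm_yM A C)
  a_p := aM_comm_yD
  b_x A C := commute_shiftedY (aD_comm_yM A C)
  b_p := aD_comm_yD

/-- The part of the parent BRST operator built from the constraints. -/
def parentQ (l : ℝ) : Module.End ℝ (ParentStates U) :=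
  constraintCharge ghosts
    (∑ A, eta A • (yD A * yD A))
    (∑ A, eta A • (aD A * yD A))
    (∑ A, aM A * yD A)
    (∑ A, eta A • (aD A * aD A))
    (∑ A, aM A * aD A - ∑ A, shiftedY l A * yD A)
    (∑ A, shiftedY l A * aD A)

theorem parentCharge_eq (hl : l ≠ 0) :
    parentCharge F = ∑ m : Fin d, gM (6 + m.val) * parentD F m + parentQ l := by
  rw [← parentNabla_add_parentSigma F hl]; rfl

theorem parentQ_sq : parentQ (U := U) l * parentQ l = 0 := by
  have H := parent_conjugatePairs (U := U) (l := l)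
  refine constraintCharge_sq (Nat.le_add_right 6 d) ?_ ?_ ?_ ?_ ?_ ?_ (H.S_Box eta)
    (H.Sd_Box eta) (H.T_Box eta) (H.S_Sd eta) (H.T_S eta) (H.T_Sd eta) (H.h_Box eta) (H.h_S eta)
    H.h_Sd (H.h_T eta) H.Sb_h (H.Sb_Box eta) (H.Sb_S eta) H.Sb_Sd (H.Sb_T eta)
  · exact .sum fun A _ => .real_smul _ ((Bosonic.yD A).mul (.yD A))
  · exact .sum fun A _ => .real_smul _ ((Bosonic.aD A).mul (.yD A))
  · exact .sum fun A _ => (Bosonic.aM A).mul (.yD A)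
  · exact .sum fun A _ => .real_smul _ ((Bosonic.aD A).mul (.aD A))
  · exact (Bosonic.sum fun A _ => (Bosonic.aM A).mul (.aD A)).sub
      (.sum fun A _ => (shiftedY_bosonic A).mul (.yD A))
  · exact .sum fun A _ => (shiftedY_bosonic A).mul (.aD A)

theorem parentD_commute_parentQ (m : Fin d) : Commute (parentD F m) (parentQ l) := by
  have hW := F.W_metric' m
  refine constraintCharge_commute (parentD_bosonic F m) ?_ ?_ ?_ ?_ ?_ ?_
  · exact (parentD_yD F m).commute_metric hW (parentD_yD F m) .yD
  · exact (parentD_aD F m).commute_metric hW (parentD_yD F m) .aD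
  · exact (parentD_aM F m).commute_contract (parentD_yD F m) .aM
  · exact (parentD_aD F m).commute_metric hW (parentD_aD F m) .aD
  · exact ((parentD_aM F m).commute_contract (parentD_aD F m) .aM).sub_right
      ((parentD_shiftedY F m).commute_contract (parentD_yD F m) shiftedY_fnLinear)
  · exact (parentD_shiftedY F m).commute_contract (parentD_aD F m) shiftedY_fnLinear

theorem parentQ_mul_gM {j : ℕ} (hj : 6 ≤ j) :
    parentQ (U := U) l * gM j = -(gM j * parentQ l) := by
  refine constraintCharge_mul_gM (by lia) ?_ ?_ ?_ ?_ ?_ ?_ hj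
  · exact .sum fun A _ => .real_smul _ ((Bosonic.yD A).mul (.yD A))
  · exact .sum fun A _ => .real_smul _ ((Bosonic.aD A).mul (.yD A))
  · exact .sum fun A _ => (Bosonic.aM A).mul (.yD A)
  · exact .sum fun A _ => .real_smul _ ((Bosonic.aD A).mul (.aD A))
  · exact (Bosonic.sum fun A _ => (Bosonic.aM A).mul (.aD A)).sub
      (.sum fun A _ => (shiftedY_bosonic A).mul (.yD A))
  · exact .sum fun A _ => (shiftedY_bosonic A).mul (.aD A)

theorem gD_mul_parentQ {j : ℕ} (hj : 6 ≤ j) :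
    gD j * parentQ (U := U) l = -(parentQ l * gD j) := by
  refine gD_mul_constraintCharge ?_ ?_ ?_ ?_ ?_ ?_ hj
  · exact .sum fun A _ => .real_smul _ ((Bosonic.yD A).mul (.yD A))
  · exact .sum fun A _ => .real_smul _ ((Bosonic.aD A).mul (.yD A))
  · exact .sum fun A _ => (Bosonic.aM A).mul (.yD A)
  · exact .sum fun A _ => .real_smul _ ((Bosonic.aD A).mul (.aD A))
  · exact (Bosonic.sum fun A _ => (Bosonic.aM A).mul (.aD A)).sub
      (.sum fun A _ => (shiftedY_bosonic A).mul (.yD A))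
  · exact .sum fun A _ => (shiftedY_bosonic A).mul (.aD A)

/-- With `Θ = θ^m 𝔇_m`: `Θ² = 0` because anticommuting `θ^m` multiply commuting `𝔇_m`, so `Θ²`
equals its own negative; `Q² = 0` by the constraint algebra; the mixed terms cancel because `𝔇_m`
commutes with `Q` while `θ^m` anticommutes with it. -/
theorem parentCharge_sq (hl : l ≠ 0) : parentCharge F * parentCharge F = 0 := by
  set Θ : Module.End ℝ (ParentStates U) := ∑ m : Fin d, gM (6 + m.val) * parentD F m with hΘ
  have h1 : Θ * Θ = 0 := by
    have h2 : Θ * Θ = ∑ m : Fin d, ∑ n : Fin d,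
        gM (6 + m.val) * gM (6 + n.val) * (parentD F m * parentD F n) := by
      rw [hΘ, Finset.sum_mul_sum]
      refine Finset.sum_congr rfl fun m _ => Finset.sum_congr rfl fun n _ => ?_
      rw [mul_assoc, (parentD_bosonic F m).mul_gM_assoc, mul_assoc]
    have h3 : Θ * Θ = -(Θ * Θ) := by
      rw [h2, ← Finset.sum_neg_distrib]
      conv_rhs => simp only [← Finset.sum_neg_distrib]
      rw [Finset.sum_comm]
      refine Finset.sum_congr rfl fun m _ => Finset.sum_congr rfl fun n _ => ?_
      rw [gM_anticomm, (parentD_comm F n m).eq, neg_mul]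
    have h4 : (2 : ℝ) • (Θ * Θ) = 0 := by
      rw [two_smul]; nth_rewrite 1 [h3]; rw [neg_add_cancel]
    exact (smul_eq_zero.1 h4).resolve_left two_ne_zero
  have h2 : Θ * parentQ l + parentQ l * Θ = 0 := by
    rw [hΘ, Finset.sum_mul, Finset.mul_sum, ← Finset.sum_add_distrib]
    refine Finset.sum_eq_zero fun m _ => ?_
    rw [← mul_assoc, parentQ_mul_gM (by lia), neg_mul, mul_assoc, mul_assoc,
      (parentD_commute_parentQ F m).eq, add_neg_cancel]
  rw [parentCharge_eq F hl, add_mul, mul_add, mul_add, h1, parentQ_sq, zero_add, add_zero, h2]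

theorem shiftedY_tame (A : Fin (d + 1)) :
    Tame 0 (shiftedY l A : Module.End ℝ (ParentStates U)) := (Tame.yM A).add (.real_smul _ .one)

theorem parentQ_tame : Tame 1 (parentQ l : Module.End ℝ (ParentStates U)) :=
  .constraintCharge (.sum fun A _ => .real_smul _ ((Tame.yD A).mul₀ (.yD A)))
    (.sum fun A _ => .real_smul _ ((Tame.aD A).mul₀ (.yD A)))
    (.sum fun A _ => (Tame.aM A).mul₀ (.yD A))
    (.sum fun A _ => .real_smul _ ((Tame.aD A).mul₀ (.aD A)))
    ((Tame.sum fun A _ => (Tame.aM A).mul₀ (.aD A)).sub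
      (.sum fun A _ => (shiftedY_tame A).mul₀ (.yD A)))
    (.sum fun A _ => (shiftedY_tame A).mul₀ (.aD A))

theorem parentD_tame (m : Fin d) : Tame 0 (parentD F m) :=
  (Tame.xD m).sub (.sum fun _ _ => .sum fun _ _ => .fn_smul _
    (((shiftedY_tame _).mul₀ (.yD _)).add ((Tame.aM _).mul₀ (.aD _))))

theorem parentCharge_tame (hl : l ≠ 0) : Tame 1 (parentCharge F) := by
  rw [parentCharge_eq F hl]
  exact (Tame.sum fun m _ => (Tame.gM (s := 1) (if_neg (by lia))).mul (parentD_tame F m) (add_zero 1)).add parentQ_tame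

theorem parentCharge_isBRSTSystem (hl : l ≠ 0) :
    IsBRSTSystem fil ghostNumber (parentCharge F) :=
  (parentCharge_tame F hl).isBRSTSystem (parentCharge_sq F hl)

end ParentBRST

end AdSHigherSpin

end

noncomputable section
namespace AdSHigherSpin

/-! ### Restriction to fewer variables, left inverse to the inclusion of states. -/

section Restriction

variable {d : ℕ} {U : TopologicalSpace.Opens (Fin d → ℝ)} {Y Y' B B' : Type} {k k' : ℕ}
variable (iY : Y ↪ Y') (iB : B ↪ B') (hk : k ≤ k')

theorem coeff_rename_map_embDomain {R S : Type*} [CommSemiring R] [CommSemiring S] (g : R →+* S)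
    (p : MvPolynomial B R) (β : B →₀ ℕ) :
    MvPolynomial.coeff (β.embDomain iB) (MvPolynomial.rename iB (MvPolynomial.map g p)) =
      g (MvPolynomial.coeff β p) := by
  rw [MvPolynomial.coeff_rename_embDomain, MvPolynomial.coeff_map]

theorem coeff_rename_map_eq_zero {R S : Type*} [CommSemiring R] [CommSemiring S] (g : R →+* S)
    (p : MvPolynomial B R) {β : B' →₀ ℕ} (h : ∀ β' : B →₀ ℕ, β'.embDomain iB ≠ β) :
    MvPolynomial.coeff β (MvPolynomial.rename iB (MvPolynomial.map g p)) = 0 :=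
  MvPolynomial.coeff_rename_eq_zero _ _ _ fun u hu =>
    absurd (by rw [Finsupp.embDomain_eq_mapDomain]; exact hu) (h u)

theorem coeff_inclPoly (p : MvPolynomial B (Coef U Y)) (β : B →₀ ℕ) (n : Y →₀ ℕ) :
    MvPowerSeries.coeff (n.embDomain iY) (MvPolynomial.coeff (β.embDomain iB)
      (inclPoly iY iB p)) = MvPowerSeries.coeff n (MvPolynomial.coeff β p) :=
  (congrArg (MvPowerSeries.coeff (n.embDomain iY))
    (coeff_rename_map_embDomain iB _ p β)).trans (MvPowerSeries.coeff_embDomain_rename _ _ _)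

theorem exists_of_coeff_inclPoly_ne_zero {p : MvPolynomial B (Coef U Y)} {β : B' →₀ ℕ}
    {n : Y' →₀ ℕ} (h : MvPowerSeries.coeff n (MvPolynomial.coeff β (inclPoly iY iB p)) ≠ 0) :
    (∃ β' : B →₀ ℕ, β'.embDomain iB = β) ∧ ∃ n' : Y →₀ ℕ, n'.embDomain iY = n := by
  have hβ : ∃ β' : B →₀ ℕ, β'.embDomain iB = β := by
    by_contra hne
    push Not at hne
    exact h ((congrArg (MvPowerSeries.coeff n)
      (coeff_rename_map_eq_zero iB _ p hne)).trans (map_zero _))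
  refine ⟨hβ, ?_⟩
  obtain ⟨β', rfl⟩ := hβ
  by_contra hn
  have h0 : MvPowerSeries.coeff n (MvPowerSeries.rename iY (MvPolynomial.coeff β' p)) = 0 := by
    refine MvPowerSeries.coeff_rename_eq_zero (R := SmoothFn U) (f := iY) _ ?_
    rintro ⟨n', hn'⟩
    exact hn ⟨n', by rw [Finsupp.embDomain_eq_mapDomain]; exact hn'⟩
  exact h ((congrArg (MvPowerSeries.coeff n) (coeff_rename_map_embDomain iB _ p β')).trans h0)

theorem coeff_incl (φ : Fock U Y B k) (S : Finset (Fin k)) (β : B →₀ ℕ) (n : Y →₀ ℕ) :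
    (incl iY iB hk φ).coeff (S.map (Fin.castLEEmb hk)) (β.embDomain iB) (n.embDomain iY) =
      φ.coeff S β n := by
  have h1 : ∀ h ∈ S.map (Fin.castLEEmb hk), h.val < k := by
    intro h hh
    obtain ⟨a, -, rfl⟩ := Finset.mem_map.1 hh
    exact a.2
  have h2 : (Finset.univ.filter fun h : Fin k => Fin.castLE hk h ∈ S.map (Fin.castLEEmb hk)) =
      S := by
    ext h
    rw [Finset.mem_filter_univ]
    exact Finset.mem_map' (Fin.castLEEmb hk)
  change MvPowerSeries.coeff _ (MvPolynomial.coeff _ (if _ then _ else _ :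
    MvPolynomial B' (Coef U Y'))) = _
  rw [if_pos h1, h2, coeff_inclPoly]
  rfl

theorem exists_of_coeff_incl_ne_zero {φ : Fock U Y B k} {S : Finset (Fin k')} {β : B' →₀ ℕ}
    {n : Y' →₀ ℕ} (h : (incl iY iB hk φ).coeff S β n ≠ 0) :
    (∃ S' : Finset (Fin k), S'.map (Fin.castLEEmb hk) = S) ∧
    (∃ β' : B →₀ ℕ, β'.embDomain iB = β) ∧ ∃ n' : Y →₀ ℕ, n'.embDomain iY = n := by
  change MvPowerSeries.coeff _ (MvPolynomial.coeff _ (if _ then _ else _ :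
    MvPolynomial B' (Coef U Y'))) ≠ 0 at h
  split_ifs at h with hS
  · refine ⟨⟨Finset.univ.filter fun h : Fin k => Fin.castLE hk h ∈ S, ?_⟩,
      exists_of_coeff_inclPoly_ne_zero iY iB h⟩
    ext x
    simp only [Finset.mem_map, Finset.mem_filter, Finset.mem_univ, true_and, Fin.castLEEmb_apply]
    constructor
    · rintro ⟨a, ha, rfl⟩; exact ha
    · intro hx
      exact ⟨⟨x.val, hS x hx⟩, hx, rfl⟩
  · exact absurd rfl h

/-- The component of a state independent of the variables that are not in the images of `iY` and
`iB`, and of the ghosts with numbers at least `k`. -/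
def res : Fock U Y' B' k' →ₗ[SmoothFn U] Fock U Y B k where
  toFun φ := ofCoeff (fun S β n => φ.coeff (S.map (Fin.castLEEmb hk)) (β.embDomain iB)
    (n.embDomain iY)) fun S =>
      (((φ.finite_support (S.map (Fin.castLEEmb hk))).preimage
        (Finsupp.embDomain_injective iB).injOn)).subset fun β ⟨n, hn⟩ => ⟨_, hn⟩
  map_add' φ ψ := Fock.ext_coeff fun S β n => by
    rw [Fock.coeff_add]; simp only [coeff_ofCoeff]; rfl
  map_smul' f φ := Fock.ext_coeff fun S β n => by
    rw [RingHom.id_apply, Fock.coeff_smul]; simp only [coeff_ofCoeff]; rfl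

theorem coeff_res (φ : Fock U Y' B' k') (S : Finset (Fin k)) (β : B →₀ ℕ) (n : Y →₀ ℕ) :
    (res iY iB hk φ).coeff S β n =
      φ.coeff (S.map (Fin.castLEEmb hk)) (β.embDomain iB) (n.embDomain iY) := coeff_ofCoeff _ _ _ _ _

theorem res_incl (φ : Fock U Y B k) : res iY iB hk (incl iY iB hk φ) = φ :=
  Fock.ext_coeff fun S β n => by rw [coeff_res, coeff_incl]

/-- The weight vanishes on the retained variables and is positive on the eliminated ones. A monomial
therefore has weight zero exactly when it involves retained variables only. -/
theorem incl_res {w : Weight Y' B'} (hg : ∀ j, k ≤ j → j < k' → 0 < w.g j)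
    (hg' : ∀ j < k, w.g j = 0) (ha : ∀ i, i ∉ Set.range iB → 0 < w.a i)
    (ha' : ∀ i, w.a (iB i) = 0) (hy : ∀ i, i ∉ Set.range iY → 0 < w.y i)
    (hy' : ∀ i, w.y (iY i) = 0) (φ : Fock U Y' B' k') :
    incl iY iB hk (res iY iB hk φ) = fdiag w (fun x => if x = 0 then 1 else 0) φ := by
  classical
  refine Fock.ext_coeff fun S β n => ?_
  have hg0 : ∀ j < k', 0 ≤ w.g j := fun j hj =>
    (lt_or_ge j k).elim (fun h => (hg' j h).ge) fun h => (hg j h hj).le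
  have ha0 : ∀ i, 0 ≤ w.a i := fun i => by
    by_cases h : i ∈ Set.range iB
    · obtain ⟨j, rfl⟩ := h; exact (ha' j).ge
    · exact (ha i h).le
  have hy0 : ∀ i, 0 ≤ w.y i := fun i => by
    by_cases h : i ∈ Set.range iY
    · obtain ⟨j, rfl⟩ := h; exact (hy' j).ge
    · exact (hy i h).le
  have h1 : 0 ≤ ∑ h ∈ S, w.g h.val := Finset.sum_nonneg fun h _ => hg0 _ h.2
  have h2 : 0 ≤ β.sum fun i e => (e : ℤ) * w.a i :=
    Finset.sum_nonneg fun i _ => mul_nonneg (Int.natCast_nonneg _) (ha0 i)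
  have h3 : 0 ≤ n.sum fun i e => (e : ℤ) * w.y i :=
    Finset.sum_nonneg fun i _ => mul_nonneg (Int.natCast_nonneg _) (hy0 i)
  rw [coeff_fdiag]
  by_cases hw : w.eval S β n = 0
  · rw [if_pos hw, one_smul]
    have e1 : ∑ h ∈ S, w.g h.val = 0 := by simp only [Weight.eval] at hw; lia
    have e2 : (β.sum fun i e => (e : ℤ) * w.a i) = 0 := by simp only [Weight.eval] at hw; lia
    have e3 : (n.sum fun i e => (e : ℤ) * w.y i) = 0 := by simp only [Weight.eval] at hw; lia
    have hS : ∃ S' : Finset (Fin k), S'.map (Fin.castLEEmb hk) = S := by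
      refine ⟨Finset.univ.filter fun h : Fin k => Fin.castLE hk h ∈ S, ?_⟩
      ext x
      simp only [Finset.mem_map, Finset.mem_filter, Finset.mem_univ, true_and,
        Fin.castLEEmb_apply]
      constructor
      · rintro ⟨a, ha, rfl⟩; exact ha
      · intro hx
        have := (Finset.sum_eq_zero_iff_of_nonneg fun h _ => hg0 _ h.2).1 e1 x hx
        refine ⟨⟨x.val, ?_⟩, hx, rfl⟩
        by_contra hlt
        exact (hg x.val (by lia) x.2).ne' this
    have hβ : ∃ β' : B →₀ ℕ, β'.embDomain iB = β := by
      refine ⟨β.comapDomain iB iB.injective.injOn, ?_⟩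
      rw [Finsupp.embDomain_comapDomain]
      intro i hi
      by_contra hr
      have := (Finset.sum_eq_zero_iff_of_nonneg fun i _ =>
        mul_nonneg (Int.natCast_nonneg _) (ha0 i)).1 e2 i hi
      rcases mul_eq_zero.1 this with h | h
      · exact (Finsupp.mem_support_iff.1 hi) (by exact_mod_cast h)
      · exact (ha i hr).ne' h
    have hn : ∃ n' : Y →₀ ℕ, n'.embDomain iY = n := by
      refine ⟨n.comapDomain iY iY.injective.injOn, ?_⟩
      rw [Finsupp.embDomain_comapDomain]
      intro i hi
      by_contra hr
      have := (Finset.sum_eq_zero_iff_of_nonneg fun i _ =>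
        mul_nonneg (Int.natCast_nonneg _) (hy0 i)).1 e3 i hi
      rcases mul_eq_zero.1 this with h | h
      · exact (Finsupp.mem_support_iff.1 hi) (by exact_mod_cast h)
      · exact (hy i hr).ne' h
    obtain ⟨S', rfl⟩ := hS
    obtain ⟨β', rfl⟩ := hβ
    obtain ⟨n', rfl⟩ := hn
    rw [coeff_incl, coeff_res]
  · rw [if_neg hw, zero_smul]
    by_contra hne
    obtain ⟨⟨S', rfl⟩, ⟨β', rfl⟩, n', rfl⟩ := exists_of_coeff_incl_ne_zero iY iB hk hne
    apply hw
    simp only [Weight.eval, Finset.sum_map, Finsupp.embDomain_eq_mapDomain]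
    rw [Finsupp.sum_mapDomain_index_inj iB.injective, Finsupp.sum_mapDomain_index_inj iY.injective]
    simp only [ha', hy', mul_zero, Finsupp.sum, Finset.sum_const_zero, add_zero]
    exact Finset.sum_eq_zero fun h _ => hg' _ h.2

theorem degree_embDomain {ι ι' : Type*} (f : ι ↪ ι') (n : ι →₀ ℕ) :
    (n.embDomain f).degree = n.degree := by
  rw [Finsupp.degree_apply, Finsupp.degree_apply, Finsupp.support_embDomain, Finset.sum_map]
  simp only [Finsupp.embDomain_apply_self]

theorem res_filContinuous : FilContinuous fil fil
    ((res iY iB hk : Fock U Y' B' k' →ₗ[SmoothFn U] Fock U Y B k).restrictScalars ℝ) :=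
  fun j => ⟨j, fun φ hφ S β n hn => by
    change (res iY iB hk φ).coeff S β n = 0
    rw [coeff_res]
    refine hφ _ _ _ ?_
    rwa [degree_embDomain]⟩

theorem incl_filContinuous : FilContinuous fil fil
    ((incl iY iB hk : Fock U Y B k →ₗ[SmoothFn U] Fock U Y' B' k').restrictScalars ℝ) :=
  fun j => ⟨j, fun φ hφ S β n hn => by
    by_contra hne
    obtain ⟨⟨S', rfl⟩, ⟨β', rfl⟩, n', rfl⟩ := exists_of_coeff_incl_ne_zero iY iB hk hne
    apply hne
    change (incl iY iB hk φ).coeff _ _ _ = 0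
    rw [coeff_incl]
    refine hφ _ _ _ ?_
    rwa [degree_embDomain] at hn⟩

theorem yD_incl {i : Y'} (hi : i ∉ Set.range iY) (φ : Fock U Y B k) :
    yD i (incl iY iB hk φ) = 0 := Fock.ext_coeff fun S β n => by
  rw [coeff_yD, Fock.coeff_zero]
  by_contra hne
  obtain ⟨-, -, n', hn'⟩ := exists_of_coeff_incl_ne_zero iY iB hk (right_ne_zero_of_smul hne)
  have := DFunLike.congr_fun hn' i
  rw [Finsupp.embDomain_of_notMem_range _ _ _ hi] at this
  simp at this

theorem aD_incl {i : B'} (hi : i ∉ Set.range iB) (φ : Fock U Y B k) :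
    aD i (incl iY iB hk φ) = 0 := Fock.ext_coeff fun S β n => by
  rw [coeff_aD, Fock.coeff_zero]
  by_contra hne
  obtain ⟨-, ⟨β', hβ'⟩, -⟩ := exists_of_coeff_incl_ne_zero iY iB hk (right_ne_zero_of_smul hne)
  have := DFunLike.congr_fun hβ' i
  rw [Finsupp.embDomain_of_notMem_range _ _ _ hi] at this
  simp at this

theorem gD_incl {j : ℕ} (hj : k ≤ j) (φ : Fock U Y B k) :
    gD j (incl iY iB hk φ) = 0 := Fock.ext_coeff fun S β n => by
  rw [coeff_gD, Fock.coeff_zero]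
  split_ifs with h h'
  · rfl
  · by_contra hne
    obtain ⟨⟨S', hS'⟩, -⟩ := exists_of_coeff_incl_ne_zero iY iB hk (right_ne_zero_of_smul hne)
    have := Finset.mem_insert_self (⟨j, h⟩ : Fin k') S
    rw [← hS'] at this
    obtain ⟨a, -, ha⟩ := Finset.mem_map.1 this
    have h1 := congrArg Fin.val ha
    simp only [Fin.castLEEmb_apply, Fin.val_castLE] at h1
    have := a.2
    lia
  · rfl

section Intertwining

variable (φ : Fock U Y' B' k')

theorem res_fnM (f : SmoothFn U) : res iY iB hk (fnM f φ) = fnM f (res iY iB hk φ) :=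
  (res iY iB hk).map_smul f φ

theorem res_real_smul (c : ℝ) : res iY iB hk (c • φ) = c • res iY iB hk φ :=
  Fock.ext_coeff fun S β n => by simp only [coeff_res, Fock.coeff_real_smul]

theorem res_xD (m : Fin d) : res iY iB hk (xD m φ) = xD m (res iY iB hk φ) :=
  Fock.ext_coeff fun S β n => by simp only [coeff_res, coeff_xD]

theorem res_yD (i : Y) : res iY iB hk (yD (iY i) φ) = yD i (res iY iB hk φ) :=
  Fock.ext_coeff fun S β n => by
    simp only [coeff_res, coeff_yD, Finsupp.embDomain_add, Finsupp.embDomain_single,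
      Finsupp.embDomain_apply_self]

theorem res_aD (i : B) : res iY iB hk (aD (iB i) φ) = aD i (res iY iB hk φ) :=
  Fock.ext_coeff fun S β n => by
    simp only [coeff_res, coeff_aD, Finsupp.embDomain_add, Finsupp.embDomain_single,
      Finsupp.embDomain_apply_self]

theorem embDomain_sub_single {ι ι' : Type*} (f : ι ↪ ι') (n : ι →₀ ℕ) (i : ι) :
    (n - Finsupp.single i 1).embDomain f = n.embDomain f - Finsupp.single (f i) 1 := by
  classical
  ext j
  by_cases h : j ∈ Set.range f
  · obtain ⟨j, rfl⟩ := h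
    simp [Finsupp.single_apply]
  · rw [Finsupp.embDomain_of_notMem_range _ _ _ h, Finsupp.tsub_apply,
      Finsupp.embDomain_of_notMem_range _ _ _ h, zero_tsub]

theorem res_yM (i : Y) : res iY iB hk (yM (iY i) φ) = yM i (res iY iB hk φ) :=
  Fock.ext_coeff fun S β n => by
    simp only [coeff_res, coeff_yM, embDomain_sub_single, Finsupp.embDomain_apply_self]

theorem res_aM (i : B) : res iY iB hk (aM (iB i) φ) = aM i (res iY iB hk φ) :=
  Fock.ext_coeff fun S β n => by
    simp only [coeff_res, coeff_aM, embDomain_sub_single, Finsupp.embDomain_apply_self]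

theorem res_yM_of_notMem {i : Y'} (hi : i ∉ Set.range iY) : res iY iB hk (yM i φ) = 0 :=
  Fock.ext_coeff fun S β n => by
    rw [coeff_res, coeff_yM, Finsupp.embDomain_of_notMem_range _ _ _ hi, if_pos rfl]; rfl

theorem res_aM_of_notMem {i : B'} (hi : i ∉ Set.range iB) : res iY iB hk (aM i φ) = 0 :=
  Fock.ext_coeff fun S β n => by
    rw [coeff_res, coeff_aM, Finsupp.embDomain_of_notMem_range _ _ _ hi, if_pos rfl]; rfl

theorem ghSign_map (j : ℕ) (S : Finset (Fin k)) :
    ghSign j (S.map (Fin.castLEEmb hk)) = ghSign j S := by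
  rw [ghSign, ghSign, Finset.filter_map, Finset.card_map]
  rfl

theorem res_gM {j : ℕ} (hj : j < k) : res iY iB hk (gM j φ) = gM j (res iY iB hk φ) :=
  Fock.ext_coeff fun S β n => by
    have e : (⟨j, hj.trans_le hk⟩ : Fin k') = Fin.castLEEmb hk ⟨j, hj⟩ := rfl
    simp only [coeff_res, coeff_gM, hj, hj.trans_le hk, dif_pos, ghSign_map, e, Finset.mem_map',
      ← Finset.map_erase]

theorem res_gD {j : ℕ} (hj : j < k) : res iY iB hk (gD j φ) = gD j (res iY iB hk φ) :=
  Fock.ext_coeff fun S β n => by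
    have e : (⟨j, hj.trans_le hk⟩ : Fin k') = Fin.castLEEmb hk ⟨j, hj⟩ := rfl
    simp only [coeff_res, coeff_gD, hj, hj.trans_le hk, dif_pos, ghSign_map, e, Finset.mem_map',
      ← Finset.map_insert]

theorem res_gM_of_le {j : ℕ} (hj : k ≤ j) : res iY iB hk (gM j φ) = 0 :=
  Fock.ext_coeff fun S β n => by
    rw [coeff_res, coeff_gM]
    split_ifs with h h'
    · obtain ⟨a, -, ha⟩ := Finset.mem_map.1 h'
      have := congrArg Fin.val ha
      simp at this
      have := a.2
      lia
    · rfl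
    · rfl

end Intertwining

end Restriction

/-! ### Contractions whose Laplacian is a number operator. -/

section DiagonalContraction

variable {d : ℕ} {U : TopologicalSpace.Opens (Fin d → ℝ)} {Y Y' B B' : Type} {k k' : ℕ}

local notation "𝓔" => Module.End ℝ (Fock U Y B k)

/-- An operator commuting with functions of `x`, as a linear map over these functions. -/
def FnLinear.toLinear {A : Module.End ℝ (Fock U Y B k)} (h : FnLinear A) :
    Fock U Y B k →ₗ[SmoothFn U] Fock U Y B k where
  toFun := A
  map_add' := A.map_add
  map_smul' := h.map_smul

theorem fdiag_mul (w : Weight Y B) (f g : ℤ → ℝ) :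
    (fdiag w f * fdiag w g : 𝓔) = fdiag w fun x => f x * g x :=
  LinearMap.ext fun φ => Fock.ext_coeff fun S β n => by
    simp only [Module.End.mul_apply, coeff_fdiag, mul_smul]

theorem fdiag_add (w : Weight Y B) (f g : ℤ → ℝ) :
    (fdiag w f + fdiag w g : 𝓔) = fdiag w fun x => f x + g x :=
  LinearMap.ext fun φ => Fock.ext_coeff fun S β n => by
    simp only [LinearMap.add_apply, Fock.coeff_add, coeff_fdiag, add_smul]

theorem fdiag_one (w : Weight Y B) : (fdiag w fun _ => 1 : 𝓔) = 1 :=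
  LinearMap.ext fun φ => Fock.ext_coeff fun S β n => by
    simp only [coeff_fdiag, one_smul, Module.End.one_apply]

theorem fdiag_zero (w : Weight Y B) : (fdiag w fun _ => 0 : 𝓔) = 0 :=
  LinearMap.ext fun φ => Fock.ext_coeff fun S β n => by
    rw [coeff_fdiag, zero_smul]; rfl

/-- If `δη + ηδ` is diagonal with the weight as eigenvalue, dividing `η` by the weight gives a
homotopy whose Laplacian is the projector to nonzero weight. Its complement, weight zero, is the
space `E`. -/
theorem Contraction.of_diagonal {E : Type} [AddCommGroup E] [Module (SmoothFn U) E] [Module ℝ E]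
    [IsScalarTower ℝ (SmoothFn U) E] {ι : E →ₗ[SmoothFn U] Fock U Y B k}
    {π : Fock U Y B k →ₗ[SmoothFn U] E} {w : Weight Y B} {δ η : Module.End ℝ (Fock U Y B k)}
    (lδ : FnLinear δ) (lη : FnLinear (η * AdSHigherSpin.fdiag w fun x => (x : ℝ)⁻¹))
    (hπ : ∀ φ, π (ι φ) = φ)
    (hι : ∀ φ, ι (π φ) = AdSHigherSpin.fdiag w (fun x => if x = 0 then 1 else 0) φ)
    (hδι : ∀ φ, δ (ι φ) = 0) (hδ : δ * δ = 0) (hη : η * η = 0) (h : δ * η + η * δ = AdSHigherSpin.fdiag w fun x => (x : ℝ))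
    (wδ : Hom w 0 δ) (wη : Hom w 0 η) (gδ : Hom ghWeight 1 δ) (gη : Hom ghWeight (-1) η) :
    Contraction ghostNumber ι π lδ.toLinear lη.toLinear := by
  have cδ : ∀ f, fdiag w f * δ = δ * fdiag w f := fun f => by simpa using wδ f
  have cη : ∀ f, fdiag w f * η = η * fdiag w f := fun f => by simpa using wη f
  set I : 𝓔 := AdSHigherSpin.fdiag w fun x => (x : ℝ)⁻¹ with hI
  set P : 𝓔 := AdSHigherSpin.fdiag w fun x => if x = 0 then 1 else 0 with hP
  -- The convention `0⁻¹ = 0` makes the normalized homotopy vanish on weight zero, which yields the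
  -- side conditions of a contraction.
  have hPI : P * I = 0 := by
    rw [hP, hI, fdiag_mul, ← fdiag_zero w]
    congr 1; funext x; split_ifs with hx <;> simp [hx]
  have hIP : I * P = 0 := by
    rw [hP, hI, fdiag_mul, ← fdiag_zero w]
    congr 1; funext x; split_ifs with hx <;> simp [hx]
  have decomp : P + δ * (η * I) + η * I * δ = 1 := by
    rw [mul_assoc η I, cδ, ← mul_assoc, ← mul_assoc, add_assoc, ← add_mul, h, hP, hI, fdiag_mul,
      fdiag_add, ← fdiag_one w]
    congr 1; funext x; split_ifs with hx <;> simp [hx]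
  have ηη : η * I * (η * I) = 0 := by
    rw [mul_assoc, ← mul_assoc I, cη, mul_assoc, ← mul_assoc, hη, zero_mul]
  have ηP : η * I * P = 0 := by rw [mul_assoc, hIP, mul_zero]
  have Pη : P * (η * I) = 0 := by rw [← mul_assoc, cη, mul_assoc, hPI, mul_zero]
  have δP : δ * P = 0 := LinearMap.ext fun φ => by
    rw [Module.End.mul_apply, ← hι, hδι]; rfl
  have δηδ : δ * (η * I * δ) = δ := by
    have := congrArg (δ * ·) decomp
    simpa only [mul_add, δP, ← mul_assoc δ δ, hδ, zero_mul, zero_add, mul_one] using this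
  have hπP : ∀ φ, π (P φ) = π φ := fun φ => by rw [← hι, hπ]
  have hPι : ∀ φ, P (ι φ) = ι φ := fun φ => by rw [← hι, hπ]
  refine ⟨hπ, fun φ => ?_, fun φ => LinearMap.congr_fun hδ φ, fun φ => LinearMap.congr_fun ηη φ,
    fun φ => ?_, fun φ => ?_, fun φ => ?_, fun φ => ?_, fun φ => ?_, fun φ => ?_⟩
  · rw [hι]; exact LinearMap.congr_fun decomp φ
  · have : η * I * (δ * (η * I)) = η * I := by
      have := congrArg (η * I * ·) decomp
      simpa only [mul_add, ηP, ← mul_assoc (η * I) (η * I), ηη, zero_mul, add_zero, zero_add,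
        mul_one] using this
    exact LinearMap.congr_fun this φ
  · exact LinearMap.congr_fun δηδ φ
  · have := LinearMap.congr_fun ηP (ι φ)
    rw [Module.End.mul_apply, hPι] at this
    exact this
  · have := LinearMap.congr_fun Pη φ
    change π ((η * I) φ) = 0
    rw [← hπP, ← Module.End.mul_apply, this]; simp
  · have := LinearMap.congr_fun gδ.ghost_comm φ
    simp at this
    exact sub_eq_iff_eq_add'.1 this
  · have := LinearMap.congr_fun (gη.mul (Hom.fdiag ghWeight w fun x => (x : ℝ)⁻¹) (add_zero (-1))).ghost_comm φ
    simp at this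
    exact (sub_eq_iff_eq_add'.1 this).trans (sub_eq_add_neg _ _).symm

/-- The recorded properties of the lift `K` suffice to find the reduced operator without summing the
series: weights of `φ` are inherited by `K φ`, and `Ω K φ` is again a lift. The weights `w₁`, `w₂`
play the two roles required by `exists_equiv_sub`. -/
theorem Contraction.exists_lift [Finite B] {E : Type} [AddCommGroup E] [Module (SmoothFn U) E]
    [Module ℝ E] [IsScalarTower ℝ (SmoothFn U) E] {ι : E →ₗ[SmoothFn U] Fock U Y B k}
    {π : Fock U Y B k →ₗ[SmoothFn U] E} {δ η Ω : Module.End ℝ (Fock U Y B k)}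
    {lδ : FnLinear δ} {lη : FnLinear η}
    (hC : Contraction ghostNumber ι π lδ.toLinear lη.toLinear) {fE : ℕ → Submodule (SmoothFn U) E}
    (hι : FilContinuous fE fil (ι.restrictScalars ℝ))
    (hπ : FilContinuous fil fE (π.restrictScalars ℝ))
    (tδ : Tame 1 δ) (tη : Tame (-1) η) (tΩ : Tame 1 Ω) {w₁ w₂ : Weight Y B} {c : ℕ}
    (h₁ : HasDeg w₁ 1 (η * (Ω - δ))) (ha : ∀ i, w₁.a i = 0) (hy : ∀ i, 0 ≤ w₁.y i)
    (hyc : ∀ i, w₁.y i ≤ c) (h₂ : HasDeg w₂ 0 (η * (Ω - δ))) (hy₂ : ∀ i, w₂.y i = 0)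
    (ha₂ : ∀ i, w₂.a i ≤ -1) :
    ∃ K : E →ₗ[ℝ] Fock U Y B k, (∀ φ, π (K φ) = φ) ∧
      (∀ w, HasDeg w 0 (η * (Ω - δ)) → ∀ φ, ι φ ∈ wtFil w 0 → K φ ∈ wtFil w 0) ∧
      (Ω * Ω = 0 → ∀ φ, Ω (K φ) = K (π (Ω (K φ)))) ∧
      ∀ Ω' : Module.End ℝ E, (∀ φ, Ω' φ = π (Ω (K φ))) →
        ConsistentReduction fil ghostNumber Ω fE ι Ω' ∧ (Ω * Ω = 0 → Ω' * Ω' = 0) := by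
  -- The lift inverts `1 + η(Ω - δ)`, whereas the series inverts `1 - T`; hence the sign.
  have tT : Tame 0 (-(η * (Ω - δ))) := (tη.mul (tΩ.sub tδ) rfl).neg
  obtain ⟨L, hL, hLi, hw⟩ := exists_equiv_sub tT.hasDeg.choose_spec.filContinuous tT.finOrder
    h₁.neg ha hy hyc h₂.neg hy₂ ha₂
  have hL' : ∀ φ, L φ = φ + lη.toLinear (Ω φ - lδ.toLinear φ) := fun φ => by
    rw [hL, LinearMap.neg_apply, sub_neg_eq_add]; rfl
  refine ⟨reductionLift Ω ι lη.toLinear L, hC.π_lift hL', fun w hT φ hφ => ?_,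
    hC.Ω_lift hL', fun Ω' hΩ' => ⟨hC.consistentReduction hL' hι hπ
      tδ.hasDeg.choose_spec.filContinuous tη.hasDeg.choose_spec.filContinuous hLi hΩ',
      fun hΩ => hC.nilpotent hL' hΩ hΩ'⟩⟩
  rw [reductionLift_apply]
  -- By the decomposition, `ηδι = 0`, so `ηΩι` may be replaced by the perturbation, whose degree is
  -- controlled.
  have h0 : lη.toLinear (Ω (ι φ)) = (η * (Ω - δ)) (ι φ) := by
    have h := hC.decomp (ι φ)
    rw [hC.π_ι, hC.η_ι, map_zero, add_zero] at h
    have h' : lη.toLinear (lδ.toLinear (ι φ)) = 0 := by simpa using h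
    change _ = lη.toLinear (Ω (ι φ) - lδ.toLinear (ι φ))
    rw [map_sub, h', sub_zero]
  rw [h0]
  have h1 := hT 0 _ hφ
  rw [add_zero] at h1
  exact Submodule.sub_mem _ hφ (hw w 0 hT.neg _ h1)

end DiagonalContraction

end AdSHigherSpin

end

noncomputable section
namespace AdSHigherSpin

set_option linter.unusedSimpArgs false

/-! ### The Koszul complex and its homotopy. -/

section Koszul

variable {R : Type*} [Ring R] [Algebra ℝ R] {κ : Type} [Fintype κ] [DecidableEq κ]

/-- Anticommuting variables `P` with derivatives `Q`, and commuting variables `y` with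
derivatives `D`. -/
structure KoszulPairs (P Q y D : κ → R) : Prop where
  P_P : ∀ i j, P i * P j = -(P j * P i)
  Q_Q : ∀ i j, Q i * Q j = -(Q j * Q i)
  Q_P : ∀ i j, Q i * P j = (if i = j then 1 else 0) - P j * Q i
  D_y : ∀ i j, D i * y j = y j * D i + if i = j then 1 else 0
  y_y : ∀ i j, Commute (y i) (y j)
  D_D : ∀ i j, Commute (D i) (D j)
  y_P : ∀ i j, Commute (y i) (P j)
  y_Q : ∀ i j, Commute (y i) (Q j)
  D_P : ∀ i j, Commute (D i) (P j)
  D_Q : ∀ i j, Commute (D i) (Q j)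

theorem eq_zero_of_eq_neg {x : R} (h : x = -x) : x = 0 := by
  have h4 : (2 : ℝ) • x = 0 := by rw [two_smul]; nth_rewrite 1 [h]; rw [neg_add_cancel]
  exact (smul_eq_zero.1 h4).resolve_left two_ne_zero

theorem sum_mul_sum_eq_zero {P D : κ → R} (hP : ∀ i j, P i * P j = -(P j * P i))
    (hD : ∀ i j, Commute (D i) (D j)) (hDP : ∀ i j, Commute (D i) (P j)) :
    (∑ i, P i * D i) * ∑ i, P i * D i = 0 := by
  have h2 : (∑ i, P i * D i) * ∑ i, P i * D i = ∑ i, ∑ j, P i * P j * (D i * D j) := by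
    rw [Finset.sum_mul_sum]
    refine Finset.sum_congr rfl fun i _ => Finset.sum_congr rfl fun j _ => ?_
    rw [mul_assoc, ← mul_assoc (D i), (hDP i j).eq]
    simp only [mul_assoc]
  refine eq_zero_of_eq_neg ?_
  rw [h2, ← Finset.sum_neg_distrib]
  conv_rhs => simp only [← Finset.sum_neg_distrib]
  rw [Finset.sum_comm]
  refine Finset.sum_congr rfl fun i _ => Finset.sum_congr rfl fun j _ => ?_
  rw [hP, (hD j i).eq, neg_mul]

namespace KoszulPairs

variable {P Q y D : κ → R} (H : KoszulPairs P Q y D)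
include H

theorem differential_sq : (∑ i, P i * D i) * ∑ i, P i * D i = 0 :=
  sum_mul_sum_eq_zero H.P_P H.D_D H.D_P

theorem homotopy_sq : (∑ i, y i * Q i) * ∑ i, y i * Q i = 0 := by
  simp only [(H.y_Q _ _).eq]
  exact sum_mul_sum_eq_zero H.Q_Q H.y_y H.y_Q

/-- The mixed terms `y_j P_i Q_j D_i` cancel between the two orders, and the canonical relations
leave the Euler operator counting `P` and `y`. -/
theorem anticommutator : (∑ i, P i * D i) * (∑ i, y i * Q i) + (∑ i, y i * Q i) * (∑ i, P i * D i) =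
    ∑ i, P i * Q i + ∑ i, y i * D i := by
  have h : ∀ i j, P i * D i * (y j * Q j) + y j * Q j * (P i * D i) =
      (if i = j then P i * Q j else 0) + if j = i then y j * D i else 0 := by
    intro i j
    have h1 : P i * D i * (y j * Q j) =
        y j * (P i * Q j * D i) + P i * ((if i = j then 1 else 0) * Q j) := by
      rw [mul_assoc, ← mul_assoc (D i), H.D_y, add_mul, mul_add, mul_assoc (y j), (H.D_Q i j).eq,
        ← mul_assoc (P i), ← (H.y_P j i).eq]
      simp only [mul_assoc]
    have h2 : y j * Q j * (P i * D i) =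
        y j * ((if j = i then 1 else 0) * D i) - y j * (P i * Q j * D i) := by
      rw [mul_assoc, ← mul_assoc (Q j), H.Q_P, sub_mul, mul_sub]
    rw [h1, h2]
    simp only [ite_mul, one_mul, zero_mul, mul_ite, mul_zero]
    abel
  rw [Finset.sum_mul_sum, Finset.sum_mul_sum, Finset.sum_comm, ← Finset.sum_add_distrib]
  simp only [← Finset.sum_add_distrib]
  rw [Finset.sum_comm]
  simp only [h, Finset.sum_add_distrib, Finset.sum_ite_eq, Finset.sum_ite_eq', Finset.mem_univ,
    if_true]

end KoszulPairs

end Koszul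

/-! ### Number operators as weights, and absence of ghosts from weight bounds. -/

section NumberOperator

variable {d : ℕ} {U : TopologicalSpace.Opens (Fin d → ℝ)} {Y B : Type} {k : ℕ}

local notation "𝓔" => Module.End ℝ (Fock U Y B k)

theorem number_operator_eq_fdiag [Fintype Y] [Fintype B] (w : Weight Y B) :
    (∑ j ∈ Finset.range k, (w.g j : ℝ) • (gM j * gD j) + ∑ i, (w.a i : ℝ) • (aM i * aD i) +
      ∑ i, (w.y i : ℝ) • (yM i * yD i) : 𝓔) = fdiag w fun x => (x : ℝ) := by
  refine LinearMap.ext fun φ => Fock.ext_coeff fun S β n => ?_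
  simp only [LinearMap.add_apply, LinearMap.sum_apply, LinearMap.smul_apply, Fock.coeff_add,
    Fock.coeff_sum, Fock.coeff_real_smul, coeff_aM_aD, coeff_yM_yD, coeff_fdiag, Weight.eval]
  rw [Finset.sum_range]
  simp only [coeff_gM_gD (Fin.is_lt _), Fin.eta, smul_ite, smul_zero, Finset.sum_ite_mem,
    Finset.univ_inter, smul_smul, ← Finset.sum_smul, ← add_smul]
  congr 1
  rw [Finsupp.sum_fintype _ _ (by simp), Finsupp.sum_fintype _ _ (by simp)]
  push_cast
  simp only [mul_comm]

theorem eq_zero_of_mem_wtFil {w : Weight Y B} (hw : ∀ (S : Finset (Fin k)) β n, w.eval S β n ≤ 0)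
    {φ : Fock U Y B k} (h : φ ∈ wtFil w 1) : φ = 0 :=
  Fock.ext_coeff fun S β n => h S β n (by have := hw S β n; lia)

/-- All weights are nonpositive, so weight at least `0` means that no ghost of negative weight
occurs. In the proof, removing such a ghost would give weight at least `1`, which no monomial has.
-/
theorem gD_eq_zero_of_mem_wtFil {w : Weight Y B} (hg : ∀ j, w.g j ≤ 0) (ha : ∀ i, w.a i = 0)
    (hy : ∀ i, w.y i = 0) {j : ℕ} (hj : w.g j ≤ -1) {φ : Fock U Y B k} (h : φ ∈ wtFil w 0) :
    gD j φ = 0 := by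
  refine eq_zero_of_mem_wtFil (w := w) (fun S β n => ?_)
    (((HasDeg.gD w j).mono (r' := 1) (by lia)) 0 φ h)
  simpa [Weight.eval, ha, hy] using Finset.sum_nonpos fun h _ => hg _

end NumberOperator

/-! ### The operator `σ` as a Koszul differential. -/

section ParentKoszul

variable {d : ℕ} {l : ℝ} {U : TopologicalSpace.Opens (Fin d → ℝ)} (F : AdSFrame l U)

local notation "𝓔" => Module.End ℝ (ParentStates U)

/-- The ghosts `-θ^m e_m^a`. -/
def thetaForm (a : Fin d) : Module.End ℝ (ParentStates U) :=
  -∑ m : Fin d, fnM (F.e m a) * gM (6 + m.val)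

/-- The derivatives `-e_a^m ∂/∂θ^m`. -/
def thetaDer (a : Fin d) : Module.End ℝ (ParentStates U) :=
  -∑ m : Fin d, fnM (F.einv a m) * gD (6 + m.val)

theorem anticomm_of_sum {p : Fin d → Module.End ℝ (ParentStates U)} {f g : Fin d → SmoothFn U}
    (lp : ∀ m, FnLinear (p m)) (hp : ∀ m n, p m * p n = -(p n * p m)) :
    (∑ m, fnM (f m) * p m) * (∑ m, fnM (g m) * p m) =
      -((∑ m, fnM (g m) * p m) * (∑ m, fnM (f m) * p m)) := by
  rw [Finset.sum_mul_sum, Finset.sum_mul_sum, Finset.sum_comm, ← Finset.sum_neg_distrib]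
  refine Finset.sum_congr rfl fun m _ => ?_
  rw [← Finset.sum_neg_distrib]
  refine Finset.sum_congr rfl fun n _ => ?_
  have h3 : Commute (fnM (f n) : 𝓔) (fnM (g m)) := FnLinear.fnM _ _
  rw [mul_assoc, (lp n (g m)).left_comm, hp, mul_assoc (fnM (g m)), (lp m (f n)).left_comm,
    mul_neg, mul_neg, h3.left_comm]

theorem thetaDer_mul_thetaForm (i j : Fin d) : thetaDer F i * thetaForm F j =
    (if i = j then 1 else 0) - thetaForm F j * thetaDer F i := by
  have h : ∀ m n : Fin d, (fnM (F.einv i m) * gD (6 + m.val) * (fnM (F.e n j) * gM (6 + n.val)) :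
      𝓔) = (if m = n then fnM (F.einv i m * F.e n j) else 0) -
        fnM (F.e n j) * gM (6 + n.val) * (fnM (F.einv i m) * gD (6 + m.val)) := by
    intro m n
    have h1 : Commute (gD (6 + m.val) : 𝓔) (fnM (F.e n j)) := FnLinear.gD _ _
    have h2 : Commute (gM (6 + n.val) : 𝓔) (fnM (F.einv i m)) := FnLinear.gM _ _
    have h3 : Commute (fnM (F.einv i m) : 𝓔) (fnM (F.e n j)) := FnLinear.fnM _ _
    rw [mul_assoc, h1.left_comm, mul_assoc (fnM (F.e n j)), h2.left_comm, fnM_mul]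
    split_ifs with hmn
    · subst hmn
      rw [gD_mul_gM_self (by lia), mul_sub, mul_sub, mul_one, h3.left_comm]
    · rw [gD_mul_gM_of_ne (by intro h; exact hmn (Fin.ext (by lia))), mul_neg, mul_neg,
        h3.left_comm, zero_sub]
  simp only [thetaDer, thetaForm, neg_mul_neg, Finset.sum_mul_sum, h, Finset.sum_sub_distrib,
    Finset.sum_ite_eq, Finset.mem_univ, if_true]
  rw [← fnM_sum, F.einv_e]
  congr 1
  · split_ifs
    · exact fnM_one
    · exact fnM_zero
  · exact Finset.sum_comm

theorem commute_thetaForm {X : Module.End ℝ (ParentStates U)} (lX : FnLinear X) (bX : Bosonic X)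
    (a : Fin d) : Commute X (thetaForm F a) := (Commute.sum_right _ _ _ fun m _ =>
  (lX _).mul_right (bX (6 + m.val)).1).neg_right

theorem commute_thetaDer {X : Module.End ℝ (ParentStates U)} (lX : FnLinear X) (bX : Bosonic X)
    (a : Fin d) : Commute X (thetaDer F a) := (Commute.sum_right _ _ _ fun m _ =>
  (lX _).mul_right (bX (6 + m.val)).2).neg_right

/-- In the frame basis `σ` pairs each `Y^a` with the ghost `-θ^m e_m^a`. Invertibility of the
vielbein makes `-e_a^m ∂/∂θ^m` the dual derivatives; the coefficients are functions of `x`, with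
which ghosts and `Y` commute. -/
theorem parent_koszulPairs : KoszulPairs (thetaForm F) (thetaDer F)
    (fun a => yM a.castSucc) (fun a => yD a.castSucc) where
  P_P i j := by
    rw [thetaForm, thetaForm, neg_mul_neg, neg_mul_neg]
    exact anticomm_of_sum (fun m => .gM _) fun m n => gM_anticomm _ _
  Q_Q i j := by
    rw [thetaDer, thetaDer, neg_mul_neg, neg_mul_neg]
    exact anticomm_of_sum (fun m => .gD _) fun m n => gD_anticomm _ _
  Q_P := thetaDer_mul_thetaForm F
  D_y i j := by rw [yD_mul_yM]; simp only [Fin.castSucc_inj]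
  y_y i j := yM_comm _ _
  D_D i j := yD_comm _ _
  y_P i j := commute_thetaForm F (.yM _) (.yM _) j
  y_Q i j := commute_thetaDer F (.yM _) (.yM _) j
  D_P i j := commute_thetaForm F (.yD _) (.yD _) j
  D_Q i j := commute_thetaDer F (.yD _) (.yD _) j

theorem sum_thetaForm_mul_thetaDer : ∑ a, thetaForm F a * thetaDer F a =
    ∑ m : Fin d, gM (6 + m.val) * gD (6 + m.val) := by
  have h : ∀ a m n, fnM (F.e m a) * gM (6 + m.val) * (fnM (F.einv a n) * gD (6 + n.val)) =
      fnM (F.e m a * F.einv a n) * (gM (6 + m.val) * gD (6 + n.val) : 𝓔) := fun a m n => by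
    have h1 : Commute (gM (6 + m.val) : 𝓔) (fnM (F.einv a n)) := FnLinear.gM _ _
    rw [mul_assoc, h1.left_comm, fnM_mul, mul_assoc]
  simp only [thetaForm, thetaDer, neg_mul_neg, Finset.sum_mul_sum, h]
  rw [Finset.sum_comm]
  refine Finset.sum_congr rfl fun m _ => ?_
  rw [Finset.sum_comm]
  simp only [← Finset.sum_mul, ← fnM_sum, F.e_einv]
  rw [Finset.sum_eq_single m (fun n _ hn => by rw [if_neg hn.symm, fnM_zero, zero_mul]) (by simp),
    if_pos rfl, fnM_one, one_mul]

theorem parentSigma_eq : parentSigma F = ∑ a : Fin d, thetaForm F a * yD a.castSucc := by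
  simp only [parentSigma, thetaForm, neg_mul, Finset.sum_neg_distrib, Finset.sum_mul, fn_smul_eq,
    mul_assoc]
  rw [Finset.sum_comm]

/-- The homotopy `-Y^a e_a^m ∂/∂θ^m`. -/
def parentHomotopy : Module.End ℝ (ParentStates U) :=
  ∑ a : Fin d, yM a.castSucc * thetaDer F a

/-- The weight counting the variables `Y^a` and `θ^m`. -/
def thetaWeight {d : ℕ} : Weight (Fin (d + 1)) (Fin (d + 1)) :=
  ⟨fun j => if 6 ≤ j then 1 else 0, fun _ => 0, fun i => if i = Fin.last d then 0 else 1⟩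

theorem parentSigma_anticommutator : parentSigma F * parentHomotopy F +
    parentHomotopy F * parentSigma F = fdiag thetaWeight fun x => (x : ℝ) := by
  rw [parentSigma_eq, parentHomotopy, (parent_koszulPairs F).anticommutator,
    sum_thetaForm_mul_thetaDer, ← number_operator_eq_fdiag]
  have h1 : ∀ j ∈ Finset.range 6, (((thetaWeight (d := d)).g j : ℤ) : ℝ) •
      (gM j * gD j : 𝓔) = 0 := fun j hj => by
    have : ¬ 6 ≤ j := by simpa using hj
    simp [thetaWeight, this]
  rw [Finset.sum_range_add, Finset.sum_eq_zero h1, zero_add, Finset.sum_range,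
    Fin.sum_univ_castSucc (f := fun i => (((thetaWeight (d := d)).y i : ℤ) : ℝ) •
      (yM i * yD i : 𝓔))]
  simp [thetaWeight, Fin.castSucc_ne_last]

end ParentKoszul

end AdSHigherSpin

end

noncomputable section
namespace AdSHigherSpin

set_option linter.unusedSimpArgs false

/-! ### The operators of the intermediate system. -/

section AmbientOperators

variable {d : ℕ} {l : ℝ} {U : TopologicalSpace.Opens (Fin d → ℝ)} (F : AdSFrame l U)

local notation "𝓔" => Module.End ℝ (AmbientStates U)

theorem one_add_zM_eq_coefM : (1 + zM l : 𝓔) = coefM (1 + l⁻¹ • MvPowerSeries.X ()) := by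
  rw [coefM_add, coefM_one, coefM_real_smul]; rfl

theorem one_add_zM_mul_zInv : (1 + zM l : 𝓔) * zInv l = 1 := by
  rw [one_add_zM_eq_coefM, zInv, ← coefM_mul, MvPowerSeries.mul_invOfUnit, coefM_one]
  simp

theorem zInv_mul_one_add_zM : zInv l * (1 + zM l : 𝓔) = 1 := by
  rw [one_add_zM_eq_coefM, zInv, (coefM_comm _ _).eq, ← coefM_mul, MvPowerSeries.mul_invOfUnit,
    coefM_one]
  simp

theorem commute_zInv {X : Module.End ℝ (AmbientStates U)} (h : Commute X (zM l)) :
    Commute X (zInv l) := by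
  have h1 : Commute X (1 + zM l) := (Commute.one_right X).add_right h
  have := congrArg (fun A => zInv l * A * zInv l) h1.eq
  simp only [mul_assoc, one_add_zM_mul_zInv, mul_one] at this
  simp only [← mul_assoc, zInv_mul_one_add_zM, one_mul] at this
  exact this.symm

theorem ambientD_commute_zM (a : Fin d) : Commute (ambientD F a) (zM l) := by
  refine (Commute.sub_left (Commute.sum_left _ _ _ fun m _ => ?_) (Commute.sum_left _ _ _
    fun m _ => Commute.sum_left _ _ _ fun C _ => Commute.sum_left _ _ _ fun D _ => ?_)).smul_right _
  · have h1 : Commute (fnM (F.einv a m) : Module.End ℝ (AmbientStates U)) (yM ()) :=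
      (FnLinear.yM _ _).symm
    have h2 : Commute (xD m : Module.End ℝ (AmbientStates U)) (yM ()) := (yM_comm_xD _ _).symm
    rw [fn_smul_eq]
    exact Commute.mul_left h1 h2
  · have h1 : Commute (fnM (F.einv a m * F.W m D C) : Module.End ℝ (AmbientStates U)) (yM ()) :=
      (FnLinear.yM _ _).symm
    have h2 : Commute (aM C : Module.End ℝ (AmbientStates U)) (yM ()) := aM_comm_yM _ _
    have h3 : Commute (aD D : Module.End ℝ (AmbientStates U)) (yM ()) := aD_comm_yM _ _
    rw [fn_smul_eq]
    exact Commute.mul_left h1 (Commute.mul_left h2 h3)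

theorem ambientD_commute_zInv (a : Fin d) : Commute (ambientD F a) (zInv l) :=
  commute_zInv (ambientD_commute_zM F a)

theorem ambientD_tame (a : Fin d) : Tame 0 (ambientD F a) :=
  (Tame.sum fun m _ => .fn_smul _ (.xD m)).sub (.sum fun _ _ => .sum fun _ _ => .sum fun _ _ =>
    .fn_smul _ ((Tame.aM _).mul₀ (.aD _)))

theorem ambientD_bosonic (a : Fin d) : Bosonic (ambientD F a) :=
  (Bosonic.sum fun m _ => .fn_smul _ (.xD m)).sub (.sum fun _ _ => .sum fun _ _ => .sum fun _ _ =>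
    .fn_smul _ ((Bosonic.aM _).mul (.aD _)))

theorem ambientCharge_tame : Tame 1 (ambientCharge F) := by
  have hz : Tame 0 (zM l : 𝓔) := .real_smul _ (.yM _)
  have hzD : Tame 0 (zD l : 𝓔) := .real_smul _ (.yD _)
  have hw : Tame 0 (wM l : 𝓔) := .real_smul _ (.aM _)
  have hwD : Tame 0 (wD l : 𝓔) := .real_smul _ (.aD _)
  have hi : Tame 0 (zInv l : 𝓔) := .coefM _
  refine .constraintCharge (.sub (.sub ((hi.mul₀ hi).mul₀ (.sum fun a _ => .real_smul _ ?_)) ?_) ?_)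
    (.sub (hi.mul₀ (.sum fun a _ => .real_smul _ ((Tame.aD _).mul₀ (ambientD_tame F a)))) ?_)
    (.add (hi.mul₀ (.sum fun a _ => (Tame.aM _).mul₀ (ambientD_tame F a))) (hw.mul₀ hzD))
    (.sum fun a _ => .real_smul _ ((Tame.aD _).mul₀ (.aD _)))
    ((Tame.sum fun a _ => (Tame.aM _).mul₀ (.aD _)).sub ((Tame.one.add hz).mul₀ hzD))
    ((Tame.one.add hz).mul₀ hwD)
  · exact ((ambientD_tame F a).mul₀ (ambientD_tame F a)).sub
      (.sum fun b _ => .fn_smul _ (ambientD_tame F b))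
  · exact .real_smul _ (hzD.mul₀ hzD)
  · exact .real_smul _ (hi.mul₀ hzD)
  · exact .real_smul _ (hwD.mul₀ hzD)

end AmbientOperators

section RestrictCharge

variable {d : ℕ} {U : TopologicalSpace.Opens (Fin d → ℝ)} {Y Y' B B' : Type} {k k' : ℕ}

/-- All ghosts of the charge survive the restriction, so only the constraints have to be compared,
and only on the one state `φ`: in the application the comparison fails on states that are not
covariantly constant. Since `Sd` stands to the left of `∂/∂b†`, the latter is first moved past it.
-/
theorem res_constraintCharge {iY : Y ↪ Y'} {iB : B ↪ B'} {hk : k ≤ k'} (h6 : 6 ≤ k)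
    {Box S Sd T h Sb : Module.End ℝ (Fock U Y' B' k')}
    {Box₁ S₁ Sd₁ T₁ h₁ Sb₁ : Module.End ℝ (Fock U Y B k)} (bSd : Bosonic Sd) (bSd₁ : Bosonic Sd₁)
    {φ : Fock U Y' B' k'} (eBox : res iY iB hk (Box φ) = Box₁ (res iY iB hk φ))
    (eS : res iY iB hk (S φ) = S₁ (res iY iB hk φ))
    (eSd : res iY iB hk (Sd φ) = Sd₁ (res iY iB hk φ))
    (eT : res iY iB hk (T φ) = T₁ (res iY iB hk φ))
    (eh : res iY iB hk (h φ) = h₁ (res iY iB hk φ))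
    (eSb : res iY iB hk (Sb φ) = Sb₁ (res iY iB hk φ)) :
    res iY iB hk (constraintCharge ghosts Box S Sd T h Sb φ) =
      constraintCharge ghosts Box₁ S₁ Sd₁ T₁ h₁ Sb₁ (res iY iB hk φ) := by
  have e0 : 0 < k := by lia
  have e1 : 1 < k := by lia
  have e2 : 2 < k := by lia
  have e3 : 3 < k := by lia
  have e4 : 4 < k := by lia
  have e5 : 5 < k := by lia
  simp only [constraintCharge, ghosts, two_mul_eq_smul, (bSd 2).2.eq, (bSd₁ 2).2.eq,
    LinearMap.add_apply, LinearMap.sub_apply, LinearMap.smul_apply, Module.End.mul_apply, map_add,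
    map_sub, res_real_smul, res_gM iY iB hk _ e0, res_gM iY iB hk _ e1, res_gM iY iB hk _ e2,
    res_gM iY iB hk _ e3, res_gM iY iB hk _ e4, res_gM iY iB hk _ e5, res_gD iY iB hk _ e0,
    res_gD iY iB hk _ e1, res_gD iY iB hk _ e2, res_gD iY iB hk _ e3, res_gD iY iB hk _ e4,
    res_gD iY iB hk _ e5, eBox, eS, eSd, eT, eh, eSb]

end RestrictCharge

/-! ### Elimination of `Y^a` and `θ^m`: contraction and perturbation. -/

section ParentReduction

variable {d : ℕ} {l : ℝ} {U : TopologicalSpace.Opens (Fin d → ℝ)} (F : AdSFrame l U)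

local notation "𝓔" => Module.End ℝ (ParentStates U)

/-- The component independent of `Y^a` and `θ^m`. -/
def resAmbient (U : TopologicalSpace.Opens (Fin d → ℝ)) :
    ParentStates U →ₗ[SmoothFn U] AmbientStates U :=
  res ⟨fun _ => Fin.last d, fun _ _ _ => rfl⟩ (Function.Embedding.refl _) (Nat.le_add_right 6 d)

theorem thetaDer_tame (a : Fin d) : Tame (-1) (thetaDer F a) :=
  (Tame.sum fun m _ => .fn_smul _ (.gD (by rw [if_neg (by lia)]))).neg

theorem thetaForm_tame (a : Fin d) : Tame 1 (thetaForm F a) :=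
  (Tame.sum fun m _ => .fn_smul _ (.gM (by rw [if_neg (by lia)]))).neg

theorem thetaForm_fnLinear (a : Fin d) : FnLinear (thetaForm F a) :=
  (FnLinear.sum fun m _ => (FnLinear.fnM _).mul (.gM _)).neg

theorem thetaDer_fnLinear (a : Fin d) : FnLinear (thetaDer F a) :=
  (FnLinear.sum fun m _ => (FnLinear.fnM _).mul (.gD _)).neg

theorem parentSigma_fnLinear : FnLinear (parentSigma F) := by
  rw [parentSigma_eq]
  exact .sum fun a _ => (thetaForm_fnLinear F a).mul (.yD _)

theorem parentHomotopy_fnLinear : FnLinear (parentHomotopy F) :=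
  .sum fun a _ => (FnLinear.yM _).mul (thetaDer_fnLinear F a)

theorem parentSigma_tame : Tame 1 (parentSigma F) := by
  rw [parentSigma_eq]
  exact .sum fun a _ => (thetaForm_tame F a).mul (.yD _) rfl

theorem parentHomotopy_tame : Tame (-1) (parentHomotopy F) :=
  .sum fun a _ => (Tame.yM _).mul (thetaDer_tame F a) rfl

theorem parentHomotopy_hom {w : Weight (Fin (d + 1)) (Fin (d + 1))} {υ γ : ℤ}
    (hy : ∀ a : Fin d, w.y a.castSucc = υ) (hγ : ∀ m : Fin d, w.g (6 + m.val) = γ) :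
    Hom w (υ - γ) (parentHomotopy F) := by
  refine .sum fun a _ => (Hom.yM w _).mul (r' := -γ) (.neg (.sum fun m _ => ?_))
    (by rw [hy]; rfl)
  rw [← hγ m]
  exact .fn_smul _ (Hom.gD w _)

theorem parentSigma_hom {w : Weight (Fin (d + 1)) (Fin (d + 1))} {υ γ : ℤ}
    (hy : ∀ a : Fin d, w.y a.castSucc = υ) (hγ : ∀ m : Fin d, w.g (6 + m.val) = γ) :
    Hom w (γ - υ) (parentSigma F) := by
  rw [parentSigma_eq]
  refine .sum fun a _ => Hom.mul (r := γ) (.neg (.sum fun m _ => ?_)) (Hom.yD w _)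
    (by rw [hy]; rfl)
  rw [← hγ m]
  exact .fn_smul _ (Hom.gM w _)

theorem tame_inverse {Y B : Type} {k : ℕ} (w : Weight Y B) (f : ℤ → ℝ) :
    Tame 0 (fdiag w f : Module.End ℝ (Fock U Y B k)) :=
  .of_linear (.fdiag w f) (Hom.fdiag orderWeight w f).hasDeg (.fdiag _ w f)

theorem parentHomotopy_inverse_fnLinear :
    FnLinear (parentHomotopy F * fdiag thetaWeight fun x => (x : ℝ)⁻¹) :=
  (parentHomotopy_fnLinear F).mul (.fdiag _ _)

theorem inclAmbient_resAmbient (φ : ParentStates U) : inclAmbient U (resAmbient U φ) =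
    fdiag thetaWeight (fun x => if x = 0 then 1 else 0) φ := by
  refine incl_res _ _ _ ?_ ?_ ?_ ?_ ?_ ?_ φ
  · intro j hj _; simp [thetaWeight, hj]
  · intro j hj
    have : ¬ 6 ≤ j := by lia
    simp [thetaWeight, this]
  · intro i hi; exact absurd ⟨i, rfl⟩ hi
  · intro i; rfl
  · intro i hi
    have : i ≠ Fin.last d := fun h => hi ⟨(), h.symm⟩
    simp [thetaWeight, this]
  · intro i; exact if_pos rfl

theorem parentSigma_inclAmbient (φ : AmbientStates U) : parentSigma F (inclAmbient U φ) = 0 := by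
  have hr : ∀ a : Fin d, a.castSucc ∉ Set.range (⟨fun _ => Fin.last d, fun _ _ _ => rfl⟩ :
      Unit ↪ Fin (d + 1)) := by
    rintro a ⟨_, h⟩
    exact Fin.castSucc_ne_last a h.symm
  rw [parentSigma_eq, LinearMap.sum_apply]
  refine Finset.sum_eq_zero fun a _ => ?_
  rw [Module.End.mul_apply, inclAmbient, yD_incl _ _ _ (hr a), map_zero]

theorem parentSigma_sq : parentSigma F * parentSigma F = 0 := by
  rw [parentSigma_eq]; exact (parent_koszulPairs F).differential_sq

theorem parentHomotopy_sq : parentHomotopy F * parentHomotopy F = 0 :=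
  (parent_koszulPairs F).homotopy_sq

theorem resAmbient_inclAmbient (φ : AmbientStates U) : resAmbient U (inclAmbient U φ) = φ :=
  res_incl _ _ _ φ

theorem parent_contraction : Contraction ghostNumber (inclAmbient U) (resAmbient U)
    (parentSigma_fnLinear F).toLinear (parentHomotopy_inverse_fnLinear F).toLinear := by
  have hy : ∀ a : Fin d, (thetaWeight (d := d)).y a.castSucc = 1 := fun a => by
    simp [thetaWeight, Fin.castSucc_ne_last]
  have hγ : ∀ m : Fin d, (thetaWeight (d := d)).g (6 + m.val) = 1 := fun m => by
    simp [thetaWeight]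
  have h1 := parentSigma_hom F hy hγ
  have h2 := parentHomotopy_hom F hy hγ
  rw [sub_self] at h1 h2
  exact Contraction.of_diagonal (w := thetaWeight) (δ := parentSigma F) (η := parentHomotopy F)
    (ι := inclAmbient U) (π := resAmbient U) (parentSigma_fnLinear F)
    (parentHomotopy_inverse_fnLinear F) resAmbient_inclAmbient inclAmbient_resAmbient
    (parentSigma_inclAmbient F) (parentSigma_sq F) (parentHomotopy_sq F)
    (parentSigma_anticommutator F) h1 h2 (parentSigma_tame F).hom (parentHomotopy_tame F).hom

theorem parentQ_hasDeg {w : Weight (Fin (d + 1)) (Fin (d + 1))} {α υ r : ℤ}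
    (hg : ∀ j < 6, w.g j = 0) (ha : ∀ i, w.a i = α) (hy : ∀ i, w.y i = υ) (hυ : 0 ≤ υ)
    (h1 : r ≤ -2 * υ) (h2 : r ≤ -α - υ) (h3 : r ≤ α - υ) (h4 : r ≤ -2 * α) (h5 : r ≤ 0)
    (h6 : r ≤ -α) : HasDeg w r (parentQ l : 𝓔) := by
  have hs : ∀ A, HasDeg w 0 (shiftedY l A : 𝓔) := fun A =>
    ((Hom.yM w A).hasDeg.mono (by rw [hy]; exact hυ)).add (.smul _ (.one w))
  have g0 := hg 0 (by lia)
  have g1 := hg 1 (by lia)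
  have g2 := hg 2 (by lia)
  have g3 := hg 3 (by lia)
  have g4 := hg 4 (by lia)
  have g5 := hg 5 (by lia)
  refine constraintCharge_hasDeg (.sum fun A _ => .smul _ ?_) (.sum fun A _ => .smul _ ?_)
    (.sum fun A _ => ?_) (.sum fun A _ => .smul _ ?_) (.sub (.sum fun A _ => ?_)
    (.sum fun A _ => ?_)) (.sum fun A _ => ?_)
    (by lia) (by lia) (by lia) (by lia) (by lia) (by lia)
  · exact (Hom.yD w A).hasDeg.mul (Hom.yD w A).hasDeg (by rw [hy]; lia)
  · exact (Hom.aD w A).hasDeg.mul (Hom.yD w A).hasDeg (by rw [ha, hy]; lia)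
  · exact (Hom.aM w A).hasDeg.mul (Hom.yD w A).hasDeg (by rw [ha, hy]; lia)
  · exact (Hom.aD w A).hasDeg.mul (Hom.aD w A).hasDeg (by rw [ha]; lia)
  · exact (Hom.aM w A).hasDeg.mul (Hom.aD w A).hasDeg (by rw [ha]; lia)
  · exact (hs A).mul (Hom.yD w A).hasDeg (by rw [hy]; lia)
  · exact (hs A).mul (Hom.aD w A).hasDeg (by rw [ha]; lia)

theorem parentNabla_hasDeg {w : Weight (Fin (d + 1)) (Fin (d + 1))} {υ γ : ℤ}
    (hy : ∀ i, w.y i = υ) {α : ℤ} (ha : ∀ i, w.a i = α) (hγ : ∀ m : Fin d, w.g (6 + m.val) = γ) :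
    HasDeg w γ (parentNabla F) := by
  refine Hom.hasDeg (.sub (.sum fun m _ => (Hom.gM w _).mul (Hom.xD w m) (by rw [hγ, add_zero]))
    (.sum fun m _ => .sum fun A _ => .sum fun C _ => .fn_smul _ ((Hom.gM w _).mul (r' := 0)
      (.add ((Hom.yM w _).mul (Hom.yD w _) (by rw [hy, hy]; lia))
        ((Hom.aM w _).mul (Hom.aD w _) (by rw [ha, ha]; lia))) (by rw [hγ, add_zero]))))

/-- Here every oscillator has weight `α`, every `Y^A` weight `υ` and every `θ^m` weight `γ`. The
homotopy trades a `θ` for a `Y` and contributes `υ - γ`, the covariant derivative contributes `γ`,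
and `r` bounds these and the charge `Q` from below. -/
theorem parent_perturbation_hasDeg {w : Weight (Fin (d + 1)) (Fin (d + 1))} {α υ γ : ℤ} (r : ℤ) {s : ℤ}
    (hg : ∀ j < 6, w.g j = 0) (hγ : ∀ m : Fin d, w.g (6 + m.val) = γ) (ha : ∀ i, w.a i = α)
    (hy : ∀ i, w.y i = υ) (hυ : 0 ≤ υ)
    (h1 : r ≤ -2 * υ) (h2 : r ≤ -α - υ) (h3 : r ≤ α - υ) (h4 : r ≤ -2 * α) (h5 : r ≤ 0)
    (h6 : r ≤ -α) (h7 : r ≤ γ) (hs : s ≤ r + υ - γ) :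
    HasDeg w s (parentHomotopy F *
      fdiag thetaWeight (fun x => (x : ℝ)⁻¹) * (parentCharge F - parentSigma F)) := by
  have e : parentCharge F - parentSigma F = parentNabla F + parentQ l := by
    rw [parentCharge, add_right_comm, add_sub_cancel_right]; rfl
  rw [e]
  exact ((parentHomotopy_hom F (fun a => hy _) hγ).mul (Hom.fdiag w _ _) (add_zero _)).hasDeg.mul
    (((parentNabla_hasDeg F hy ha hγ).mono h7).add
      (parentQ_hasDeg hg ha hy hυ h1 h2 h3 h4 h5 h6)) (by lia)

/-- The derivative `∂/∂θ^m` extracts `𝔇_m` and anticommutes with the rest. So if a state and its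
image under the charge are both independent of `θ`, the state is covariantly constant. -/
theorem gD_mul_parentCharge (hl : l ≠ 0) (m : Fin d) :
    gD (6 + m.val) * parentCharge F = parentD F m - parentCharge F * gD (6 + m.val) := by
  have h : gD (6 + m.val) * ∑ n : Fin d, gM (6 + n.val) * parentD F n =
      parentD F m - (∑ n : Fin d, gM (6 + n.val) * parentD F n) * gD (6 + m.val) := by
    rw [Finset.mul_sum, Finset.sum_mul, eq_sub_iff_add_eq, ← Finset.sum_add_distrib]
    rw [Finset.sum_eq_single m]
    · rw [← mul_assoc, gD_mul_gM_self (by lia), mul_assoc, (parentD_bosonic F m _).2.eq, sub_mul,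
        one_mul, mul_assoc, sub_add_cancel]
    · intro n _ hn
      rw [← mul_assoc, gD_mul_gM_of_ne (by intro h; exact hn (Fin.ext (by lia))), mul_assoc,
        (parentD_bosonic F n _).2.eq, neg_mul, mul_assoc, neg_add_cancel]
    · simp
  rw [parentCharge_eq F hl, mul_add, h, gD_mul_parentQ (by lia)]
  noncomm_ring

end ParentReduction

end AdSHigherSpin

end

noncomputable section
namespace AdSHigherSpin

set_option linter.unusedSimpArgs false

/-! ### Elimination of `Y^a` and `θ^m`: covariantly constant lifts. -/

section ParentReduction

variable {d : ℕ} {l : ℝ} {U : TopologicalSpace.Opens (Fin d → ℝ)} (F : AdSFrame l U)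

theorem castSucc_notMem_range (a : Fin d) :
    a.castSucc ∉ Set.range (⟨fun _ => Fin.last d, fun _ _ _ => rfl⟩ : Unit ↪ Fin (d + 1)) := by
  rintro ⟨_, h⟩
  exact Fin.castSucc_ne_last a h.symm

theorem resAmbient_aM (A : Fin (d + 1)) (Ψ : ParentStates U) :
    resAmbient U (aM A Ψ) = aM A (resAmbient U Ψ) := res_aM _ (.refl _) _ Ψ A

theorem resAmbient_aD (A : Fin (d + 1)) (Ψ : ParentStates U) :
    resAmbient U (aD A Ψ) = aD A (resAmbient U Ψ) := res_aD _ (.refl _) _ Ψ A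

theorem resAmbient_xD (m : Fin d) (Ψ : ParentStates U) :
    resAmbient U (xD m Ψ) = xD m (resAmbient U Ψ) := res_xD _ _ _ Ψ m

theorem resAmbient_fnM (f : SmoothFn U) (Ψ : ParentStates U) :
    resAmbient U (fnM f Ψ) = fnM f (resAmbient U Ψ) := res_fnM _ _ _ Ψ f

theorem resAmbient_real_smul (c : ℝ) (Ψ : ParentStates U) :
    resAmbient U (c • Ψ) = c • resAmbient U Ψ := res_real_smul _ _ _ Ψ c

theorem resAmbient_yD_last (Ψ : ParentStates U) :
    resAmbient U (yD (Fin.last d) Ψ) = yD () (resAmbient U Ψ) :=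
  res_yD ⟨fun _ => Fin.last d, fun _ _ _ => rfl⟩ _ _ Ψ ()

theorem resAmbient_shiftedY_castSucc (a : Fin d) (Ψ : ParentStates U) :
    resAmbient U (shiftedY l a.castSucc Ψ) = 0 := by
  have h := res_yM_of_notMem _ (.refl (Fin (d + 1))) (Nat.le_add_right 6 d) Ψ
    (castSucc_notMem_range a)
  rw [shiftedY, if_neg (Fin.castSucc_ne_last a), zero_smul, add_zero]
  exact h

theorem resAmbient_shiftedY_last (hl : l ≠ 0) (Ψ : ParentStates U) :
    resAmbient U (shiftedY l (Fin.last d) Ψ) =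
      l • ((1 + zM l : Module.End ℝ (AmbientStates U)) (resAmbient U Ψ)) := by
  have h : resAmbient U (yM (Fin.last d) Ψ) = yM () (resAmbient U Ψ) :=
    res_yM ⟨fun _ => Fin.last d, fun _ _ _ => rfl⟩ _ _ Ψ ()
  rw [shiftedY, if_pos rfl, LinearMap.add_apply, map_add, h, LinearMap.smul_apply,
    resAmbient_real_smul, zM, LinearMap.add_apply, smul_add, LinearMap.smul_apply, smul_smul,
    mul_inv_cancel₀ hl, one_smul, add_comm]
  rfl

/-- At `Y^a = 0` only the component `A = (d)` of `Y + V` survives, where it equals `l(1 + z)`; its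
coefficient `ω^c_{m (d)} = l⁻¹ e^c_m` leaves the derivatives `∂/∂Y^c` along the vielbein. -/
theorem resAmbient_parentD (hl : l ≠ 0) (m : Fin d) (Ψ : ParentStates U) :
    resAmbient U (parentD F m Ψ) = xD m (resAmbient U Ψ) -
      ∑ A, ∑ C, fnM (F.W m C A) (aM A (aD C (resAmbient U Ψ))) -
        ∑ c : Fin d, fnM (F.e m c) ((1 + zM l : Module.End ℝ (AmbientStates U))
          (resAmbient U (yD c.castSucc Ψ))) := by
  rw [parentD, LinearMap.sub_apply, map_sub, resAmbient_xD, sub_sub]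
  have h : ∑ A, ∑ C, fnM (F.W m C A) (resAmbient U (shiftedY l A (yD C Ψ))) =
      ∑ c : Fin d, fnM (F.e m c) ((1 + zM l : Module.End ℝ (AmbientStates U))
        (resAmbient U (yD c.castSucc Ψ))) := by
    rw [Fin.sum_univ_castSucc]
    simp only [resAmbient_shiftedY_castSucc, map_zero, Finset.sum_const_zero, zero_add,
      resAmbient_shiftedY_last hl]
    rw [Fin.sum_univ_castSucc, F.W_last_last, fnM_zero, LinearMap.zero_apply, add_zero]
    refine Finset.sum_congr rfl fun c _ => ?_
    rw [F.W_castSucc_last, fnM_real_smul, LinearMap.smul_apply, map_smul, smul_smul,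
      inv_mul_cancel₀ hl, one_smul]
  rw [← h]
  simp only [matrixOp, parentE, LinearMap.sum_apply, map_sum, Module.End.mul_apply, resAmbient_fnM,
    LinearMap.add_apply, map_add, resAmbient_aM, resAmbient_aD, Finset.sum_add_distrib]
  exact congrArg _ (add_comm _ _)

theorem zInv_fnLinear : FnLinear (zInv l : Module.End ℝ (AmbientStates U)) := FnLinear.coefM _

theorem zInv_one_add_zM_apply (χ : AmbientStates U) :
    zInv l ((1 + zM l : Module.End ℝ (AmbientStates U)) χ) = χ := by
  have h := LinearMap.congr_fun (zInv_mul_one_add_zM (U := U) (l := l)) χ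
  rw [Module.End.mul_apply, Module.End.one_apply] at h
  exact h

theorem aD_comm_zInv (A : Fin (d + 1)) :
    Commute (aD A : Module.End ℝ (AmbientStates U)) (zInv l) := aD_comm_coefM _ _

theorem aM_comm_zInv (A : Fin (d + 1)) :
    Commute (aM A : Module.End ℝ (AmbientStates U)) (zInv l) := aM_comm_coefM _ _

theorem resAmbient_constraintCharge {Box S Sd T h Sb : Module.End ℝ (ParentStates U)}
    {Box₁ S₁ Sd₁ T₁ h₁ Sb₁ : Module.End ℝ (AmbientStates U)} (bSd : Bosonic Sd)
    (bSd₁ : Bosonic Sd₁) {φ : ParentStates U}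
    (eBox : resAmbient U (Box φ) = Box₁ (resAmbient U φ))
    (eS : resAmbient U (S φ) = S₁ (resAmbient U φ))
    (eSd : resAmbient U (Sd φ) = Sd₁ (resAmbient U φ))
    (eT : resAmbient U (T φ) = T₁ (resAmbient U φ))
    (eh : resAmbient U (h φ) = h₁ (resAmbient U φ))
    (eSb : resAmbient U (Sb φ) = Sb₁ (resAmbient U φ)) :
    resAmbient U (constraintCharge ghosts Box S Sd T h Sb φ) =
      constraintCharge ghosts Box₁ S₁ Sd₁ T₁ h₁ Sb₁ (resAmbient U φ) :=
  res_constraintCharge le_rfl bSd bSd₁ eBox eS eSd eT eh eSb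

theorem resAmbient_sum_parentD (hl : l ≠ 0) (a : Fin d) (Ψ : ParentStates U) :
    ∑ m, fnM (F.einv a m) (resAmbient U (parentD F m Ψ)) = ambientD F a (resAmbient U Ψ) -
      (1 + zM l : Module.End ℝ (AmbientStates U)) (resAmbient U (yD a.castSucc Ψ)) := by
  simp only [resAmbient_parentD F hl, map_sub, Finset.sum_sub_distrib, map_sum]
  rw [ambientD, LinearMap.sub_apply]
  congr 1
  · simp only [LinearMap.sum_apply, fn_smul_eq, Module.End.mul_apply, fnM_mul]
  · rw [Finset.sum_comm]
    have h : ∀ c : Fin d, ∑ m, fnM (F.einv a m) (fnM (F.e m c)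
        ((1 + zM l : Module.End ℝ (AmbientStates U)) (resAmbient U (yD c.castSucc Ψ)))) =
        if a = c then (1 + zM l : Module.End ℝ (AmbientStates U))
          (resAmbient U (yD c.castSucc Ψ)) else 0 := by
      intro c
      have h1 := LinearMap.congr_fun (congrArg (fun f => (fnM f : Module.End ℝ (AmbientStates U)))
        (F.einv_e a c)) ((1 + zM l : Module.End ℝ (AmbientStates U))
          (resAmbient U (yD c.castSucc Ψ)))
      simp only [fnM_sum, fnM_mul, LinearMap.sum_apply, Module.End.mul_apply] at h1
      rw [h1]
      split_ifs
      · rw [fnM_one]; rfl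
      · rw [fnM_zero]; rfl
    simp only [h, Finset.sum_ite_eq, Finset.mem_univ, if_true]

section Lift

variable (hl : l ≠ 0) {Φ : ParentStates U} (hΦ : ∀ m, parentD F m Φ = 0)
include hl hΦ

/-- Covariant constancy, contracted with the inverse vielbein, expresses the first derivatives in
`Y^a` through `𝒟_a`, since `1 + z` is invertible. -/
theorem resAmbient_yD_lift (a : Fin d) :
    resAmbient U (yD a.castSucc Φ) = zInv l (ambientD F a (resAmbient U Φ)) := by
  have h := resAmbient_sum_parentD F hl a Φ
  simp only [hΦ, map_zero, Finset.sum_const_zero] at h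
  rw [sub_eq_zero.1 h.symm, ← Module.End.mul_apply, zInv_mul_one_add_zM]
  rfl

theorem parentD_yD_lift (m : Fin d) (C : Fin (d + 1)) :
    parentD F m (yD C Φ) = ∑ A, fnM (F.W m A C) (yD A Φ) := by
  have h := LinearMap.congr_fun (parentD_yD F m C) Φ
  simpa [hΦ, LinearMap.sum_apply] using h

/-- The same identity is applied to `∂Φ/∂Y^a`. This is a covector component and not covariantly
constant: its derivative is a connection term. The Lorentz part of that term completes the covariant
second derivative, and the part `ω^{(d)}_{m a} = l⁻¹ e_{m a}` produces the term with `∂/∂z`. -/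
theorem resAmbient_yD_yD_lift (a : Fin d) :
    resAmbient U (yD a.castSucc (yD a.castSucc Φ)) =
      zInv l (zInv l (ambientD F a (ambientD F a (resAmbient U Φ)) -
        ∑ b, fnM (∑ m, F.einv a m * F.conn m b a) (ambientD F b (resAmbient U Φ)))) -
        ((l ^ 2)⁻¹ * etaT a) • zInv l (zD l (resAmbient U Φ)) := by
  have h := resAmbient_sum_parentD F hl a (yD a.castSucc Φ)
  have h1 : ∑ m, fnM (F.einv a m) (resAmbient U (parentD F m (yD a.castSucc Φ))) =
      zInv l (∑ b, fnM (∑ m, F.einv a m * F.conn m b a) (ambientD F b (resAmbient U Φ))) +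
        ((l ^ 2)⁻¹ * etaT a) • zD l (resAmbient U Φ) := by
    simp only [parentD_yD_lift F hl hΦ, map_sum, resAmbient_fnM]
    rw [Finset.sum_comm, Fin.sum_univ_castSucc]
    congr 1
    · refine Finset.sum_congr rfl fun b _ => ?_
      have e : ∀ (f : SmoothFn U) (χ : AmbientStates U),
          zInv l (fnM f χ) = fnM f (zInv l χ) := fun f χ => zInv_fnLinear.map_smul f χ
      rw [resAmbient_yD_lift F hl hΦ, e]
      simp only [fnM_sum, fnM_mul, LinearMap.sum_apply, Module.End.mul_apply,
        F.W_castSucc_castSucc]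
    · have h2 := LinearMap.congr_fun (congrArg (fun f => (fnM f : Module.End ℝ (AmbientStates U)))
        (F.einv_e a a)) (yD () (resAmbient U Φ))
      simp only [fnM_sum, fnM_mul, LinearMap.sum_apply, Module.End.mul_apply, if_true, fnM_one,
        Module.End.one_apply] at h2
      simp only [F.W_last_castSucc, fnM_real_smul, LinearMap.smul_apply, map_smul,
        ← Finset.smul_sum, resAmbient_yD_last, h2, zD, smul_smul]
      congr 1
      field_simp
  rw [h1] at h
  have h4 : (1 + zM l : Module.End ℝ (AmbientStates U))
      (resAmbient U (yD a.castSucc (yD a.castSucc Φ))) =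
      ambientD F a (resAmbient U (yD a.castSucc Φ)) - (zInv l (∑ b, fnM (∑ m, F.einv a m *
        F.conn m b a) (ambientD F b (resAmbient U Φ))) +
        ((l ^ 2)⁻¹ * etaT a) • zD l (resAmbient U Φ)) := by
    rw [h]; abel
  rw [← zInv_one_add_zM_apply (l := l) (resAmbient U (yD a.castSucc (yD a.castSucc Φ))), h4,
    resAmbient_yD_lift F hl hΦ, ← Module.End.mul_apply (ambientD F a),
    (ambientD_commute_zInv F a).eq, Module.End.mul_apply, map_sub, map_add, map_sub, map_sub,
    map_smul]
  abel

theorem resAmbient_parentBox :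
    resAmbient U ((∑ A, eta A • (yD A * yD A) : Module.End ℝ (ParentStates U)) Φ) =
      ambientBox F (resAmbient U Φ) := by
  rw [LinearMap.sum_apply, map_sum, Fin.sum_univ_castSucc]
  simp only [LinearMap.smul_apply, Module.End.mul_apply, resAmbient_real_smul,
    resAmbient_yD_yD_lift F hl hΦ, resAmbient_yD_last, eta_last]
  rw [ambientBox]
  simp only [LinearMap.sub_apply, Module.End.mul_apply, LinearMap.sum_apply, map_sum,
    LinearMap.smul_apply, map_smul, smul_sub, Finset.sum_sub_distrib, fn_smul_eq]
  -- Each direction contributes equally because `η_a² = 1`; summing gives the factor `d` in front of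
  -- `(1 + z)⁻¹ ∂/∂z`.
  have h1 : ∀ a : Fin d, eta a.castSucc • ((l ^ 2)⁻¹ * etaT a) • zInv l (zD l (resAmbient U Φ)) =
      (l ^ 2)⁻¹ • zInv l (zD l (resAmbient U Φ)) := fun a => by
    have := etaT_mul_self a
    rw [smul_smul]; congr 1
    change etaT a * _ = _
    linear_combination (l ^ 2)⁻¹ * this
  have h2 : (l ^ 2)⁻¹ • zD l (zD l (resAmbient U Φ)) = yD () (yD () (resAmbient U Φ)) := by
    simp only [zD, LinearMap.smul_apply, map_smul, smul_smul]
    rw [show (l ^ 2)⁻¹ * (l * l) = 1 by field_simp, one_smul]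
  simp only [h1, h2, Finset.sum_const, Finset.card_univ, Fintype.card_fin]
  rw [← Nat.cast_smul_eq_nsmul ℝ, smul_smul]
  simp only [map_sub, map_sum, smul_sub, Finset.sum_sub_distrib, neg_one_smul, one_smul, etaT,
    Finset.smul_sum, map_smul]
  abel

theorem resAmbient_parentCharge :
    resAmbient U (parentCharge F Φ) = ambientCharge F (resAmbient U Φ) := by
  have h0 : resAmbient U ((∑ m : Fin d, gM (6 + m.val) * parentD F m :
      Module.End ℝ (ParentStates U)) Φ) = 0 := by
    rw [LinearMap.sum_apply, map_sum]
    refine Finset.sum_eq_zero fun m _ => ?_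
    exact res_gM_of_le _ _ _ _ (by lia)
  rw [parentCharge_eq F hl, LinearMap.add_apply, map_add, h0, zero_add, parentQ, ambientCharge]
  refine resAmbient_constraintCharge (.sum fun A _ => (Bosonic.aM A).mul (.yD A)) ?_
    (resAmbient_parentBox F hl hΦ) ?_ ?_ ?_ ?_ ?_
  · exact .add ((Bosonic.coefM _).mul (.sum fun a _ => (Bosonic.aM _).mul (ambientD_bosonic F a)))
      ((Bosonic.real_smul _ (.aM _)).mul (.real_smul _ (.yD _)))
  · rw [LinearMap.sum_apply, map_sum, Fin.sum_univ_castSucc]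
    simp only [LinearMap.smul_apply, Module.End.mul_apply, resAmbient_real_smul, resAmbient_aD,
      resAmbient_yD_lift F hl hΦ, resAmbient_yD_last, eta_last, LinearMap.sub_apply,
      LinearMap.sum_apply, map_sum, map_smul, wD, zD, smul_smul]
    have h2 : (l ^ 2)⁻¹ * (l * l) = 1 := by field_simp
    rw [h2, one_smul, neg_one_smul, ← sub_eq_add_neg]
    congr 1
    refine Finset.sum_congr rfl fun a _ => ?_
    rw [← Module.End.mul_apply (aD _), (aD_comm_zInv _).eq]
    rfl
  · rw [LinearMap.sum_apply, map_sum, Fin.sum_univ_castSucc]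
    simp only [LinearMap.smul_apply, Module.End.mul_apply, resAmbient_real_smul, resAmbient_aM,
      resAmbient_yD_lift F hl hΦ, resAmbient_yD_last, LinearMap.add_apply,
      LinearMap.sum_apply, map_sum, map_smul, wM, zD, smul_smul]
    rw [mul_inv_cancel₀ hl, one_smul]
    congr 1
    refine Finset.sum_congr rfl fun a _ => ?_
    rw [← Module.End.mul_apply (aM _), (aM_comm_zInv _).eq]
    rfl
  · simp only [LinearMap.sum_apply, map_sum, LinearMap.smul_apply, Module.End.mul_apply,
      resAmbient_real_smul, resAmbient_aD]
  · simp only [LinearMap.sub_apply, map_sub, LinearMap.sum_apply, map_sum, Module.End.mul_apply,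
      resAmbient_aM, resAmbient_aD]
    rw [Fin.sum_univ_castSucc (f := fun A => resAmbient U (shiftedY l A (yD A Φ)))]
    simp only [resAmbient_shiftedY_castSucc, Finset.sum_const_zero, zero_add,
      resAmbient_shiftedY_last hl, resAmbient_yD_last, zD, LinearMap.smul_apply, map_smul]
  · simp only [LinearMap.sum_apply, map_sum, Module.End.mul_apply]
    rw [Fin.sum_univ_castSucc]
    simp only [resAmbient_shiftedY_castSucc, Finset.sum_const_zero, zero_add,
      resAmbient_shiftedY_last hl, resAmbient_aD, wD, LinearMap.smul_apply, map_smul]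

end Lift

/-- The parent system is consistently reduced to the intermediate system. -/
theorem parent_reduction (hl : l ≠ 0) :
    ConsistentReduction fil ghostNumber (parentCharge F) fil (inclAmbient U) (ambientCharge F) ∧
      ambientCharge F * ambientCharge F = 0 := by
  have tη : Tame (-1) (parentHomotopy F * fdiag thetaWeight fun x => (x : ℝ)⁻¹) :=
    (parentHomotopy_tame F).mul (tame_inverse _ _) rfl
  let w (α υ γ : ℤ) : Weight (Fin (d + 1)) (Fin (d + 1)) :=
    ⟨fun j => if 6 ≤ j then γ else 0, fun _ => α, fun _ => υ⟩
  have hg : ∀ α υ γ : ℤ, ∀ j < 6, (w α υ γ).g j = 0 := fun α υ γ j hj => if_neg (by lia)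
  have hγ : ∀ α υ γ : ℤ, ∀ m : Fin d, (w α υ γ).g (6 + m.val) = γ := fun α υ γ m =>
    if_pos (by lia)
  -- For `w₁`, with weight `1` for `Y` and `-2` for `θ`, the homotopy gains `3` and the rest loses
  -- at most `2`, through the two `Y`-derivatives of `Box` or the `θ` of the covariant derivative.
  -- For `w₂`, with `-1` for `a†` and `θ`, the homotopy gains `1`, and `S†` or a `θ` loses at most
  -- `1`.
  obtain ⟨K, hπ, hw, hΩ, hred⟩ := (parent_contraction F).exists_lift (Ω := parentCharge F)
    (fE := fil) (incl_filContinuous _ _ _) (res_filContinuous _ _ _) (parentSigma_tame F) tη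
    (parentCharge_tame F hl) (w₁ := w 0 1 (-2)) (w₂ := w (-1) 0 (-1)) (c := 1)
    (parent_perturbation_hasDeg F (-2) (hg _ _ _) (hγ _ _ _) (fun _ => rfl) (fun _ => rfl)
      (by lia) (by lia) (by lia) (by lia) (by lia) (by lia) (by lia) (by lia) (by lia))
    (fun _ => rfl) (fun _ => zero_le_one) (fun _ => Nat.cast_one.ge)
    (parent_perturbation_hasDeg F (-1) (hg _ _ _) (hγ _ _ _) (fun _ => rfl) (fun _ => rfl)
      (by lia) (by lia) (by lia) (by lia) (by lia) (by lia) (by lia) (by lia) (by lia))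
    (fun _ => rfl) (fun _ => le_rfl)
  have h3 := parent_perturbation_hasDeg F (w := w 0 0 (-1)) (-1) (s := 0) (hg _ _ _) (hγ _ _ _)
    (fun _ => rfl) (fun _ => rfl)
    (by lia) (by lia) (by lia) (by lia) (by lia) (by lia) (by lia) (by lia) (by lia)
  -- The weight now counts minus the number of `θ`; the perturbation does not lower it, so the lift
  -- of a `θ`-independent state is `θ`-independent.
  have hθ : ∀ φ (m : Fin d), gD (6 + m.val) (K φ) = 0 := fun φ m => by
    refine gD_eq_zero_of_mem_wtFil (w := w 0 0 (-1)) (fun j => ?_) (fun _ => rfl) (fun _ => rfl)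
      (hγ _ _ _ m).le (hw _ h3 φ fun S β n hn => ?_)
    · change (if 6 ≤ j then (-1 : ℤ) else 0) ≤ 0
      split_ifs <;> lia
    · by_contra hne
      obtain ⟨⟨S', rfl⟩, -⟩ := exists_of_coeff_incl_ne_zero _ _ _ hne
      refine hn.ne ?_
      simp only [Weight.eval, Finset.sum_map, w, mul_zero, Finsupp.sum, Finset.sum_const_zero,
        add_zero]
      exact Finset.sum_eq_zero fun h _ => if_neg (not_le.2 h.2)
  -- `ΩKφ` is itself a lift, hence also free of `θ`, and differentiating it with respect to `θ^m`
  -- gives `𝔇_m Kφ = 0`.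
  have hD : ∀ φ m, parentD F m (K φ) = 0 := fun φ m => by
    have h := LinearMap.congr_fun (gD_mul_parentCharge F hl m) (K φ)
    rw [Module.End.mul_apply, LinearMap.sub_apply, Module.End.mul_apply, hθ, map_zero, sub_zero,
      hΩ (parentCharge_sq F hl), hθ] at h
    exact h.symm
  obtain ⟨h, h'⟩ := hred (ambientCharge F) fun φ => by
    rw [resAmbient_parentCharge F hl (hD φ), hπ]
  exact ⟨h, h' (parentCharge_sq F hl)⟩

theorem ambientCharge_isBRSTSystem (hl : l ≠ 0) :
    IsBRSTSystem fil ghostNumber (ambientCharge F) :=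
  (ambientCharge_tame F).isBRSTSystem (parent_reduction F hl).2

end ParentReduction

end AdSHigherSpin

end

noncomputable section
namespace AdSHigherSpin

set_option linter.unusedSimpArgs false

/-! ### Constraints completed by their action on the ghosts. -/

section GhostDerivatives

variable {d : ℕ} {U : TopologicalSpace.Opens (Fin d → ℝ)} {Y B : Type} {k : ℕ}

local notation "𝓔" => Module.End ℝ (Fock U Y B k)

set_option maxHeartbeats 1000000 in
-- The anticommutator of `∂/∂μ` with the charge is `h` completed by ghost number operators; likewise
-- `∂/∂ν` yields the completed `S̄†` below. On states free of `μ`, `ν` whose image is free of them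
-- too, these completed constraints must vanish.
theorem gD_four_mul_constraintCharge (hk : 6 ≤ k) {Box S Sd T h Sb : 𝓔}
    (bBox : Bosonic Box) (bS : Bosonic S) (bSd : Bosonic Sd) (bT : Bosonic T) (bh : Bosonic h)
    (bSb : Bosonic Sb) :
    gD 4 * constraintCharge ghosts Box S Sd T h Sb =
      h - (2 : ℝ) • (gM 0 * gD 0) - (2 : ℝ) • (gD 2 * gM 2) + (2 : ℝ) • (gM 3 * gD 3) +
        (2 : ℝ) • (gM 5 * gD 5) - constraintCharge ghosts Box S Sd T h Sb * gD 4 := by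
  have h0 : 0 < k := by lia
  have h1 : 1 < k := by lia
  have h2 : 2 < k := by lia
  have h3 : 3 < k := by lia
  have h4 : 4 < k := by lia
  have h5 : 5 < k := by lia
  simp only [constraintCharge, ghosts, two_mul_eq_smul, mul_assoc, mul_add, add_mul, mul_sub,
    sub_mul, smul_mul_assoc, mul_smul_comm, bBox.mul_gM, bBox.mul_gD, bBox.mul_gM_assoc,
    bBox.mul_gD_assoc, bS.mul_gM, bS.mul_gD, bS.mul_gM_assoc,
    bS.mul_gD_assoc, bSd.mul_gM, bSd.mul_gD, bSd.mul_gM_assoc,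
    bSd.mul_gD_assoc, bT.mul_gM, bT.mul_gD, bT.mul_gM_assoc,
    bT.mul_gD_assoc, bh.mul_gM, bh.mul_gD, bh.mul_gM_assoc,
    bh.mul_gD_assoc, bSb.mul_gM, bSb.mul_gD, bSb.mul_gM_assoc,
    bSb.mul_gD_assoc, gM_swap, gM_swap_assoc, gM_sq, gM_sq_assoc, gD_swap, gD_swap_assoc, gD_sq,
    gD_sq_assoc, gD_gM_swap_assoc, gD_mul_gM_of_ne, gD_mul_gM_self, gD_gM_self_assoc, h0, h1, h2,
    h3, h4, h5, mul_neg, neg_mul,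
    neg_neg, smul_neg, mul_zero, zero_mul, smul_zero, neg_zero, add_zero, zero_add, sub_zero,
    zero_sub, mul_one, one_mul, Nat.reduceLT, ne_eq, Nat.reduceEqDiff, not_false_eq_true,
    OfNat.ofNat_ne_zero, OfNat.zero_ne_ofNat, OfNat.ofNat_ne_one, OfNat.one_ne_ofNat, zero_ne_one,
    one_ne_zero, smul_smul, smul_add, smul_sub, Nat.ofNat_pos, Nat.one_lt_ofNat, Nat.lt_one_iff,
    zero_lt_one]
  module

set_option maxHeartbeats 1000000 in
theorem gD_five_mul_constraintCharge (hk : 6 ≤ k) {Box S Sd T h Sb : 𝓔}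
    (bBox : Bosonic Box) (bS : Bosonic S) (bSd : Bosonic Sd) (bT : Bosonic T) (bh : Bosonic h)
    (bSb : Bosonic Sb) :
    gD 5 * constraintCharge ghosts Box S Sd T h Sb =
      Sb + (2 : ℝ) • (gM 0 * gD 1) + gM 1 * gD 3 + gD 2 * gD 4 - (2 : ℝ) • (gM 4 * gD 5) -
        constraintCharge ghosts Box S Sd T h Sb * gD 5 := by
  have h0 : 0 < k := by lia
  have h1 : 1 < k := by lia
  have h2 : 2 < k := by lia
  have h3 : 3 < k := by lia
  have h4 : 4 < k := by lia
  have h5 : 5 < k := by lia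
  simp only [constraintCharge, ghosts, two_mul_eq_smul, mul_assoc, mul_add, add_mul, mul_sub,
    sub_mul, smul_mul_assoc, mul_smul_comm, bBox.mul_gM, bBox.mul_gD, bBox.mul_gM_assoc,
    bBox.mul_gD_assoc, bS.mul_gM, bS.mul_gD, bS.mul_gM_assoc,
    bS.mul_gD_assoc, bSd.mul_gM, bSd.mul_gD, bSd.mul_gM_assoc,
    bSd.mul_gD_assoc, bT.mul_gM, bT.mul_gD, bT.mul_gM_assoc,
    bT.mul_gD_assoc, bh.mul_gM, bh.mul_gD, bh.mul_gM_assoc,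
    bh.mul_gD_assoc, bSb.mul_gM, bSb.mul_gD, bSb.mul_gM_assoc,
    bSb.mul_gD_assoc, gM_swap, gM_swap_assoc, gM_sq, gM_sq_assoc, gD_swap, gD_swap_assoc, gD_sq,
    gD_sq_assoc, gD_gM_swap_assoc, gD_mul_gM_of_ne, gD_mul_gM_self, gD_gM_self_assoc, h0, h1, h2,
    h3, h4, h5, mul_neg, neg_mul,
    neg_neg, smul_neg, mul_zero, zero_mul, smul_zero, neg_zero, add_zero, zero_add, sub_zero,
    zero_sub, mul_one, one_mul, Nat.reduceLT, ne_eq, Nat.reduceEqDiff, not_false_eq_true,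
    OfNat.ofNat_ne_zero, OfNat.zero_ne_ofNat, OfNat.ofNat_ne_one, OfNat.one_ne_ofNat, zero_ne_one,
    one_ne_zero, smul_smul, smul_add, smul_sub, Nat.ofNat_pos, Nat.one_lt_ofNat, Nat.lt_one_iff,
    zero_lt_one]
  module

theorem constraintCharge_sub_constraintCharge (Box S Sd T h Sb h' Sb' : 𝓔) :
    constraintCharge ghosts Box S Sd T h Sb - constraintCharge ghosts Box S Sd T h' Sb' =
      gM 4 * (h - h') + gM 5 * (Sb - Sb') := by
  simp only [constraintCharge, ghosts, mul_sub]
  abel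

end GhostDerivatives

/-! ### Elimination of `z, w, μ, ν`: contraction and perturbation. -/

section AmbientContraction

variable {d : ℕ} {l : ℝ} {U : TopologicalSpace.Opens (Fin d → ℝ)} (F : AdSFrame l U)

local notation "𝓔" => Module.End ℝ (AmbientStates U)

theorem zD_mul_zM (hl : l ≠ 0) : (zD l * zM l : 𝓔) = zM l * zD l + 1 := by
  simp only [zD, zM, smul_mul_assoc, mul_smul_comm, smul_smul, yD_mul_yM, if_true, smul_add]
  rw [mul_inv_cancel₀ hl, inv_mul_cancel₀ hl, one_smul, one_smul]

theorem wD_mul_wM (hl : l ≠ 0) : (wD l * wM l : 𝓔) = wM l * wD l + 1 := by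
  simp only [wD, wM, smul_mul_assoc, mul_smul_comm, smul_smul, aD_mul_aM, if_true, smul_add]
  rw [mul_inv_cancel₀ hl, inv_mul_cancel₀ hl, one_smul, one_smul]

theorem zM_mul_zD (hl : l ≠ 0) : (zM l * zD l : 𝓔) = yM () * yD () := by
  simp only [zD, zM, smul_mul_assoc, mul_smul_comm, smul_smul]
  rw [mul_inv_cancel₀ hl, one_smul]

theorem wM_mul_wD (hl : l ≠ 0) : (wM l * wD l : 𝓔) = aM (Fin.last d) * aD (Fin.last d) := by
  simp only [wD, wM, smul_mul_assoc, mul_smul_comm, smul_smul]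
  rw [mul_inv_cancel₀ hl, one_smul]

theorem zM_comm_wM : Commute (zM l : 𝓔) (wM l) :=
  ((aM_comm_yM _ _).symm.smul_left _).smul_right _

theorem zM_comm_wD : Commute (zM l : 𝓔) (wD l) :=
  ((aD_comm_yM _ _).symm.smul_left _).smul_right _

theorem zD_comm_wM : Commute (zD l : 𝓔) (wM l) :=
  ((aM_comm_yD _ _).symm.smul_left _).smul_right _

theorem zD_comm_wD : Commute (zD l : 𝓔) (wD l) :=
  ((aD_comm_yD _ _).symm.smul_left _).smul_right _

theorem zM_bosonic : Bosonic (zM l : 𝓔) := .real_smul _ (.yM _)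
theorem zD_bosonic : Bosonic (zD l : 𝓔) := .real_smul _ (.yD _)
theorem wM_bosonic : Bosonic (wM l : 𝓔) := .real_smul _ (.aM _)
theorem wD_bosonic : Bosonic (wD l : 𝓔) := .real_smul _ (.aD _)
theorem zM_fnLinear : FnLinear (zM l : 𝓔) := .real_smul _ (.yM _)
theorem zD_fnLinear : FnLinear (zD l : 𝓔) := .real_smul _ (.yD _)
theorem wM_fnLinear : FnLinear (wM l : 𝓔) := .real_smul _ (.aM _)
theorem wD_fnLinear : FnLinear (wD l : 𝓔) := .real_smul _ (.aD _)
theorem zM_tame : Tame 0 (zM l : 𝓔) := .real_smul _ (.yM _)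
theorem zD_tame : Tame 0 (zD l : 𝓔) := .real_smul _ (.yD _)
theorem wM_tame : Tame 0 (wM l : 𝓔) := .real_smul _ (.aM _)
theorem wD_tame : Tame 0 (wD l : 𝓔) := .real_smul _ (.aD _)

/-- The pairs are `(z, -μ)` and `(w, ν)`: at `z = 0` the constraint `h` contributes `-∂/∂z` and
`S̄†` contributes `∂/∂w`, whence the sign on `μ` and on its derivative. -/
theorem ambient_koszulPairs (hl : l ≠ 0) : KoszulPairs
    ![(-gM 4 : Module.End ℝ (AmbientStates U)), gM 5] ![-gD 4, gD 5] ![zM l, wM l]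
    ![zD l, wD l] where
  P_P i j := by
    fin_cases i <;> fin_cases j <;> simp [gM_sq, gM_anticomm 4 5]
  Q_Q i j := by
    fin_cases i <;> fin_cases j <;> simp [gD_sq, gD_anticomm 4 5]
  Q_P i j := by
    fin_cases i <;> fin_cases j <;> simp [gD_mul_gM_self, gD_mul_gM_of_ne]
  D_y i j := by
    fin_cases i <;> fin_cases j <;>
      simp [zD_mul_zM hl, wD_mul_wM hl, zM_comm_wD.eq, zD_comm_wM.eq]
  y_y i j := by
    fin_cases i <;> fin_cases j
    · exact Commute.refl _
    · exact zM_comm_wM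
    · exact zM_comm_wM.symm
    · exact Commute.refl _
  D_D i j := by
    fin_cases i <;> fin_cases j
    · exact Commute.refl _
    · exact zD_comm_wD
    · exact zD_comm_wD.symm
    · exact Commute.refl _
  y_P i j := by
    fin_cases i <;> fin_cases j
    · exact (zM_bosonic _).1.neg_right
    · exact (zM_bosonic _).1
    · exact (wM_bosonic _).1.neg_right
    · exact (wM_bosonic _).1
  y_Q i j := by
    fin_cases i <;> fin_cases j
    · exact (zM_bosonic _).2.neg_right
    · exact (zM_bosonic _).2
    · exact (wM_bosonic _).2.neg_right
    · exact (wM_bosonic _).2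
  D_P i j := by
    fin_cases i <;> fin_cases j
    · exact (zD_bosonic _).1.neg_right
    · exact (zD_bosonic _).1
    · exact (wD_bosonic _).1.neg_right
    · exact (wD_bosonic _).1
  D_Q i j := by
    fin_cases i <;> fin_cases j
    · exact (zD_bosonic _).2.neg_right
    · exact (zD_bosonic _).2
    · exact (wD_bosonic _).2.neg_right
    · exact (wD_bosonic _).2

/-- The leading part `-μ ∂/∂z + ν ∂/∂w` of the intermediate BRST operator. -/
def ambientDelta (l : ℝ) : Module.End ℝ (AmbientStates U) := -gM 4 * zD l + gM 5 * wD l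

/-- The homotopy `-z ∂/∂μ + w ∂/∂ν`. -/
def ambientHomotopy (l : ℝ) : Module.End ℝ (AmbientStates U) := zM l * -gD 4 + wM l * gD 5

/-- The weight counting the variables `z, w, μ, ν`. -/
def zwWeight {d : ℕ} : Weight Unit (Fin (d + 1)) :=
  ⟨fun j => if 4 ≤ j then 1 else 0, fun i => if i = Fin.last d then 1 else 0, fun _ => 1⟩

theorem ambientDelta_sq (hl : l ≠ 0) : (ambientDelta l * ambientDelta l : 𝓔) = 0 := by
  have h := (ambient_koszulPairs (U := U) hl).differential_sq
  rwa [Fin.sum_univ_two] at h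

theorem ambientHomotopy_sq (hl : l ≠ 0) : (ambientHomotopy l * ambientHomotopy l : 𝓔) = 0 := by
  have h := (ambient_koszulPairs (U := U) hl).homotopy_sq
  rwa [Fin.sum_univ_two] at h

theorem ambientDelta_anticommutator (hl : l ≠ 0) :
    (ambientDelta l * ambientHomotopy l + ambientHomotopy l * ambientDelta l : 𝓔) =
      fdiag zwWeight fun x => (x : ℝ) := by
  have h := (ambient_koszulPairs (U := U) hl).anticommutator
  simp only [Fin.sum_univ_two, Matrix.cons_val_zero, Matrix.cons_val_one] at h
  rw [ambientDelta, ambientHomotopy, h, ← number_operator_eq_fdiag, Fin.sum_univ_castSucc,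
    zM_mul_zD hl, wM_mul_wD hl]
  simp [zwWeight, Finset.sum_range_succ, Fin.castSucc_ne_last]
  abel

theorem ambientDelta_fnLinear : FnLinear (ambientDelta l : 𝓔) :=
  ((FnLinear.gM 4).neg.mul zD_fnLinear).add ((FnLinear.gM 5).mul wD_fnLinear)

theorem ambientHomotopy_fnLinear : FnLinear (ambientHomotopy l : 𝓔) :=
  (zM_fnLinear.mul (FnLinear.gD 4).neg).add (wM_fnLinear.mul (FnLinear.gD 5))

theorem ambientHomotopy_inverse_fnLinear :
    FnLinear (ambientHomotopy l * fdiag zwWeight (fun x => (x : ℝ)⁻¹) : 𝓔) :=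
  ambientHomotopy_fnLinear.mul (.fdiag _ _)

theorem ambientDelta_tame : Tame 1 (ambientDelta l : 𝓔) :=
  ((Tame.gM (s := 1) (by norm_num)).neg.mul zD_tame (add_zero 1)).add
    ((Tame.gM (s := 1) (by norm_num)).mul wD_tame (add_zero 1))

theorem ambientHomotopy_tame : Tame (-1) (ambientHomotopy l : 𝓔) :=
  (zM_tame.mul (Tame.gD (s := -1) (by norm_num)).neg (zero_add (-1))).add
    (wM_tame.mul (Tame.gD (s := -1) (by norm_num)) (zero_add (-1)))

/-- The component independent of `z, w, μ, ν`. -/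
def resTensor (U : TopologicalSpace.Opens (Fin d → ℝ)) :
    AmbientStates U →ₗ[SmoothFn U] TensorStates U 4 :=
  res Function.Embedding.ofIsEmpty Fin.castSuccEmb (by norm_num)

theorem resTensor_inclTensor (φ : TensorStates U 4) : resTensor U (inclTensor U φ) = φ :=
  res_incl _ _ _ φ

theorem last_notMem_range : Fin.last d ∉ Set.range (Fin.castSuccEmb : Fin d ↪ Fin (d + 1)) := by
  rintro ⟨a, h⟩
  exact Fin.castSucc_ne_last a h

theorem inclTensor_resTensor (φ : AmbientStates U) : inclTensor U (resTensor U φ) =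
    fdiag zwWeight (fun x => if x = 0 then 1 else 0) φ := by
  refine incl_res _ _ _ ?_ ?_ ?_ ?_ ?_ ?_ φ
  · intro j hj _; simp [zwWeight, hj]
  · intro j hj
    have : ¬ 4 ≤ j := by lia
    simp [zwWeight, this]
  · intro i hi
    have : i = Fin.last d := by
      induction i using Fin.lastCases with
      | last => rfl
      | cast i => exact absurd ⟨i, rfl⟩ hi
    simp [zwWeight, this]
  · intro i; exact if_neg (Fin.castSucc_ne_last i)
  · intro i hi; exact zero_lt_one
  · intro i; exact i.elim

theorem ambientDelta_inclTensor (φ : TensorStates U 4) :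
    ambientDelta l (inclTensor U φ) = 0 := by
  have h1 : zD l (inclTensor U φ) = 0 := by
    rw [zD, LinearMap.smul_apply, inclTensor, yD_incl _ _ _ (by rintro ⟨i, -⟩; exact i.elim),
      smul_zero]
  have h2 : wD l (inclTensor U φ) = 0 := by
    rw [wD, LinearMap.smul_apply, inclTensor, aD_incl _ _ _ last_notMem_range, smul_zero]
  rw [ambientDelta, LinearMap.add_apply, Module.End.mul_apply, Module.End.mul_apply, h1, h2,
    map_zero, map_zero, add_zero]

theorem ambientDelta_hom {w : Weight Unit (Fin (d + 1))} (h4 : w.g 4 - w.y () = 0)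
    (h5 : w.g 5 - w.a (Fin.last d) = 0) : Hom w 0 (ambientDelta l : 𝓔) :=
  .add ((Hom.gM w 4).neg.mul (.smul _ (Hom.yD w ())) h4)
    ((Hom.gM w 5).mul (.smul _ (Hom.aD w _)) h5)

theorem ambientHomotopy_hom {w : Weight Unit (Fin (d + 1))} (h4 : w.y () - w.g 4 = 0)
    (h5 : w.a (Fin.last d) - w.g 5 = 0) : Hom w 0 (ambientHomotopy l : 𝓔) :=
  .add (Hom.mul (.smul _ (Hom.yM w ())) (Hom.gD w 4).neg h4)
    (Hom.mul (.smul _ (Hom.aM w _)) (Hom.gD w 5) h5)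

theorem ambient_contraction (hl : l ≠ 0) : Contraction ghostNumber (inclTensor U) (resTensor U)
    (ambientDelta_fnLinear (U := U) (l := l)).toLinear
    (ambientHomotopy_inverse_fnLinear (U := U) (l := l)).toLinear := by
  have h1 : Hom zwWeight 0 (ambientDelta l : 𝓔) := ambientDelta_hom (by simp [zwWeight])
    (by simp [zwWeight])
  have h2 : Hom zwWeight 0 (ambientHomotopy l : 𝓔) := ambientHomotopy_hom (by simp [zwWeight])
    (by simp [zwWeight])
  exact Contraction.of_diagonal (w := zwWeight) (δ := ambientDelta l) (η := ambientHomotopy l)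
    (ι := inclTensor U) (π := resTensor U) ambientDelta_fnLinear
    ambientHomotopy_inverse_fnLinear resTensor_inclTensor inclTensor_resTensor
    ambientDelta_inclTensor (ambientDelta_sq hl) (ambientHomotopy_sq hl)
    (ambientDelta_anticommutator hl) h1 h2 ambientDelta_tame.hom ambientHomotopy_tame.hom

/-- Removing the leading part amounts to replacing `1 + z` by `z` in `h` and `S̄†`. In `S̄†` this
extra `z` is what the weight argument gains. -/
theorem ambientCharge_sub_ambientDelta : ambientCharge F - ambientDelta l =
    constraintCharge ghosts
      (ambientBox F)
      (zInv l * ∑ a : Fin d, etaT a • (aD a.castSucc * ambientD F a) - (l ^ 2)⁻¹ • (wD l * zD l))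
      (zInv l * ∑ a : Fin d, aM a.castSucc * ambientD F a + wM l * zD l)
      (∑ A, eta A • (aD A * aD A))
      (∑ A, aM A * aD A - zM l * zD l)
      (zM l * wD l) := by
  have h := constraintCharge_sub_constraintCharge
    (ambientBox F)
    (zInv l * ∑ a : Fin d, etaT a • (aD a.castSucc * ambientD F a) - (l ^ 2)⁻¹ • (wD l * zD l))
    (zInv l * ∑ a : Fin d, aM a.castSucc * ambientD F a + wM l * zD l)
    (∑ A, eta A • (aD A * aD A))
    (∑ A, aM A * aD A - (1 + zM l) * zD l) ((1 + zM l) * wD l)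
    (∑ A, aM A * aD A - zM l * zD l) (zM l * wD l)
  have h' : ambientDelta l = gM 4 * (∑ A, aM A * aD A - (1 + zM l) * zD l -
      (∑ A, aM A * aD A - zM l * zD l)) + gM 5 * ((1 + zM l) * wD l - zM l * wD l : 𝓔) := by
    rw [ambientDelta]
    noncomm_ring
  rw [h', ← h, ambientCharge]
  abel

theorem ambientD_hom {w : Weight Unit (Fin (d + 1))} {α : ℤ} (ha : ∀ i, w.a i = α) (a : Fin d) :
    Hom w 0 (ambientD F a) :=
  (Hom.sum fun m _ => .fn_smul _ (.xD w m)).sub (.sum fun _ _ => .sum fun _ _ => .sum fun _ _ =>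
    .fn_smul _ ((Hom.aM w _).mul (.aD w _) (by rw [ha, ha, add_neg_cancel])))

theorem ambient_perturbation_hasDeg {w : Weight Unit (Fin (d + 1))} {α υ r s t : ℤ}
    (ha : ∀ i, w.a i = α) (hy : w.y () = υ) (hυ : 0 ≤ υ)
    (h1 : r ≤ w.g 0 - 2 * υ) (h2 : r ≤ w.g 1 - α) (h3 : r ≤ w.g 1 - α - υ)
    (h4 : r ≤ α - w.g 2) (h5 : r ≤ α - υ - w.g 2) (h6 : r ≤ w.g 3 - 2 * α) (h7 : r ≤ w.g 4)
    (h8 : r ≤ w.g 5 + υ - α) (h9 : r ≤ w.g 1 - w.g 2 - w.g 0) (h10 : r ≤ w.g 3 - w.g 2 - w.g 1)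
    (h11 : r ≤ w.g 5 + w.g 0 - w.g 1) (h12 : r ≤ w.g 5 + w.g 1 - w.g 3)
    (h13 : r ≤ w.g 5 - w.g 2 - w.g 4) (h14 : t ≤ υ - w.g 4) (h15 : t ≤ α - w.g 5)
    (hs : s ≤ t + r) : HasDeg w s (ambientHomotopy l * fdiag zwWeight (fun x => (x : ℝ)⁻¹) *
      (ambientCharge F - ambientDelta l)) := by
  have wzM : HasDeg w υ (zM l : 𝓔) := by rw [← hy]; exact (Hom.smul _ (Hom.yM w ())).hasDeg
  have wzD : HasDeg w (-υ) (zD l : 𝓔) := by rw [← hy]; exact (Hom.smul _ (Hom.yD w ())).hasDeg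
  have wwM : HasDeg w α (wM l : 𝓔) := by
    rw [← ha (Fin.last d)]; exact (Hom.smul _ (Hom.aM w _)).hasDeg
  have wwD : HasDeg w (-α) (wD l : 𝓔) := by
    rw [← ha (Fin.last d)]; exact (Hom.smul _ (Hom.aD w _)).hasDeg
  have wi : HasDeg w 0 (zInv l : 𝓔) := HasDeg.coefM (fun i => by rw [hy]; exact hυ) _
  have wD := fun a => (ambientD_hom F ha a).hasDeg
  have waM : ∀ A, HasDeg w α (aM A : 𝓔) := fun A => by rw [← ha A]; exact (Hom.aM w A).hasDeg
  have waD : ∀ A, HasDeg w (-α) (aD A : 𝓔) := fun A => by rw [← ha A]; exact (Hom.aD w A).hasDeg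
  have hη : HasDeg w t (ambientHomotopy l : 𝓔) :=
    .add (wzM.mul (Hom.gD w 4).neg.hasDeg (by lia)) (wwM.mul (Hom.gD w 5).hasDeg (by lia))
  refine (hη.mul (Hom.fdiag w _ _).hasDeg (by lia : t ≤ t + 0)).mul ?_ hs
  rw [ambientCharge_sub_ambientDelta]
  refine constraintCharge_hasDeg (.sub (.sub ?_ ?_) ?_) (.sub ?_ ?_) (.add ?_ ?_)
    (.sum fun A _ => .smul _ ?_) (.sub (.sum fun A _ => ?_) ?_) ?_
    (by lia) (by lia) (by lia) (by lia) (by lia) (by lia)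
  · refine (wi.mul wi (by lia : (0 : ℤ) ≤ 0 + 0)).mul (r' := 0) (.sum fun a _ => .smul _ (.sub
      ((wD a).mul (wD a) (by lia)) (.sum fun b _ => .fn_smul _ (wD b)))) (by lia)
  · exact .smul _ (wzD.mul wzD (by lia))
  · exact .smul _ (wi.mul wzD (by lia))
  · exact wi.mul (r' := -α) (.sum fun a _ => .smul _ ((waD _).mul (wD a) (by lia))) (by lia)
  · exact .smul _ (wwD.mul wzD (by lia))
  · exact wi.mul (r' := α) (.sum fun a _ => (waM _).mul (wD a) (by lia)) (by lia)
  · exact wwM.mul wzD (by lia)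
  · exact (waD A).mul (waD A) (by lia)
  · exact (waM A).mul (waD A) (by lia)
  · exact wzM.mul wzD (by lia)
  · exact wzM.mul wwD (by lia)

end AmbientContraction

end AdSHigherSpin

end

noncomputable section
namespace AdSHigherSpin

set_option linter.unusedSimpArgs false

/-! ### Ghost parts of the constraints `S̄†` and `h`. -/

section GhostShifts

variable {d : ℕ} {U : TopologicalSpace.Opens (Fin d → ℝ)} {Y B : Type} {k : ℕ}

local notation "𝓔" => Module.End ℝ (Fock U Y B k)

/-- The ghost part of the constraint `S̄†`: `2 c₀ ∂/∂c† + c† ∂/∂ξ`. -/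
def ghostShift : Module.End ℝ (Fock U Y B k) := (2 : ℝ) • (gM 0 * gD 1) + gM 1 * gD 3

/-- The ghost part of the constraint `h`. -/
def ghostLevel : Module.End ℝ (Fock U Y B k) :=
  (2 : ℝ) • (gM 3 * gD 3) - (2 : ℝ) • (gM 0 * gD 0) - (2 : ℝ) • (gD 2 * gM 2)

theorem Bosonic.comm_ghostShift {A : 𝓔} (h : Bosonic A) : Commute A ghostShift :=
  (((h 0).1.mul_right (h 1).2).smul_right _).add_right ((h 1).1.mul_right (h 3).2)

theorem Bosonic.comm_ghostLevel {A : 𝓔} (h : Bosonic A) : Commute A ghostLevel :=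
  ((((h 3).1.mul_right (h 3).2).smul_right _).sub_right
    (((h 0).1.mul_right (h 0).2).smul_right _)).sub_right
    (((h 2).2.mul_right (h 2).1).smul_right _)

theorem commute_apply {A C : 𝓔} (h : Commute A C) (φ : Fock U Y B k) : A (C φ) = C (A φ) :=
  LinearMap.congr_fun h.eq φ

end GhostShifts

/-! ### Derivatives in `z` and `w` of a lift at `z = w = 0`. -/

section TensorReduction

variable {d : ℕ} {l : ℝ} {U : TopologicalSpace.Opens (Fin d → ℝ)} (F : AdSFrame l U)

local notation "𝓔" => Module.End ℝ (AmbientStates U)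

theorem resTensor_real_smul (c : ℝ) (Ψ : AmbientStates U) :
    resTensor U (c • Ψ) = c • resTensor U Ψ := res_real_smul _ _ _ Ψ c

theorem resTensor_fnM (f : SmoothFn U) (Ψ : AmbientStates U) :
    resTensor U (fnM f Ψ) = fnM f (resTensor U Ψ) := res_fnM _ _ _ Ψ f

theorem resTensor_xD (m : Fin d) (Ψ : AmbientStates U) :
    resTensor U (xD m Ψ) = xD m (resTensor U Ψ) := res_xD _ _ _ Ψ m

theorem resTensor_aM (a : Fin d) (Ψ : AmbientStates U) :
    resTensor U (aM a.castSucc Ψ) = aM a (resTensor U Ψ) := res_aM _ Fin.castSuccEmb _ Ψ a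

theorem resTensor_aD (a : Fin d) (Ψ : AmbientStates U) :
    resTensor U (aD a.castSucc Ψ) = aD a (resTensor U Ψ) := res_aD _ Fin.castSuccEmb _ Ψ a

theorem resTensor_gM {j : ℕ} (hj : j < 4) (Ψ : AmbientStates U) :
    resTensor U (gM j Ψ) = gM j (resTensor U Ψ) := res_gM _ _ _ Ψ hj

theorem resTensor_gD {j : ℕ} (hj : j < 4) (Ψ : AmbientStates U) :
    resTensor U (gD j Ψ) = gD j (resTensor U Ψ) := res_gD _ _ _ Ψ hj

theorem resTensor_gM_of_le {j : ℕ} (hj : 4 ≤ j) (Ψ : AmbientStates U) :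
    resTensor U (gM j Ψ) = 0 := res_gM_of_le _ _ _ Ψ hj

theorem resTensor_wM (Ψ : AmbientStates U) : resTensor U (wM l Ψ) = 0 := by
  have h : resTensor U (aM (Fin.last d) Ψ) = 0 := res_aM_of_notMem _ _ _ Ψ last_notMem_range
  rw [wM, LinearMap.smul_apply, resTensor_real_smul, h, smul_zero]

theorem resTensor_zM (Ψ : AmbientStates U) : resTensor U (zM l Ψ) = 0 := by
  have h : resTensor U (yM () Ψ) = 0 := res_yM_of_notMem _ _ _ Ψ (by rintro ⟨i, -⟩; exact i.elim)
  rw [zM, LinearMap.smul_apply, resTensor_real_smul, h, smul_zero]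

theorem resTensor_one_add_zM (Ψ : AmbientStates U) :
    resTensor U ((1 + zM l : 𝓔) Ψ) = resTensor U Ψ := by
  rw [LinearMap.add_apply, Module.End.one_apply, map_add, resTensor_zM, add_zero]

theorem resTensor_zInv (Ψ : AmbientStates U) : resTensor U (zInv l Ψ) = resTensor U Ψ := by
  rw [← resTensor_one_add_zM (l := l), ← Module.End.mul_apply, one_add_zM_mul_zInv,
    Module.End.one_apply]

theorem resTensor_ghostShift (Ψ : AmbientStates U) :
    resTensor U (ghostShift Ψ) = ghostShift (resTensor U Ψ) := by
  simp only [ghostShift, LinearMap.add_apply, LinearMap.smul_apply, Module.End.mul_apply, map_add,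
    resTensor_real_smul, resTensor_gM, resTensor_gD, Nat.one_lt_ofNat, Nat.ofNat_pos,
    Nat.reduceLT]

theorem resTensor_ghostLevel (Ψ : AmbientStates U) :
    resTensor U (ghostLevel Ψ) = ghostLevel (resTensor U Ψ) := by
  simp only [ghostLevel, LinearMap.sub_apply, LinearMap.smul_apply, Module.End.mul_apply, map_sub,
    resTensor_real_smul, resTensor_gM, resTensor_gD, Nat.one_lt_ofNat, Nat.ofNat_pos,
    Nat.reduceLT]

/-- The covariant derivative with the Lorentz connection only. -/
def lorentzD (a : Fin d) : Module.End ℝ (AmbientStates U) :=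
  ∑ m, F.einv a m • xD m -
    ∑ m, ∑ c : Fin d, ∑ b : Fin d,
      (F.einv a m * F.conn m b c) • (aM c.castSucc * aD b.castSucc)

theorem resTensor_lorentzD (a : Fin d) (Ψ : AmbientStates U) :
    resTensor U (lorentzD F a Ψ) = covD F a (resTensor U Ψ) := by
  simp only [lorentzD, covD, LinearMap.sub_apply, LinearMap.sum_apply, map_sub, map_sum,
    fn_smul_eq, Module.End.mul_apply, resTensor_fnM, resTensor_xD, resTensor_aM, resTensor_aD]

theorem sum_einv_e_smul (a : Fin d) (A : Fin d → 𝓔) :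
    ∑ m, ∑ b, (F.einv a m * F.e m b) • A b = A a := by
  rw [Finset.sum_comm]
  simp only [fn_smul_eq, ← Finset.sum_mul, ← fnM_sum, F.einv_e]
  rw [Finset.sum_eq_single a (fun b _ hb => by rw [if_neg hb.symm, fnM_zero, zero_mul])
    (fun h => absurd (Finset.mem_univ a) h), if_pos rfl, fnM_one, one_mul]

/-- The vielbein part of the connection rotates `a†^a` and `a†^{(d)}` into each other. Contraction
with the inverse vielbein leaves one term of each kind. -/
theorem ambientD_eq (hl : l ≠ 0) (a : Fin d) : ambientD F a =
    lorentzD F a - wM l * aD a.castSucc - ((l ^ 2)⁻¹ * etaT a) • (aM a.castSucc * wD l) := by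
  have h1 : ∑ m, ∑ C, ∑ D, (F.einv a m * F.W m D C) • (aM C * aD D : 𝓔) =
      ∑ m, ∑ c : Fin d, ∑ b : Fin d,
        (F.einv a m * F.conn m b c) • (aM c.castSucc * aD b.castSucc) +
      ∑ m, ∑ c : Fin d, (F.einv a m * F.e m c) •
        ((l⁻¹ * etaT c) • (aM c.castSucc * aD (Fin.last d))) +
      ∑ m, ∑ b : Fin d, (F.einv a m * F.e m b) • (l⁻¹ • (aM (Fin.last d) * aD b.castSucc)) := by
    rw [← Finset.sum_add_distrib, ← Finset.sum_add_distrib]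
    refine Finset.sum_congr rfl fun m _ => ?_
    rw [Fin.sum_univ_castSucc]
    simp only [Fin.sum_univ_castSucc, F.W_castSucc_castSucc, F.W_last_castSucc,
      F.W_castSucc_last, F.W_last_last, mul_zero, Finset.sum_add_distrib, mul_smul_comm]
    rw [fn_smul_eq (0 : SmoothFn U), fnM_zero, zero_mul, add_zero]
    congr 1
    · congr 1
      refine Finset.sum_congr rfl fun c _ => ?_
      rw [fn_smul_eq, fn_smul_eq, fnM_real_smul, smul_mul_assoc, mul_smul_comm]
    · refine Finset.sum_congr rfl fun c _ => ?_
      rw [fn_smul_eq, fn_smul_eq, fnM_real_smul, smul_mul_assoc, mul_smul_comm]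
  rw [ambientD, h1, sum_einv_e_smul F a fun c => (l⁻¹ * etaT c) • (aM c.castSucc * aD (Fin.last d)),
    sum_einv_e_smul F a fun b => l⁻¹ • (aM (Fin.last d) * aD b.castSucc), lorentzD, wM, wD,
    smul_mul_assoc, mul_smul_comm, smul_smul]
  have : (l ^ 2)⁻¹ * etaT a * l = l⁻¹ * etaT a := by field_simp
  rw [this]
  abel

theorem lorentzD_comm_wD (a : Fin d) : Commute (lorentzD F a) (wD l) := by
  refine (Commute.sub_left (Commute.sum_left _ _ _ fun m _ => ?_) (Commute.sum_left _ _ _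
    fun m _ => Commute.sum_left _ _ _ fun C _ => Commute.sum_left _ _ _ fun D _ => ?_)).smul_right _
  · have h1 : Commute (fnM (F.einv a m) : Module.End ℝ (AmbientStates U)) (aD (Fin.last d)) :=
      (FnLinear.aD _ _).symm
    have h2 : Commute (xD m : Module.End ℝ (AmbientStates U)) (aD (Fin.last d)) :=
      (aD_comm_xD _ _).symm
    rw [fn_smul_eq]
    exact Commute.mul_left h1 h2
  · have h1 : Commute (fnM (F.einv a m * F.conn m D C) : Module.End ℝ (AmbientStates U))
        (aD (Fin.last d)) := (FnLinear.aD _ _).symm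
    have h2 : Commute (aM C.castSucc : Module.End ℝ (AmbientStates U)) (aD (Fin.last d)) := by
      have h := aD_mul_aM (U := U) (Y := Unit) (k := 6) (Fin.last d) C.castSucc
      rw [if_neg (Fin.castSucc_ne_last C).symm, add_zero] at h
      exact h.symm
    have h3 : Commute (aD D.castSucc : Module.End ℝ (AmbientStates U)) (aD (Fin.last d)) :=
      aD_comm _ _
    rw [fn_smul_eq]
    exact Commute.mul_left h1 (Commute.mul_left h2 h3)

theorem wD_comm_aM (a : Fin d) : Commute (wD l : 𝓔) (aM a.castSucc) := by
  have h := aD_mul_aM (U := U) (Y := Unit) (k := 6) (Fin.last d) a.castSucc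
  rw [if_neg (Fin.castSucc_ne_last a).symm, add_zero] at h
  exact Commute.smul_left h _

theorem wD_comm_aD (A : Fin (d + 1)) : Commute (wD l : 𝓔) (aD A) := (aD_comm _ _).smul_left _

theorem wD_mul_ambientD (hl : l ≠ 0) (a : Fin d) :
    wD l * ambientD F a = ambientD F a * wD l - aD a.castSucc := by
  have e1 : (wD l * (wM l * aD a.castSucc) : 𝓔) = wM l * aD a.castSucc * wD l + aD a.castSucc := by
    rw [← mul_assoc, wD_mul_wM hl, add_mul, one_mul, mul_assoc, (wD_comm_aD _).eq, mul_assoc]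
  have e2 : (wD l * (aM a.castSucc * wD l) : 𝓔) = aM a.castSucc * wD l * wD l := by
    rw [← mul_assoc, (wD_comm_aM a).eq]
  rw [ambientD_eq F hl, mul_sub, mul_sub, sub_mul, sub_mul, (lorentzD_comm_wD F a).eq, e1,
    mul_smul_comm, smul_mul_assoc, e2]
  abel

theorem resTensor_ambientD (hl : l ≠ 0) (a : Fin d) (Ψ : AmbientStates U) :
    resTensor U (ambientD F a Ψ) = covD F a (resTensor U Ψ) -
      ((l ^ 2)⁻¹ * etaT a) • aM a (resTensor U (wD l Ψ)) := by
  rw [ambientD_eq F hl]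
  simp only [LinearMap.sub_apply, LinearMap.smul_apply, Module.End.mul_apply, map_sub,
    resTensor_real_smul, resTensor_lorentzD, resTensor_wM, resTensor_aM, sub_zero]

/-- The operator that `(1 + z) ∂/∂z` induces on tensor fields. -/
def tensorLevel : Module.End ℝ (TensorStates U 4) := numA + ghostLevel

/-- The number operator of all the variables `a†^A`. -/
def ambientNum : Module.End ℝ (AmbientStates U) := ∑ A, aM A * aD A

theorem resTensor_ambientNum (Ψ : AmbientStates U) :
    resTensor U (ambientNum Ψ) = numA (resTensor U Ψ) := by
  have h : ∀ χ : AmbientStates U, resTensor U (aM (Fin.last d) χ) = 0 := fun χ =>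
    res_aM_of_notMem _ _ _ χ last_notMem_range
  simp only [ambientNum, numA, Fin.sum_univ_castSucc, LinearMap.add_apply, LinearMap.sum_apply,
    Module.End.mul_apply, map_add, map_sum, resTensor_aM, resTensor_aD, h, add_zero]

theorem wD_mul_ambientNum (hl : l ≠ 0) :
    (wD l * ambientNum : 𝓔) = ambientNum * wD l + wD l := by
  rw [ambientNum, Fin.sum_univ_castSucc, mul_add, add_mul, ← wM_mul_wD hl, ← mul_assoc,
    wD_mul_wM hl, add_mul, one_mul]
  have : Commute (wD l : 𝓔) (∑ a : Fin d, aM a.castSucc * aD a.castSucc) :=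
    Commute.sum_right _ _ _ fun a _ => (wD_comm_aM a).mul_right (wD_comm_aD _)
  rw [this.eq]
  abel

theorem zD_comm_ambientNum : Commute (zD l : 𝓔) ambientNum :=
  Commute.sum_right _ _ _ fun A _ => by
    have h1 : Commute (yD () : Module.End ℝ (AmbientStates U)) (aM A) := (aM_comm_yD _ _).symm
    have h2 : Commute (yD () : Module.End ℝ (AmbientStates U)) (aD A) := (aD_comm_yD _ _).symm
    have h3 : Commute (yD () : Module.End ℝ (AmbientStates U)) (aM A * aD A) :=
      Commute.mul_right h1 h2
    exact Commute.smul_left h3 l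

section Lift

variable (hl : l ≠ 0) {Φ : AmbientStates U}
  (hz : (1 + zM l : Module.End ℝ (AmbientStates U)) (zD l Φ) = ambientNum Φ + ghostLevel Φ)
  (hw : (1 + zM l : Module.End ℝ (AmbientStates U)) (wD l Φ) = -ghostShift Φ)

include hw in
-- The hypotheses `hz` and `hw` are the completed constraints `h` and `S̄†` on a state free of `μ`,
-- `ν`. At `z = w = 0` they turn `∂/∂w` into minus the ghost shift and `∂/∂z` into `tensorLevel`;
-- differentiating them once more gives the second derivatives.
theorem resTensor_wD : resTensor U (wD l Φ) = -ghostShift (resTensor U Φ) := by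
  rw [← resTensor_one_add_zM (l := l), hw, map_neg, resTensor_ghostShift]

include hw in
theorem resTensor_wD_wD :
    resTensor U (wD l (wD l Φ)) = ghostShift (ghostShift (resTensor U Φ)) := by
  have h1 : Commute (1 + zM l) (wD l : 𝓔) := (Commute.one_left _).add_left zM_comm_wD
  have h := congrArg (wD l) hw
  rw [← Module.End.mul_apply, ← h1.eq, Module.End.mul_apply, map_neg,
    commute_apply wD_bosonic.comm_ghostShift] at h
  rw [← resTensor_one_add_zM (l := l), h, map_neg, resTensor_ghostShift, resTensor_wD hw, map_neg,
    neg_neg]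

include hz in
theorem resTensor_zD : resTensor U (zD l Φ) = tensorLevel (resTensor U Φ) := by
  rw [← resTensor_one_add_zM (l := l), hz, map_add, resTensor_ghostLevel, resTensor_ambientNum]
  rfl

include hl hz hw in
-- Differentiating `hz` by `w` uses `∂_w N = (N + 1) ∂_w`, which is the source of the `+ 1`.
theorem resTensor_wD_zD : resTensor U (wD l (zD l Φ)) =
    -(tensorLevel + 1 : Module.End ℝ (TensorStates U 4)) (ghostShift (resTensor U Φ)) := by
  have h1 : Commute (1 + zM l) (wD l : 𝓔) := (Commute.one_left _).add_left zM_comm_wD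
  have h := congrArg (wD l) hz
  rw [← Module.End.mul_apply (wD l), ← h1.eq, Module.End.mul_apply, map_add,
    ← Module.End.mul_apply (wD l) ambientNum, commute_apply wD_bosonic.comm_ghostLevel,
    wD_mul_ambientNum hl, LinearMap.add_apply (ambientNum * wD l), Module.End.mul_apply] at h
  rw [← resTensor_one_add_zM (l := l), h, map_add, map_add, resTensor_ghostLevel,
    resTensor_ambientNum, resTensor_wD hw]
  simp only [tensorLevel, LinearMap.add_apply, map_neg, Module.End.one_apply]
  abel

include hl hz in
-- Differentiating `hz` by `z` also hits the factor `1 + z`, which is the source of the `- 1`.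
theorem resTensor_zD_zD : resTensor U (zD l (zD l Φ)) =
    (tensorLevel - 1 : Module.End ℝ (TensorStates U 4)) (tensorLevel (resTensor U Φ)) := by
  have h1 : zD l * (1 + zM l) = (1 + zM l) * zD l + (1 : 𝓔) := by
    rw [mul_add, zD_mul_zM hl]; noncomm_ring
  have h := congrArg (zD l) hz
  rw [← Module.End.mul_apply (zD l), h1, LinearMap.add_apply, Module.End.mul_apply,
    Module.End.one_apply, map_add, commute_apply zD_bosonic.comm_ghostLevel, commute_apply zD_comm_ambientNum,
    ← eq_sub_iff_add_eq] at h
  rw [← resTensor_one_add_zM (l := l), h, map_sub, map_add, resTensor_ghostLevel, resTensor_ambientNum, resTensor_zD hz]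
  rfl

end Lift

end TensorReduction

end AdSHigherSpin

end

noncomputable section
namespace AdSHigherSpin

set_option linter.unusedSimpArgs false

/-! ### Tensor operators and covariant constancy of the oscillators. -/

section TensorOperators

variable {d : ℕ} {l : ℝ} {U : TopologicalSpace.Opens (Fin d → ℝ)} (F : AdSFrame l U) {k : ℕ}

theorem covD_bosonic (a : Fin d) : Bosonic (covD F a : Module.End ℝ (TensorStates U k)) :=
  (Bosonic.sum fun m _ => .fn_smul _ (.xD m)).sub (.sum fun _ _ => .sum fun _ _ => .sum fun _ _ =>
    .fn_smul _ ((Bosonic.aM _).mul (.aD _)))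

theorem covD_tame (a : Fin d) : Tame 0 (covD F a : Module.End ℝ (TensorStates U k)) :=
  (Tame.sum fun m _ => .fn_smul _ (.xD m)).sub (.sum fun _ _ => .sum fun _ _ => .sum fun _ _ =>
    .fn_smul _ ((Tame.aM _).mul₀ (.aD _)))

theorem covBox_bosonic : Bosonic (covBox F : Module.End ℝ (TensorStates U k)) :=
  .sum fun a _ => .real_smul _ (((covD_bosonic F a).mul (covD_bosonic F a)).sub
    (.sum fun b _ => .fn_smul _ (covD_bosonic F b)))

theorem covBox_tame : Tame 0 (covBox F : Module.End ℝ (TensorStates U k)) :=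
  .sum fun a _ => .real_smul _ (((covD_tame F a).mul₀ (covD_tame F a)).sub
    (.sum fun b _ => .fn_smul _ (covD_tame F b)))

theorem divergence_bosonic : Bosonic (divergence F : Module.End ℝ (TensorStates U k)) :=
  .sum fun a _ => .real_smul _ ((Bosonic.aD a).mul (covD_bosonic F a))

theorem divergence_tame : Tame 0 (divergence F : Module.End ℝ (TensorStates U k)) :=
  .sum fun a _ => .real_smul _ ((Tame.aD a).mul₀ (covD_tame F a))

theorem gradient_bosonic : Bosonic (gradient F : Module.End ℝ (TensorStates U k)) :=
  .sum fun a _ => (Bosonic.aM a).mul (covD_bosonic F a)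

theorem gradient_tame : Tame 0 (gradient F : Module.End ℝ (TensorStates U k)) :=
  .sum fun a _ => (Tame.aM a).mul₀ (covD_tame F a)

theorem numA_bosonic : Bosonic (numA : Module.End ℝ (TensorStates U k)) :=
  .sum fun a _ => (Bosonic.aM a).mul (.aD a)

theorem numA_tame : Tame 0 (numA : Module.End ℝ (TensorStates U k)) :=
  .sum fun a _ => (Tame.aM a).mul₀ (.aD a)

theorem aSq_bosonic : Bosonic (aSq : Module.End ℝ (TensorStates U k)) :=
  .sum fun a _ => .real_smul _ ((Bosonic.aM a).mul (.aM a))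

theorem aSq_tame : Tame 0 (aSq : Module.End ℝ (TensorStates U k)) :=
  .sum fun a _ => .real_smul _ ((Tame.aM a).mul₀ (.aM a))

theorem aTrace_bosonic : Bosonic (aTrace : Module.End ℝ (TensorStates U k)) :=
  .sum fun a _ => .real_smul _ ((Bosonic.aD a).mul (.aD a))

theorem aTrace_tame : Tame 0 (aTrace : Module.End ℝ (TensorStates U k)) :=
  .sum fun a _ => .real_smul _ ((Tame.aD a).mul₀ (.aD a))

theorem covD_mul_aM (a e : Fin d) : (covD F a * aM e : Module.End ℝ (TensorStates U k)) =
    aM e * covD F a - ∑ c, (∑ m, F.einv a m * F.conn m e c) • aM c := by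
  have h1 : ∀ m, ((F.einv a m • xD m) * aM e : Module.End ℝ (TensorStates U k)) =
      aM e * (F.einv a m • xD m) := fun m => by
    have h3 : Commute (aM e : Module.End ℝ (TensorStates U k)) (fnM (F.einv a m)) :=
      FnLinear.aM e _
    have h4 : Commute (aM e : Module.End ℝ (TensorStates U k)) (xD m) := aM_comm_xD e m
    rw [fn_smul_eq]
    exact (Commute.mul_right h3 h4).symm.eq
  have h2 : ∀ m c b, (((F.einv a m * F.conn m b c) • (aM c * aD b)) * aM e :
      Module.End ℝ (TensorStates U k)) = aM e * ((F.einv a m * F.conn m b c) • (aM c * aD b)) +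
        if b = e then (F.einv a m * F.conn m b c) • aM c else 0 := fun m c b => by
    rw [fn_smul_eq, mul_assoc, mul_assoc (aM c), aD_mul_aM, mul_add, mul_add, ← mul_assoc (aM c),
      (aM_comm c e).eq, mul_assoc, ← mul_assoc (fnM _), ← (FnLinear.aM e _).eq, mul_assoc]
    split_ifs
    · rw [mul_one, fn_smul_eq]
    · rw [mul_zero, mul_zero]
  rw [covD, sub_mul, mul_sub, Finset.sum_mul, Finset.mul_sum, Finset.sum_congr rfl fun m _ => h1 m]
  simp only [Finset.sum_mul, h2, Finset.sum_add_distrib, Finset.sum_ite_eq', Finset.mem_univ,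
    if_true, Finset.mul_sum]
  rw [sub_add_eq_sub_sub]
  congr 1
  rw [Finset.sum_comm]
  refine Finset.sum_congr rfl fun c _ => ?_
  simp only [fn_smul_eq, fnM_sum, Finset.sum_mul]

theorem AdSFrame.etaT_smul_conn_swap (m a b : Fin d) :
    etaT b • F.conn m b a = -(etaT a • F.conn m a b) := by
  rw [eq_neg_iff_add_eq_zero, add_comm]
  exact F.metric m a b

/-- The oscillator `a†^a` is covariantly constant. -/
theorem sum_covD_aM : ∑ a, (covD F a * aM a - ∑ b, (∑ m, F.einv a m * F.conn m b a) •
      ((etaT a * etaT b) • aM b) : Module.End ℝ (TensorStates U k)) = ∑ a, aM a * covD F a := by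
  refine Finset.sum_congr rfl fun a _ => ?_
  rw [covD_mul_aM, sub_sub, sub_eq_self, ← Finset.sum_add_distrib]
  refine Finset.sum_eq_zero fun c _ => ?_
  rw [fn_smul_eq, fn_smul_eq, mul_smul_comm, ← smul_mul_assoc, ← fnM_real_smul, ← add_mul,
    ← fnM_add]
  suffices h : ∑ m, F.einv a m * F.conn m a c +
      (etaT a * etaT c) • ∑ m, F.einv a m * F.conn m c a = 0 by rw [h, fnM_zero, zero_mul]
  rw [Finset.smul_sum, ← Finset.sum_add_distrib]
  refine Finset.sum_eq_zero fun m _ => ?_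
  rw [← mul_smul_comm, ← mul_add, mul_smul, F.etaT_smul_conn_swap, smul_neg, smul_smul,
    etaT_mul_self, one_smul, add_neg_cancel, mul_zero]

end TensorOperators

section

variable {R : Type*} [Ring R] [Algebra ℝ R]

/-- The algebra of a single direction in the d'Alembertian, with `c = l⁻²`, `e = η_a`, `D = D_a`,
`a` the oscillator, `s` the ghost shift, `t` the annihilation operator, and `X`, `Y` the connection
sums. `D` and `a` do not commute, so `D a - Y` is kept together for `sum_covD_aM`. -/
theorem smul_box_identity {c e : ℝ} (he : e * e = 1) (D a s t X Y : R) :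
    e • (D * (D + (c * e) • (a * s)) + (c * e) • (a * (D * s + (c * e) • (a * (s * s)) + t)) -
      (X + (c * e) • (Y * s))) =
    e • (D * D - X) + c • ((D * a - Y) * s + a * D * s + a * t + c • (e • (a * a) * (s * s))) := by
  have h1 : e * (c * e) = c := by linear_combination c * he
  have h2 : e * (c * e * (c * e)) = c * c * e := by linear_combination c ^ 2 * e * he
  simp only [mul_add, mul_smul_comm, sub_mul, smul_mul_assoc, mul_assoc, smul_add, smul_sub,
    smul_smul, h1]
  module

end

/-! ### The constraints on a lift, expressed in intrinsic coordinates. -/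

section TensorReduction

variable {d : ℕ} {l : ℝ} {U : TopologicalSpace.Opens (Fin d → ℝ)} (F : AdSFrame l U)

local notation "𝓔" => Module.End ℝ (TensorStates U 4)

section Lift

variable (hl : l ≠ 0) {Φ : AmbientStates U}
  (hz : (1 + zM l : Module.End ℝ (AmbientStates U)) (zD l Φ) = ambientNum Φ + ghostLevel Φ)
  (hw : (1 + zM l : Module.End ℝ (AmbientStates U)) (wD l Φ) = -ghostShift Φ)

include hl hw in
theorem resTensor_ambientD_lift (a : Fin d) : resTensor U (ambientD F a Φ) =
    (covD F a + ((l ^ 2)⁻¹ * etaT a) • (aM a * ghostShift) : 𝓔) (resTensor U Φ) := by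
  rw [resTensor_ambientD F hl, resTensor_wD hw, map_neg, smul_neg, sub_neg_eq_add]
  rfl

include hl hw in
-- Restricting `𝒟_a` costs a term with `∂/∂w`, and `∂_w` acting on `𝒟_a Φ` yields an additional
-- `∂/∂a†^a` by `wD_mul_ambientD`. Summed over `a`, this last term becomes the isolated `N_{a†}` in
-- the d'Alembertian.
theorem resTensor_ambientD_ambientD (a : Fin d) : resTensor U (ambientD F a (ambientD F a Φ)) =
    (covD F a * (covD F a + ((l ^ 2)⁻¹ * etaT a) • (aM a * ghostShift)) +
      ((l ^ 2)⁻¹ * etaT a) • (aM a * (covD F a * ghostShift +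
        ((l ^ 2)⁻¹ * etaT a) • (aM a * (ghostShift * ghostShift)) + aD a)) : 𝓔)
      (resTensor U Φ) := by
  rw [resTensor_ambientD F hl, resTensor_ambientD_lift F hl hw, ← Module.End.mul_apply (wD l),
    wD_mul_ambientD F hl, LinearMap.sub_apply, map_sub, Module.End.mul_apply,
    resTensor_ambientD F hl, resTensor_wD hw, resTensor_wD_wD hw, resTensor_aD]
  simp only [LinearMap.add_apply, LinearMap.smul_apply, Module.End.mul_apply, map_add, map_sub,
    map_neg, map_smul, smul_sub, smul_neg, smul_add]
  abel

include hl hz hw in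
theorem resTensor_ambientBox : resTensor U (ambientBox F Φ) =
    (covBox F + (l ^ 2)⁻¹ • ((2 : ℝ) • (gradient F * ghostShift) + numA +
      (l ^ 2)⁻¹ • (aSq * (ghostShift * ghostShift)) - (tensorLevel - 1) * tensorLevel -
        (d : ℝ) • tensorLevel) : 𝓔) (resTensor U Φ) := by
  have h1 : ∑ a, etaT a • ((covD F a * (covD F a + ((l ^ 2)⁻¹ * etaT a) • (aM a * ghostShift)) +
      ((l ^ 2)⁻¹ * etaT a) • (aM a * (covD F a * ghostShift +
        ((l ^ 2)⁻¹ * etaT a) • (aM a * (ghostShift * ghostShift)) + aD a))) -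
      ∑ b, (∑ m, F.einv a m * F.conn m b a) •
        (covD F b + ((l ^ 2)⁻¹ * etaT b) • (aM b * ghostShift)) : 𝓔) =
      covBox F + (l ^ 2)⁻¹ • ((2 : ℝ) • (gradient F * ghostShift) + numA +
        (l ^ 2)⁻¹ • (aSq * (ghostShift * ghostShift))) := by
    have key : ∀ a, etaT a • ((covD F a * (covD F a + ((l ^ 2)⁻¹ * etaT a) • (aM a * ghostShift)) +
        ((l ^ 2)⁻¹ * etaT a) • (aM a * (covD F a * ghostShift +
          ((l ^ 2)⁻¹ * etaT a) • (aM a * (ghostShift * ghostShift)) + aD a))) -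
        ∑ b, (∑ m, F.einv a m * F.conn m b a) •
          (covD F b + ((l ^ 2)⁻¹ * etaT b) • (aM b * ghostShift)) : 𝓔) =
        etaT a • (covD F a * covD F a - ∑ b, (∑ m, F.einv a m * F.conn m b a) • covD F b) +
        (l ^ 2)⁻¹ • ((covD F a * aM a - ∑ b, (∑ m, F.einv a m * F.conn m b a) •
          ((etaT a * etaT b) • aM b)) * ghostShift + aM a * covD F a * ghostShift + aM a * aD a +
          (l ^ 2)⁻¹ • (etaT a • (aM a * aM a) * (ghostShift * ghostShift))) := fun a => by
      have e2 : ∑ b, ((∑ m, F.einv a m * F.conn m b a) •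
          (covD F b + ((l ^ 2)⁻¹ * etaT b) • (aM b * ghostShift)) : 𝓔) =
          ∑ b, (∑ m, F.einv a m * F.conn m b a) • covD F b + ((l ^ 2)⁻¹ * etaT a) •
            ((∑ b, (∑ m, F.einv a m * F.conn m b a) • ((etaT a * etaT b) • aM b)) *
              ghostShift) := by
        rw [Finset.sum_mul, Finset.smul_sum, ← Finset.sum_add_distrib]
        refine Finset.sum_congr rfl fun b _ => ?_
        rw [fn_smul_eq, fn_smul_eq, fn_smul_eq, mul_add, mul_smul_comm, mul_smul_comm,
          smul_mul_assoc, smul_smul, mul_assoc, mul_assoc, ← mul_assoc (etaT a), etaT_mul_self,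
          one_mul]
      rw [e2, smul_box_identity (etaT_mul_self a)]
    rw [Finset.sum_congr rfl fun a _ => key a, Finset.sum_add_distrib, ← Finset.smul_sum,
      Finset.sum_add_distrib, Finset.sum_add_distrib, Finset.sum_add_distrib, ← Finset.sum_mul,
      sum_covD_aM, ← Finset.sum_mul, ← Finset.smul_sum, ← Finset.sum_mul, two_smul, covBox,
      gradient, numA, aSq]
  rw [ambientBox]
  simp only [LinearMap.sub_apply (_ - _), LinearMap.sub_apply (zInv l * zInv l * _),
    LinearMap.smul_apply, Module.End.mul_apply, map_sub,
    resTensor_real_smul, resTensor_zInv, resTensor_zD hz, resTensor_zD_zD hl hz]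
  have h2 : resTensor U ((∑ a, etaT a • (ambientD F a * ambientD F a -
      ∑ b, (∑ m, F.einv a m * F.conn m b a) • ambientD F b) : Module.End ℝ (AmbientStates U)) Φ) =
      (covBox F + (l ^ 2)⁻¹ • ((2 : ℝ) • (gradient F * ghostShift) + numA +
        (l ^ 2)⁻¹ • (aSq * (ghostShift * ghostShift))) : 𝓔) (resTensor U Φ) := by
    rw [← h1]
    simp only [LinearMap.sum_apply, LinearMap.smul_apply, LinearMap.sub_apply, map_sum, map_sub,
      resTensor_real_smul, fn_smul_eq, Module.End.mul_apply (fnM _), resTensor_fnM,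
      resTensor_ambientD_lift F hl hw, Module.End.mul_apply (ambientD F _),
      resTensor_ambientD_ambientD F hl hw]
  rw [h2]
  simp only [LinearMap.add_apply, LinearMap.sub_apply, LinearMap.smul_apply, Module.End.mul_apply,
    smul_sub, smul_add, smul_smul]
  rw [mul_comm (d : ℝ)]
  abel

include hl hz hw in
-- `∂/∂a†_a` passing the oscillator in the correction to `𝒟_a` gives `N + d`; the term `-l⁻² ∂_w
-- ∂_z` adds `tensorLevel + 1`.
theorem resTensor_ambientS : resTensor U ((zInv l * ∑ a : Fin d, etaT a •
      (aD a.castSucc * ambientD F a) - (l ^ 2)⁻¹ • (wD l * zD l) :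
        Module.End ℝ (AmbientStates U)) Φ) =
    (divergence F + (l ^ 2)⁻¹ • ((numA + (d : ℝ) • 1 + (tensorLevel + 1)) * ghostShift) : 𝓔)
      (resTensor U Φ) := by
  have h1 : ∑ a, etaT a • (aD a * (covD F a + ((l ^ 2)⁻¹ * etaT a) • (aM a * ghostShift)) : 𝓔) =
      divergence F + (l ^ 2)⁻¹ • ((numA + (d : ℝ) • 1) * ghostShift) := by
    have key : ∀ a, etaT a • (aD a * (covD F a + ((l ^ 2)⁻¹ * etaT a) • (aM a * ghostShift)) : 𝓔) =
        etaT a • (aD a * covD F a) + (l ^ 2)⁻¹ • ((aM a * aD a + 1) * ghostShift) := fun a => by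
      have h := aD_mul_aM (U := U) (Y := Empty) (k := 4) a a
      rw [if_pos rfl] at h
      rw [← h, mul_add, smul_add, mul_smul_comm, smul_smul, mul_left_comm, etaT_mul_self, mul_one,
        mul_assoc]
    rw [Finset.sum_congr rfl fun a _ => key a, Finset.sum_add_distrib, ← Finset.smul_sum,
      ← Finset.sum_mul, Finset.sum_add_distrib, Finset.sum_const, Finset.card_univ,
      Fintype.card_fin, ← Nat.cast_smul_eq_nsmul ℝ, divergence, numA]
  have h2 : resTensor U ((∑ a : Fin d, etaT a • (aD a.castSucc * ambientD F a) :
      Module.End ℝ (AmbientStates U)) Φ) = (divergence F + (l ^ 2)⁻¹ •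
        ((numA + (d : ℝ) • 1) * ghostShift) : 𝓔) (resTensor U Φ) := by
    rw [← h1]
    simp only [LinearMap.sum_apply, LinearMap.smul_apply, map_sum, resTensor_real_smul,
      resTensor_ambientD_lift F hl hw, Module.End.mul_apply (aD _), resTensor_aD]
  rw [LinearMap.sub_apply, map_sub, Module.End.mul_apply, resTensor_zInv, h2, LinearMap.smul_apply,
    resTensor_real_smul, Module.End.mul_apply, resTensor_wD_zD hl hz hw, smul_neg, sub_neg_eq_add,
    add_mul _ (tensorLevel + 1), smul_add, ← add_assoc, LinearMap.add_apply (divergence F + _)]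
  rfl

include hl hw in
theorem resTensor_ambientSd : resTensor U ((zInv l * ∑ a : Fin d, aM a.castSucc * ambientD F a +
      wM l * zD l : Module.End ℝ (AmbientStates U)) Φ) =
    (gradient F + (l ^ 2)⁻¹ • (aSq * ghostShift) : 𝓔) (resTensor U Φ) := by
  have h1 : ∑ a, (aM a * (covD F a + ((l ^ 2)⁻¹ * etaT a) • (aM a * ghostShift)) : 𝓔) =
      gradient F + (l ^ 2)⁻¹ • (aSq * ghostShift) := by
    rw [gradient, aSq, Finset.sum_mul, Finset.smul_sum, ← Finset.sum_add_distrib]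
    refine Finset.sum_congr rfl fun a _ => ?_
    rw [mul_add, mul_smul_comm, smul_mul_assoc, smul_smul, mul_assoc]
  rw [← h1, LinearMap.add_apply, map_add, Module.End.mul_apply, resTensor_zInv,
    Module.End.mul_apply, resTensor_wM, add_zero]
  simp only [LinearMap.sum_apply, map_sum, resTensor_ambientD_lift F hl hw,
    Module.End.mul_apply (aM _), resTensor_aM]

include hl hw in
theorem resTensor_ambientT :
    resTensor U ((∑ A, eta A • (aD A * aD A) : Module.End ℝ (AmbientStates U)) Φ) =
      (aTrace - (l ^ 2)⁻¹ • (ghostShift * ghostShift) : 𝓔) (resTensor U Φ) := by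
  have h : resTensor U (aD (Fin.last d) (aD (Fin.last d) Φ)) =
      (l ^ 2)⁻¹ • ghostShift (ghostShift (resTensor U Φ)) := by
    rw [← resTensor_wD_wD hw]
    simp only [wD, LinearMap.smul_apply, map_smul, resTensor_real_smul, smul_smul]
    rw [show (l ^ 2)⁻¹ * (l * l) = 1 by field_simp, one_smul]
  simp only [LinearMap.sum_apply, map_sum, Fin.sum_univ_castSucc, LinearMap.smul_apply,
    Module.End.mul_apply, resTensor_real_smul, resTensor_aD, h, eta_last, aTrace,
    LinearMap.sub_apply, neg_one_smul, etaT, map_sub, map_sum, resTensor_real_smul, resTensor_aD, h, ← sub_eq_add_neg]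

end Lift

end TensorReduction

end AdSHigherSpin

end

noncomputable section
namespace AdSHigherSpin

set_option linter.unusedSimpArgs false

/-! ### The intrinsic operator in a form with explicit real coefficients. -/

section HatCharge

variable {d : ℕ} {l : ℝ} {U : TopologicalSpace.Opens (Fin d → ℝ)} (F : AdSFrame l U) {k : ℕ}

local notation "𝓔" => Module.End ℝ (TensorStates U k)

theorem natCast_eq_smul_one (n : ℕ) : (n : 𝓔) = (n : ℝ) • 1 := by
  rw [Nat.cast_smul_eq_nsmul, nsmul_one]

theorem ofNat_eq_smul_one (n : ℕ) [n.AtLeastTwo] :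
    (OfNat.ofNat n : 𝓔) = (OfNat.ofNat n : ℝ) • 1 := natCast_eq_smul_one n

theorem hatCharge_eq : (hatCharge F k : 𝓔) =
    gM 0 * (covBox F + (l ^ 2)⁻¹ • (numA + (2 : ℝ) • (gM 1 * gD 3 * gradient F) +
      ((3 - d : ℝ) • 1 - numA - (2 : ℝ) • (gM 2 * gD 2) - (2 : ℝ) • (gM 3 * gD 3)) *
        (numA - (2 : ℝ) • 1 + (2 : ℝ) • (gM 2 * gD 2) + (2 : ℝ) • (gM 3 * gD 3)))) +
    gM 1 * (divergence F + (l ^ 2)⁻¹ • ((2 : ℝ) • (gM 0 * gD 1 * ((2 : ℝ) • numA +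
      (d - 3 : ℝ) • 1 + (2 : ℝ) • (gM 2 * gD 2) + (2 : ℝ) • (gM 3 * gD 3))))) +
    (gradient F + (l ^ 2)⁻¹ • (aSq * (gM 1 * gD 3 + (2 : ℝ) • (gM 0 * gD 1)))) * gD 2 -
    gM 1 * gD 2 * gD 0 +
    gM 3 * (aTrace - (2 : ℝ) • (gD 2 * gD 1) - (l ^ 2)⁻¹ • ((2 : ℝ) • (gM 0 *
      (1 - (2 : ℝ) • (gM 1 * gD 1)) * gD 3))) := by
  simp only [hatCharge, hatBox, hatS, hatSd, hatT, ghosts, natCast_eq_smul_one, ofNat_eq_smul_one,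
    smul_mul_assoc, one_mul, sub_smul, add_sub_assoc]

theorem hatCharge_tame : Tame 1 (hatCharge F k : 𝓔) := by
  rw [hatCharge_eq]
  have g0 : Tame 1 (gM 0 : 𝓔) := .gM rfl
  have g1 : Tame 1 (gM 1 : 𝓔) := .gM rfl
  have g2 : Tame (-1) (gM 2 : 𝓔) := .gM rfl
  have g3 : Tame 1 (gM 3 : 𝓔) := .gM rfl
  have d0 : Tame (-1) (gD 0 : 𝓔) := .gD rfl
  have d1 : Tame (-1) (gD 1 : 𝓔) := .gD rfl
  have d2 : Tame 1 (gD 2 : 𝓔) := .gD rfl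
  have d3 : Tame (-1) (gD 3 : 𝓔) := .gD rfl
  have n2 : Tame 0 (gM 2 * gD 2 : 𝓔) := g2.mul d2 rfl
  have n3 : Tame 0 (gM 3 * gD 3 : 𝓔) := g3.mul d3 rfl
  have n1 : Tame 0 (gM 1 * gD 1 : 𝓔) := g1.mul d1 rfl
  have m13 : Tame 0 (gM 1 * gD 3 : 𝓔) := g1.mul d3 rfl
  have m01 : Tame 0 (gM 0 * gD 1 : 𝓔) := g0.mul d1 rfl
  have o : ∀ c : ℝ, Tame 0 (c • 1 : 𝓔) := fun c => .real_smul _ .one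
  have tB : Tame 0 (covBox F + (l ^ 2)⁻¹ • (numA + (2 : ℝ) • (gM 1 * gD 3 * gradient F) +
      ((3 - d : ℝ) • 1 - numA - (2 : ℝ) • (gM 2 * gD 2) - (2 : ℝ) • (gM 3 * gD 3)) *
        (numA - (2 : ℝ) • 1 + (2 : ℝ) • (gM 2 * gD 2) + (2 : ℝ) • (gM 3 * gD 3))) : 𝓔) :=
    .add (covBox_tame F) (.real_smul _ (.add (numA_tame.add (.real_smul _ (m13.mul₀
      (gradient_tame F)))) (.mul₀ (.sub (.sub ((o _).sub numA_tame) (.real_smul _ n2))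
      (.real_smul _ n3)) (.add (.add (numA_tame.sub (o _)) (.real_smul _ n2)) (.real_smul _ n3)))))
  have tS : Tame 0 (divergence F + (l ^ 2)⁻¹ • ((2 : ℝ) • (gM 0 * gD 1 * ((2 : ℝ) • numA +
      (d - 3 : ℝ) • 1 + (2 : ℝ) • (gM 2 * gD 2) + (2 : ℝ) • (gM 3 * gD 3)))) : 𝓔) :=
    .add (divergence_tame F) (.real_smul _ (.real_smul _ (m01.mul₀ (.add (.add (.add
      (.real_smul _ numA_tame) (o _)) (.real_smul _ n2)) (.real_smul _ n3)))))
  have tG : Tame 0 (gradient F + (l ^ 2)⁻¹ • (aSq * (gM 1 * gD 3 + (2 : ℝ) • (gM 0 * gD 1))) : 𝓔) :=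
    .add (gradient_tame F) (.real_smul _ (aSq_tame.mul₀ (m13.add (.real_smul _ m01))))
  have tC : Tame 1 (gM 1 * gD 2 * gD 0 : 𝓔) := (g1.mul d2 (t := 2) rfl).mul d0 rfl
  have tT : Tame 0 (aTrace - (2 : ℝ) • (gD 2 * gD 1) - (l ^ 2)⁻¹ • ((2 : ℝ) • (gM 0 *
      (1 - (2 : ℝ) • (gM 1 * gD 1)) * gD 3)) : 𝓔) :=
    .sub (aTrace_tame.sub (.real_smul _ (d2.mul d1 rfl))) (.real_smul _ (.real_smul _
      ((g0.mul (t := 1) (Tame.one.sub (.real_smul _ n1)) rfl).mul d3 rfl)))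
  exact .add (.sub (.add (.add (g0.mul tB rfl) (g1.mul tS rfl)) (tG.mul d2 rfl)) tC)
    (g3.mul tT rfl)

end HatCharge

/-! ### The reduction to intrinsic coordinates. -/

section TensorReduction

variable {d : ℕ} {l : ℝ} {U : TopologicalSpace.Opens (Fin d → ℝ)} (F : AdSFrame l U)

local notation "𝓔" => Module.End ℝ (TensorStates U 4)

/-- The right-hand side is the charge as it comes out of the reduction. The square of the ghost
shift is `2c₀(1 - 2c†∂_{c†})∂_ξ`: it is killed by the `c₀` in front of the d'Alembertian and gives
the `l⁻²` term of `𝒯̂`. -/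
theorem hatCharge_four_eq : (hatCharge F 4 : 𝓔) =
    gM 0 * (covBox F + (l ^ 2)⁻¹ • ((2 : ℝ) • (gradient F * ghostShift) + numA +
      (l ^ 2)⁻¹ • (aSq * (ghostShift * ghostShift)) - (tensorLevel - 1) * tensorLevel -
        (d : ℝ) • tensorLevel)) +
    gM 1 * (divergence F + (l ^ 2)⁻¹ • ((numA + (d : ℝ) • 1 + (tensorLevel + 1)) * ghostShift)) +
    gD 2 * (gradient F + (l ^ 2)⁻¹ • (aSq * ghostShift)) +
    gM 3 * (aTrace - (l ^ 2)⁻¹ • (ghostShift * ghostShift)) -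
    gM 1 * gD 2 * gD 0 - (2 : ℝ) • (gM 3 * gD 2 * gD 1) := by
  have bB : Bosonic (covBox F : 𝓔) := covBox_bosonic F
  have bS : Bosonic (divergence F : 𝓔) := divergence_bosonic F
  have bG : Bosonic (gradient F : 𝓔) := gradient_bosonic F
  have bN : Bosonic (numA : 𝓔) := numA_bosonic
  have bA : Bosonic (aSq : 𝓔) := aSq_bosonic
  have bT : Bosonic (aTrace : 𝓔) := aTrace_bosonic
  rw [hatCharge_eq]
  simp only [tensorLevel, ghostLevel, ghostShift, mul_assoc, mul_add, add_mul, mul_sub,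
    sub_mul, smul_mul_assoc, mul_smul_comm, bB.mul_gM, bB.mul_gD, bB.mul_gM_assoc,
    bB.mul_gD_assoc, bS.mul_gM, bS.mul_gD, bS.mul_gM_assoc,
    bS.mul_gD_assoc, bG.mul_gM, bG.mul_gD, bG.mul_gM_assoc,
    bG.mul_gD_assoc, bN.mul_gM, bN.mul_gD, bN.mul_gM_assoc,
    bN.mul_gD_assoc, bA.mul_gM, bA.mul_gD, bA.mul_gM_assoc,
    bA.mul_gD_assoc, bT.mul_gM, bT.mul_gD, bT.mul_gM_assoc,
    bT.mul_gD_assoc, gM_swap, gM_swap_assoc, gM_sq, gM_sq_assoc, gD_swap, gD_swap_assoc, gD_sq,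
    gD_sq_assoc, gD_gM_swap_assoc, gD_mul_gM_of_ne, gD_mul_gM_self, gD_gM_self_assoc, mul_neg,
    neg_mul, neg_neg, smul_neg, mul_zero, zero_mul, smul_zero, neg_zero, add_zero, zero_add,
    sub_zero, zero_sub, mul_one, one_mul, Nat.reduceLT, ne_eq, Nat.reduceEqDiff, not_false_eq_true,
    OfNat.ofNat_ne_zero, OfNat.zero_ne_ofNat, OfNat.ofNat_ne_one, OfNat.one_ne_ofNat, zero_ne_one,
    one_ne_zero, smul_smul, smul_add, smul_sub, Nat.ofNat_pos, Nat.one_lt_ofNat, Nat.lt_one_iff,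
    zero_lt_one]
  module

theorem resTensor_constraintCharge {Box S Sd T h Sb : Module.End ℝ (AmbientStates U)}
    (bSd : Bosonic Sd) (Φ : AmbientStates U) :
    resTensor U (constraintCharge ghosts Box S Sd T h Sb Φ) =
      gM 0 (resTensor U (Box Φ)) + gM 1 (resTensor U (S Φ)) + gD 2 (resTensor U (Sd Φ)) +
        gM 3 (resTensor U (T Φ)) - gM 1 (gD 2 (gD 0 (resTensor U Φ))) -
          (2 : ℝ) • gM 3 (gD 2 (gD 1 (resTensor U Φ))) := by
  have p0 : ∀ Ψ : AmbientStates U, resTensor U (gM 4 Ψ) = 0 := resTensor_gM_of_le le_rfl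
  have p1 : ∀ Ψ : AmbientStates U, resTensor U (gM 5 Ψ) = 0 := resTensor_gM_of_le (by norm_num)
  simp only [constraintCharge, ghosts, two_mul_eq_smul, (bSd 2).2.eq, LinearMap.add_apply,
    LinearMap.sub_apply, LinearMap.smul_apply, Module.End.mul_apply, map_add, map_sub,
    resTensor_real_smul, p0, p1, resTensor_gM, resTensor_gD, Nat.one_lt_ofNat, Nat.ofNat_pos,
    Nat.reduceLT, smul_zero, add_zero, sub_zero]

theorem ambientSd_bosonic : Bosonic (zInv l * ∑ a : Fin d, aM a.castSucc * ambientD F a +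
    wM l * zD l : Module.End ℝ (AmbientStates U)) :=
  .add ((Bosonic.coefM _).mul (.sum fun a _ => (Bosonic.aM _).mul (ambientD_bosonic F a)))
    (wM_bosonic.mul zD_bosonic)

theorem resTensor_ambientCharge (hl : l ≠ 0) {Φ : AmbientStates U}
    (hz : (1 + zM l : Module.End ℝ (AmbientStates U)) (zD l Φ) = ambientNum Φ + ghostLevel Φ)
    (hw : (1 + zM l : Module.End ℝ (AmbientStates U)) (wD l Φ) = -ghostShift Φ) :
    resTensor U (ambientCharge F Φ) = hatCharge F 4 (resTensor U Φ) := by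
  rw [hatCharge_four_eq, ambientCharge, resTensor_constraintCharge (ambientSd_bosonic F),
    resTensor_ambientBox F hl hz hw,
    resTensor_ambientS F hl hz hw, resTensor_ambientSd F hl hw, resTensor_ambientT hl hw]
  rfl

theorem ambientBox_bosonic : Bosonic (ambientBox F) :=
  .sub (.sub (((Bosonic.coefM _).mul (.coefM _)).mul (.sum fun a _ => .real_smul _
    (((ambientD_bosonic F a).mul (ambientD_bosonic F a)).sub
      (.sum fun b _ => .fn_smul _ (ambientD_bosonic F b)))))
    (.real_smul _ (zD_bosonic.mul zD_bosonic)))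
    (.real_smul _ ((Bosonic.coefM _).mul zD_bosonic))

theorem ambientS_bosonic : Bosonic (zInv l * ∑ a : Fin d, etaT a • (aD a.castSucc * ambientD F a) -
    (l ^ 2)⁻¹ • (wD l * zD l) : Module.End ℝ (AmbientStates U)) :=
  .sub ((Bosonic.coefM _).mul (.sum fun a _ => .real_smul _ ((Bosonic.aD _).mul
    (ambientD_bosonic F a)))) (.real_smul _ (wD_bosonic.mul zD_bosonic))

theorem ambientNum_bosonic : Bosonic (ambientNum : Module.End ℝ (AmbientStates U)) :=
  .sum fun A _ => (Bosonic.aM A).mul (.aD A)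

theorem eta_trace_bosonic :
    Bosonic (∑ A, eta A • (aD A * aD A) : Module.End ℝ (AmbientStates U)) :=
  .sum fun A _ => .real_smul _ ((Bosonic.aD A).mul (.aD A))

theorem one_add_zM_bosonic : Bosonic (1 + zM l : Module.End ℝ (AmbientStates U)) :=
  Bosonic.one.add zM_bosonic

theorem gD_four_mul_ambientCharge : gD 4 * ambientCharge F =
    ambientNum - (1 + zM l) * zD l + ghostLevel + (2 : ℝ) • (gM 5 * gD 5) -
      ambientCharge F * gD 4 := by
  have h := gD_four_mul_constraintCharge le_rfl (ambientBox_bosonic F) (ambientS_bosonic F)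
    (ambientSd_bosonic F) eta_trace_bosonic
    (ambientNum_bosonic.sub (one_add_zM_bosonic.mul zD_bosonic) : Bosonic (_ - (1 + zM l) * zD l))
    (one_add_zM_bosonic.mul wD_bosonic : Bosonic ((1 + zM l) * wD l))
  rw [ambientCharge, ← ambientNum, h, ghostLevel]
  abel

theorem gD_five_mul_ambientCharge : gD 5 * ambientCharge F =
    (1 + zM l) * wD l + ghostShift + gD 2 * gD 4 - (2 : ℝ) • (gM 4 * gD 5) -
      ambientCharge F * gD 5 := by
  have h := gD_five_mul_constraintCharge le_rfl (ambientBox_bosonic F) (ambientS_bosonic F)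
    (ambientSd_bosonic F) eta_trace_bosonic
    (ambientNum_bosonic.sub (one_add_zM_bosonic.mul zD_bosonic) : Bosonic (_ - (1 + zM l) * zD l))
    (one_add_zM_bosonic.mul wD_bosonic : Bosonic ((1 + zM l) * wD l))
  rw [ambientCharge, ← ambientNum, h, ghostShift]
  abel

/-- The intermediate system is consistently reduced to the system in intrinsic coordinates. -/
theorem ambient_reduction (hl : l ≠ 0) :
    ConsistentReduction fil ghostNumber (ambientCharge F) fil (inclTensor U) (hatCharge F 4) ∧
      (hatCharge F 4 * hatCharge F 4 : 𝓔) = 0 := by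
  have tη : Tame (-1) (ambientHomotopy l * fdiag zwWeight fun x => (x : ℝ)⁻¹ :
      Module.End ℝ (AmbientStates U)) := ambientHomotopy_tame.mul (tame_inverse _ _) rfl
  let w (α υ γ₁ γ₃ γ₄ γ₅ : ℤ) : Weight Unit (Fin (d + 1)) :=
    ⟨fun j => if j = 1 then γ₁ else if j = 3 then γ₃ else if j = 4 then γ₄ else
      if j = 5 then γ₅ else 0, fun _ => α, fun _ => υ⟩
  have h0 := (ambientCharge_isBRSTSystem F hl).nilpotent
  -- For `w₁` the homotopy gains at least `5` and the remaining charge loses at most `4`; the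
  -- extremes are `Box`, the constraint `h`, and the cubic terms of `ν` with `c₀∂_{c†}` and `c†∂_ξ`,
  -- which force graded weights for `c†` and `ξ`. For `w₂` the homotopy gains `1` and the charge
  -- loses at most `1`.
  obtain ⟨K, hπ, hw, hΩ, hred⟩ := (ambient_contraction (U := U) hl).exists_lift
    (Ω := ambientCharge F)
    (fE := fil) (incl_filContinuous _ _ _) (res_filContinuous _ _ _) ambientDelta_tame tη
    (ambientCharge_tame F) (w₁ := w 0 2 (-1) (-2) (-4) (-5)) (w₂ := w (-1) 0 (-1) (-2) (-1) (-2))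
    (c := 2)
    (ambient_perturbation_hasDeg F (r := -4) (s := 1) (t := 5) (fun _ => rfl) rfl (by norm_num)
      (by simp [w]) (by simp [w]) (by simp [w]) (by simp [w]) (by simp [w]) (by simp [w])
      (by simp [w]) (by simp [w]) (by simp [w]) (by simp [w]) (by simp [w]) (by simp [w])
      (by simp [w]) (by simp [w]) (by simp [w]) (by norm_num))
    (fun _ => rfl) (fun _ => by simp [w]) (fun _ => le_rfl)
    (ambient_perturbation_hasDeg F (r := -1) (s := 0) (t := 1) (fun _ => rfl) rfl le_rfl
      (by simp [w]) (by simp [w]) (by simp [w]) (by simp [w]) (by simp [w]) (by simp [w])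
      (by simp [w]) (by simp [w]) (by simp [w]) (by simp [w]) (by simp [w]) (by simp [w])
      (by simp [w]) (by simp [w]) (by simp [w]) (by norm_num))
    (fun _ => rfl) (fun _ => le_rfl)
  have h3 := ambient_perturbation_hasDeg F (w := w 0 0 0 0 (-1) (-1)) (r := -1) (s := 0) (t := 1)
    (fun _ => rfl) rfl le_rfl
      (by simp [w]) (by simp [w]) (by simp [w]) (by simp [w]) (by simp [w]) (by simp [w])
      (by simp [w]) (by simp [w]) (by simp [w]) (by simp [w]) (by simp [w]) (by simp [w])
      (by simp [w]) (by simp [w]) (by simp [w]) (by norm_num)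
  have hK : ∀ φ, K φ ∈ wtFil (w 0 0 0 0 (-1) (-1)) 0 := fun φ => hw _ h3 φ fun S β n hn => by
    by_contra hne
    obtain ⟨⟨S', rfl⟩, -⟩ := exists_of_coeff_incl_ne_zero _ _ _ hne
    refine hn.ne ?_
    simp only [Weight.eval, Finset.sum_map, w, mul_zero, Finsupp.sum, Finset.sum_const_zero,
      add_zero]
    refine Finset.sum_eq_zero fun h _ => ?_
    have := h.2
    simp only [Fin.castLEEmb_apply, Fin.val_castLE]
    split_ifs <;> first | rfl | lia
  -- Counting minus the number of `μ` and `ν`, the perturbation loses nothing, so lifts are free of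
  -- both.
  have hg : ∀ φ, ∀ j, j = 4 ∨ j = 5 → gD j (K φ) = 0 := fun φ j hj => by
    refine gD_eq_zero_of_mem_wtFil (w := w 0 0 0 0 (-1) (-1)) (fun j => ?_) (fun _ => rfl)
      (fun _ => rfl) ?_ (hK φ)
    · simp only [w]; split_ifs <;> norm_num
    · rcases hj with rfl | rfl <;> simp [w]
  have h4 : ∀ φ, gD 4 (K φ) = 0 := fun φ => hg φ 4 (.inl rfl)
  have h5 : ∀ φ, gD 5 (K φ) = 0 := fun φ => hg φ 5 (.inr rfl)
  have hΩ4 : ∀ φ, gD 4 (ambientCharge F (K φ)) = 0 := fun φ => by rw [hΩ h0, h4]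
  have hΩ5 : ∀ φ, gD 5 (ambientCharge F (K φ)) = 0 := fun φ => by rw [hΩ h0, h5]
  -- The image of a lift is a lift and also free of `μ`, `ν`. The two ghost derivatives of it give
  -- exactly the hypotheses `hz` and `hw`.
  obtain ⟨h, h'⟩ := hred (hatCharge F 4) fun φ => by
    have hz := LinearMap.congr_fun (gD_four_mul_ambientCharge F) (K φ)
    have hw := LinearMap.congr_fun (gD_five_mul_ambientCharge F) (K φ)
    rw [Module.End.mul_apply, hΩ4, LinearMap.sub_apply, LinearMap.add_apply (_ + ghostLevel),
      LinearMap.add_apply _ ghostLevel, LinearMap.sub_apply _ (_ * zD l), LinearMap.smul_apply,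
      Module.End.mul_apply (gM 5), h5, Module.End.mul_apply _ (gD 4), h4, map_zero, map_zero,
      smul_zero, add_zero, sub_zero, sub_add_eq_add_sub] at hz
    rw [Module.End.mul_apply, hΩ5, LinearMap.sub_apply, LinearMap.sub_apply, LinearMap.smul_apply,
      Module.End.mul_apply (gM 4), h5, Module.End.mul_apply _ (gD 5), h5, map_zero, map_zero,
      smul_zero, sub_zero, sub_zero, LinearMap.add_apply _ (gD 2 * gD 4), Module.End.mul_apply (gD 2),
      h4, map_zero, add_zero, LinearMap.add_apply _ ghostShift] at hw
    rw [resTensor_ambientCharge F hl (sub_eq_zero.1 hz.symm).symm (eq_neg_of_add_eq_zero_left hw.symm),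
      hπ]
  exact ⟨h, h' h0⟩

end TensorReduction

end AdSHigherSpin

end

noncomputable section
namespace AdSHigherSpin

set_option linter.unusedSimpArgs false

/-! ### Surjectivity of the trace operator. -/

section LocallyNilpotent

theorem bijective_one_sub_of_locally_nilpotent {R M : Type*} [Ring R] [AddCommGroup M] [Module R M]
    (P : Module.End R M) (h : ∀ φ, ∃ n, (P ^ n) φ = 0) : Function.Bijective (1 - P : Module.End R M) := by
  refine ⟨(injective_iff_map_eq_zero _).2 fun φ hφ => ?_, fun φ => ?_⟩
  · have h1 : P φ = φ := by
      rw [LinearMap.sub_apply, Module.End.one_apply, sub_eq_zero] at hφ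
      exact hφ.symm
    obtain ⟨n, hn⟩ := h φ
    have h2 : ∀ n, (P ^ n) φ = φ := fun n => by
      induction n with
      | zero => simp
      | succ n ih => rw [pow_succ, Module.End.mul_apply, h1, ih]
    rw [← h2 n, hn]
  · obtain ⟨n, hn⟩ := h φ
    refine ⟨(∑ i ∈ Finset.range n, P ^ i) φ, ?_⟩
    rw [← Module.End.mul_apply, mul_neg_geom_sum, LinearMap.sub_apply, hn, sub_zero,
      Module.End.one_apply]

theorem sq_mul_sq_of_mul_eq {R : Type*} [Ring R] {x y : R} (h : x * y = y * x + 1) :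
    x * x * (y * y) = (y * x + 1) * (y * x + 1) + (y * x + 1) := by
  rw [mul_assoc, ← mul_assoc x y y, h, add_mul, one_mul, mul_add, h, mul_assoc y x y, h,
    ← mul_assoc, h]

end LocallyNilpotent

section TraceInverse

variable {d : ℕ} {U : TopologicalSpace.Opens (Fin d → ℝ)} {k : ℕ}

local notation "𝓔" => Module.End ℝ (TensorStates U k)

/-- The trace operator `∂/∂a†_a ∂/∂a†^a - 2 ∂/∂b† ∂/∂c†`. -/
def ghostTrace : Module.End ℝ (TensorStates U k) := aTrace - (2 : ℝ) • (gD 2 * gD 1)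

theorem traceOp_eq : traceOp U = ghostTrace := LinearMap.ext fun φ => by
  change traceLin U φ = _
  simp only [traceLin, ghostTrace, aTrace, LinearMap.sub_apply, LinearMap.sum_apply,
    LinearMap.smul_apply]
  rfl

theorem traceLin_apply (φ : TensorStates U 3) : traceLin U φ = ghostTrace φ :=
  LinearMap.congr_fun traceOp_eq φ

/-- Double integration in the variable `a†^i`. -/
def doubleIntegral (i : Fin d) : Module.End ℝ (TensorStates U k) :=
  aM i * aM i * fdiag ⟨fun _ => 0, fun j => if j = i then 1 else 0, fun _ => 0⟩
    fun x => ((x + 1) * (x + 2) : ℝ)⁻¹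

/-- On monomials of degree `x` in `a†^i` the operator `∂²(a†^i)²` has the eigenvalue `(x + 1)(x +
2)`, which is nonzero because `x ≥ 0`. -/
theorem aD_sq_mul_doubleIntegral (i : Fin d) : (aD i * aD i * doubleIntegral i : 𝓔) = 1 := by
  have h := aD_mul_aM (U := U) (Y := Empty) (k := k) i i
  rw [if_pos rfl] at h
  have hn : (aM i * aD i : 𝓔) = fdiag ⟨fun _ => 0, fun j => if j = i then 1 else 0, fun _ => 0⟩
      fun x => (x : ℝ) := by
    rw [← number_operator_eq_fdiag]
    simp
  set w : Weight Empty (Fin d) := ⟨fun _ => 0, fun j => if j = i then 1 else 0, fun _ => 0⟩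
  have h1 : (aM i * aD i + 1 : 𝓔) = fdiag w fun x => (x : ℝ) + 1 := by
    rw [hn, ← fdiag_one w, fdiag_add]
  rw [doubleIntegral, ← mul_assoc, sq_mul_sq_of_mul_eq h, h1, fdiag_mul, fdiag_add, fdiag_mul]
  refine LinearMap.ext fun φ => Fock.ext_coeff fun S β n => ?_
  have h0 : 0 ≤ w.eval S β n := by
    refine add_nonneg (add_nonneg (Finset.sum_nonneg fun _ _ => le_rfl) (Finset.sum_nonneg
      fun j _ => mul_nonneg (Nat.cast_nonneg _) ?_)) (Finset.sum_nonneg fun j _ => ?_)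
    · simp only [w]; split_ifs <;> norm_num
    · exact j.elim
  have h3 : (0 : ℝ) ≤ (w.eval S β n : ℝ) := by exact_mod_cast h0
  rw [coeff_fdiag, Module.End.one_apply]
  convert one_smul ℝ (φ.coeff S β n) using 2
  field_simp
  ring

theorem doubleIntegral_fnLinear (i : Fin d) : FnLinear (doubleIntegral i : 𝓔) :=
  ((FnLinear.aM i).mul (.aM i)).mul (.fdiag _ _)

theorem FnLinear.sub {A A' : 𝓔} (h : FnLinear A) (h' : FnLinear A') : FnLinear (A - A') :=
  fun f => (h f).sub_left (h' f)

theorem ghostTrace_fnLinear : FnLinear (ghostTrace : 𝓔) :=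
  (FnLinear.sum fun a _ => .real_smul _ ((FnLinear.aD a).mul (.aD a))).sub
    (.real_smul _ ((FnLinear.gD 2).mul (.gD 1)))

theorem ghostTrace_tame : Tame 0 (ghostTrace : 𝓔) := by
  have h2 : Tame 1 (gD 2 : 𝓔) := .gD (by norm_num)
  have h1 : Tame (-1) (gD 1 : 𝓔) := .gD (by norm_num)
  have h : Tame 0 (gD 2 * gD 1 : 𝓔) := h2.mul h1 (by norm_num)
  exact aTrace_tame.sub (h.real_smul 2)

/-- The trace operator is surjective, with an inverse commuting with functions. -/
theorem exists_ghostTrace_inverse (hd : 1 ≤ d) :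
    ∃ ρ : TensorStates U k →ₗ[SmoothFn U] TensorStates U k, (∀ φ, ghostTrace (ρ φ) = φ) ∧
      ∀ φ, ghostNumber (ρ φ) = ρ (ghostNumber φ) := by
  -- `d ≥ 1` provides an oscillator in which to integrate.
  let i : Fin d := ⟨0, hd⟩
  let R : 𝓔 := ghostTrace - etaT i • (aD i * aD i)
  -- With `J` the double integral in direction `i` and `R` the rest of the trace, the trace of `η_i
  -- J` is `1 - P`. So `η_i J (1 - P)⁻¹` is a right inverse.
  let P : 𝓔 := -(etaT i • (R * doubleIntegral i))
  -- Minus the degree in the other oscillators, `c†` and `b†`. `R` raises it by `2`, `J` leaves it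
  -- alone, and it is never positive; hence `P` is locally nilpotent and the series for the inverse
  -- is finite on each state.
  let w : Weight Empty (Fin d) := ⟨fun j => if j = 1 ∨ j = 2 then -1 else 0,
    fun j => if j = i then 0 else -1, fun _ => 0⟩
  have lP : FnLinear P := (FnLinear.real_smul _ ((ghostTrace_fnLinear.sub (.real_smul _
    ((FnLinear.aD i).mul (.aD i)))).mul (doubleIntegral_fnLinear i))).neg
  have hR : HasDeg w 2 R := by
    have e : R = ∑ a ∈ Finset.univ.erase i, etaT a • (aD a * aD a) - (2 : ℝ) • (gD 2 * gD 1) := by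
      simp only [R, ghostTrace, aTrace, ← Finset.sum_erase_add _ _ (Finset.mem_univ i)]
      abel
    rw [e]
    refine .sub (.sum fun a ha => .smul _ ?_) (.smul _ ?_)
    · have h : w.a a = -1 := if_neg (Finset.ne_of_mem_erase ha)
      exact (Hom.aD w a).hasDeg.mul (Hom.aD w a).hasDeg (by rw [h]; norm_num)
    · exact (Hom.gD w 2).hasDeg.mul (Hom.gD w 1).hasDeg (by simp [w])
  have hJ : HasDeg w 0 (doubleIntegral i : 𝓔) := by
    have h : w.a i = 0 := by simp [w]
    exact (((Hom.aM w i).hasDeg.mul (s := 0) (Hom.aM w i).hasDeg (by rw [h]; norm_num)).mul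
      (Hom.fdiag w _ _).hasDeg (by norm_num))
  have hP : HasDeg w 2 P := .neg (.smul _ (hR.mul hJ (by norm_num)))
  have hw : ∀ (S : Finset (Fin k)) β n, w.eval S β n ≤ 0 := fun S β n => by
    refine add_nonpos (add_nonpos (Finset.sum_nonpos fun j _ => ?_) (Finset.sum_nonpos
      fun j _ => mul_nonpos_of_nonneg_of_nonpos (Nat.cast_nonneg _) ?_))
      (Finset.sum_nonpos fun j _ => j.elim)
    · simp only [w]; split_ifs <;> norm_num
    · simp only [w]; split_ifs <;> norm_num
  have hnil : ∀ φ, ∃ n, (lP.toLinear ^ n) φ = 0 := fun φ => by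
    obtain ⟨j, hj⟩ := exists_mem_wtFil (w := w) (fun _ => rfl) φ
    have h1 : ∀ n, (lP.toLinear ^ n) φ = (P ^ n) φ := fun n => by
      induction n with
      | zero => rfl
      | succ n ih => rw [pow_succ', pow_succ', Module.End.mul_apply, ih]; rfl
    refine ⟨(1 - j).toNat, ?_⟩
    rw [h1]
    refine eq_zero_of_mem_wtFil hw (wtFil_mono w ?_ (hP.pow _ j φ hj))
    have := Int.self_le_toNat (1 - j)
    lia
  let L := LinearEquiv.ofBijective _ (bijective_one_sub_of_locally_nilpotent _ hnil)
  have hL : ∀ φ, L φ = φ - P φ := fun φ => rfl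
  have lJ : FnLinear (etaT i • doubleIntegral i : 𝓔) := .real_smul _ (doubleIntegral_fnLinear i)
  have h1 : ghostTrace * (etaT i • doubleIntegral i) = 1 - P := by
    have h2 : (ghostTrace : 𝓔) = R + etaT i • (aD i * aD i) := (sub_add_cancel _ _).symm
    rw [h2, add_mul, smul_mul_assoc, mul_smul_comm, mul_smul_comm, smul_smul, etaT_mul_self,
      one_smul, aD_sq_mul_doubleIntegral, add_comm]
    exact (sub_neg_eq_add _ _).symm
  have tJ : Hom ghWeight 0 (doubleIntegral i : 𝓔) :=
    ((Hom.aM ghWeight i).mul (.aM ghWeight i) (by simp [ghWeight])).mul (.fdiag _ _ _) (add_zero 0)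
  have tR : Hom ghWeight 0 R := ghostTrace_tame.hom.sub (.smul _
    ((Hom.aD ghWeight i).mul (.aD ghWeight i) (by simp [ghWeight])))
  have tP : Hom ghWeight 0 P := .neg (.smul _ (tR.mul tJ (add_zero 0)))
  have cP : ∀ φ, ghostNumber (P φ) = P (ghostNumber φ) := fun φ => by
    have h := LinearMap.congr_fun tP.ghost_comm φ
    rw [Int.cast_zero, zero_smul] at h
    exact sub_eq_zero.1 h
  have cJ : ∀ φ : TensorStates U k, ghostNumber ((etaT i • doubleIntegral i : 𝓔) φ) =
      (etaT i • doubleIntegral i : 𝓔) (ghostNumber φ) := fun φ => by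
    have h := LinearMap.congr_fun (tJ.smul (etaT i)).ghost_comm φ
    rw [Int.cast_zero, zero_smul] at h
    exact sub_eq_zero.1 h
  refine ⟨lJ.toLinear ∘ₗ L.symm.toLinearMap, fun φ => ?_, fun φ => ?_⟩
  · have h := LinearMap.congr_fun h1 (L.symm φ)
    rw [LinearMap.sub_apply, Module.End.one_apply, ← hL, L.apply_symm_apply] at h
    exact h
  · change ghostNumber ((etaT i • doubleIntegral i : 𝓔) (L.symm φ)) =
      (etaT i • doubleIntegral i : 𝓔) (L.symm (ghostNumber φ))
    rw [cJ]
    congr 1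
    rw [LinearEquiv.eq_symm_apply, hL, ← cP, ← map_sub, ← hL, L.apply_symm_apply]

end TraceInverse

end AdSHigherSpin

end

noncomputable section
namespace AdSHigherSpin

set_option linter.unusedSimpArgs false

/-! ### Dependence on `ξ`. -/

section TracelessReduction

variable {d : ℕ} {l : ℝ} {U : TopologicalSpace.Opens (Fin d → ℝ)} (F : AdSFrame l U)

local notation "𝓔" => Module.End ℝ (TensorStates U 4)

/-- The inclusion of the `ξ`-independent states. -/
def inclXi (U : TopologicalSpace.Opens (Fin d → ℝ)) :
    TensorStates U 3 →ₗ[SmoothFn U] TensorStates U 4 :=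
  incl (Function.Embedding.refl _) (Function.Embedding.refl _) (by norm_num)

/-- The `ξ`-independent component. -/
def resXi (U : TopologicalSpace.Opens (Fin d → ℝ)) :
    TensorStates U 4 →ₗ[SmoothFn U] TensorStates U 3 :=
  res (Function.Embedding.refl _) (Function.Embedding.refl _) (by norm_num)

theorem resXi_inclXi (φ : TensorStates U 3) : resXi U (inclXi U φ) = φ := res_incl _ _ _ φ

theorem gD_inclXi (φ : TensorStates U 3) : gD 3 (inclXi U φ) = 0 := gD_incl _ _ _ le_rfl φ

theorem resXi_real_smul (c : ℝ) (Ψ : TensorStates U 4) : resXi U (c • Ψ) = c • resXi U Ψ :=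
  res_real_smul _ _ _ Ψ c

theorem resXi_fnM (f : SmoothFn U) (Ψ : TensorStates U 4) :
    resXi U (fnM f Ψ) = fnM f (resXi U Ψ) := res_fnM _ _ _ Ψ f

theorem resXi_xD (m : Fin d) (Ψ : TensorStates U 4) :
    resXi U (xD m Ψ) = xD m (resXi U Ψ) := res_xD _ _ _ Ψ m

theorem resXi_aM (a : Fin d) (Ψ : TensorStates U 4) :
    resXi U (aM a Ψ) = aM a (resXi U Ψ) := res_aM _ (.refl _) _ Ψ a

theorem resXi_aD (a : Fin d) (Ψ : TensorStates U 4) :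
    resXi U (aD a Ψ) = aD a (resXi U Ψ) := res_aD _ (.refl _) _ Ψ a

theorem resXi_gM {j : ℕ} (hj : j < 3) (Ψ : TensorStates U 4) :
    resXi U (gM j Ψ) = gM j (resXi U Ψ) := res_gM _ _ _ Ψ hj

theorem resXi_gD {j : ℕ} (hj : j < 3) (Ψ : TensorStates U 4) :
    resXi U (gD j Ψ) = gD j (resXi U Ψ) := res_gD _ _ _ Ψ hj

theorem resXi_gM_three (Ψ : TensorStates U 4) : resXi U (gM 3 Ψ) = 0 := res_gM_of_le _ _ _ Ψ le_rfl

theorem inclXi_resXi (φ : TensorStates U 4) (h : gD 3 φ = 0) : inclXi U (resXi U φ) = φ := by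
  have h1 := incl_res (Function.Embedding.refl Empty) (Function.Embedding.refl (Fin d))
    (k := 3) (k' := 4) (by norm_num) (w := ⟨fun j => if j = 3 then 1 else 0, fun _ => 0, fun _ => 0⟩)
    (fun j hj hj' => by simp [show j = 3 by lia]) (fun j hj => if_neg (by lia))
    (fun i hi => absurd ⟨i, rfl⟩ hi) (fun _ => rfl) (fun i hi => i.elim) (fun _ => rfl) φ
  refine h1.trans (Fock.ext_coeff fun S β n => ?_)
  rw [coeff_fdiag]
  split_ifs with h0
  · exact one_smul _ _
  · rw [zero_smul]
    set p : Fin 4 := ⟨3, by norm_num⟩ with hp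
    have h3 : p ∈ S := by
      by_contra h3
      refine h0 ?_
      simp only [Weight.eval, mul_zero, Finsupp.sum, Finset.sum_const_zero, add_zero]
      refine Finset.sum_eq_zero fun j hj => if_neg fun h4 => h3 ?_
      rwa [show j = p from Fin.ext h4] at hj
    have h4 := congrArg (fun ψ => Fock.coeff ψ (S.erase p) β n) h
    simp only [coeff_gD, Nat.reduceLT, dif_pos, Fock.coeff_zero] at h4
    rw [if_neg (Finset.notMem_erase _ _), ← hp, Finset.insert_erase h3] at h4
    have h6 := congrArg (ghSign 3 (S.erase p) • ·) h4
    simp only [smul_smul, ghSign_mul_self, one_smul, smul_zero] at h6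
    exact h6.symm

theorem inclXi_add_gM_inclXi (φ : TensorStates U 4) :
    inclXi U (resXi U φ) + gM 3 (inclXi U (resXi U (gD 3 φ))) = φ := by
  have h0 : ∀ ψ : TensorStates U 4, gD 3 (gD 3 ψ) = 0 := fun ψ =>
    LinearMap.congr_fun (gD_sq (U := U) (k := 4) (B := Fin d) (Y := Empty) 3) ψ
  have h1 := LinearMap.congr_fun (gD_mul_gM_self (U := U) (k := 4) (B := Fin d) (Y := Empty)
    (i := 3) (by norm_num)) (gD 3 φ)
  rw [LinearMap.sub_apply, Module.End.mul_apply, Module.End.mul_apply, h0, map_zero, sub_zero,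
    Module.End.one_apply] at h1
  have h2 := inclXi_resXi (φ - gM 3 (gD 3 φ)) (by rw [map_sub, h1, sub_self])
  rw [map_sub, resXi_gM_three, sub_zero] at h2
  rw [h2, inclXi_resXi _ (h0 φ), sub_add_cancel]

theorem resXi_covD (a : Fin d) (Ψ : TensorStates U 4) :
    resXi U (covD F a Ψ) = covD F a (resXi U Ψ) := by
  simp only [covD, LinearMap.sub_apply, LinearMap.sum_apply, map_sub, map_sum,
    fn_smul_eq, Module.End.mul_apply, resXi_fnM, resXi_xD, resXi_aM, resXi_aD]

theorem resXi_covBox (Ψ : TensorStates U 4) : resXi U (covBox F Ψ) = covBox F (resXi U Ψ) := by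
  simp only [covBox, LinearMap.sub_apply, LinearMap.sum_apply, LinearMap.smul_apply, map_sub,
    map_sum, resXi_real_smul, fn_smul_eq, Module.End.mul_apply, resXi_fnM, resXi_covD]

theorem resXi_divergence (Ψ : TensorStates U 4) :
    resXi U (divergence F Ψ) = divergence F (resXi U Ψ) := by
  simp only [divergence, LinearMap.sum_apply, LinearMap.smul_apply,
    map_sum, resXi_real_smul, Module.End.mul_apply, resXi_aD, resXi_covD]

theorem resXi_gradient (Ψ : TensorStates U 4) :
    resXi U (gradient F Ψ) = gradient F (resXi U Ψ) := by
  simp only [gradient, LinearMap.sum_apply, map_sum, Module.End.mul_apply, resXi_aM, resXi_covD]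

theorem resXi_numA (Ψ : TensorStates U 4) : resXi U (numA Ψ) = numA (resXi U Ψ) := by
  simp only [numA, LinearMap.sum_apply, map_sum, Module.End.mul_apply, resXi_aM, resXi_aD]

theorem resXi_aSq (Ψ : TensorStates U 4) : resXi U (aSq Ψ) = aSq (resXi U Ψ) := by
  simp only [aSq, LinearMap.sum_apply, LinearMap.smul_apply,
    map_sum, resXi_real_smul, Module.End.mul_apply, resXi_aM]

theorem resXi_aTrace (Ψ : TensorStates U 4) : resXi U (aTrace Ψ) = aTrace (resXi U Ψ) := by
  simp only [aTrace, LinearMap.sum_apply, LinearMap.smul_apply,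
    map_sum, resXi_real_smul, Module.End.mul_apply, resXi_aD]

theorem resXi_ghostTrace (Ψ : TensorStates U 4) :
    resXi U (ghostTrace Ψ) = ghostTrace (resXi U Ψ) := by
  simp only [ghostTrace, LinearMap.sub_apply, LinearMap.smul_apply, map_sub, resXi_real_smul,
    Module.End.mul_apply, resXi_aTrace, resXi_gD, Nat.one_lt_ofNat, Nat.reduceLT]

/-- With three ghosts `ξ` and `∂/∂ξ` are zero operators. With four, on a state without `ξ`, the
terms containing `∂/∂ξ` vanish and those creating `ξ` are discarded by the restriction. -/
theorem resXi_hatCharge {Ψ : TensorStates U 4} (h : gD 3 Ψ = 0) :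
    resXi U (hatCharge F 4 Ψ) = hatCharge F 3 (resXi U Ψ) := by
  have bN : Bosonic (numA : 𝓔) := numA_bosonic
  have hg : ∀ A : 𝓔, Bosonic A → gD 3 (A Ψ) = 0 := fun A hA => by
    have := LinearMap.congr_fun (hA 3).2.eq Ψ
    rw [Module.End.mul_apply, Module.End.mul_apply, h, map_zero] at this
    exact this.symm
  have h2 : ∀ j, j ≠ 3 → ∀ χ : TensorStates U 4, gD 3 χ = 0 → gD 3 (gD j χ) = 0 := fun j _ χ hχ => by
    have := LinearMap.congr_fun (gD_anticomm (U := U) (k := 4) (B := Fin d) (Y := Empty) 3 j) χ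
    rw [Module.End.mul_apply, LinearMap.neg_apply, Module.End.mul_apply, hχ, map_zero, neg_zero] at this
    exact this
  have h4 : ∀ j, j ≠ 3 → ∀ χ : TensorStates U 4, gD 3 χ = 0 → gD 3 (gM j χ) = 0 := fun j hj χ hχ => by
    have := LinearMap.congr_fun (gD_mul_gM_of_ne (U := U) (k := 4) (B := Fin d) (Y := Empty) hj.symm) χ
    rw [Module.End.mul_apply, LinearMap.neg_apply, Module.End.mul_apply, hχ, map_zero, neg_zero] at this
    exact this
  have z3 : (gD 3 : Module.End ℝ (TensorStates U 3)) = 0 := gD_eq_zero le_rfl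
  have m3 : (gM 3 : Module.End ℝ (TensorStates U 3)) = 0 := gM_eq_zero le_rfl
  rw [hatCharge_eq, hatCharge_eq]
  simp only [z3, m3, LinearMap.add_apply, LinearMap.sub_apply, LinearMap.smul_apply,
    Module.End.mul_apply, Module.End.one_apply, LinearMap.zero_apply, map_add, map_sub, map_smul,
    map_zero, resXi_real_smul, resXi_gM_three, resXi_gM, resXi_gD, resXi_covBox, resXi_divergence,
    resXi_gradient, resXi_numA, resXi_aSq, resXi_aTrace, smul_zero, add_zero, sub_zero, h,
    hg _ bN, hg _ (gradient_bosonic F), hg _ (covBox_bosonic F), h2 2 (by norm_num) _ h,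
    h4 2 (by norm_num) _ (h2 2 (by norm_num) _ h), h2 1 (by norm_num) _ h,
    Nat.ofNat_pos, Nat.one_lt_ofNat, Nat.reduceLT, zero_add]

/-- The product `∂_ξ ξ` projects onto states without `ξ`. On these the only term of the charge
creating a `ξ` is `ξ 𝒯̂₀`. -/
theorem gD_hatCharge_sub : (gD 3 * (hatCharge F 4 - gM 3 * ghostTrace) * gD 3 * gM 3 : 𝓔) = 0 := by
  have bB : Bosonic (covBox F : 𝓔) := covBox_bosonic F
  have bS : Bosonic (divergence F : 𝓔) := divergence_bosonic F
  have bG : Bosonic (gradient F : 𝓔) := gradient_bosonic F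
  have bN : Bosonic (numA : 𝓔) := numA_bosonic
  have bA : Bosonic (aSq : 𝓔) := aSq_bosonic
  have bT : Bosonic (aTrace : 𝓔) := aTrace_bosonic
  rw [hatCharge_eq]
  simp only [ghostTrace, mul_assoc, mul_add, add_mul, mul_sub,
    sub_mul, smul_mul_assoc, mul_smul_comm, bB.mul_gM, bB.mul_gD, bB.mul_gM_assoc,
    bB.mul_gD_assoc, bS.mul_gM, bS.mul_gD, bS.mul_gM_assoc,
    bS.mul_gD_assoc, bG.mul_gM, bG.mul_gD, bG.mul_gM_assoc,
    bG.mul_gD_assoc, bN.mul_gM, bN.mul_gD, bN.mul_gM_assoc,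
    bN.mul_gD_assoc, bA.mul_gM, bA.mul_gD, bA.mul_gM_assoc,
    bA.mul_gD_assoc, bT.mul_gM, bT.mul_gD, bT.mul_gM_assoc,
    bT.mul_gD_assoc, gM_swap, gM_swap_assoc, gM_sq, gM_sq_assoc, gD_swap, gD_swap_assoc, gD_sq,
    gD_sq_assoc, gD_gM_swap_assoc, gD_mul_gM_of_ne, gD_mul_gM_self, gD_gM_self_assoc, mul_neg,
    neg_mul, neg_neg, smul_neg, mul_zero, zero_mul, smul_zero, neg_zero, add_zero, zero_add,
    sub_zero, zero_sub, mul_one, one_mul, Nat.reduceLT, ne_eq, Nat.reduceEqDiff, not_false_eq_true,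
    OfNat.ofNat_ne_zero, OfNat.zero_ne_ofNat, OfNat.ofNat_ne_one, OfNat.one_ne_ofNat, zero_ne_one,
    one_ne_zero, smul_smul, smul_add, smul_sub, Nat.ofNat_pos, Nat.one_lt_ofNat, Nat.lt_one_iff,
    zero_lt_one]
  module

end TracelessReduction

end AdSHigherSpin

end

noncomputable section
namespace AdSHigherSpin

set_option linter.unusedSimpArgs false

/-! ### Reduction to traceless states. -/

section TracelessReduction

variable {d : ℕ} {l : ℝ} {U : TopologicalSpace.Opens (Fin d → ℝ)} (F : AdSFrame l U)

local notation "𝓔" => Module.End ℝ (TensorStates U 4)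

theorem resXi_ghostNumber (Ψ : TensorStates U 4) :
    resXi U (ghostNumber Ψ) = ghostNumber (resXi U Ψ) := by
  simp only [ghostNumber, Finset.sum_range_succ, Finset.sum_range_zero, LinearMap.add_apply,
    LinearMap.smul_apply, Module.End.mul_apply, map_add, resXi_real_smul, resXi_gM_three, smul_zero,
    add_zero, resXi_gM, resXi_gD, Nat.one_lt_ofNat, Nat.ofNat_pos, Nat.reduceLT,
    LinearMap.zero_apply, map_zero]

theorem ghostNumber_gD_three (Ψ : TensorStates U 4) :
    ghostNumber (gD 3 Ψ) = gD 3 (ghostNumber Ψ) - gD 3 Ψ := by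
  have t : Tame (-1) (gD 3 : 𝓔) := .gD (by norm_num)
  have h := LinearMap.congr_fun t.hom.ghost_comm Ψ
  simp only [LinearMap.sub_apply, Module.End.mul_apply, LinearMap.smul_apply, Int.cast_neg,
    Int.cast_one, neg_one_smul, LinearMap.neg_apply] at h
  rw [sub_eq_add_neg, ← h]
  abel

theorem inclXi_ghostNumber (φ : TensorStates U 3) :
    ghostNumber (inclXi U φ) = inclXi U (ghostNumber φ) := by
  have h : gD 3 (ghostNumber (inclXi U φ)) = 0 := by
    have := ghostNumber_gD_three (inclXi U φ)
    rw [gD_inclXi, map_zero, sub_zero] at this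
    exact this.symm
  rw [← inclXi_resXi _ h, resXi_ghostNumber, resXi_inclXi]

theorem fil_one_eq_bot {k : ℕ} {φ : TensorStates U k} (h : φ ∈ fil 1) : φ = 0 :=
  Fock.ext_coeff fun S β n => h S β n (by
    rw [Finsupp.degree_apply, Finset.sum_eq_zero fun i _ => i.elim]; exact zero_lt_one)

/-- There are no variables `Y` left, so the filtration vanishes from order one on and continuity is
automatic. -/
theorem filContinuous_tensorStates {k : ℕ} {N : Type} [AddCommGroup N] [Module (SmoothFn U) N]
    [Module ℝ N] [IsScalarTower ℝ (SmoothFn U) N] (fN : ℕ → Submodule (SmoothFn U) N)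
    (O : TensorStates U k →ₗ[ℝ] N) : FilContinuous fil fN O := fun j => ⟨1, fun φ hφ => by
  rw [fil_one_eq_bot hφ, map_zero]; exact zero_mem _⟩

theorem gD_three_comm_ghostTrace : Commute (gD 3 : 𝓔) ghostTrace := by
  have h1 : (gD 3 * (gD 2 * gD 1) : 𝓔) = gD 2 * gD 1 * gD 3 := by
    rw [← mul_assoc, gD_anticomm 3 2, neg_mul, mul_assoc, gD_anticomm 3 1, mul_neg, neg_neg,
      mul_assoc]
  have h2 : Commute (gD 3 : 𝓔) aTrace := (aTrace_bosonic 3).2.symm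
  have h3 : Commute (gD 3 : 𝓔) ((2 : ℝ) • (gD 2 * gD 1)) := Commute.smul_right h1 2
  exact Commute.sub_right h2 h3

theorem gD_hatCharge_inclXi (φ : TensorStates U 3) :
    gD 3 (hatCharge F 4 (inclXi U φ)) = ghostTrace (inclXi U φ) := by
  have h := LinearMap.congr_fun (gD_hatCharge_sub F) (inclXi U φ)
  have e0 := LinearMap.congr_fun (gD_mul_gM_self (U := U) (k := 4) (B := Fin d) (Y := Empty)
    (i := 3) (by norm_num))
  have e1 := e0 (inclXi U φ)
  have e2 := e0 (ghostTrace (inclXi U φ))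
  have e3 : gD 3 (ghostTrace (inclXi U φ)) = 0 := by
    rw [commute_apply gD_three_comm_ghostTrace, gD_inclXi, map_zero]
  rw [LinearMap.sub_apply, Module.End.mul_apply, Module.End.mul_apply, gD_inclXi, map_zero, sub_zero,
    Module.End.one_apply] at e1
  rw [LinearMap.sub_apply, Module.End.mul_apply, Module.End.mul_apply, e3, map_zero, sub_zero,
    Module.End.one_apply] at e2
  rw [Module.End.mul_apply, Module.End.mul_apply, e1, Module.End.mul_apply, LinearMap.sub_apply,
    map_sub, Module.End.mul_apply, e2, LinearMap.zero_apply, sub_eq_zero] at h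
  exact h

/-- For a traceless state without `ξ` the image under `Ω̂` has no `ξ` either, so it is
`Ω̂_{ξ=0=π}φ`. The `ξ`-component of `Ω̂²φ = 0` is then precisely the trace of this image. -/
theorem ghostTrace_hatCharge_eq_zero (h0 : (hatCharge F 4 * hatCharge F 4 : 𝓔) = 0)
    {φ : TensorStates U 3} (hφ : ghostTrace φ = 0) : ghostTrace (hatCharge F 3 φ) = 0 := by
  have h1 : ghostTrace (inclXi U φ) = 0 := by
    have h : gD 3 (ghostTrace (inclXi U φ)) = 0 := by
      rw [commute_apply gD_three_comm_ghostTrace, gD_inclXi, map_zero]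
    rw [← inclXi_resXi _ h, resXi_ghostTrace, resXi_inclXi, hφ, map_zero]
  have h2 : gD 3 (hatCharge F 4 (inclXi U φ)) = 0 := by rw [gD_hatCharge_inclXi, h1]
  have h3 : hatCharge F 4 (inclXi U φ) = inclXi U (hatCharge F 3 φ) := by
    rw [← inclXi_resXi _ h2, resXi_hatCharge F (gD_inclXi φ), resXi_inclXi]
  have h4 := LinearMap.congr_fun h0 (inclXi U φ)
  rw [Module.End.mul_apply, h3, LinearMap.zero_apply] at h4
  have h5 := gD_hatCharge_inclXi F (hatCharge F 3 φ)
  rw [h4, map_zero] at h5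
  rw [← resXi_inclXi (hatCharge F 3 φ), ← resXi_ghostTrace, ← h5, map_zero]

theorem gM_three_comm_ghostTrace : Commute (gM 3 : 𝓔) ghostTrace := by
  have h1 : (gM 3 * (gD 2 * gD 1) : 𝓔) = gD 2 * gD 1 * gM 3 := by
    rw [mul_assoc (gD 2) (gD 1) (gM 3), gD_mul_gM_of_ne (by norm_num : (1 : ℕ) ≠ 3), mul_neg,
      ← mul_assoc (gD 2) (gM 3), gD_mul_gM_of_ne (by norm_num : (2 : ℕ) ≠ 3), neg_mul, neg_neg, mul_assoc]
  have h2 : Commute (gM 3 : 𝓔) aTrace := (aTrace_bosonic 3).1.symm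
  have h3 : Commute (gM 3 : 𝓔) ((2 : ℝ) • (gD 2 * gD 1)) := Commute.smul_right h1 2
  exact Commute.sub_right h2 h3

theorem ghostTrace_inclXi (φ : TensorStates U 3) :
    ghostTrace (inclXi U φ) = inclXi U (ghostTrace φ) := by
  have h : gD 3 (ghostTrace (inclXi U φ)) = 0 := by
    rw [commute_apply gD_three_comm_ghostTrace, gD_inclXi, map_zero]
  rw [← inclXi_resXi _ h, resXi_ghostTrace, resXi_inclXi]

theorem inclTraceless_apply (φ : LinearMap.ker (traceLin U)) :
    inclTraceless U φ = inclXi U (φ : TensorStates U 3) := rfl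

theorem ghostTrace_coe (φ : LinearMap.ker (traceLin U)) :
    ghostTrace (φ : TensorStates U 3) = 0 := (traceLin_apply _).symm.trans φ.2

theorem gM_three_mul_ghostTrace_fnLinear : FnLinear (gM 3 * ghostTrace : 𝓔) :=
  (FnLinear.gM 3).mul ghostTrace_fnLinear

/-- The operator `ξ 𝒯̂₀`, linear over functions. -/
def traceDelta (U : TopologicalSpace.Opens (Fin d → ℝ)) :
    TensorStates U 4 →ₗ[SmoothFn U] TensorStates U 4 :=
  gM_three_mul_ghostTrace_fnLinear.toLinear

theorem traceDelta_apply (φ : TensorStates U 4) : traceDelta U φ = gM 3 (ghostTrace φ) := rfl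

theorem gM_three_mul_ghostTrace_tame : Tame 1 (gM 3 * ghostTrace : 𝓔) :=
  (Tame.gM (s := 1) (by norm_num)).mul ghostTrace_tame (add_zero 1)

theorem gM_three_mul_ghostTrace_sq : (gM 3 * ghostTrace * (gM 3 * ghostTrace) : 𝓔) = 0 := by
  rw [mul_assoc, ← mul_assoc ghostTrace, ← gM_three_comm_ghostTrace.eq, mul_assoc, gM_sq_assoc]

theorem gD_gM_inclXi (φ : TensorStates U 3) : gD 3 (gM 3 (inclXi U φ)) = inclXi U φ := by
  have h := LinearMap.congr_fun (gD_mul_gM_self (U := U) (k := 4) (B := Fin d) (Y := Empty)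
    (i := 3) (by norm_num)) (inclXi U φ)
  rwa [LinearMap.sub_apply, Module.End.mul_apply, Module.End.mul_apply, gD_inclXi, map_zero,
    sub_zero, Module.End.one_apply] at h

theorem resXi_gD_gM (φ : TensorStates U 4) : resXi U (gD 3 (gM 3 φ)) = resXi U φ := by
  have h := LinearMap.congr_fun (gD_mul_gM_self (U := U) (k := 4) (B := Fin d) (Y := Empty)
    (i := 3) (by norm_num)) φ
  rw [LinearMap.sub_apply, Module.End.mul_apply, Module.End.mul_apply, Module.End.one_apply] at h
  rw [h, map_sub, resXi_gM_three, sub_zero]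

section Homotopy

variable (ρ : TensorStates U 3 →ₗ[SmoothFn U] TensorStates U 3)

/-- The homotopy `ρ ∂/∂ξ`, for a right inverse `ρ` of the trace operator. -/
def traceHomotopy : TensorStates U 4 →ₗ[SmoothFn U] TensorStates U 4 :=
  inclXi U ∘ₗ ρ ∘ₗ resXi U ∘ₗ gDlin 3

theorem traceHomotopy_apply (φ : TensorStates U 4) :
    traceHomotopy ρ φ = inclXi U (ρ (resXi U (gD 3 φ))) := rfl

variable {ρ} (hρ : ∀ φ, ghostTrace (ρ φ) = φ)

/-- The projection to traceless states, for a right inverse `ρ` of the trace operator. -/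
def tracelessProj : TensorStates U 4 →ₗ[SmoothFn U] LinearMap.ker (traceLin U) :=
  ((LinearMap.id - ρ ∘ₗ traceLin U) ∘ₗ resXi U).codRestrict _ fun φ => by
    rw [LinearMap.mem_ker, traceLin_apply]
    change ghostTrace (resXi U φ - ρ (traceLin U (resXi U φ))) = 0
    rw [map_sub, hρ, traceLin_apply, sub_self]

theorem coe_tracelessProj (φ : TensorStates U 4) :
    (tracelessProj hρ φ : TensorStates U 3) = resXi U φ - ρ (ghostTrace (resXi U φ)) := by
  rw [← traceLin_apply]; rfl

include hρ

theorem traceDelta_traceHomotopy (φ : TensorStates U 4) :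
    traceDelta U (traceHomotopy ρ φ) = gM 3 (inclXi U (resXi U (gD 3 φ))) := by
  rw [traceHomotopy_apply, traceDelta_apply, ghostTrace_inclXi, hρ]

omit hρ in
theorem traceHomotopy_traceDelta (φ : TensorStates U 4) :
    traceHomotopy ρ (traceDelta U φ) = inclXi U (ρ (ghostTrace (resXi U φ))) := by
  rw [traceHomotopy_apply, traceDelta_apply, resXi_gD_gM, resXi_ghostTrace]

theorem tracelessProj_inclTraceless (φ : LinearMap.ker (traceLin U)) :
    tracelessProj hρ (inclTraceless U φ) = φ := Subtype.ext <| by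
  rw [coe_tracelessProj, inclTraceless_apply, resXi_inclXi, ghostTrace_coe, map_zero, sub_zero]

theorem trace_decomp (φ : TensorStates U 4) :
    inclTraceless U (tracelessProj hρ φ) + traceDelta U (traceHomotopy ρ φ) +
      traceHomotopy ρ (traceDelta U φ) = φ := by
  rw [traceDelta_traceHomotopy hρ, traceHomotopy_traceDelta, inclTraceless_apply,
    coe_tracelessProj, map_sub, sub_add_eq_add_sub, sub_add_cancel, inclXi_add_gM_inclXi]

theorem traceDelta_traceHomotopy_traceDelta (φ : TensorStates U 4) :
    traceDelta U (traceHomotopy ρ (traceDelta U φ)) = traceDelta U φ := by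
  have h : ghostTrace (gM 3 (inclXi U (resXi U (gD 3 φ)))) =
      gM 3 (ghostTrace (inclXi U (resXi U (gD 3 φ)))) :=
    (commute_apply gM_three_comm_ghostTrace _).symm
  have h2 : ∀ ψ : TensorStates U 4, gM 3 (gM 3 ψ) = 0 := fun ψ => LinearMap.congr_fun (gM_sq 3) ψ
  have h3 := congrArg (traceDelta U) (inclXi_add_gM_inclXi φ)
  rw [map_add, traceDelta_apply (gM 3 _), h, h2, add_zero, traceDelta_apply,
    ghostTrace_inclXi] at h3
  rw [traceDelta_traceHomotopy hρ, ← h3, resXi_gD_gM, resXi_inclXi]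

theorem trace_contraction (cρ : ∀ φ, ghostNumber (ρ φ) = ρ (ghostNumber φ)) :
    Contraction ghostNumber (inclTraceless U) (tracelessProj hρ) (traceDelta U)
      (traceHomotopy ρ) where
  π_ι := tracelessProj_inclTraceless hρ
  decomp := trace_decomp hρ
  δ_δ φ := LinearMap.congr_fun gM_three_mul_ghostTrace_sq φ
  η_η φ := by
    rw [traceHomotopy_apply, traceHomotopy_apply, gD_inclXi, map_zero, map_zero, map_zero]
  η_δ_η φ := by
    rw [traceHomotopy_traceDelta, traceHomotopy_apply, resXi_inclXi, hρ]
  δ_η_δ := traceDelta_traceHomotopy_traceDelta hρ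
  η_ι φ := by
    rw [inclTraceless_apply, traceHomotopy_apply, gD_inclXi, map_zero, map_zero, map_zero]
  π_η φ := Subtype.ext (by
    rw [coe_tracelessProj, traceHomotopy_apply, resXi_inclXi, hρ, sub_self, ZeroMemClass.coe_zero])
  gh_δ φ := by
    have h := LinearMap.congr_fun gM_three_mul_ghostTrace_tame.hom.ghost_comm φ
    rw [Int.cast_one, one_smul] at h
    exact sub_eq_iff_eq_add'.1 h
  gh_η φ := by
    rw [traceHomotopy_apply, traceHomotopy_apply, inclXi_ghostNumber, cρ, ← resXi_ghostNumber,
      ghostNumber_gD_three, map_sub, map_sub, map_sub]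

omit hρ in
-- The homotopy takes values in states without `ξ`, on which `Ω̂ - ξ𝒯̂₀` creates no `ξ` for the next
-- homotopy to remove. The perturbation therefore squares to zero and its geometric series stops
-- after the linear term.
theorem traceHomotopy_perturbation_apply (φ : TensorStates U 4) :
    traceHomotopy ρ (hatCharge F 4 (traceHomotopy ρ φ) - traceDelta U (traceHomotopy ρ φ)) = 0 := by
  rw [traceHomotopy_apply _ (_ - _), map_sub, traceHomotopy_apply, gD_hatCharge_inclXi,
    traceDelta_apply, ghostTrace_inclXi, gD_gM_inclXi, sub_self, map_zero, map_zero, map_zero]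

omit hρ in
variable (ρ) in
/-- The operator `ρ ∂/∂ξ (Ω̂ - ξ 𝒯̂₀)`. -/
def tracePerturbation : 𝓔 :=
  (traceHomotopy ρ).restrictScalars ℝ * (hatCharge F 4 - gM 3 * ghostTrace)

omit hρ in
theorem tracePerturbation_apply (φ : TensorStates U 4) :
    tracePerturbation F ρ φ = traceHomotopy ρ (hatCharge F 4 φ - traceDelta U φ) := rfl

omit hρ in
theorem tracePerturbation_sq (φ : TensorStates U 4) :
    tracePerturbation F ρ (tracePerturbation F ρ φ) = 0 := by
  rw [tracePerturbation_apply, tracePerturbation_apply, traceHomotopy_perturbation_apply]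

omit hρ in
theorem tracePerturbation_finOrder : FinOrder (SmoothFn U) (tracePerturbation F ρ) :=
  (FinOrder.of_linear fun f φ => (traceHomotopy ρ).map_smul f φ).mul
    ((hatCharge_tame F).sub gM_three_mul_ghostTrace_tame).finOrder

omit hρ in
variable (ρ) in
/-- The isomorphism `1 + ρ ∂/∂ξ (Ω̂ - ξ 𝒯̂₀)`. -/
def traceEquiv : TensorStates U 4 ≃ₗ[ℝ] TensorStates U 4 :=
  LinearEquiv.ofLinearMap (LinearMap.id + tracePerturbation F ρ)
    (LinearMap.id - tracePerturbation F ρ)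
    (LinearMap.ext fun φ => by
      rw [LinearMap.comp_apply, LinearMap.sub_apply, LinearMap.add_apply, LinearMap.id_apply,
        LinearMap.id_apply, map_sub, tracePerturbation_sq, sub_zero, sub_add_cancel])
    (LinearMap.ext fun φ => by
      rw [LinearMap.comp_apply, LinearMap.sub_apply, LinearMap.add_apply, LinearMap.id_apply,
        LinearMap.id_apply, map_add, tracePerturbation_sq, add_zero, add_sub_cancel_right])

omit hρ in
theorem traceEquiv_apply (φ : TensorStates U 4) : traceEquiv F ρ φ =
    φ + traceHomotopy ρ (hatCharge F 4 φ - traceDelta U φ) := rfl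

omit hρ in
theorem traceEquiv_symm_isGradedDiffOp :
    IsGradedDiffOp fil fil ((traceEquiv F ρ).symm : TensorStates U 4 →ₗ[ℝ] TensorStates U 4) := by
  refine ⟨filContinuous_tensorStates _ _, fun j => ?_⟩
  obtain ⟨n, hn⟩ := (FinOrder.of_linear (A := SmoothFn U) (O := (LinearMap.id : 𝓔))
    fun _ _ => rfl).sub (tracePerturbation_finOrder F (ρ := ρ))
  exact ⟨n, hn.mono_submodule bot_le⟩

omit hρ in
theorem tracelessCharge_lift {φ : TensorStates U 3} (hφ : ghostTrace φ = 0) :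
    traceHomotopy ρ (hatCharge F 4 (inclXi U φ)) = 0 := by
  rw [traceHomotopy_apply, gD_hatCharge_inclXi, ghostTrace_inclXi, hφ, map_zero, map_zero,
    map_zero, map_zero]

end Homotopy

/-- The operator that the BRST operator in intrinsic coordinates induces on traceless states. -/
def tracelessCharge (h0 : (hatCharge F 4 * hatCharge F 4 : 𝓔) = 0) :
    Module.End ℝ (LinearMap.ker (traceLin U)) where
  toFun φ := ⟨hatCharge F 3 φ, by
    rw [LinearMap.mem_ker, traceLin_apply, ghostTrace_hatCharge_eq_zero F h0 (ghostTrace_coe φ)]⟩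
  map_add' φ ψ := Subtype.ext ((hatCharge F 3).map_add _ _)
  map_smul' c φ := Subtype.ext ((hatCharge F 3).map_smul c (φ : TensorStates U 3))

theorem coe_tracelessCharge (h0 : (hatCharge F 4 * hatCharge F 4 : 𝓔) = 0)
    (φ : LinearMap.ker (traceLin U)) :
    (tracelessCharge F h0 φ : TensorStates U 3) = hatCharge F 3 φ := rfl

set_option maxRecDepth 4000 in
/-- The system in intrinsic coordinates is consistently reduced to traceless states. -/
theorem traceless_reduction (hd : 1 ≤ d) (h0 : (hatCharge F 4 * hatCharge F 4 : 𝓔) = 0) :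
    tracelessCharge F h0 * tracelessCharge F h0 = 0 ∧
      ConsistentReduction fil ghostNumber (hatCharge F 4)
        (fun m => (fil m).comap (inclTraceless U)) (inclTraceless U) (tracelessCharge F h0) := by
  obtain ⟨ρ, hρ, cρ⟩ := exists_ghostTrace_inverse (U := U) (k := 3) hd
  have hC := trace_contraction hρ cρ
  have hL := traceEquiv_apply F (ρ := ρ)
  -- On traceless states without `ξ` the homotopy applied to the charge gives zero, so the lift is
  -- the inclusion itself and no correction arises.
  have hΩ' : ∀ φ, tracelessCharge F h0 φ = tracelessProj hρ (hatCharge F 4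
      (reductionLift (hatCharge F 4) (inclTraceless U) (traceHomotopy ρ) (traceEquiv F ρ) φ)) :=
    fun φ => Subtype.ext <| by
      rw [reductionLift_apply, inclTraceless_apply, tracelessCharge_lift F (ghostTrace_coe φ),
        map_zero, sub_zero, coe_tracelessProj, resXi_hatCharge F (gD_inclXi _),
        resXi_inclXi, ghostTrace_hatCharge_eq_zero F h0 (ghostTrace_coe φ), map_zero, sub_zero,
        coe_tracelessCharge]
  have h1 : tracelessCharge F h0 * tracelessCharge F h0 = 0 :=
    Contraction.nilpotent (A := SmoothFn U) (M := TensorStates U 4)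
      (E := LinearMap.ker (traceLin U)) hC hL h0 hΩ'
  have h2 : ConsistentReduction fil ghostNumber (hatCharge F 4)
      (fun m => (fil m).comap (inclTraceless U)) (inclTraceless U) (tracelessCharge F h0) :=
    Contraction.consistentReduction (A := SmoothFn U) (M := TensorStates U 4)
      (E := LinearMap.ker (traceLin U)) hC hL
      (fun j => ⟨j, fun φ hφ => hφ⟩) (filContinuous_tensorStates _ _)
      (filContinuous_tensorStates _ _) (filContinuous_tensorStates _ _)
      (traceEquiv_symm_isGradedDiffOp F) hΩ'
  exact ⟨h1, h2⟩

end TracelessReduction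

end AdSHigherSpin

end

noncomputable section
namespace AdSHigherSpin

set_option linter.unusedSimpArgs false

/-! ### Reading off ghost coefficients with a vacuum projector. -/

section Vacuum

variable {d : ℕ} {U : TopologicalSpace.Opens (Fin d → ℝ)} {Y B : Type} {k : ℕ}

local notation "𝓔" => Module.End ℝ (Fock U Y B k)

/-- The projection to the states independent of the first `n` ghosts. -/
def vac : ℕ → Module.End ℝ (Fock U Y B k)
  | 0 => 1
  | n + 1 => gD n * gM n * vac n

theorem gD_mul_gM_commute_gM {i j : ℕ} (h : i ≠ j) : Commute (gD i * gM i : 𝓔) (gM j) := by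
  change _ = _
  rw [mul_assoc, gM_anticomm i j, mul_neg, ← mul_assoc, gD_mul_gM_of_ne h, neg_mul, neg_neg,
    mul_assoc]

theorem gD_mul_gM_commute_gD {i j : ℕ} (h : i ≠ j) : Commute (gD i * gM i : 𝓔) (gD j) := by
  have h1 : (gM i * gD j : 𝓔) = -(gD j * gM i) := by rw [gD_mul_gM_of_ne h.symm, neg_neg]
  change _ = _
  rw [mul_assoc, h1, mul_neg, ← mul_assoc, gD_anticomm i j, neg_mul, neg_neg, mul_assoc]

theorem vac_commute_gM {n j : ℕ} (h : n ≤ j) : Commute (vac n : 𝓔) (gM j) := by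
  induction n with
  | zero => exact Commute.one_left _
  | succ n ih =>
    have h1 : Commute (gD n * gM n : 𝓔) (gM j) := gD_mul_gM_commute_gM (by lia)
    have h2 : Commute (vac n : 𝓔) (gM j) := ih (by lia)
    exact Commute.mul_left h1 h2

theorem vac_commute_gD {n j : ℕ} (h : n ≤ j) : Commute (vac n : 𝓔) (gD j) := by
  induction n with
  | zero => exact Commute.one_left _
  | succ n ih =>
    have h1 : Commute (gD n * gM n : 𝓔) (gD j) := gD_mul_gM_commute_gD (by lia)
    have h2 : Commute (vac n : 𝓔) (gD j) := ih (by lia)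
    exact Commute.mul_left h1 h2

theorem Bosonic.commute_vac {A : 𝓔} (h : Bosonic A) (n : ℕ) : Commute A (vac n) := by
  induction n with
  | zero => exact Commute.one_right _
  | succ n ih =>
    have h1 : Commute A (gD n * gM n) := Commute.mul_right (h n).2 (h n).1
    exact Commute.mul_right h1 ih

theorem gD_mul_vac {i n : ℕ} (h : i < n) : (gD i * vac n : 𝓔) = 0 := by
  induction n with
  | zero => exact absurd h (Nat.not_lt_zero _)
  | succ n ih =>
    rw [vac]
    rcases Nat.lt_succ_iff_lt_or_eq.1 h with h | rfl
    · rw [← mul_assoc, ← (gD_mul_gM_commute_gD h.ne').eq, mul_assoc, ih h, mul_zero]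
    · rw [mul_assoc, gD_sq_assoc]

theorem vac_mul_gM {i n : ℕ} (h : i < n) : (vac n * gM i : 𝓔) = 0 := by
  induction n with
  | zero => exact absurd h (Nat.not_lt_zero _)
  | succ n ih =>
    rw [vac]
    rcases Nat.lt_succ_iff_lt_or_eq.1 h with h | rfl
    · rw [mul_assoc, ih h, mul_zero]
    · rw [mul_assoc, (vac_commute_gM le_rfl).eq, mul_assoc, gM_sq_assoc, mul_zero]

theorem gD_mul_vac_assoc {i n : ℕ} (h : i < n) (A : 𝓔) : gD i * (vac n * A) = 0 := by
  rw [← mul_assoc, gD_mul_vac h, zero_mul]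

theorem vac_mul_gM_assoc {i n : ℕ} (h : i < n) (A : 𝓔) : vac n * (gM i * A) = 0 := by
  rw [← mul_assoc, vac_mul_gM h, zero_mul]

theorem vac_mul_vac {n : ℕ} (h : n ≤ k) : (vac n * vac n : 𝓔) = vac n := by
  induction n with
  | zero => exact one_mul _
  | succ n ih =>
    have h1 : IsIdempotentElem (gD n * gM n : 𝓔) := by
      have h2 : (gM n * (gD n * gM n) : 𝓔) = gM n := by
        rw [gD_mul_gM_self h, mul_sub, mul_one, gM_sq_assoc, sub_zero]
      rw [IsIdempotentElem, mul_assoc, h2]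
    have h2 : Commute (vac n : 𝓔) (gD n) := vac_commute_gD le_rfl
    have h3 : Commute (vac n : 𝓔) (gM n) := vac_commute_gM le_rfl
    exact IsIdempotentElem.mul_of_commute (Commute.mul_right h2 h3).symm h1 (ih (by lia))

theorem vac_mul_vac_assoc {n : ℕ} (h : n ≤ k) (A : 𝓔) : vac n * (vac n * A) = vac n * A := by
  rw [← mul_assoc, vac_mul_vac h]

/-- An operator commuting with all ghosts is determined by its action on the ghost vacuum. The
factors of the projector are removed one at a time. -/
theorem Bosonic.eq_zero_of_vac_mul {A : 𝓔} (hA : Bosonic A) {n : ℕ} (hn : n ≤ k)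
    (h : vac n * A = 0) : A = 0 := by
  induction n with
  | zero => rwa [vac, one_mul] at h
  | succ n ih =>
    refine ih (by lia) ?_
    rw [vac, mul_assoc, mul_assoc] at h
    have h1 := gD_gM_self_assoc (show n < k by lia) (vac n * A)
    rw [h, eq_comm, sub_eq_zero] at h1
    have h2 : gM n * (vac n * A) = 0 := by rw [h1, gM_sq_assoc]
    have h4 : Commute (vac n : 𝓔) (gD n) := vac_commute_gD le_rfl
    -- Write `A' = vac n * A`, which commutes with `∂` of ghost `n`. From `A' = g ∂ A'` one gets `g
    -- A' = 0` and `A' = g A' ∂`, hence `A' = 0`.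
    have h3 : gD n * (vac n * A) = vac n * A * gD n := (Commute.mul_left h4 (hA n).2).symm.eq
    rw [h1, h3, ← mul_assoc, h2, zero_mul]

end Vacuum

end AdSHigherSpin

end

noncomputable section
namespace AdSHigherSpin

set_option linter.unusedSimpArgs false

/-! ### Relations with the number operator and with `a†^a a†_a`. -/

section OscillatorRelations

variable {d : ℕ} {l : ℝ} {U : TopologicalSpace.Opens (Fin d → ℝ)} (F : AdSFrame l U) {k : ℕ}

local notation "𝓔" => Module.End ℝ (TensorStates U k)

/-- The weight that counts the oscillators `a†`. -/
def aWeight : Weight Empty (Fin d) := ⟨fun _ => 0, fun _ => 1, fun _ => 0⟩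

theorem numA_eq_fdiag : (numA : 𝓔) = fdiag aWeight fun x => (x : ℝ) := by
  rw [← number_operator_eq_fdiag]
  simp [aWeight, numA]

theorem Hom.mul_numA {A : 𝓔} {r : ℤ} (h : Hom aWeight r A) :
    A * numA = numA * A - (r : ℝ) • A := by
  have h1 := h fun x => (x : ℝ)
  have h2 : (AdSHigherSpin.fdiag aWeight fun x : ℤ => ((x + r : ℤ) : ℝ)) =
      (numA + (r : ℝ) • 1 : 𝓔) := by
    refine LinearMap.ext fun φ => Fock.ext_coeff fun S β n => ?_
    rw [coeff_fdiag, numA_eq_fdiag, Int.cast_add, add_smul, LinearMap.add_apply, Fock.coeff_add,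
      coeff_fdiag, LinearMap.smul_apply, Module.End.one_apply, Fock.coeff_real_smul]
  rw [h2, ← numA_eq_fdiag, mul_add, mul_smul_comm, mul_one] at h1
  rw [h1, add_sub_cancel_right]

theorem covD_hom (a : Fin d) : Hom aWeight 0 (covD F a : 𝓔) :=
  (Hom.sum fun m _ => .fn_smul _ (.xD _ m)).sub (.sum fun _ _ => .sum fun _ _ => .sum fun _ _ =>
    .fn_smul _ ((Hom.aM _ _).mul (.aD _ _) (add_neg_cancel 1)))

theorem covBox_hom : Hom aWeight 0 (covBox F : 𝓔) :=
  .sum fun a _ => .smul _ (((covD_hom F a).mul (covD_hom F a) (add_zero 0)).sub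
    (.sum fun b _ => .fn_smul _ (covD_hom F b)))

theorem divergence_hom : Hom aWeight (-1) (divergence F : 𝓔) :=
  .sum fun a _ => .smul _ ((Hom.aD _ a).mul (covD_hom F a) (add_zero _))

theorem gradient_hom : Hom aWeight 1 (gradient F : 𝓔) :=
  .sum fun a _ => (Hom.aM _ a).mul (covD_hom F a) (add_zero _)

theorem aSq_hom : Hom aWeight 2 (aSq : 𝓔) :=
  .sum fun a _ => .smul _ ((Hom.aM _ a).mul (.aM _ a) (by rfl))

theorem aTrace_hom : Hom aWeight (-2) (aTrace : 𝓔) :=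
  .sum fun a _ => .smul _ ((Hom.aD _ a).mul (.aD _ a) (by rfl))

theorem covBox_mul_numA : (covBox F * numA : 𝓔) = numA * covBox F := by
  rw [(covBox_hom F).mul_numA, Int.cast_zero, zero_smul, sub_zero]

theorem divergence_mul_numA : (divergence F * numA : 𝓔) = numA * divergence F + divergence F := by
  rw [(divergence_hom F).mul_numA, Int.cast_neg, Int.cast_one, neg_one_smul, sub_neg_eq_add]

theorem gradient_mul_numA : (gradient F * numA : 𝓔) = numA * gradient F - gradient F := by
  rw [(gradient_hom F).mul_numA, Int.cast_one, one_smul]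

theorem aSq_mul_numA : (aSq * numA : 𝓔) = numA * aSq - (2 : ℝ) • aSq := by
  rw [aSq_hom.mul_numA, Int.cast_ofNat]

theorem aTrace_mul_numA : (aTrace * numA : 𝓔) = numA * aTrace + (2 : ℝ) • aTrace := by
  rw [aTrace_hom.mul_numA, Int.cast_neg, Int.cast_ofNat, neg_smul, sub_neg_eq_add]

theorem aM_commute_aSq (a : Fin d) : Commute (aM a : 𝓔) aSq :=
  .sum_right _ _ _ fun b _ => by
    have h1 : Commute (aM a : 𝓔) (aM b) := aM_comm a b
    exact Commute.smul_right (Commute.mul_right h1 h1) (etaT b)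

theorem fnM_commute_aSq (f : SmoothFn U) : Commute (fnM f : 𝓔) aSq :=
  .sum_right _ _ _ fun b _ => by
    have h1 : Commute (fnM f : 𝓔) (aM b) := (FnLinear.aM b f).symm
    exact Commute.smul_right (Commute.mul_right h1 h1) (etaT b)

/-- `a†^a a†_a` is Lorentz invariant: the connection contributes a matrix antisymmetric after
lowering an index, contracted with the symmetric product of two oscillators. -/
theorem covD_commute_aSq (a : Fin d) : Commute (covD F a : 𝓔) aSq := by
  set W : Fin d → Fin d → SmoothFn U := fun e c => ∑ m, F.einv a m * F.conn m e c with hW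
  have hanti : ∀ e c, etaT e • W e c = -(etaT c • W c e) := fun e c => by
    simp only [hW, Finset.smul_sum, ← Finset.sum_neg_distrib]
    refine Finset.sum_congr rfl fun m _ => ?_
    rw [← mul_smul_comm, F.etaT_smul_conn_swap, mul_neg, mul_smul_comm]
  have h1 : ∀ e, (covD F a * (aM e * aM e) : 𝓔) = aM e * aM e * covD F a -
      (2 : ℝ) • ∑ c, fnM (W e c) * (aM c * aM e) := fun e => by
    have h2 : (aM e * ∑ c, fnM (W e c) * aM c : 𝓔) = ∑ c, fnM (W e c) * (aM c * aM e) := by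
      rw [Finset.mul_sum]
      refine Finset.sum_congr rfl fun c _ => ?_
      rw [← mul_assoc, (FnLinear.aM e _).eq, mul_assoc, (aM_comm e c).eq]
    have h3 : (covD F a * aM e : 𝓔) = aM e * covD F a - ∑ c, fnM (W e c) * aM c :=
      covD_mul_aM F a e
    rw [← mul_assoc, h3, sub_mul, mul_assoc (aM e), h3, mul_sub, h2, Finset.sum_mul, two_smul,
      ← mul_assoc, sub_sub]
    simp only [mul_assoc]
  have h4 : ((2 : ℝ) • ∑ e, etaT e • ∑ c, fnM (W e c) * (aM c * aM e) : 𝓔) = 0 := by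
    have h5 : (∑ e, etaT e • ∑ c, fnM (W e c) * (aM c * aM e) : 𝓔) =
        -∑ e, etaT e • ∑ c, fnM (W e c) * (aM c * aM e) := by
      simp only [Finset.smul_sum, ← Finset.sum_neg_distrib]
      conv_rhs => rw [Finset.sum_comm]
      refine Finset.sum_congr rfl fun e _ => Finset.sum_congr rfl fun c _ => ?_
      rw [← smul_mul_assoc, ← fnM_real_smul, hanti, fnM_neg, neg_mul, fnM_real_smul,
        smul_mul_assoc, (aM_comm c e).eq]
    rw [two_smul]
    nth_rewrite 1 [h5]
    exact neg_add_cancel _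
  change covD F a * ∑ e, _ = (∑ e, _) * covD F a
  simp only [Finset.mul_sum, Finset.sum_mul, mul_smul_comm, smul_mul_assoc, h1, smul_sub,
    Finset.sum_sub_distrib]
  rw [sub_eq_self]
  rw [← h4, Finset.smul_sum]
  exact Finset.sum_congr rfl fun e _ => smul_comm _ _ _

theorem aD_mul_aSq (a : Fin d) : (aD a * aSq : 𝓔) = aSq * aD a + (2 * etaT a) • aM a := by
  have h : ∀ b : Fin d, (aD a * (aM b * aM b) : 𝓔) = aM b * aM b * aD a +
      if a = b then (2 : ℝ) • aM a else 0 := fun b => by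
    rw [← mul_assoc, aD_mul_aM, add_mul, mul_assoc, aD_mul_aM, mul_add, ← mul_assoc, add_assoc]
    split_ifs with hab
    · rw [hab, mul_one, one_mul, two_smul]
    · rw [mul_zero, zero_mul, add_zero]
  simp only [aSq, Finset.mul_sum, Finset.sum_mul, mul_smul_comm, smul_mul_assoc, h, smul_add,
    Finset.sum_add_distrib, smul_ite, smul_zero, Finset.sum_ite_eq, Finset.mem_univ, if_true,
    smul_smul, mul_comm (2 : ℝ)]

theorem covBox_mul_aSq : (covBox F * aSq : 𝓔) = aSq * covBox F := by
  have h1 : ∀ a b, ((∑ m, F.einv a m * F.conn m b a) • covD F b * aSq : 𝓔) =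
      aSq * (∑ m, F.einv a m * F.conn m b a) • covD F b := fun a b => by
    rw [fn_smul_eq, mul_assoc, (covD_commute_aSq F b).eq, ← mul_assoc, (fnM_commute_aSq _).eq,
      mul_assoc]
  have h2 : ∀ a, (covD F a * covD F a * aSq : 𝓔) = aSq * (covD F a * covD F a) := fun a => by
    rw [mul_assoc, (covD_commute_aSq F a).eq, ← mul_assoc, (covD_commute_aSq F a).eq, mul_assoc]
  rw [covBox, Finset.sum_mul, Finset.mul_sum]
  refine Finset.sum_congr rfl fun a _ => ?_
  rw [smul_mul_assoc, mul_smul_comm, sub_mul, mul_sub, h2, Finset.sum_mul, Finset.mul_sum,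
    Finset.sum_congr rfl fun b _ => h1 a b]

theorem gradient_mul_aSq : (gradient F * aSq : 𝓔) = aSq * gradient F :=
  Commute.sum_left _ _ _ fun a _ => by
    have h1 : Commute (aM a : 𝓔) aSq := aM_commute_aSq a
    have h2 : Commute (covD F a : 𝓔) aSq := covD_commute_aSq F a
    exact Commute.mul_left h1 h2

theorem divergence_mul_aSq :
    (divergence F * aSq : 𝓔) = aSq * divergence F + (2 : ℝ) • gradient F := by
  simp only [divergence, gradient, Finset.sum_mul, Finset.mul_sum, Finset.smul_sum,
    ← Finset.sum_add_distrib]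
  refine Finset.sum_congr rfl fun a _ => ?_
  rw [smul_mul_assoc, mul_assoc, (covD_commute_aSq F a).eq, ← mul_assoc, aD_mul_aSq, add_mul,
    smul_add, smul_mul_assoc, smul_smul, mul_left_comm, etaT_mul_self, mul_one, mul_smul_comm,
    mul_assoc]

theorem aTrace_mul_aSq : (aTrace * aSq : 𝓔) =
    aSq * aTrace + (4 : ℝ) • numA + (2 * d : ℝ) • 1 := by
  have h : ∀ a : Fin d, (etaT a • (aD a * aD a) * aSq : 𝓔) =
      aSq * (etaT a • (aD a * aD a)) + (4 : ℝ) • (aM a * aD a) + (2 : ℝ) • 1 := fun a => by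
    have h1 := aD_mul_aM (U := U) (Y := Empty) (k := k) a a
    rw [if_pos rfl] at h1
    rw [smul_mul_assoc, mul_assoc, aD_mul_aSq, mul_add, ← mul_assoc, aD_mul_aSq, mul_smul_comm,
      h1, add_mul, mul_smul_comm, mul_assoc, smul_mul_assoc]
    simp only [smul_add, smul_smul, mul_left_comm (etaT a), etaT_mul_self]
    module
  rw [aTrace, Finset.sum_mul, Finset.sum_congr rfl fun a _ => h a, Finset.sum_add_distrib,
    Finset.sum_add_distrib, ← Finset.mul_sum, ← Finset.smul_sum, Finset.sum_const,
    Finset.card_univ, Fintype.card_fin, ← Nat.cast_smul_eq_nsmul ℝ, smul_smul,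
    mul_comm (d : ℝ)]
  rfl

end OscillatorRelations

end AdSHigherSpin

end

noncomputable section
namespace AdSHigherSpin

set_option linter.unusedSimpArgs false

section AssocRelations

variable {d : ℕ} {l : ℝ} {U : TopologicalSpace.Opens (Fin d → ℝ)} (F : AdSFrame l U) {k : ℕ}

local notation "𝓔" => Module.End ℝ (TensorStates U k)

theorem covBox_mul_numA_assoc (X : 𝓔) : covBox F * (numA * X) = numA * (covBox F * X) := by
  rw [← mul_assoc, covBox_mul_numA, mul_assoc]

theorem divergence_mul_numA_assoc (X : 𝓔) :
    divergence F * (numA * X) = numA * (divergence F * X) + divergence F * X := by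
  rw [← mul_assoc, divergence_mul_numA, add_mul, mul_assoc]

theorem gradient_mul_numA_assoc (X : 𝓔) :
    gradient F * (numA * X) = numA * (gradient F * X) - gradient F * X := by
  rw [← mul_assoc, gradient_mul_numA, sub_mul, mul_assoc]

theorem aSq_mul_numA_assoc (X : 𝓔) :
    aSq * (numA * X) = numA * (aSq * X) - (2 : ℝ) • (aSq * X) := by
  rw [← mul_assoc, aSq_mul_numA, sub_mul, mul_assoc, smul_mul_assoc]

theorem aTrace_mul_numA_assoc (X : 𝓔) :
    aTrace * (numA * X) = numA * (aTrace * X) + (2 : ℝ) • (aTrace * X) := by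
  rw [← mul_assoc, aTrace_mul_numA, add_mul, mul_assoc, smul_mul_assoc]

end AssocRelations

/-! ### Commutators on AdS extracted from `Ω̂² = 0`. -/

section Relations

variable {d : ℕ} {l : ℝ} {U : TopologicalSpace.Opens (Fin d → ℝ)} (F : AdSFrame l U)

local notation "𝓔" => Module.End ℝ (TensorStates U 4)
local notation "𝓟" => (vac 4 : Module.End ℝ (TensorStates U 4))

set_option maxHeartbeats 8000000 in
/-- The coefficients of the ghosts in the square of the BRST operator. -/
theorem vac_hatCharge_sq :
    𝓟 * (gD 1 * (gD 0 * (hatCharge F 4 * (hatCharge F 4 * 𝓟)))) =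
      𝓟 * (covBox F * divergence F - divergence F * covBox F + (l ^ 2)⁻¹ •
        ((2 : ℝ) • (gradient F * aTrace) - (2 : ℝ) • (numA * divergence F) +
          (1 - d : ℝ) • divergence F)) ∧
    𝓟 * (gD 3 * (gD 0 * (hatCharge F 4 * (hatCharge F 4 * 𝓟)))) =
      𝓟 * (covBox F * aTrace - aTrace * covBox F) ∧
    𝓟 * (gD 3 * (gD 1 * (hatCharge F 4 * (hatCharge F 4 * 𝓟)))) =
      𝓟 * (divergence F * aTrace - aTrace * divergence F) ∧
    𝓟 * (gD 0 * (hatCharge F 4 * (hatCharge F 4 * (gM 2 * 𝓟)))) =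
      𝓟 * (covBox F * gradient F - gradient F * covBox F - (l ^ 2)⁻¹ •
        ((2 : ℝ) • (aSq * divergence F) - (2 : ℝ) • (numA * gradient F) +
          (3 - d : ℝ) • gradient F)) ∧
    𝓟 * (gD 1 * (hatCharge F 4 * (hatCharge F 4 * (gM 2 * 𝓟)))) =
      𝓟 * (divergence F * gradient F - gradient F * divergence F - covBox F - (l ^ 2)⁻¹ •
        (aSq * aTrace - numA * numA + (2 - d : ℝ) • numA)) ∧
    𝓟 * (gD 3 * (hatCharge F 4 * (hatCharge F 4 * (gM 2 * 𝓟)))) =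
      𝓟 * (aTrace * gradient F - gradient F * aTrace - (2 : ℝ) • divergence F) := by
  have bB : Bosonic (covBox F : 𝓔) := covBox_bosonic F
  have bS : Bosonic (divergence F : 𝓔) := divergence_bosonic F
  have bG : Bosonic (gradient F : 𝓔) := gradient_bosonic F
  have bN : Bosonic (numA : 𝓔) := numA_bosonic
  have bA : Bosonic (aSq : 𝓔) := aSq_bosonic
  have bT : Bosonic (aTrace : 𝓔) := aTrace_bosonic
  have cB := (bB.commute_vac 4).eq
  have lB := (bB.commute_vac 4).left_comm
  have cS := (bS.commute_vac 4).eq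
  have lS := (bS.commute_vac 4).left_comm
  have cG := (bG.commute_vac 4).eq
  have lG := (bG.commute_vac 4).left_comm
  have cN := (bN.commute_vac 4).eq
  have lN := (bN.commute_vac 4).left_comm
  have cA := (bA.commute_vac 4).eq
  have lA := (bA.commute_vac 4).left_comm
  have cT := (bT.commute_vac 4).eq
  have lT := (bT.commute_vac 4).left_comm
  rw [hatCharge_eq]
  -- Derivatives on the left select the coefficient of a ghost monomial in `Ω̂²`, everything else
  -- being killed by the vacuum projectors. A `b†` on the right serves as input for the term `Ŝ†
  -- ∂/∂b†`, which gives access to commutators with the gradient. Beyond ghost algebra only the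
  -- relations with the number operator enter.
  refine ⟨?_, ?_, ?_, ?_, ?_, ?_⟩ <;>
  · simp only [mul_assoc, mul_add, add_mul, mul_sub,
      sub_mul, smul_mul_assoc, mul_smul_comm, bB.mul_gM, bB.mul_gD, bB.mul_gM_assoc,
      bB.mul_gD_assoc, bS.mul_gM, bS.mul_gD, bS.mul_gM_assoc,
      bS.mul_gD_assoc, bG.mul_gM, bG.mul_gD, bG.mul_gM_assoc,
      bG.mul_gD_assoc, bN.mul_gM, bN.mul_gD, bN.mul_gM_assoc,
      bN.mul_gD_assoc, bA.mul_gM, bA.mul_gD, bA.mul_gM_assoc,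
      bA.mul_gD_assoc, bT.mul_gM, bT.mul_gD, bT.mul_gM_assoc,
      bT.mul_gD_assoc, gM_swap, gM_swap_assoc, gM_sq, gM_sq_assoc, gD_swap, gD_swap_assoc, gD_sq,
      gD_sq_assoc, gD_gM_swap_assoc, gD_mul_gM_of_ne, gD_mul_gM_self, gD_gM_self_assoc, mul_neg,
      neg_mul, neg_neg, smul_neg, mul_zero, zero_mul, smul_zero, neg_zero, add_zero, zero_add,
      sub_zero, zero_sub, mul_one, one_mul, Nat.reduceLT, ne_eq, Nat.reduceEqDiff,
      not_false_eq_true, OfNat.ofNat_ne_zero, OfNat.zero_ne_ofNat, OfNat.ofNat_ne_one,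
      OfNat.one_ne_ofNat, zero_ne_one, one_ne_zero, smul_smul, smul_add, smul_sub,
      Nat.ofNat_pos, Nat.one_lt_ofNat, Nat.lt_one_iff, zero_lt_one, gD_mul_vac, gD_mul_vac_assoc,
      vac_mul_gM, vac_mul_gM_assoc, cB, cS, cG, cN, cA, cT, lB, lS, lG, lN, lA, lT, vac_mul_vac,
      vac_mul_vac_assoc, le_refl, covBox_mul_numA, covBox_mul_numA_assoc, divergence_mul_numA,
      divergence_mul_numA_assoc, gradient_mul_numA, gradient_mul_numA_assoc, aTrace_mul_numA,
      aTrace_mul_numA_assoc]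
    module

variable {F}

theorem vac_mul_gD_mul_sq (h0 : (hatCharge F 4 * hatCharge F 4 : 𝓔) = 0) (A C : 𝓔) :
    𝓟 * (A * (hatCharge F 4 * (hatCharge F 4 * C))) = 0 := by
  rw [← mul_assoc (hatCharge F 4), h0, zero_mul, mul_zero, mul_zero]

theorem vac_mul_gD_mul_gD_mul_sq (h0 : (hatCharge F 4 * hatCharge F 4 : 𝓔) = 0) (A A' C : 𝓔) :
    𝓟 * (A * (A' * (hatCharge F 4 * (hatCharge F 4 * C)))) = 0 := by
  rw [← mul_assoc A, vac_mul_gD_mul_sq h0]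

/-- An identity of ghost-independent operators built from operators that are compatible with the
inclusion of `ξ`-independent states holds on these. -/
theorem eq_zero_of_resXi {A : 𝓔} {A' : Module.End ℝ (TensorStates U 3)} (h : A = 0)
    (hA : ∀ Ψ, resXi U (A Ψ) = A' (resXi U Ψ)) : A' = 0 := LinearMap.ext fun φ => by
  have h1 := hA (inclXi U φ)
  rw [h, LinearMap.zero_apply, map_zero, resXi_inclXi] at h1
  exact h1.symm

/-- The curvature of the covariant derivatives enters only through nilpotency, which goes back to
flatness of the `so(d-1,2)` connection. Nilpotency holds with the ghost `ξ` present;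
`eq_zero_of_resXi` transfers the ghost-free identity to states without it. The next five relations
are obtained alike from the other coefficients. -/
theorem divergence_mul_covBox (h0 : (hatCharge F 4 * hatCharge F 4 : 𝓔) = 0) :
    (divergence F * covBox F : Module.End ℝ (TensorStates U 3)) = covBox F * divergence F +
      (l ^ 2)⁻¹ • ((2 : ℝ) • (gradient F * aTrace) - (2 : ℝ) • (numA * divergence F) +
        (1 - d : ℝ) • divergence F) := by
  have h1 := (((covBox_bosonic F).mul (divergence_bosonic F)).sub ((divergence_bosonic F).mul
    (covBox_bosonic F))).add (.real_smul (l ^ 2)⁻¹ (((Bosonic.real_smul 2 ((gradient_bosonic F).mul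
    aTrace_bosonic)).sub (.real_smul 2 (numA_bosonic.mul (divergence_bosonic F)))).add
    (.real_smul (1 - d : ℝ) (divergence_bosonic F)))) |>.eq_zero_of_vac_mul le_rfl
    ((vac_hatCharge_sq F).1.symm.trans (vac_mul_gD_mul_gD_mul_sq h0 _ _ _))
  have h2 := eq_zero_of_resXi (A' := covBox F * divergence F - divergence F * covBox F +
    (l ^ 2)⁻¹ • ((2 : ℝ) • (gradient F * aTrace) - (2 : ℝ) • (numA * divergence F) +
      (1 - d : ℝ) • divergence F)) h1 fun Ψ => by
    simp only [LinearMap.add_apply, LinearMap.sub_apply, LinearMap.smul_apply,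
      Module.End.mul_apply, map_add, map_sub, resXi_real_smul, resXi_covBox, resXi_divergence,
      resXi_gradient, resXi_numA, resXi_aTrace]
  rw [sub_add_eq_add_sub, sub_eq_zero] at h2
  exact h2.symm

theorem aTrace_mul_covBox (h0 : (hatCharge F 4 * hatCharge F 4 : 𝓔) = 0) :
    (aTrace * covBox F : Module.End ℝ (TensorStates U 3)) = covBox F * aTrace := by
  have h1 := (((covBox_bosonic F).mul aTrace_bosonic).sub (aTrace_bosonic.mul
    (covBox_bosonic F))).eq_zero_of_vac_mul le_rfl
    ((vac_hatCharge_sq F).2.1.symm.trans (vac_mul_gD_mul_gD_mul_sq h0 _ _ _))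
  have h2 := eq_zero_of_resXi (A' := covBox F * aTrace - aTrace * covBox F) h1 fun Ψ => by
    simp only [LinearMap.sub_apply, Module.End.mul_apply, map_sub, resXi_covBox, resXi_aTrace]
  exact (sub_eq_zero.1 h2).symm

theorem aTrace_mul_divergence (h0 : (hatCharge F 4 * hatCharge F 4 : 𝓔) = 0) :
    (aTrace * divergence F : Module.End ℝ (TensorStates U 3)) = divergence F * aTrace := by
  have h1 := (((divergence_bosonic F).mul aTrace_bosonic).sub (aTrace_bosonic.mul
    (divergence_bosonic F))).eq_zero_of_vac_mul le_rfl
    ((vac_hatCharge_sq F).2.2.1.symm.trans (vac_mul_gD_mul_gD_mul_sq h0 _ _ _))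
  have h2 := eq_zero_of_resXi (A' := divergence F * aTrace - aTrace * divergence F) h1 fun Ψ => by
    simp only [LinearMap.sub_apply, Module.End.mul_apply, map_sub, resXi_divergence, resXi_aTrace]
  exact (sub_eq_zero.1 h2).symm

theorem covBox_mul_gradient (h0 : (hatCharge F 4 * hatCharge F 4 : 𝓔) = 0) :
    (covBox F * gradient F : Module.End ℝ (TensorStates U 3)) = gradient F * covBox F +
      (l ^ 2)⁻¹ • ((2 : ℝ) • (aSq * divergence F) - (2 : ℝ) • (numA * gradient F) +
        (3 - d : ℝ) • gradient F) := by
  have h1 := (((covBox_bosonic F).mul (gradient_bosonic F)).sub ((gradient_bosonic F).mul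
    (covBox_bosonic F))).sub (.real_smul (l ^ 2)⁻¹ (((Bosonic.real_smul 2 (aSq_bosonic.mul
    (divergence_bosonic F))).sub (.real_smul 2 (numA_bosonic.mul (gradient_bosonic F)))).add
    (.real_smul (3 - d : ℝ) (gradient_bosonic F)))) |>.eq_zero_of_vac_mul le_rfl
    ((vac_hatCharge_sq F).2.2.2.1.symm.trans (vac_mul_gD_mul_sq h0 _ _))
  have h2 := eq_zero_of_resXi (A' := covBox F * gradient F - gradient F * covBox F -
    (l ^ 2)⁻¹ • ((2 : ℝ) • (aSq * divergence F) - (2 : ℝ) • (numA * gradient F) +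
      (3 - d : ℝ) • gradient F)) h1 fun Ψ => by
    simp only [LinearMap.add_apply, LinearMap.sub_apply, LinearMap.smul_apply,
      Module.End.mul_apply, map_add, map_sub, resXi_real_smul, resXi_covBox, resXi_divergence,
      resXi_gradient, resXi_numA, resXi_aSq]
  rw [sub_sub, sub_eq_zero] at h2
  exact h2

theorem divergence_mul_gradient (h0 : (hatCharge F 4 * hatCharge F 4 : 𝓔) = 0) :
    (divergence F * gradient F : Module.End ℝ (TensorStates U 3)) = gradient F * divergence F +
      covBox F + (l ^ 2)⁻¹ • (aSq * aTrace - numA * numA + (2 - d : ℝ) • numA) := by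
  have h1 := ((((divergence_bosonic F).mul (gradient_bosonic F)).sub ((gradient_bosonic F).mul
    (divergence_bosonic F))).sub (covBox_bosonic F)).sub (.real_smul (l ^ 2)⁻¹
    (((aSq_bosonic.mul aTrace_bosonic).sub (numA_bosonic.mul numA_bosonic)).add
      (.real_smul (2 - d : ℝ) numA_bosonic))) |>.eq_zero_of_vac_mul le_rfl
    ((vac_hatCharge_sq F).2.2.2.2.1.symm.trans (vac_mul_gD_mul_sq h0 _ _))
  have h2 := eq_zero_of_resXi (A' := divergence F * gradient F - gradient F * divergence F -
    covBox F - (l ^ 2)⁻¹ • (aSq * aTrace - numA * numA + (2 - d : ℝ) • numA)) h1 fun Ψ => by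
    simp only [LinearMap.add_apply, LinearMap.sub_apply, LinearMap.smul_apply,
      Module.End.mul_apply, map_add, map_sub, resXi_real_smul, resXi_covBox, resXi_divergence,
      resXi_gradient, resXi_numA, resXi_aSq, resXi_aTrace]
  rw [sub_sub, sub_sub, sub_eq_zero, ← add_assoc] at h2
  exact h2

theorem aTrace_mul_gradient (h0 : (hatCharge F 4 * hatCharge F 4 : 𝓔) = 0) :
    (aTrace * gradient F : Module.End ℝ (TensorStates U 3)) = gradient F * aTrace +
      (2 : ℝ) • divergence F := by
  have h1 := ((aTrace_bosonic.mul (gradient_bosonic F)).sub ((gradient_bosonic F).mul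
    aTrace_bosonic)).sub (.real_smul 2 (divergence_bosonic F)) |>.eq_zero_of_vac_mul le_rfl
    ((vac_hatCharge_sq F).2.2.2.2.2.symm.trans (vac_mul_gD_mul_sq h0 _ _))
  have h2 := eq_zero_of_resXi (A' := aTrace * gradient F - gradient F * aTrace -
    (2 : ℝ) • divergence F) h1 fun Ψ => by
    simp only [LinearMap.sub_apply, LinearMap.smul_apply, Module.End.mul_apply, map_sub,
      resXi_real_smul, resXi_divergence, resXi_gradient, resXi_aTrace]
  rw [sub_sub, sub_eq_zero] at h2
  exact h2

end Relations

end AdSHigherSpin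

end

noncomputable section
namespace AdSHigherSpin

set_option linter.unusedSimpArgs false

/-! ### The modified operator and the triplet charge. -/

section ModifiedCharge

theorem mul_mul_of_mul_eq {R : Type*} [Ring R] {a b c : R} (h : a * b = c) (x : R) :
    a * (b * x) = c * x := by rw [← mul_assoc, h]

variable {d : ℕ} {l : ℝ} {U : TopologicalSpace.Opens (Fin d → ℝ)} (F : AdSFrame l U)

local notation "𝓔" => Module.End ℝ (TensorStates U 3)

/-- Expands the product in `□̂` and the added trace term, the `ξ`-dependent terms being zero with
three ghosts. This is the common starting point for nilpotency, commutation with the trace and the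
comparison with the triplet. -/
theorem modCharge_eq : modCharge F =
    gM 0 * (covBox F + (l ^ 2)⁻¹ • ((6 - d : ℝ) • numA - numA * numA + (2 * d - 6 : ℝ) • 1 +
      aSq * aTrace)) +
    (l ^ 2)⁻¹ • (gM 0 * (gM 2 * gD 2 * ((6 - 2 * d : ℝ) • 1 - (4 : ℝ) • numA) -
      gM 1 * gD 1 * ((4 : ℝ) • numA + (2 * d - 6 : ℝ) • 1) -
      (12 : ℝ) • (gM 1 * gD 1 * gM 2 * gD 2) + (4 : ℝ) • (gD 1 * gD 2 * aSq) +
      (4 : ℝ) • (gM 1 * gM 2 * aTrace))) +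
    gM 1 * divergence F + gradient F * gD 2 - gM 1 * gD 2 * gD 0 := by
  have bB : Bosonic (covBox F : 𝓔) := covBox_bosonic F
  have bS : Bosonic (divergence F : 𝓔) := divergence_bosonic F
  have bG : Bosonic (gradient F : 𝓔) := gradient_bosonic F
  have bN : Bosonic (numA : 𝓔) := numA_bosonic
  have bA : Bosonic (aSq : 𝓔) := aSq_bosonic
  have bT : Bosonic (aTrace : 𝓔) := aTrace_bosonic
  have z3 : (gD 3 : 𝓔) = 0 := gD_eq_zero le_rfl
  have m3 : (gM 3 : 𝓔) = 0 := gM_eq_zero le_rfl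
  rw [modCharge, hatCharge_eq, traceOp_eq, ghostTrace, m3, z3]
  simp only [ofNat_eq_smul_one, mul_assoc, mul_add, add_mul, mul_sub,
    sub_mul, smul_mul_assoc, mul_smul_comm, bB.mul_gM, bB.mul_gD, bB.mul_gM_assoc,
    bB.mul_gD_assoc, bS.mul_gM, bS.mul_gD, bS.mul_gM_assoc,
    bS.mul_gD_assoc, bG.mul_gM, bG.mul_gD, bG.mul_gM_assoc,
    bG.mul_gD_assoc, bN.mul_gM, bN.mul_gD, bN.mul_gM_assoc,
    bN.mul_gD_assoc, bA.mul_gM, bA.mul_gD, bA.mul_gM_assoc,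
    bA.mul_gD_assoc, bT.mul_gM, bT.mul_gD, bT.mul_gM_assoc,
    bT.mul_gD_assoc, gM_swap, gM_swap_assoc, gM_sq, gM_sq_assoc, gD_swap, gD_swap_assoc, gD_sq,
    gD_sq_assoc, gD_gM_swap_assoc, gD_mul_gM_of_ne, gD_mul_gM_self, gD_gM_self_assoc, mul_neg,
    neg_mul, neg_neg, smul_neg, mul_zero, zero_mul, smul_zero, neg_zero, add_zero, zero_add,
    sub_zero, zero_sub, mul_one, one_mul, Nat.reduceLT, ne_eq, Nat.reduceEqDiff,
    not_false_eq_true, OfNat.ofNat_ne_zero, OfNat.zero_ne_ofNat, OfNat.ofNat_ne_one,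
    OfNat.one_ne_ofNat, zero_ne_one, one_ne_zero, smul_smul, smul_add, smul_sub,
    Nat.ofNat_pos, Nat.one_lt_ofNat, Nat.lt_one_iff, zero_lt_one]
  module

/-- Both sides agree in normal order; only ghost anticommutators and the relations with the number
operator are used, not the commutators on AdS. The shift of `N` by `d/2` absorbs the constants
depending on `d`. -/
theorem modCharge_eq_neg_tripletCharge : modCharge F = -tripletCharge (d : ℝ) l
      (-covBox F) (-divergence F) (gradient F) (numA + ((d : ℝ) / 2) • 1)
      (-(1 / 2 : ℝ) • aTrace) (-(1 / 2 : ℝ) • aSq)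
      (gM 0) (gD 0) (-gD 2) (-gM 2) (gM 1) (gD 1) := by
  have bB : Bosonic (covBox F : 𝓔) := covBox_bosonic F
  have bS : Bosonic (divergence F : 𝓔) := divergence_bosonic F
  have bG : Bosonic (gradient F : 𝓔) := gradient_bosonic F
  have bN : Bosonic (numA : 𝓔) := numA_bosonic
  have bA : Bosonic (aSq : 𝓔) := aSq_bosonic
  have bT : Bosonic (aTrace : 𝓔) := aTrace_bosonic
  rw [modCharge_eq]
  simp only [tripletCharge, div_eq_mul_inv, ofNat_eq_smul_one, mul_assoc, mul_add, add_mul, mul_sub,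
    sub_mul, smul_mul_assoc, mul_smul_comm, bB.mul_gM, bB.mul_gD, bB.mul_gM_assoc,
    bB.mul_gD_assoc, bS.mul_gM, bS.mul_gD, bS.mul_gM_assoc,
    bS.mul_gD_assoc, bG.mul_gM, bG.mul_gD, bG.mul_gM_assoc,
    bG.mul_gD_assoc, bN.mul_gM, bN.mul_gD, bN.mul_gM_assoc,
    bN.mul_gD_assoc, bA.mul_gM, bA.mul_gD, bA.mul_gM_assoc,
    bA.mul_gD_assoc, bT.mul_gM, bT.mul_gD, bT.mul_gM_assoc,
    bT.mul_gD_assoc, gM_swap, gM_swap_assoc, gM_sq, gM_sq_assoc, gD_swap, gD_swap_assoc, gD_sq,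
    gD_sq_assoc, gD_gM_swap_assoc, gD_mul_gM_of_ne, gD_mul_gM_self, gD_gM_self_assoc, mul_neg,
    neg_mul, neg_neg, smul_neg, mul_zero, zero_mul, smul_zero, neg_zero, add_zero, zero_add,
    sub_zero, zero_sub, mul_one, one_mul, Nat.reduceLT, ne_eq, Nat.reduceEqDiff,
    not_false_eq_true, OfNat.ofNat_ne_zero, OfNat.zero_ne_ofNat, OfNat.ofNat_ne_one,
    OfNat.one_ne_ofNat, zero_ne_one, one_ne_zero, smul_smul, smul_add, smul_sub,
    Nat.ofNat_pos, Nat.one_lt_ofNat, Nat.lt_one_iff, zero_lt_one, covBox_mul_numA, covBox_mul_numA_assoc,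
    divergence_mul_numA, divergence_mul_numA_assoc, gradient_mul_numA, gradient_mul_numA_assoc,
    aTrace_mul_numA, aTrace_mul_numA_assoc, aSq_mul_numA, aSq_mul_numA_assoc]
  module

variable {F}

set_option maxHeartbeats 4000000 in
-- The part of the charge quadratic in the number operator fails to commute with the trace by
-- multiples of the trace. By `aTrace_mul_aSq` the added term fails in the opposite way, and the
-- remaining terms are balanced by those with ghosts. The hypothesis `h0` enters through the
-- commutators extracted from it.
theorem modCharge_mul_traceOp
    (h0 : (hatCharge F 4 * hatCharge F 4 : Module.End ℝ (TensorStates U 4)) = 0) :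
    modCharge F * traceOp U = traceOp U * modCharge F := by
  have bB : Bosonic (covBox F : 𝓔) := covBox_bosonic F
  have bS : Bosonic (divergence F : 𝓔) := divergence_bosonic F
  have bG : Bosonic (gradient F : 𝓔) := gradient_bosonic F
  have bN : Bosonic (numA : 𝓔) := numA_bosonic
  have bA : Bosonic (aSq : 𝓔) := aSq_bosonic
  have bT : Bosonic (aTrace : 𝓔) := aTrace_bosonic
  have r1 := divergence_mul_covBox h0
  have r2 := aTrace_mul_covBox h0
  have r3 := aTrace_mul_divergence h0
  have r4 := covBox_mul_gradient h0
  have r5 := divergence_mul_gradient h0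
  have r6 := aTrace_mul_gradient h0
  rw [modCharge_eq, traceOp_eq, ghostTrace]
  simp only [mul_assoc, mul_add, add_mul, mul_sub,
    sub_mul, smul_mul_assoc, mul_smul_comm, bB.mul_gM, bB.mul_gD, bB.mul_gM_assoc,
    bB.mul_gD_assoc, bS.mul_gM, bS.mul_gD, bS.mul_gM_assoc,
    bS.mul_gD_assoc, bG.mul_gM, bG.mul_gD, bG.mul_gM_assoc,
    bG.mul_gD_assoc, bN.mul_gM, bN.mul_gD, bN.mul_gM_assoc,
    bN.mul_gD_assoc, bA.mul_gM, bA.mul_gD, bA.mul_gM_assoc,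
    bA.mul_gD_assoc, bT.mul_gM, bT.mul_gD, bT.mul_gM_assoc,
    bT.mul_gD_assoc, gM_swap, gM_swap_assoc, gM_sq, gM_sq_assoc, gD_swap, gD_swap_assoc, gD_sq,
    gD_sq_assoc, gD_gM_swap_assoc, gD_mul_gM_of_ne, gD_mul_gM_self, gD_gM_self_assoc, mul_neg,
    neg_mul, neg_neg, smul_neg, mul_zero, zero_mul, smul_zero, neg_zero, add_zero, zero_add,
    sub_zero, zero_sub, mul_one, one_mul, Nat.reduceLT, ne_eq, Nat.reduceEqDiff,
    not_false_eq_true, OfNat.ofNat_ne_zero, OfNat.zero_ne_ofNat, OfNat.ofNat_ne_one,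
    OfNat.one_ne_ofNat, zero_ne_one, one_ne_zero, smul_smul, smul_add, smul_sub,
    Nat.ofNat_pos, Nat.one_lt_ofNat, Nat.lt_one_iff, zero_lt_one, covBox_mul_numA, covBox_mul_numA_assoc,
    divergence_mul_numA, divergence_mul_numA_assoc, gradient_mul_numA, gradient_mul_numA_assoc,
    aTrace_mul_numA, aTrace_mul_numA_assoc, aSq_mul_numA, aSq_mul_numA_assoc, aTrace_mul_aSq,
    covBox_mul_aSq, gradient_mul_aSq, divergence_mul_aSq, mul_mul_of_mul_eq (aTrace_mul_aSq),
    mul_mul_of_mul_eq (covBox_mul_aSq F), mul_mul_of_mul_eq (gradient_mul_aSq F),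
    mul_mul_of_mul_eq (divergence_mul_aSq F), r1, r2, r3, r4, r5, r6, mul_mul_of_mul_eq r1,
    mul_mul_of_mul_eq r2, mul_mul_of_mul_eq r3, mul_mul_of_mul_eq r4, mul_mul_of_mul_eq r5,
    mul_mul_of_mul_eq r6]
  module

set_option maxHeartbeats 8000000 in
-- Nilpotency of `Ω̂` gives nilpotency on traceless states only. Off them the identity is verified
-- by normal ordering with the six AdS commutators and the relations of `aSq`.
theorem modCharge_sq
    (h0 : (hatCharge F 4 * hatCharge F 4 : Module.End ℝ (TensorStates U 4)) = 0) :
    modCharge F * modCharge F = 0 := by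
  have bB : Bosonic (covBox F : 𝓔) := covBox_bosonic F
  have bS : Bosonic (divergence F : 𝓔) := divergence_bosonic F
  have bG : Bosonic (gradient F : 𝓔) := gradient_bosonic F
  have bN : Bosonic (numA : 𝓔) := numA_bosonic
  have bA : Bosonic (aSq : 𝓔) := aSq_bosonic
  have bT : Bosonic (aTrace : 𝓔) := aTrace_bosonic
  have r1 := divergence_mul_covBox h0
  have r2 := aTrace_mul_covBox h0
  have r3 := aTrace_mul_divergence h0
  have r4 := covBox_mul_gradient h0
  have r5 := divergence_mul_gradient h0
  have r6 := aTrace_mul_gradient h0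
  rw [modCharge_eq]
  simp only [mul_assoc, mul_add, add_mul, mul_sub,
    sub_mul, smul_mul_assoc, mul_smul_comm, bB.mul_gM, bB.mul_gD, bB.mul_gM_assoc,
    bB.mul_gD_assoc, bS.mul_gM, bS.mul_gD, bS.mul_gM_assoc,
    bS.mul_gD_assoc, bG.mul_gM, bG.mul_gD, bG.mul_gM_assoc,
    bG.mul_gD_assoc, bN.mul_gM, bN.mul_gD, bN.mul_gM_assoc,
    bN.mul_gD_assoc, bA.mul_gM, bA.mul_gD, bA.mul_gM_assoc,
    bA.mul_gD_assoc, bT.mul_gM, bT.mul_gD, bT.mul_gM_assoc,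
    bT.mul_gD_assoc, gM_swap, gM_swap_assoc, gM_sq, gM_sq_assoc, gD_swap, gD_swap_assoc, gD_sq,
    gD_sq_assoc, gD_gM_swap_assoc, gD_mul_gM_of_ne, gD_mul_gM_self, gD_gM_self_assoc, mul_neg,
    neg_mul, neg_neg, smul_neg, mul_zero, zero_mul, smul_zero, neg_zero, add_zero, zero_add,
    sub_zero, zero_sub, mul_one, one_mul, Nat.reduceLT, ne_eq, Nat.reduceEqDiff,
    not_false_eq_true, OfNat.ofNat_ne_zero, OfNat.zero_ne_ofNat, OfNat.ofNat_ne_one,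
    OfNat.one_ne_ofNat, zero_ne_one, one_ne_zero, smul_smul, smul_add, smul_sub,
    Nat.ofNat_pos, Nat.one_lt_ofNat, Nat.lt_one_iff, zero_lt_one, covBox_mul_numA, covBox_mul_numA_assoc,
    divergence_mul_numA, divergence_mul_numA_assoc, gradient_mul_numA, gradient_mul_numA_assoc,
    aTrace_mul_numA, aTrace_mul_numA_assoc, aSq_mul_numA, aSq_mul_numA_assoc, aTrace_mul_aSq,
    covBox_mul_aSq, gradient_mul_aSq, divergence_mul_aSq, mul_mul_of_mul_eq (aTrace_mul_aSq),
    mul_mul_of_mul_eq (covBox_mul_aSq F), mul_mul_of_mul_eq (gradient_mul_aSq F),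
    mul_mul_of_mul_eq (divergence_mul_aSq F), r1, r2, r3, r4, r5, r6, mul_mul_of_mul_eq r1,
    mul_mul_of_mul_eq r2, mul_mul_of_mul_eq r3, mul_mul_of_mul_eq r4, mul_mul_of_mul_eq r5,
    mul_mul_of_mul_eq r6]
  module

variable (F)

theorem modCharge_tame : Tame 1 (modCharge F) := by
  rw [modCharge, traceOp_eq]
  have g0 : Tame 1 (gM 0 : 𝓔) := .gM rfl
  have g1 : Tame 1 (gM 1 : 𝓔) := .gM rfl
  have g2 : Tame (-1) (gM 2 : 𝓔) := .gM rfl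
  have t : Tame 0 (aSq + 4 * (gM 1 * gM 2) : 𝓔) := by
    rw [ofNat_eq_smul_one, smul_mul_assoc, one_mul]
    exact aSq_tame.add (.real_smul _ (g1.mul g2 rfl))
  exact (hatCharge_tame F).add (.real_smul _ ((g0.mul t (t := 1) rfl).mul ghostTrace_tame rfl))

theorem modCharge_apply_of_traceless {φ : TensorStates U 3} (h : ghostTrace φ = 0) :
    modCharge F φ = hatCharge F 3 φ := by
  rw [modCharge, traceOp_eq, LinearMap.add_apply, LinearMap.smul_apply, Module.End.mul_apply, h,
    map_zero, smul_zero, add_zero]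

end ModifiedCharge

end AdSHigherSpin

end

open AdSHigherSpin in
theorem mainTheorem3 {d : ℕ} (hd : 1 ≤ d) {l : ℝ} (hl : 0 < l)
    (U : TopologicalSpace.Opens (Fin d → ℝ)) (F : AdSFrame l U) :
    -- the parent system is consistently reduced to the embedding-space system
    (IsBRSTSystem fil ghostNumber (parentCharge F) ∧
      IsBRSTSystem fil ghostNumber (ambientCharge F) ∧
      ConsistentReduction fil ghostNumber (parentCharge F) fil (inclAmbient U)
        (ambientCharge F)) ∧
    -- which is consistently reduced to the system in intrinsic coordinates
    (IsBRSTSystem fil ghostNumber (hatCharge F 4) ∧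
      ConsistentReduction fil ghostNumber (ambientCharge F) fil (inclTensor U)
        (hatCharge F 4)) ∧
    -- which is consistently reduced to traceless states
    (∃ Ω₀ : Module.End ℝ (LinearMap.ker (traceLin U)),
      (∀ φ, (Ω₀ φ : TensorStates U 3) = hatCharge F 3 φ) ∧
      (∀ φ, (Ω₀ φ : TensorStates U 3) = modCharge F φ) ∧
      Ω₀ * Ω₀ = 0 ∧
      ConsistentReduction fil ghostNumber (hatCharge F 4)
        (fun m => (fil m).comap (inclTraceless U)) (inclTraceless U) Ω₀) ∧
    -- the modified operator
    IsBRSTSystem fil ghostNumber (modCharge F) ∧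
    modCharge F * traceOp U = traceOp U * modCharge F ∧
    modCharge F = -tripletCharge (d : ℝ) l
      (-covBox F) (-divergence F) (gradient F) (numA + ((d : ℝ) / 2) • 1)
      (-(1 / 2 : ℝ) • aTrace) (-(1 / 2 : ℝ) • aSq)
      (gM 0) (gD 0) (-gD 2) (-gM 2) (gM 1) (gD 1) := by
  have hl' : l ≠ 0 := hl.ne'
  have hP := parentCharge_isBRSTSystem F hl'
  have hA := ambientCharge_isBRSTSystem F hl'
  obtain ⟨hR, h0⟩ := ambient_reduction F hl'
  obtain ⟨h1, hT⟩ := traceless_reduction F hd h0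
  exact ⟨⟨hP, hA, (parent_reduction F hl').1⟩, ⟨(hatCharge_tame F).isBRSTSystem h0, hR⟩,
    ⟨tracelessCharge F h0, fun _ => rfl,
      fun φ => (modCharge_apply_of_traceless F (ghostTrace_coe φ)).symm, h1, hT⟩,
    (modCharge_tame F).isBRSTSystem (modCharge_sq h0), modCharge_mul_traceOp h0,
    modCharge_eq_neg_tripletCharge F⟩
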